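/- Let $d\ge 1$, let $\mathfrak B=\bigotimes_{i\in\mathbb Z}M_d(\mathbb C)$ be the infinite $C^*$-tensor product with canonical embeddings $\beta_i:M_d\to\mathfrak B$ onto the $i$-th factor, and let $\gamma$ be the right shift, $\gamma(\beta_i(A))=\beta_{i+1}(A)$. For finite $\Lambda\subset\mathbb Z$ let $\mathfrak B_\Lambda$ be the subalgebra generated by the $\beta_i(M_d)$, $i\in\Lambda$. Let $G$ be a subgroup of the unitary group of $M_d$, and put $$\mathfrak A_\Lambda=\{B\in\mathfrak B_\Lambda:\ g^{\otimes\Lambda}\,B\,(g^{\otimes\Lambda})^*=B\ \text{ for all } g\in G\},\qquad \mathfrak A=\overline{\bigcup_{n\ge1}\mathfrak A_{[-n,n]}} .$$ The shift $\gamma$ restricts to an automorphism of $\mathfrak A$. A state $\tilde\phi$ on $\mathfrak B$ is the $C^*$-finitely correlated state generated by $(M_d,E,\rho)$ if $E:M_d\otimes M_d\to M_d$ is completely positive, $\rho$ is a state on $M_d$ with $\rho(E(1\otimes C))=\rho(C)$ for all $C\in M_d$, and, for all $m\in\mathbb Z$, $n\ge1$ and $A_1,\dots,A_n\in M_d$,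 $$\tilde\phi\big(\beta_{m+1}(A_1)\cdots\beta_{m+n}(A_n)\big)=\rho\big(E(A_1\otimes E(A_2\otimes\cdots\otimes E(A_n\otimes 1)\cdots))\big).$$ A generalized quantum Markov chain on $\mathfrak A$ is a state $\phi=\tilde\phi|_{\mathfrak A}$, where $\tilde\phi$ is generated by $(M_d,E,\rho)$ and $E$ is $G$-covariant: $E\big((g\otimes g)(A\otimes B)(g\otimes g)^*\big)=g\,E(A\otimes B)\,g^*$ for all $A,B\in M_d$ and $g\in G$. For a state $\psi$ on a finite-dimensional $C^*$-algebra $N\cong\bigoplus_iM_{n_i}$ let $S(\psi)=-\sum_i\operatorname{Tr}D_i\log D_i$, where $D=(D_i)_i$ is its density matrix, $\psi(a)=\sum_i\operatorname{Tr}(D_ia_i)$. The mean entropy of $\phi$ is $s(\phi)=\lim_{n\to\infty}\frac1n S(\phi|_{\mathfrak A_{[1,n]}})$. For unital completely positive maps $\alpha_1,\dots,\alpha_k$ from a finite-dimensional $C^*$-algebra $N$ to $\mathfrak A$ let, with $\eta(x)=-x\log x$, $$H_\phi(\alpha_1,\dots,\alpha_k)=\sup\Big[\sum_{J}\eta(\phi_J(1))-\sum_{l=1}^k\sum_i\eta(\phi^l_i(1))+\sum_{l=1}^kS(\phi\circ\alpha_l)-\sum_{l=1}^k\sum_i\phi^l_i(1)\,S\big(\widehat{\phi^l_i}\circ\alpha_l\big)\Big],$$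 the supremum being over all finite decompositions $\phi=\sum_{J=(i_1,\dots,i_k)}\phi_J$ into positive linear functionals on $\mathfrak A$, where $\phi^l_i=\sum_{J:\,i_l=i}\phi_J$ and $\widehat{\psi}=\psi/\psi(1)$ (terms with $\phi^l_i=0$ are omitted). The Connes–Narnhofer–Thirring dynamical entropy of $\gamma$ with respect to $\phi$ is $$h_\phi(\gamma)=\sup_{\alpha}\ \lim_{k\to\infty}\frac1kH_\phi(\alpha,\gamma\circ\alpha,\dots,\gamma^{k-1}\circ\alpha),$$ the supremum being over all finite-dimensional $C^*$-algebras $N$ and all unital completely positive maps $\alpha:N\to\mathfrak A$. **Theorem.** Let $\phi$ be a generalized quantum Markov chain on $\mathfrak A$. Then the limit defining the mean entropy $s(\phi)$ exists and is finite, and $$h_\phi(\gamma)=s(\phi).$$ -/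

import Mathlib

noncomputable section
open scoped ComplexOrder Kronecker
namespace QChain

/-- Configurations of the chain that differ from the reference configuration `0` at finitely many
sites. -/
abbrev Conf (d : ℕ) [NeZero d] : Type := ℤ →₀ Fin d

/-- The Hilbert space `ℓ²(Conf d)`, i.e. the incomplete infinite tensor product of copies of `ℂ^d`
along the reference vector `e_0`. -/
abbrev ChainSpace (d : ℕ) [NeZero d] : Type := lp (fun _ : Conf d => ℂ) 2

/-- Bounded operators on `ChainSpace d`; they contain the tensor product `⨂_ℤ M_d`. -/
abbrev ChainOp (d : ℕ) [NeZero d] : Type := ChainSpace d →L[ℂ] ChainSpace d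

section site
variable {d : ℕ} [NeZero d]

/-- Exchange of the symbol at site `i` with an external symbol. -/
def flip (i : ℤ) : Conf d × Fin d ≃ Conf d × Fin d :=
  Function.Involutive.toPerm (fun p => (p.1.update i p.2, p.1 i)) (by
    rintro ⟨s, b⟩
    ext x <;> simp)

theorem summable_sq (ξ : ChainSpace d) : Summable fun s => ‖ξ s‖ ^ 2 := by
  simpa using (memℓp_gen_iff (by norm_num)).1 (lp.memℓp ξ)

theorem norm_sq_eq (ξ : ChainSpace d) : ‖ξ‖ ^ 2 = ∑' s, ‖ξ s‖ ^ 2 := by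
  simpa using lp.norm_rpow_eq_tsum (p := 2) (by norm_num) ξ

theorem hasSum_flip (i : ℤ) (ξ : ChainSpace d) :
    HasSum (fun s : Conf d => ∑ b, ‖ξ (s.update i b)‖ ^ 2) (d * ‖ξ‖ ^ 2) := by
  have h1 : HasSum (fun p : Conf d × Fin d => ‖ξ p.1‖ ^ 2) (d * ‖ξ‖ ^ 2) := by
    have hs : Summable (fun p : Conf d × Fin d => ‖ξ p.1‖ ^ 2) := by
      have := (summable_sq ξ).mul_of_nonneg (g := fun _ : Fin d => (1 : ℝ)) (Summable.of_finite)
        (fun _ => by positivity) (fun _ => by simp)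
      simpa using this
    convert hs.hasSum using 1
    rw [hs.tsum_prod, norm_sq_eq, ← tsum_mul_left]
    simp
  have h2 := ((flip (d := d) i).hasSum_iff.2 h1)
  exact h2.prod_fiberwise fun s => hasSum_fintype _

/-- Action of a matrix on the `i`-th coordinate of a function of configurations. -/
def siteFun (i : ℤ) (A : Matrix (Fin d) (Fin d) ℂ) (ξ : Conf d → ℂ) : Conf d → ℂ :=
  fun s => ∑ b, A (s i) b * ξ (s.update i b)

theorem siteFun_le (i : ℤ) (A : Matrix (Fin d) (Fin d) ℂ) (ξ : ChainSpace d) (s : Conf d) :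
    ‖siteFun i A ξ s‖ ^ 2 ≤ (∑ a, ∑ b, ‖A a b‖ ^ 2) * ∑ b, ‖ξ (s.update i b)‖ ^ 2 := by
  calc ‖siteFun i A ξ s‖ ^ 2 ≤ (∑ b, ‖A (s i) b‖ * ‖ξ (s.update i b)‖) ^ 2 := by
        gcongr
        refine (norm_sum_le _ _).trans (le_of_eq ?_)
        simp
    _ ≤ (∑ b, ‖A (s i) b‖ ^ 2) * ∑ b, ‖ξ (s.update i b)‖ ^ 2 :=
        Finset.sum_mul_sq_le_sq_mul_sq _ _ _
    _ ≤ _ := by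
        refine mul_le_mul_of_nonneg_right ?_ (by positivity)
        exact Finset.single_le_sum (f := fun a => ∑ b, ‖A a b‖ ^ 2)
          (fun a _ => by positivity) (Finset.mem_univ (s i))

theorem siteFun_summable (i : ℤ) (A : Matrix (Fin d) (Fin d) ℂ) (ξ : ChainSpace d) :
    Summable fun s => ‖siteFun i A ξ s‖ ^ 2 :=
  Summable.of_nonneg_of_le (fun _ => by positivity) (siteFun_le i A ξ)
    ((hasSum_flip i ξ).summable.mul_left _)

/-- `siteFun` as a linear map of `ChainSpace d`. -/
def siteLin (i : ℤ) (A : Matrix (Fin d) (Fin d) ℂ) : ChainSpace d →ₗ[ℂ] ChainSpace d where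
  toFun ξ := ⟨siteFun i A ξ, memℓp_gen (by simpa using siteFun_summable i A ξ)⟩
  map_add' ξ η := by
    ext s
    change siteFun i A (ξ + η) s = siteFun i A ξ s + siteFun i A η s
    simp [siteFun, mul_add, Finset.sum_add_distrib]
  map_smul' c ξ := by
    ext s
    change siteFun i A (c • ξ) s = c • siteFun i A ξ s
    simp [siteFun, Finset.mul_sum, mul_left_comm]

theorem siteLin_bound (i : ℤ) (A : Matrix (Fin d) (Fin d) ℂ) (ξ : ChainSpace d) :
    ‖siteLin i A ξ‖ ≤ √((∑ a, ∑ b, ‖A a b‖ ^ 2) * d) * ‖ξ‖ := by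
  refine le_of_sq_le_sq ?_ (by positivity)
  rw [mul_pow, Real.sq_sqrt (by positivity), norm_sq_eq, mul_assoc]
  have h := (hasSum_flip i ξ).mul_left (∑ a, ∑ b, ‖A a b‖ ^ 2)
  rw [← h.tsum_eq]
  exact (siteFun_summable i A ξ).tsum_le_tsum (siteFun_le i A ξ) h.summable

/-- The operator of a single-site observable `A` at site `i`:
`(A ξ)(s) = ∑ b, A (s i) b * ξ (s with s i replaced by b)`. -/
def siteOp (i : ℤ) (A : Matrix (Fin d) (Fin d) ℂ) : ChainOp d :=
  (siteLin i A).mkContinuous _ (siteLin_bound i A)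

@[simp] theorem siteOp_apply (i : ℤ) (A : Matrix (Fin d) (Fin d) ℂ) (ξ : ChainSpace d)
    (s : Conf d) : siteOp i A ξ s = ∑ b, A (s i) b * ξ (s.update i b) := rfl

theorem update_update (i : ℤ) (s : Conf d) (b c : Fin d) :
    (s.update i b).update i c = s.update i c := by
  ext; simp

theorem siteOp_adjoint (i : ℤ) (A : Matrix (Fin d) (Fin d) ℂ) :
    siteOp i (star A) = star (siteOp i A) := by
  rw [ContinuousLinearMap.star_eq_adjoint, ContinuousLinearMap.eq_adjoint_iff]
  intro ξ η
  rw [lp.inner_eq_tsum, lp.inner_eq_tsum]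
  let F : Conf d × Fin d → ℂ := fun p =>
    (starRingEnd ℂ) (star A (p.1 i) p.2 * ξ (p.1.update i p.2)) * η p.1
  have hF : Summable F := by
    have hs : Summable (fun p : Conf d × Fin d => ‖η p.1‖ ^ 2) := by
      have := (summable_sq η).mul_of_nonneg (g := fun _ : Fin d => (1 : ℝ)) (Summable.of_finite)
        (fun _ => by positivity) (fun _ => by simp)
      simpa using this
    have hs' : Summable (fun p : Conf d × Fin d => ‖ξ p.1‖ ^ 2) := by
      have := (summable_sq ξ).mul_of_nonneg (g := fun _ : Fin d => (1 : ℝ)) (Summable.of_finite)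
        (fun _ => by positivity) (fun _ => by simp)
      simpa using this
    have hs'' := (flip (d := d) i).summable_iff.2 hs'
    refine Summable.of_norm_bounded ((hs.add hs'').mul_left (∑ a, ∑ b, ‖A a b‖)) ?_
    rintro ⟨s, b⟩
    have hA : ‖A b (s i)‖ ≤ ∑ a, ∑ b, ‖A a b‖ :=
      (Finset.single_le_sum (f := fun c => ‖A b c‖) (fun c _ => by positivity)
        (Finset.mem_univ (s i))).trans
      (Finset.single_le_sum (f := fun a => ∑ c, ‖A a c‖) (fun c _ => by positivity)
        (Finset.mem_univ b))
    have : ‖F (s, b)‖ = ‖A b (s i)‖ * (‖ξ (s.update i b)‖ * ‖η s‖) := by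
      simp [F, Matrix.star_apply, mul_assoc]
    rw [this]
    refine mul_le_mul hA ?_ (by positivity) (by positivity)
    change _ ≤ ‖η s‖ ^ 2 + ‖ξ (s.update i b)‖ ^ 2
    nlinarith [sq_nonneg (‖ξ (s.update i b)‖ - ‖η s‖), sq_nonneg ‖η s‖,
      sq_nonneg ‖ξ (s.update i b)‖]
  have h1 := hF.tsum_prod
  have hF' := (flip (d := d) i).summable_iff.2 hF
  have h2 := hF'.tsum_prod
  have h3 : ∑' p, (F ∘ flip i) p = ∑' p, F p := (flip (d := d) i).tsum_eq F
  rw [h3] at h2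
  have e1 : ∀ s, inner ℂ (siteOp i (star A) ξ s) (η s) = ∑' b, F (s, b) := by
    intro s
    simp [F, tsum_fintype, Finset.mul_sum, mul_comm]
  have e2 : ∀ s, inner ℂ (ξ s) (siteOp i A η s) = ∑' b, (F ∘ flip i) (s, b) := by
    intro s
    simp only [siteOp_apply, tsum_fintype, Function.comp]
    simp only [RCLike.inner_apply, Finset.sum_mul]
    refine Finset.sum_congr rfl fun b _ => ?_
    have : (flip (d := d) i) (s, b) = (s.update i b, s i) := rfl
    simp only [F, this, update_update]
    have : s.update i (s i) = s := by ext; simp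
    simp [this, Matrix.star_apply]
    ring
  simp_rw [e1, e2]
  rw [← h1, ← h2]

/-- The canonical embedding `β_i` of `M_d` as the `i`-th tensor factor. -/
def site (i : ℤ) : Matrix (Fin d) (Fin d) ℂ →⋆ₐ[ℂ] ChainOp d where
  toFun := siteOp i
  map_one' := by
    ext ξ s
    have : s.update i (s i) = s := by ext; simp
    simp [Matrix.one_apply, this]
  map_mul' A B := by
    ext ξ s
    change _ = siteOp i A (siteOp i B ξ) s
    simp only [siteOp_apply, Matrix.mul_apply, update_update, Finset.mul_sum, Finset.sum_mul]
    rw [Finset.sum_comm]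
    simp [mul_assoc, Function.update_self]
  map_zero' := by ext ξ s; simp
  map_add' A B := by ext ξ s; simp [add_mul, Finset.sum_add_distrib]
  commutes' c := by
    ext ξ s
    have : s.update i (s i) = s := by ext; simp
    simp [Matrix.algebraMap_matrix_apply, this]
  map_star' := siteOp_adjoint i

theorem site_apply (i : ℤ) (A : Matrix (Fin d) (Fin d) ℂ) (ξ : ChainSpace d)
    (s : Conf d) : site i A ξ s = ∑ b, A (s i) b * ξ (s.update i b) := rfl

theorem site_commute {i j : ℤ} (h : i ≠ j) (A B : Matrix (Fin d) (Fin d) ℂ) :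
    Commute (site i A) (site j B) := by
  ext ξ s
  change site i A (site j B ξ) s = site j B (site i A ξ) s
  simp only [site_apply, Finset.mul_sum]
  rw [Finset.sum_comm]
  refine Finset.sum_congr rfl fun b _ => Finset.sum_congr rfl fun c _ => ?_
  have : (s.update i c).update j b = (s.update j b).update i c := by
    ext x; simp [Function.update_comm h]
  rw [this]
  simp [Function.update_of_ne h, Function.update_of_ne h.symm]
  ring

/-- Translation of configurations: `(confShift s) i = s (i + 1)`. -/
def confShift : Conf d ≃ Conf d where
  toFun s := s.equivMapDomain (Equiv.subRight (1 : ℤ))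
  invFun s := s.equivMapDomain (Equiv.addRight (1 : ℤ))
  left_inv s := by ext; simp [Finsupp.equivMapDomain]
  right_inv s := by ext; simp [Finsupp.equivMapDomain]

@[simp] theorem confShift_apply (s : Conf d) (i : ℤ) : confShift s i = s (i + 1) := rfl

@[simp] theorem confShift_symm_apply (s : Conf d) (i : ℤ) : confShift.symm s i = s (i - 1) := rfl

/-- Composition of a vector with a permutation of the configurations. -/
def reindex (e : Conf d ≃ Conf d) (ξ : ChainSpace d) : ChainSpace d :=
  ⟨fun s => ξ (e s), memℓp_gen (by
    simpa [Function.comp_def] using e.summable_iff.2 (summable_sq ξ))⟩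

/-- The unitary of `ChainSpace d` that implements the right shift. -/
def shiftUnitary : ChainSpace d ≃ₗᵢ[ℂ] ChainSpace d where
  toFun := reindex confShift
  invFun := reindex confShift.symm
  map_add' _ _ := rfl
  map_smul' _ _ := rfl
  left_inv ξ := by ext s; simp [reindex]
  right_inv ξ := by ext s; simp [reindex]
  norm_map' ξ := by
    refine (sq_eq_sq₀ (norm_nonneg _) (norm_nonneg _)).1 ?_
    rw [norm_sq_eq, norm_sq_eq]
    exact confShift.tsum_eq fun s => ‖ξ s‖ ^ 2

/-- The right shift, as an automorphism of the algebra of all bounded operators; it maps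
`β_i(A)` to `β_{i+1}(A)`. -/
def shiftOp : ChainOp d ≃⋆ₐ[ℂ] ChainOp d := shiftUnitary.conjStarAlgEquiv

theorem shiftOp_site (i : ℤ) (A : Matrix (Fin d) (Fin d) ℂ) :
    shiftOp (site i A) = site (i + 1) A := by
  ext ξ s
  change ∑ b, A (s (i + 1)) b * ξ (confShift.symm ((confShift s).update i b)) = _
  rw [site_apply]
  refine Finset.sum_congr rfl fun b _ => ?_
  have hc : confShift.symm ((confShift s).update i b) = s.update (i + 1) b := by
    ext j
    rw [confShift_symm_apply]
    by_cases h : j = i + 1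
    · subst h; simp
    · have : j - 1 ≠ i := by omega
      simp [Function.update_of_ne h, Function.update_of_ne this]
  rw [hc]

theorem shiftOp_symm_site (i : ℤ) (A : Matrix (Fin d) (Fin d) ℂ) :
    shiftOp.symm (site i A) = site (i - 1) A := by
  rw [StarAlgEquiv.symm_apply_eq, shiftOp_site, sub_add_cancel]

theorem shiftOp_continuous : Continuous (shiftOp (d := d)) := by
  refine AddMonoidHomClass.continuous_of_bound shiftOp 1 fun x => ?_
  rw [one_mul]
  refine ContinuousLinearMap.opNorm_le_bound _ (norm_nonneg _) fun ξ => ?_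
  change ‖shiftUnitary (x (shiftUnitary.symm ξ))‖ ≤ _
  rw [LinearIsometryEquiv.norm_map]
  simpa using x.le_opNorm (shiftUnitary.symm ξ)

theorem shiftOp_symm_continuous : Continuous (shiftOp (d := d)).symm := by
  refine AddMonoidHomClass.continuous_of_bound shiftOp.symm 1 fun x => ?_
  rw [one_mul]
  refine ContinuousLinearMap.opNorm_le_bound _ (norm_nonneg _) fun ξ => ?_
  change ‖shiftUnitary.symm (x (shiftUnitary ξ))‖ ≤ _
  rw [LinearIsometryEquiv.norm_map]
  simpa using x.le_opNorm (shiftUnitary ξ)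

variable (d) in
/-- The local algebra `𝔅_Λ`. -/
def localAlg (Λ : Finset ℤ) : StarSubalgebra ℂ (ChainOp d) :=
  StarAlgebra.adjoin ℂ (⋃ i ∈ Λ, Set.range (site (d := d) i))

variable (d) in
/-- The infinite C*-tensor product `𝔅 = ⨂_ℤ M_d`: the norm closure of the union of the local
algebras. -/
def quasiLocalAlg : StarSubalgebra ℂ (ChainOp d) :=
  (⨆ n : ℕ, localAlg d (Finset.Icc (-n : ℤ) n)).topologicalClosure

theorem site_mem_localAlg {Λ : Finset ℤ} {i : ℤ} (hi : i ∈ Λ) (A : Matrix (Fin d) (Fin d) ℂ) :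
    site i A ∈ localAlg d Λ :=
  StarAlgebra.subset_adjoin ℂ _ (Set.mem_iUnion₂.2 ⟨i, hi, A, rfl⟩)

theorem localAlg_mono {Λ Λ' : Finset ℤ} (h : Λ ⊆ Λ') : localAlg d Λ ≤ localAlg d Λ' :=
  StarAlgebra.adjoin_mono (Set.biUnion_subset_biUnion_left fun _ hi => h hi)

theorem exists_subset_Icc (Λ : Finset ℤ) : ∃ n : ℕ, Λ ⊆ Finset.Icc (-n : ℤ) n := by
  refine ⟨∑ i ∈ Λ, i.natAbs, fun i hi => ?_⟩
  have := Finset.single_le_sum (f := fun i : ℤ => i.natAbs) (fun _ _ => Nat.zero_le _) hi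
  rw [Finset.mem_Icc]
  omega

theorem localAlg_le (Λ : Finset ℤ) : localAlg d Λ ≤ quasiLocalAlg d := by
  obtain ⟨n, hn⟩ := exists_subset_Icc Λ
  exact (localAlg_mono hn).trans
    ((le_iSup (fun n : ℕ => localAlg d (Finset.Icc (-n : ℤ) n)) n).trans
      (StarSubalgebra.le_topologicalClosure _))

variable (d) in
/-- The embedding `β_i` of `M_d` into `𝔅`. -/
def siteEmb (i : ℤ) : Matrix (Fin d) (Fin d) ℂ →⋆ₐ[ℂ] quasiLocalAlg d :=
  (site i).codRestrict _ fun A => localAlg_le {i} (site_mem_localAlg (by simp) A)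

/-- The unitary `g^{⊗ Λ} = ∏_{i ∈ Λ} β_i(g)`. -/
def gaugeUnitary (g : Matrix.unitaryGroup (Fin d) ℂ) (Λ : Finset ℤ) : ChainOp d :=
  Λ.noncommProd (fun i => site i (g : Matrix (Fin d) (Fin d) ℂ))
    fun _ _ _ _ h => site_commute h _ _

theorem gaugeUnitary_mem (g : Matrix.unitaryGroup (Fin d) ℂ) (Λ : Finset ℤ) :
    gaugeUnitary g Λ ∈ unitary (ChainOp d) :=
  Submonoid.noncommProd_mem _ _ _ _ fun i _ => Unitary.map_mem (site i) g.2

/-- The gauge automorphism `α_g` on `𝔅_Λ`: it is `Ad g^{⊗ Λ}`. -/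
def gaugeAut (g : Matrix.unitaryGroup (Fin d) ℂ) (Λ : Finset ℤ) : ChainOp d ≃⋆ₐ[ℂ] ChainOp d :=
  Unitary.conjStarAlgAut ℂ (ChainOp d) ⟨gaugeUnitary g Λ, gaugeUnitary_mem g Λ⟩

/-- The gauge-invariant local algebra `𝔄_Λ = {B ∈ 𝔅_Λ | α_g(B) = B for all g ∈ G}`. -/
def gaugeLocal (G : Subgroup (Matrix.unitaryGroup (Fin d) ℂ)) (Λ : Finset ℤ) :
    StarSubalgebra ℂ (ChainOp d) where
  carrier := {B | B ∈ localAlg d Λ ∧ ∀ g ∈ G, gaugeAut g Λ B = B}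
  mul_mem' ha hb := ⟨mul_mem ha.1 hb.1, fun g hg => by rw [map_mul, ha.2 g hg, hb.2 g hg]⟩
  add_mem' ha hb := ⟨add_mem ha.1 hb.1, fun g hg => by rw [map_add, ha.2 g hg, hb.2 g hg]⟩
  algebraMap_mem' c := ⟨algebraMap_mem _ c, fun g _ => AlgHomClass.commutes (gaugeAut g Λ) c⟩
  star_mem' ha := ⟨star_mem ha.1, fun g hg => by rw [map_star, ha.2 g hg]⟩

/-- The gauge-invariant algebra `𝔄`: the norm closure of `⋃ n, 𝔄_{[-n,n]}`. -/
def gaugeAlg (G : Subgroup (Matrix.unitaryGroup (Fin d) ℂ)) : StarSubalgebra ℂ (ChainOp d) :=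
  (⨆ n : ℕ, gaugeLocal G (Finset.Icc (-n : ℤ) n)).topologicalClosure

theorem gaugeAlg_le (G : Subgroup (Matrix.unitaryGroup (Fin d) ℂ)) :
    gaugeAlg G ≤ quasiLocalAlg d :=
  StarSubalgebra.topologicalClosure_mono (iSup_mono fun _ _ h => h.1)

theorem gaugeAut_apply (g : Matrix.unitaryGroup (Fin d) ℂ) (Λ : Finset ℤ) (x : ChainOp d) :
    gaugeAut g Λ x = gaugeUnitary g Λ * x * star (gaugeUnitary g Λ) := rfl

theorem gaugeAut_of_disjoint (g : Matrix.unitaryGroup (Fin d) ℂ) {Λ T : Finset ℤ}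
    (h : Disjoint Λ T) {x : ChainOp d} (hx : x ∈ localAlg d Λ) : gaugeAut g T x = x := by
  have hle : localAlg d Λ ≤ StarAlgHom.equalizer (gaugeAut (d := d) g T : _ →⋆ₐ[ℂ] ChainOp d)
      (StarAlgHom.id ℂ _) := by
    refine StarAlgHom.adjoin_le_equalizer _ _ ?_
    intro y hy
    obtain ⟨i, hi, A, rfl⟩ := Set.mem_iUnion₂.1 hy
    change gaugeAut g T _ = _
    rw [gaugeAut_apply]
    have hc : Commute (site i A) (gaugeUnitary g T) :=
      Finset.noncommProd_commute _ _ _ _ fun j hj => site_commute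
        (fun e => Finset.disjoint_left.1 h hi (by rwa [e])) _ _
    rw [← hc.eq, mul_assoc, Unitary.mul_star_self_of_mem (gaugeUnitary_mem g T), mul_one]
    rfl
  exact hle hx

theorem gaugeAut_of_subset (g : Matrix.unitaryGroup (Fin d) ℂ) {Λ Λ' : Finset ℤ}
    (h : Λ ⊆ Λ') {x : ChainOp d} (hx : x ∈ localAlg d Λ) : gaugeAut g Λ' x = gaugeAut g Λ x := by
  have e : gaugeUnitary g Λ' = gaugeUnitary g Λ * gaugeUnitary g (Λ' \ Λ) := by
    rw [gaugeUnitary, gaugeUnitary, gaugeUnitary,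
      ← Finset.noncommProd_union_of_disjoint Finset.disjoint_sdiff]
    · exact Finset.noncommProd_congr (Finset.union_sdiff_of_subset h).symm (fun _ _ => rfl) _
  have hd := gaugeAut_of_disjoint g (Finset.disjoint_sdiff (s := Λ) (t := Λ')) hx
  rw [gaugeAut_apply] at hd
  rw [gaugeAut_apply, e, star_mul, gaugeAut_apply]
  conv_rhs => rw [← hd]
  simp only [mul_assoc]

variable {G : Subgroup (Matrix.unitaryGroup (Fin d) ℂ)}

theorem gaugeLocal_mono {Λ Λ' : Finset ℤ} (h : Λ ⊆ Λ') : gaugeLocal G Λ ≤ gaugeLocal G Λ' :=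
  fun _ hx => ⟨localAlg_mono h hx.1, fun g hg => by
    rw [gaugeAut_of_subset g h hx.1, hx.2 g hg]⟩

theorem gaugeLocal_le (Λ : Finset ℤ) : gaugeLocal G Λ ≤ gaugeAlg G := by
  obtain ⟨n, hn⟩ := exists_subset_Icc Λ
  exact (gaugeLocal_mono hn).trans
    ((le_iSup (fun n : ℕ => gaugeLocal G (Finset.Icc (-n : ℤ) n)) n).trans
      (StarSubalgebra.le_topologicalClosure _))

/-- A *-automorphism that permutes the sites maps `𝔄` into itself. -/
theorem map_mem_gaugeAlg (θ : ChainOp d ≃⋆ₐ[ℂ] ChainOp d) (hθ : Continuous θ) (e : ℤ ↪ ℤ)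
    (h : ∀ i A, θ (site i A) = site (e i) A) {x : ChainOp d} (hx : x ∈ gaugeAlg G) :
    θ x ∈ gaugeAlg G := by
  have hloc : ∀ Λ, ∀ y ∈ localAlg d Λ, θ y ∈ localAlg d (Λ.map e) := by
    intro Λ
    change localAlg d Λ ≤ (localAlg d (Λ.map e)).comap (θ : _ →⋆ₐ[ℂ] ChainOp d)
    refine StarAlgebra.adjoin_le ?_
    intro y hy
    obtain ⟨i, hi, A, rfl⟩ := Set.mem_iUnion₂.1 hy
    change θ _ ∈ localAlg d (Λ.map e)
    rw [h]
    exact site_mem_localAlg (Finset.mem_map_of_mem e hi) A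
  have hU : ∀ g Λ, θ (gaugeUnitary g Λ) = gaugeUnitary g (Λ.map e) := by
    intro g Λ
    refine (Finset.map_noncommProd Λ _ (fun _ _ _ _ h => site_commute h _ _) θ).trans ?_
    simp [h, gaugeUnitary, Finset.noncommProd, Multiset.map_map]
  have hle : gaugeAlg G ≤ (gaugeAlg G).comap (θ : _ →⋆ₐ[ℂ] ChainOp d) := by
    refine StarSubalgebra.topologicalClosure_minimal (iSup_le fun n => ?_)
      ((StarSubalgebra.isClosed_topologicalClosure _).preimage hθ)
    intro y hy
    change θ y ∈ gaugeAlg G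
    refine gaugeLocal_le ((Finset.Icc (-n : ℤ) n).map e) ⟨hloc _ y hy.1, fun g hg => ?_⟩
    rw [gaugeAut_apply, ← hU, ← map_star, ← map_mul, ← map_mul, ← gaugeAut_apply, hy.2 g hg]
  exact hle hx

variable (G) in
/-- The right shift `γ` as an automorphism of `𝔄`. -/
def gaugeShift : gaugeAlg G ≃⋆ₐ[ℂ] gaugeAlg G where
  toFun x := ⟨shiftOp (x : ChainOp d),
    map_mem_gaugeAlg shiftOp shiftOp_continuous (Equiv.addRight (1 : ℤ)).toEmbedding
      shiftOp_site x.2⟩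
  invFun x := ⟨shiftOp.symm (x : ChainOp d),
    map_mem_gaugeAlg shiftOp.symm shiftOp_symm_continuous (Equiv.subRight (1 : ℤ)).toEmbedding
      shiftOp_symm_site x.2⟩
  left_inv x := Subtype.ext (by simp)
  right_inv x := Subtype.ext (by simp)
  map_mul' x y := Subtype.ext (map_mul shiftOp (x : ChainOp d) y)
  map_add' x y := Subtype.ext (map_add shiftOp (x : ChainOp d) y)
  map_smul' c x := Subtype.ext (map_smul shiftOp c (x : ChainOp d))
  map_star' x := Subtype.ext (map_star shiftOp (x : ChainOp d))

end site

section states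
variable {A : Type*} [Ring A] [StarRing A] [Algebra ℂ A]

/-- A positive linear functional. -/
def IsPositive (φ : A →ₗ[ℂ] ℂ) : Prop := ∀ a, 0 ≤ φ (star a * a)

/-- A state. -/
def IsState (φ : A →ₗ[ℂ] ℂ) : Prop := IsPositive φ ∧ φ 1 = 1

/-- Complete positivity of a map between C*-algebras: for every `n`, the entrywise extension to
`n × n` matrices maps positive elements `X* X` to positive elements `Y* Y`. -/
def IsCompletelyPositive {B : Type*} [Ring B] [StarRing B] [Algebra ℂ B] (F : A →ₗ[ℂ] B) : Prop :=
  ∀ (n : ℕ) (X : Matrix (Fin n) (Fin n) A), ∃ Y : Matrix (Fin n) (Fin n) B,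
    (star X * X).map F = star Y * Y

/-- The finite-dimensional C*-algebra `⨁_i M_{n i}(ℂ)`; every finite-dimensional C*-algebra is
*-isomorphic to one of these. -/
abbrev Blocks {m : ℕ} (n : Fin m → ℕ) : Type := ∀ i, Matrix (Fin (n i)) (Fin (n i)) ℂ

/-- The density matrix of a functional on `⨁_i M_{n i}`: `ψ(a) = ∑ i, Tr (D_i a_i)`. -/
def density {m : ℕ} {n : Fin m → ℕ} (ψ : Blocks n →ₗ[ℂ] ℂ) : Blocks n :=
  fun i => Matrix.of fun a b => ψ (Pi.single i (Matrix.single b a 1))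

/-- Von Neumann entropy `-Tr D log D` of a state on `⨁_i M_{n i}` with density matrix `D`. -/
def blockEntropy {m : ℕ} {n : Fin m → ℕ} (ψ : Blocks n →ₗ[ℂ] ℂ) : ℝ :=
  ∑ i, (cfc Real.negMulLog (density ψ i)).trace.re

/-- Von Neumann entropy of a state on a finite-dimensional C*-algebra `A`: its entropy under an
identification `A ≅ ⨁_i M_{n i}`. All identifications give the same value. -/
def entropy (ψ : A →ₗ[ℂ] ℂ) : ℝ :=
  sSup {x | ∃ (m : ℕ) (n : Fin m → ℕ) (e : A ≃⋆ₐ[ℂ] Blocks n),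
    x = blockEntropy (ψ ∘ₗ (e.symm : Blocks n →ₗ[ℂ] A))}

/-- The marginal `ψ^l_i = ∑_{J, J l = i} ψ_J`. -/
def marginal {k r : ℕ} (ψ : (Fin k → Fin r) → (A →ₗ[ℂ] ℂ)) (l : Fin k) (i : Fin r) : A →ₗ[ℂ] ℂ :=
  ∑ J with J l = i, ψ J

/-- The total mass `ψ(1)` of a positive functional. -/
def mass (ψ : A →ₗ[ℂ] ℂ) : ℝ := (ψ 1).re

/-- The normalization `ψ / ψ(1)` of a positive functional (only used with weight `ψ(1)`, so its
value for `ψ = 0` is irrelevant). -/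
def normalization (ψ : A →ₗ[ℂ] ℂ) : A →ₗ[ℂ] ℂ := (ψ 1)⁻¹ • ψ

/-- The value of a finite decomposition `φ = ∑_J ψ_J`, `J = (i_1, …, i_k)`, for unital completely
positive maps `α_1, …, α_k` from a finite-dimensional C*-algebra to `A`:
`∑_J η(ψ_J(1)) - ∑_l ∑_i η(ψ^l_i(1)) + ∑_l S(φ ∘ α_l) - ∑_l ∑_i ψ^l_i(1) S(ψ^l_i ∘ α_l / ψ^l_i(1))`
with `η(x) = -x log x`. -/
def cntValue {m : ℕ} {n : Fin m → ℕ} {k r : ℕ} (φ : A →ₗ[ℂ] ℂ) (α : Fin k → (Blocks n →ₗ[ℂ] A))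
    (ψ : (Fin k → Fin r) → (A →ₗ[ℂ] ℂ)) : ℝ :=
  ∑ J, Real.negMulLog (mass (ψ J)) - ∑ l, ∑ i, Real.negMulLog (mass (marginal ψ l i))
    + ∑ l, blockEntropy (φ ∘ₗ α l)
    - ∑ l, ∑ i, mass (marginal ψ l i) * blockEntropy (normalization (marginal ψ l i) ∘ₗ α l)

/-- The Connes-Narnhofer-Thirring entropy `H_φ(α_1, …, α_k)`: the supremum over all finite
decompositions of `φ` into positive functionals. One range `Fin r` for all the indices is no loss,
since zero functionals may occur and contribute nothing. -/
def cntH {m : ℕ} {n : Fin m → ℕ} {k : ℕ} (φ : A →ₗ[ℂ] ℂ) (α : Fin k → (Blocks n →ₗ[ℂ] A)) :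
    EReal :=
  ⨆ (r : ℕ) (ψ : (Fin k → Fin r) → (A →ₗ[ℂ] ℂ))
    (_ : (∀ J, IsPositive (ψ J)) ∧ ∑ J, ψ J = φ), (cntValue φ α ψ : EReal)

/-- `h_{φ,θ}(α) = lim_k (1/k) H_φ(α, θ ∘ α, …, θ^{k-1} ∘ α)`. For a `θ`-invariant state the sequence
`H_φ(α, …, θ^{k-1} ∘ α)` is subadditive in `k`, so that the limit exists and is the `limsup`. -/
def cntEntropyAlong {m : ℕ} {n : Fin m → ℕ} (φ : A →ₗ[ℂ] ℂ) (θ : A ≃⋆ₐ[ℂ] A)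
    (α : Blocks n →ₗ[ℂ] A) : EReal :=
  Filter.limsup (fun k : ℕ =>
    cntH φ (fun j : Fin k => ((θ : A →ₗ[ℂ] A) ^ (j : ℕ)) ∘ₗ α) / (k : EReal)) Filter.atTop

/-- The Connes-Narnhofer-Thirring dynamical entropy `h_φ(θ)`: the supremum of `h_{φ,θ}(α)` over all
unital completely positive maps `α` from finite-dimensional C*-algebras to `A`. -/
def cntEntropy (φ : A →ₗ[ℂ] ℂ) (θ : A ≃⋆ₐ[ℂ] A) : EReal :=
  ⨆ (m : ℕ) (n : Fin m → ℕ) (α : Blocks n →ₗ[ℂ] A)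
    (_ : IsCompletelyPositive α ∧ α 1 = 1), cntEntropyAlong φ θ α

end states

section chains
variable {d : ℕ} [NeZero d]

/-- `E(A_1 ⊗ E(A_2 ⊗ ⋯ E(A_n ⊗ 1) ⋯))`. -/
def nestedE (E : Matrix (Fin d × Fin d) (Fin d × Fin d) ℂ →ₗ[ℂ] Matrix (Fin d) (Fin d) ℂ) :
    List (Matrix (Fin d) (Fin d) ℂ) → Matrix (Fin d) (Fin d) ℂ
  | [] => 1
  | A :: L => E (A ⊗ₖ nestedE E L)

/-- `φ` is the C*-finitely correlated state on `𝔅` generated by the triple `(M_d, E, ρ)`; in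
`apply_tensor` the tensor `A_1 ⊗ ⋯ ⊗ A_n` may sit at any `n` consecutive sites. -/
structure IsFinitelyCorrelated (φ : quasiLocalAlg d →ₗ[ℂ] ℂ)
    (E : Matrix (Fin d × Fin d) (Fin d × Fin d) ℂ →ₗ[ℂ] Matrix (Fin d) (Fin d) ℂ)
    (ρ : Matrix (Fin d) (Fin d) ℂ →ₗ[ℂ] ℂ) : Prop where
  isState : IsState φ
  completelyPositive : IsCompletelyPositive E
  isState_initial : IsState ρ
  invariant : ∀ C, ρ (E (1 ⊗ₖ C)) = ρ C
  apply_tensor : ∀ (m : ℤ) (n : ℕ) (A : Fin n → Matrix (Fin d) (Fin d) ℂ),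
    φ (List.ofFn fun j : Fin n => siteEmb d (m + (j : ℤ)) (A j)).prod = ρ (nestedE E (List.ofFn A))

/-- `G`-covariance of `E`. -/
def IsCovariant (G : Subgroup (Matrix.unitaryGroup (Fin d) ℂ))
    (E : Matrix (Fin d × Fin d) (Fin d × Fin d) ℂ →ₗ[ℂ] Matrix (Fin d) (Fin d) ℂ) : Prop :=
  ∀ g ∈ G, ∀ A B : Matrix (Fin d) (Fin d) ℂ,
    E (((g : Matrix (Fin d) (Fin d) ℂ) ⊗ₖ (g : Matrix (Fin d) (Fin d) ℂ)) * (A ⊗ₖ B) *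
      star ((g : Matrix (Fin d) (Fin d) ℂ) ⊗ₖ (g : Matrix (Fin d) (Fin d) ℂ))) =
    (g : Matrix (Fin d) (Fin d) ℂ) * E (A ⊗ₖ B) * star (g : Matrix (Fin d) (Fin d) ℂ)

/-- `φ` is a generalized quantum Markov chain on `𝔄`: the restriction to `𝔄` of a C*-finitely
correlated state on `𝔅` generated by `(M_d, E, ρ)` with `G`-covariant `E`. -/
def IsGeneralizedMarkovChain (G : Subgroup (Matrix.unitaryGroup (Fin d) ℂ))
    (φ : gaugeAlg G →ₗ[ℂ] ℂ) : Prop :=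
  ∃ (φ' : quasiLocalAlg d →ₗ[ℂ] ℂ)
    (E : Matrix (Fin d × Fin d) (Fin d × Fin d) ℂ →ₗ[ℂ] Matrix (Fin d) (Fin d) ℂ)
    (ρ : Matrix (Fin d) (Fin d) ℂ →ₗ[ℂ] ℂ),
    IsFinitelyCorrelated φ' E ρ ∧ IsCovariant G E ∧
      ∀ a : gaugeAlg G, φ a = φ' (StarSubalgebra.inclusion (gaugeAlg_le G) a)

/-- The restriction of `φ` to `𝔄_Λ`. -/
def localize {G : Subgroup (Matrix.unitaryGroup (Fin d) ℂ)} (φ : gaugeAlg G →ₗ[ℂ] ℂ)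
    (Λ : Finset ℤ) : gaugeLocal G Λ →ₗ[ℂ] ℂ :=
  φ ∘ₗ (StarSubalgebra.inclusion (gaugeLocal_le (G := G) Λ)).toAlgHom.toLinearMap

/-- `s` is the mean entropy of `φ`: the limit of `S(φ | 𝔄_{[1,n]}) / n` exists and equals `s`. -/
def HasMeanEntropy {G : Subgroup (Matrix.unitaryGroup (Fin d) ℂ)} (φ : gaugeAlg G →ₗ[ℂ] ℂ)
    (s : ℝ) : Prop :=
  Filter.Tendsto (fun n : ℕ => (1 / (n : ℝ)) * entropy (localize φ (Finset.Icc (1 : ℤ) n)))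
    Filter.atTop (nhds s)

end chains
end QChain
end

open QChain

/-! Two limits are compared: the rate of the local entropies on `𝔄_{[1,n]}`, and the CNT entropy.
All errors are of order `log n` on `n` sites, so they vanish per site.

Passing from `𝔅` to `𝔄`. On `N` sites the gauge-invariant algebra is the commutant of the matrices
`g^{⊗N}`. These lie in a space of dimension at most `(N+1)^(d^2)`, because the entries of `g^{⊗N}`
depend only on how often each pair of symbols occurs. By a bicommutant argument the multiplicities
of the commutant then add up to at most that number (`trace_cornerProj_le`). The Pimsner-Popa
inequality and monotonicity of relative entropy show that restricting a state to a subalgebra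
changes its entropy by at most the logarithm of the total multiplicity (`abs_blockEntropy_sub_le`).
So `𝔄` and `𝔅` have the same entropy rate, which exists by subadditivity and Fekete's lemma.

Upper bound. A unital completely positive map `α` into `𝔄` is approximated, uniformly in states, by
a unital Schwarz map into some `𝔄_{[-M,M]}` (`IsCompletelyPositive.exists_approx`); its first `k`
translates have values in `𝔄_{[-M,M+k]}`. When all maps take values in one finite-dimensional
algebra, the CNT functional is at most the entropy of the state on that algebra (`cntValue_le`).
This follows from monotonicity of the Holevo quantity and strong subadditivity, both reduced to
monotonicity of relative entropy, which is read off from Kosaki's variational formula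
(`relEnt_mono`).

Lower bound. After reduction to the support of `ρ`, the state on consecutive sites is the trace of a
product of transfer maps applied to a positive matrix `Q* Q`; the transfer map of the identity
preserves the trace and fixes `Q* Q` (`exists_canonical_form`). A Kraus decomposition of the
transfer maps purifies the state: system and memory `κ × κ` on one side, Kraus indices as
environment on the other, with equal entropies. The dimension of the memory does not depend on the
number of sites. Cut `kn` sites into `k` blocks and rotate the Kraus operators of a block so that
its environment state is diagonal (`exists_rotation`). The Kraus words of length `k` then decompose
the state (`IsTransfer.exists_decomposition`).

The masses of the pieces are the diagonal of the environment state of all `kn` sites, so their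
Shannon entropy is at least its von Neumann entropy, hence at least the local entropy up to `O(log
(kn))`. On a single block, each marginal piece comes from one Kraus operator and is therefore pure
on system and memory, so each block costs only `O(log n)` (`IsTransfer.exists_le_cntValue`).
Dividing by `kn`, then letting `k → ∞` and `n → ∞`, gives the lower bound. -/

noncomputable section
open scoped ComplexOrder Kronecker
set_option linter.unusedSectionVars false
namespace QChain

/-! ### Entropy of positive matrices in terms of eigenvalues -/

section matrixEntropy
variable {ι κ : Type*} [Fintype ι] [DecidableEq ι] [Fintype κ] [DecidableEq κ]

/-- Von Neumann entropy `-Tr D log D` of a positive semidefinite matrix of arbitrary trace. -/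
def vnEntropy (D : Matrix ι ι ℂ) : ℝ := (cfc Real.negMulLog D).trace.re

/-- Spectra of matrices are finite, so Lagrange interpolation turns every functional calculus into a
polynomial. Facts about `cfc` then follow from facts about powers. -/
theorem exists_polynomial_eqOn {s : Set ℝ} (hs : s.Finite) (f : ℝ → ℝ) :
    ∃ q : Polynomial ℝ, ∀ x ∈ s, q.eval x = f x := by
  refine ⟨Lagrange.interpolate hs.toFinset id f, fun x hx => ?_⟩
  exact Lagrange.eval_interpolate_at_node (v := id) f (fun _ _ _ _ h => h)
    (hs.mem_toFinset.2 hx)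

theorem finite_spectrum (D : Matrix ι ι ℂ) : (spectrum ℝ D).Finite :=
  Matrix.finite_real_spectrum

theorem cfc_eq_aeval {D : Matrix ι ι ℂ} (hD : IsSelfAdjoint D) {f : ℝ → ℝ} {q : Polynomial ℝ}
    (h : ∀ x ∈ spectrum ℝ D, q.eval x = f x) : cfc f D = Polynomial.aeval D q := by
  rw [← cfc_polynomial q D hD]
  exact cfc_congr fun x hx => (h x hx).symm

theorem PosSemidef.exists_diagonal {D : Matrix ι ι ℂ} (hD : D.PosSemidef) :
    ∃ U ∈ Matrix.unitaryGroup ι ℂ, ∃ p : ι → ℝ, (∀ i, 0 ≤ p i) ∧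
      D = U * Matrix.diagonal (fun i => (p i : ℂ)) * star U :=
  ⟨hD.1.eigenvectorUnitary, hD.1.eigenvectorUnitary.2, hD.1.eigenvalues, hD.eigenvalues_nonneg,
    hD.1.spectral_theorem⟩

theorem isSelfAdjoint_conj_diagonal (U : Matrix ι ι ℂ) (p : ι → ℝ) :
    IsSelfAdjoint (U * Matrix.diagonal (fun i => (p i : ℂ)) * star U) := by
  refine IsSelfAdjoint.conjugate (x := Matrix.diagonal (fun i => (p i : ℂ))) ?_ U
  rw [isSelfAdjoint_iff, Matrix.star_eq_conjTranspose, Matrix.diagonal_conjTranspose]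
  congr 1
  ext i
  simp

theorem aeval_conj_diagonal {U : Matrix ι ι ℂ} (hU : U ∈ Matrix.unitaryGroup ι ℂ) (p : ι → ℝ)
    (q : Polynomial ℝ) :
    Polynomial.aeval (U * Matrix.diagonal (fun i => (p i : ℂ)) * star U) q =
      U * Matrix.diagonal (fun i => ((q.eval (p i) : ℝ) : ℂ)) * star U := by
  have h1 : star U * U = 1 := (Matrix.mem_unitaryGroup_iff').1 hU
  have h2 : U * star U = 1 := (Matrix.mem_unitaryGroup_iff).1 hU
  induction q using Polynomial.induction_on' with
  | add q r hq hr =>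
    rw [map_add, hq, hr, ← add_mul, ← mul_add, Matrix.diagonal_add]
    simp
  | monomial n a =>
    have hpow : ∀ k : ℕ, (U * Matrix.diagonal (fun i => (p i : ℂ)) * star U) ^ k =
        U * Matrix.diagonal (fun i => (p i : ℂ) ^ k) * star U := by
      intro k
      induction k with
      | zero => simp [h2]
      | succ k ih =>
        rw [pow_succ, ih]
        calc _ = U * Matrix.diagonal (fun i => (p i : ℂ) ^ k) * (star U * U) *
              Matrix.diagonal (fun i => (p i : ℂ)) * star U := by simp only [mul_assoc]
          _ = _ := by
            rw [h1, mul_one, mul_assoc U, Matrix.diagonal_mul_diagonal]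
            simp [pow_succ]
    rw [Polynomial.aeval_monomial, hpow, Algebra.algebraMap_eq_smul_one, smul_mul_assoc, one_mul,
      ← smul_mul_assoc, ← mul_smul_comm]
    congr 2
    ext i j
    by_cases hij : i = j
    · subst hij; simp
    · simp [hij]

theorem cfc_conj_diagonal {U : Matrix ι ι ℂ} (hU : U ∈ Matrix.unitaryGroup ι ℂ) (p : ι → ℝ)
    (f : ℝ → ℝ) :
    cfc f (U * Matrix.diagonal (fun i => (p i : ℂ)) * star U) =
      U * Matrix.diagonal (fun i => (f (p i) : ℂ)) * star U := by
  obtain ⟨q, hq⟩ := exists_polynomial_eqOn ((finite_spectrum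
    (U * Matrix.diagonal (fun i => (p i : ℂ)) * star U)).union (Set.finite_range p)) f
  rw [cfc_eq_aeval (isSelfAdjoint_conj_diagonal U p) fun x hx => hq x (Or.inl hx),
    aeval_conj_diagonal hU]
  simp [hq _ (Or.inr (Set.mem_range_self _))]

theorem trace_conj {U : Matrix ι ι ℂ} (hU : U ∈ Matrix.unitaryGroup ι ℂ) (X : Matrix ι ι ℂ) :
    (U * X * star U).trace = X.trace := by
  rw [Matrix.trace_mul_cycle, (Matrix.mem_unitaryGroup_iff').1 hU, one_mul]

theorem vnEntropy_conj_diagonal {U : Matrix ι ι ℂ} (hU : U ∈ Matrix.unitaryGroup ι ℂ)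
    (p : ι → ℝ) :
    vnEntropy (U * Matrix.diagonal (fun i => (p i : ℂ)) * star U) = ∑ i, Real.negMulLog (p i) := by
  rw [vnEntropy, cfc_conj_diagonal hU, trace_conj hU, Matrix.trace_diagonal]
  simp

theorem vnEntropy_diagonal (p : ι → ℝ) :
    vnEntropy (Matrix.diagonal (fun i => (p i : ℂ))) = ∑ i, Real.negMulLog (p i) := by
  simpa using vnEntropy_conj_diagonal (one_mem (Matrix.unitaryGroup ι ℂ)) p

/-- Positive powers of `TS` and `ST` have equal traces by cyclicity. The constant term must vanish
because the two identity matrices may have different sizes. -/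
theorem trace_aeval_mul_comm (T : Matrix ι κ ℂ) (S : Matrix κ ι ℂ) {q : Polynomial ℝ}
    (hq : q.eval 0 = 0) :
    (Polynomial.aeval (T * S) q).trace = (Polynomial.aeval (S * T) q).trace := by
  have hpow : ∀ k : ℕ, (T * S) ^ (k + 1) = T * (S * T) ^ k * S := by
    intro k
    induction k with
    | zero => simp
    | succ k ih =>
      rw [pow_succ, ih, pow_succ]
      simp only [Matrix.mul_assoc]
  rw [Polynomial.aeval_eq_sum_range, Polynomial.aeval_eq_sum_range, Matrix.trace_sum,
    Matrix.trace_sum]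
  refine Finset.sum_congr rfl fun k _ => ?_
  rw [Matrix.trace_smul, Matrix.trace_smul]
  cases k with
  | zero => rw [← Polynomial.coeff_zero_eq_eval_zero] at hq; simp [hq]
  | succ k =>
    congr 1
    rw [hpow, Matrix.trace_mul_comm, ← Matrix.mul_assoc, ← pow_succ']

/-- The two products share their nonzero spectrum and `η(0) = 0`. For a pure bipartite vector with
coefficient matrix `T` this is the equality of the entropies of the two marginals. -/
theorem vnEntropy_mul_conjTranspose (T : Matrix ι κ ℂ) :
    vnEntropy (T * T.conjTranspose) = vnEntropy (T.conjTranspose * T) := by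
  obtain ⟨q, hq⟩ := exists_polynomial_eqOn (((finite_spectrum (T * T.conjTranspose)).union
    (finite_spectrum (T.conjTranspose * T))).union (Set.finite_singleton 0)) Real.negMulLog
  rw [vnEntropy, vnEntropy,
    cfc_eq_aeval (Matrix.isHermitian_mul_conjTranspose_self T).isSelfAdjoint
      fun x hx => hq x (Or.inl (Or.inl hx)),
    cfc_eq_aeval (Matrix.isHermitian_conjTranspose_mul_self T).isSelfAdjoint
      fun x hx => hq x (Or.inl (Or.inr hx)),
    trace_aeval_mul_comm T _ (by simpa using hq 0 (Or.inr rfl))]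

theorem sum_norm_sq_row {U : Matrix ι ι ℂ} (hU : U ∈ Matrix.unitaryGroup ι ℂ) (i : ι) :
    ∑ j, ‖U i j‖ ^ 2 = 1 := by
  have h := congrFun (congrFun ((Matrix.mem_unitaryGroup_iff).1 hU) i) i
  rw [Matrix.mul_apply, Matrix.one_apply_eq] at h
  have h2 : ((∑ j, ‖U i j‖ ^ 2 : ℝ) : ℂ) = 1 := by
    rw [← h]
    push_cast
    exact Finset.sum_congr rfl fun j _ => by
      rw [Matrix.star_apply, RCLike.star_def, Complex.mul_conj']
  exact_mod_cast h2

theorem sum_norm_sq_col {U : Matrix ι ι ℂ} (hU : U ∈ Matrix.unitaryGroup ι ℂ) (j : ι) :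
    ∑ i, ‖U i j‖ ^ 2 = 1 := by
  have := sum_norm_sq_row (Unitary.star_mem hU) j
  simpa [Matrix.star_apply] using this

theorem conj_diagonal_apply_self (U : Matrix ι ι ℂ) (p : ι → ℝ) (i : ι) :
    (U * Matrix.diagonal (fun i => (p i : ℂ)) * star U) i i =
      ((∑ j, ‖U i j‖ ^ 2 * p j : ℝ) : ℂ) := by
  rw [Matrix.mul_apply]
  push_cast
  refine Finset.sum_congr rfl fun j _ => ?_
  rw [Matrix.mul_diagonal, Matrix.star_apply, RCLike.star_def, ← Complex.mul_conj']
  ring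

/-- The diagonal is the image of the eigenvalues under the doubly stochastic matrix `‖U i j‖ ^ 2`,
and `η` is concave. -/
theorem vnEntropy_le_diag {D : Matrix ι ι ℂ} (hD : D.PosSemidef) :
    vnEntropy D ≤ ∑ i, Real.negMulLog (D i i).re := by
  obtain ⟨U, hU, p, hp, rfl⟩ := PosSemidef.exists_diagonal hD
  rw [vnEntropy_conj_diagonal hU]
  calc ∑ j, Real.negMulLog (p j) = ∑ j, (∑ i, ‖U i j‖ ^ 2) * Real.negMulLog (p j) := by
        simp [sum_norm_sq_col hU]
    _ = ∑ i, ∑ j, ‖U i j‖ ^ 2 * Real.negMulLog (p j) := by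
        simp_rw [Finset.sum_mul]; exact Finset.sum_comm
    _ ≤ _ := by
        refine Finset.sum_le_sum fun i _ => ?_
        rw [conj_diagonal_apply_self, Complex.ofReal_re]
        exact Real.concaveOn_negMulLog.le_map_sum (fun j _ => by positivity)
          (sum_norm_sq_row hU i) (fun j _ => hp j)

theorem negMulLog_sum_le {ι : Type*} (s : Finset ι) {p : ι → ℝ} (hp : ∀ i, 0 ≤ p i) :
    Real.negMulLog (∑ i ∈ s, p i) ≤ ∑ i ∈ s, Real.negMulLog (p i) := by
  simp only [Real.negMulLog, neg_mul, Finset.sum_neg_distrib, neg_le_neg_iff]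
  rw [Finset.sum_mul]
  refine Finset.sum_le_sum fun i hi => ?_
  rcases (hp i).eq_or_lt with h | h
  · simp [← h]
  · exact mul_le_mul_of_nonneg_left
      (Real.log_le_log h (Finset.single_le_sum (fun j _ => hp j) hi)) (hp i)

theorem trace_conj_diagonal {U : Matrix ι ι ℂ} (hU : U ∈ Matrix.unitaryGroup ι ℂ) (p : ι → ℝ) :
    (U * Matrix.diagonal (fun i => (p i : ℂ)) * star U).trace = ((∑ i, p i : ℝ) : ℂ) := by
  rw [trace_conj hU, Matrix.trace_diagonal]
  simp

theorem negMulLog_trace_le {D : Matrix ι ι ℂ} (hD : D.PosSemidef) :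
    Real.negMulLog D.trace.re ≤ vnEntropy D := by
  obtain ⟨U, hU, p, hp, rfl⟩ := PosSemidef.exists_diagonal hD
  rw [vnEntropy_conj_diagonal hU, trace_conj_diagonal hU, Complex.ofReal_re]
  exact negMulLog_sum_le _ hp

theorem vnEntropy_smul {D : Matrix ι ι ℂ} (hD : D.PosSemidef) (c : ℝ) :
    vnEntropy ((c : ℂ) • D) = c * vnEntropy D + Real.negMulLog c * D.trace.re := by
  obtain ⟨U, hU, p, hp, rfl⟩ := PosSemidef.exists_diagonal hD
  have : (c : ℂ) • (U * Matrix.diagonal (fun i => (p i : ℂ)) * star U) =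
      U * Matrix.diagonal (fun i => ((c * p i : ℝ) : ℂ)) * star U := by
    rw [← smul_mul_assoc, ← mul_smul_comm]
    congr 2
    ext i j
    by_cases hij : i = j
    · subst hij; simp
    · simp [hij]
  rw [this, vnEntropy_conj_diagonal hU, vnEntropy_conj_diagonal hU, trace_conj_diagonal hU,
    Complex.ofReal_re, Finset.mul_sum, Finset.mul_sum, ← Finset.sum_add_distrib]
  exact Finset.sum_congr rfl fun i _ => by rw [Real.negMulLog_mul]; ring

theorem vnEntropy_blockDiagonal' {m : Type*} [Fintype m] [DecidableEq m] {n : m → Type*}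
    [∀ i, Fintype (n i)] [∀ i, DecidableEq (n i)] {D : ∀ i, Matrix (n i) (n i) ℂ}
    (hD : ∀ i, (D i).PosSemidef) :
    vnEntropy (Matrix.blockDiagonal' D) = ∑ i, vnEntropy (D i) := by
  choose U hU p hp h using fun i => PosSemidef.exists_diagonal (hD i)
  have e : Matrix.blockDiagonal' D = Matrix.blockDiagonal' U *
      Matrix.diagonal (fun x : Σ i, n i => ((p x.1 x.2 : ℝ) : ℂ)) *
      star (Matrix.blockDiagonal' U) := by
    rw [Matrix.star_eq_conjTranspose, Matrix.blockDiagonal'_conjTranspose,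
      ← Matrix.blockDiagonal'_diagonal (fun i a => ((p i a : ℝ) : ℂ)),
      ← Matrix.blockDiagonal'_mul, ← Matrix.blockDiagonal'_mul]
    congr 1
    ext1 i
    exact h i
  have hU' : Matrix.blockDiagonal' U ∈ Matrix.unitaryGroup (Σ i, n i) ℂ := by
    rw [Matrix.mem_unitaryGroup_iff, Matrix.star_eq_conjTranspose,
      Matrix.blockDiagonal'_conjTranspose, ← Matrix.blockDiagonal'_mul, ← Matrix.blockDiagonal'_one]
    congr 1
    ext1 i
    exact (Matrix.mem_unitaryGroup_iff).1 (hU i)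
  rw [e, vnEntropy_conj_diagonal hU' (fun x => p x.1 x.2), Fintype.sum_sigma]
  refine Finset.sum_congr rfl fun i _ => ?_
  conv_rhs => rw [h i]
  rw [vnEntropy_conj_diagonal (hU i)]

theorem vnEntropy_unique [Unique ι] {D : Matrix ι ι ℂ} (hD : D.PosSemidef) :
    vnEntropy D = Real.negMulLog D.trace.re := by
  obtain ⟨U, hU, p, hp, rfl⟩ := PosSemidef.exists_diagonal hD
  rw [vnEntropy_conj_diagonal hU, trace_conj_diagonal hU]
  simp

end matrixEntropy
end QChain
end

noncomputable section
open scoped ComplexOrder Kronecker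
set_option linter.unusedSectionVars false
namespace QChain

/-! ### Kosaki's formula and monotonicity of relative entropy -/

section relativeEntropy
open MeasureTheory Filter Topology

theorem hasDerivAt_logRatio {p q t : ℝ} (hp : 0 < p) (hq : 0 < q) (ht : 0 ≤ t) :
    HasDerivAt (fun t => p * (Real.log (t * p + q) - Real.log (1 + t)))
      (p ^ 2 / (t * p + q) - p / (1 + t)) t := by
  have h1 : HasDerivAt (fun t : ℝ => t * p + q) p t := by
    simpa using ((hasDerivAt_id t).mul_const p).add_const q
  have h2 : HasDerivAt (fun t : ℝ => 1 + t) 1 t := (hasDerivAt_id t).const_add 1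
  have hpos : t * p + q ≠ 0 := by positivity
  have hpos' : 1 + t ≠ 0 := by positivity
  exact (((h1.log hpos).sub (h2.log hpos')).const_mul p).congr_deriv (by ring)

theorem tendsto_logRatio {p q : ℝ} (hp : 0 < p) (hq : 0 < q) :
    Tendsto (fun t => p * (Real.log (t * p + q) - Real.log (1 + t))) atTop
      (𝓝 (p * Real.log p)) := by
  refine Tendsto.const_mul p ?_
  have h : Tendsto (fun t : ℝ => p + (q - p) / (1 + t)) atTop (𝓝 (p + 0)) :=
    tendsto_const_nhds.add ((tendsto_atTop_add_const_left _ _ tendsto_id).const_div_atTop _)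
  rw [add_zero] at h
  refine ((Real.continuousAt_log hp.ne').tendsto.comp h).congr' ?_
  filter_upwards [eventually_gt_atTop 0] with t ht
  have h1 : (1 + t) ≠ 0 := by positivity
  rw [Function.comp_apply, ← Real.log_div (by positivity) h1]
  congr 1
  field_simp
  ring

/-- A primitive is `p (log (tp + q) - log (1 + t))`, which tends to `p log p` at infinity. The
integrand has the sign of `p - q` throughout, which gives integrability. -/
theorem integral_logRatio {p q : ℝ} (hp : 0 < p) (hq : 0 < q) :
    IntegrableOn (fun t => p ^ 2 / (t * p + q) - p / (1 + t)) (Set.Ioi 0) ∧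
      ∫ t in Set.Ioi (0 : ℝ), (p ^ 2 / (t * p + q) - p / (1 + t)) =
        p * Real.log p - p * Real.log q := by
  have hd : ∀ t ∈ Set.Ici (0 : ℝ), HasDerivAt
      (fun t => p * (Real.log (t * p + q) - Real.log (1 + t)))
      (p ^ 2 / (t * p + q) - p / (1 + t)) t := fun t ht => hasDerivAt_logRatio hp hq ht
  have hi : IntegrableOn (fun t => p ^ 2 / (t * p + q) - p / (1 + t)) (Set.Ioi 0) := by
    have key : ∀ t : ℝ, 0 < t → p ^ 2 / (t * p + q) - p / (1 + t) =
        p * (p - q) / ((t * p + q) * (1 + t)) := by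
      intro t ht
      have h1 : t * p + q ≠ 0 := by positivity
      have h2 : 1 + t ≠ 0 := by positivity
      field_simp
      ring
    rcases le_total q p with h | h
    · refine integrableOn_Ioi_deriv_of_nonneg' hd (fun t ht => ?_) (tendsto_logRatio hp hq)
      rw [key t ht]
      have : 0 ≤ p - q := by linarith
      have : (0 : ℝ) < t := ht
      positivity
    · refine integrableOn_Ioi_deriv_of_nonpos' hd (fun t ht => ?_) (tendsto_logRatio hp hq)
      rw [key t ht]
      have : (0 : ℝ) < t := ht
      exact div_nonpos_of_nonpos_of_nonneg
        (mul_nonpos_of_nonneg_of_nonpos hp.le (by linarith)) (by positivity)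
  refine ⟨hi, ?_⟩
  rw [integral_Ioi_of_hasDerivAt_of_tendsto' hd hi (tendsto_logRatio hp hq)]
  simp

variable {ι κ : Type*} [Fintype ι] [DecidableEq ι] [Fintype κ] [DecidableEq κ]

/-- Relative entropy `Tr A log A - Tr A log B`, for `A ≤ c B`. -/
def relEnt (A B : Matrix ι ι ℂ) : ℝ := -vnEntropy A - (A * cfc Real.log B).trace.re

/-- The functional whose supremum over `X` is the resolvent form in Kosaki's formula. -/
def kosaki (t : ℝ) (A B X : Matrix ι ι ℂ) : ℝ :=
  2 * (A * X).trace.re - t * (A * (X * star X)).trace.re - (B * (star X * X)).trace.re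

/-- In the eigenbases of the two matrices the form decouples into one scalar quadratic for each
entry of `X`. -/
theorem kosaki_diagonal {U V : Matrix ι ι ℂ} (hU : U ∈ Matrix.unitaryGroup ι ℂ)
    (hV : V ∈ Matrix.unitaryGroup ι ℂ) (p q : ι → ℝ) (t : ℝ) (x : Matrix ι ι ℂ) :
    kosaki t (U * Matrix.diagonal (fun i => (p i : ℂ)) * star U)
      (V * Matrix.diagonal (fun i => (q i : ℂ)) * star V) (U * x * star V) =
    ∑ i, ∑ j, (2 * p i * (x i j * star ((star U * V) i j)).re -
      (t * p i + q j) * ‖x i j‖ ^ 2) := by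
  have hU1 : star U * U = 1 := (Matrix.mem_unitaryGroup_iff').1 hU
  have hV1 : star V * V = 1 := (Matrix.mem_unitaryGroup_iff').1 hV
  have tr : ∀ (r : ι → ℝ) (Y : Matrix ι ι ℂ),
      (Matrix.diagonal (fun i => (r i : ℂ)) * Y).trace.re = ∑ i, r i * (Y i i).re := by
    intro r Y
    simp [Matrix.trace, Matrix.diagonal_mul, Complex.re_sum]
  have e1 : (U * Matrix.diagonal (fun i => (p i : ℂ)) * star U * (U * x * star V)).trace.re =
      ∑ i, p i * ∑ j, (x i j * star ((star U * V) i j)).re := by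
    have : (U * Matrix.diagonal (fun i => (p i : ℂ)) * star U * (U * x * star V)).trace =
        (Matrix.diagonal (fun i => (p i : ℂ)) * (x * star (star U * V))).trace := by
      rw [show U * Matrix.diagonal (fun i => (p i : ℂ)) * star U * (U * x * star V) =
        U * (Matrix.diagonal (fun i => (p i : ℂ)) * (star U * U) * x * star V) by
          simp only [mul_assoc], hU1, Matrix.trace_mul_comm, star_mul, star_star]
      simp only [mul_assoc, mul_one]
    rw [this, tr]
    refine Finset.sum_congr rfl fun i _ => ?_
    rw [Matrix.mul_apply, Complex.re_sum]
    rfl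
  have e2 : (U * Matrix.diagonal (fun i => (p i : ℂ)) * star U *
      ((U * x * star V) * star (U * x * star V))).trace.re = ∑ i, p i * ∑ j, ‖x i j‖ ^ 2 := by
    have : (U * Matrix.diagonal (fun i => (p i : ℂ)) * star U *
      ((U * x * star V) * star (U * x * star V))).trace =
        (Matrix.diagonal (fun i => (p i : ℂ)) * (x * star x)).trace := by
      rw [← trace_conj hU (Matrix.diagonal _ * (x * star x)), star_mul, star_mul, star_star]
      rw [show U * Matrix.diagonal (fun i => (p i : ℂ)) * star U *
        (U * x * star V * (V * (star x * star U))) =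
        U * Matrix.diagonal (fun i => (p i : ℂ)) * (star U * U) * x * (star V * V) *
          (star x * star U) by simp only [mul_assoc], hU1, hV1]
      simp only [mul_assoc, mul_one]
    rw [this, tr]
    refine Finset.sum_congr rfl fun i _ => ?_
    rw [Matrix.mul_apply, Complex.re_sum]
    congr 1
    refine Finset.sum_congr rfl fun j _ => ?_
    rw [Matrix.star_apply, RCLike.star_def, Complex.mul_conj']
    norm_cast
  have e3 : (V * Matrix.diagonal (fun i => (q i : ℂ)) * star V *
      (star (U * x * star V) * (U * x * star V))).trace.re = ∑ j, q j * ∑ i, ‖x i j‖ ^ 2 := by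
    have : (V * Matrix.diagonal (fun i => (q i : ℂ)) * star V *
      (star (U * x * star V) * (U * x * star V))).trace =
        (Matrix.diagonal (fun i => (q i : ℂ)) * (star x * x)).trace := by
      rw [← trace_conj hV (Matrix.diagonal _ * (star x * x)), star_mul, star_mul, star_star]
      rw [show V * Matrix.diagonal (fun i => (q i : ℂ)) * star V *
        (V * (star x * star U) * (U * x * star V)) =
        V * Matrix.diagonal (fun i => (q i : ℂ)) * (star V * V) * star x * (star U * U) *
          (x * star V) by simp only [mul_assoc], hU1, hV1]
      simp only [mul_assoc, mul_one]
    rw [this, tr]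
    refine Finset.sum_congr rfl fun i _ => ?_
    rw [Matrix.mul_apply, Complex.re_sum]
    congr 1
    refine Finset.sum_congr rfl fun j _ => ?_
    rw [Matrix.star_apply, RCLike.star_def, Complex.conj_mul']
    norm_cast
  rw [kosaki, e1, e2, e3]
  simp only [Finset.mul_sum]
  rw [Finset.sum_comm (f := fun j i => q j * ‖x i j‖ ^ 2)]
  simp only [← Finset.sum_sub_distrib]
  exact Finset.sum_congr rfl fun i _ => Finset.sum_congr rfl fun j _ => by ring

/-- The resolvent form in terms of spectral data. -/
def resolventForm (W : Matrix ι ι ℂ) (p q : ι → ℝ) (t : ℝ) : ℝ :=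
  ∑ i, ∑ j, ‖W i j‖ ^ 2 * (p i ^ 2 / (t * p i + q j))

/-- Completing the square in each entry gives `2 p xc - D x² ≤ p² c² / D` with `D = t p + q`. If `D
= 0`, then `p = 0` because `t > 0`. -/
theorem kosaki_le {U V : Matrix ι ι ℂ} (hU : U ∈ Matrix.unitaryGroup ι ℂ)
    (hV : V ∈ Matrix.unitaryGroup ι ℂ) {p q : ι → ℝ} (hp : ∀ i, 0 ≤ p i) (hq : ∀ i, 0 ≤ q i)
    {t : ℝ} (ht : 0 < t) (X : Matrix ι ι ℂ) :
    kosaki t (U * Matrix.diagonal (fun i => (p i : ℂ)) * star U)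
      (V * Matrix.diagonal (fun i => (q i : ℂ)) * star V) X ≤
      resolventForm (star U * V) p q t := by
  have hX : X = U * (star U * X * V) * star V := by
    have hU1 : U * star U = 1 := (Matrix.mem_unitaryGroup_iff).1 hU
    have hV1 : V * star V = 1 := (Matrix.mem_unitaryGroup_iff).1 hV
    rw [show U * (star U * X * V) * star V = (U * star U) * X * (V * star V) by
      simp only [mul_assoc], hU1, hV1, one_mul, mul_one]
  rw [hX, kosaki_diagonal hU hV]
  refine Finset.sum_le_sum fun i _ => Finset.sum_le_sum fun j _ => ?_
  set x := (star U * X * V) i j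
  set c := (star U * V) i j
  have h1 : (x * star c).re ≤ ‖x‖ * ‖c‖ := by
    refine (Complex.re_le_norm _).trans ?_
    simp
  rcases (add_nonneg (mul_nonneg ht.le (hp i)) (hq j)).eq_or_lt with h | h
  · have : p i = 0 := by
      have := mul_nonneg ht.le (hp i)
      have := hq j
      have h3 : t * p i = 0 := by linarith
      exact (mul_eq_zero.1 h3).resolve_left ht.ne'
    rw [← h, this]
    simp
  · set D := t * p i + q j
    have h2 : 2 * p i * (x * star c).re ≤ 2 * p i * (‖x‖ * ‖c‖) :=
      mul_le_mul_of_nonneg_left h1 (by linarith [hp i])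
    refine (sub_le_sub_right h2 _).trans ?_
    rw [← mul_div_assoc, le_div_iff₀ h]
    nlinarith [sq_nonneg (D * ‖x‖ - p i * ‖c‖)]

theorem exists_kosaki_eq {U V : Matrix ι ι ℂ} (hU : U ∈ Matrix.unitaryGroup ι ℂ)
    (hV : V ∈ Matrix.unitaryGroup ι ℂ) {p q : ι → ℝ} (hp : ∀ i, 0 ≤ p i) (hq : ∀ i, 0 ≤ q i)
    {t : ℝ} (ht : 0 < t) :
    ∃ X, kosaki t (U * Matrix.diagonal (fun i => (p i : ℂ)) * star U)
      (V * Matrix.diagonal (fun i => (q i : ℂ)) * star V) X =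
      resolventForm (star U * V) p q t := by
  -- Entrywise maximiser of the scalar quadratics, `x = p c / (t p + q)`.
  refine ⟨U * Matrix.of (fun i j => ((p i / (t * p i + q j) : ℝ) : ℂ) * (star U * V) i j) *
    star V, ?_⟩
  rw [kosaki_diagonal hU hV]
  refine Finset.sum_congr rfl fun i _ => Finset.sum_congr rfl fun j _ => ?_
  rw [Matrix.of_apply]
  set c := (star U * V) i j
  rw [mul_assoc (_ : ℂ) c, RCLike.star_def, Complex.mul_conj', norm_mul, Complex.norm_real, mul_pow,
    Real.norm_eq_abs, sq_abs]
  have : (((p i / (t * p i + q j) : ℝ) : ℂ) * (‖c‖ : ℂ) ^ 2).re =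
      p i / (t * p i + q j) * ‖c‖ ^ 2 := by norm_cast
  rw [this]
  rcases (add_nonneg (mul_nonneg ht.le (hp i)) (hq j)).eq_or_lt with h | h
  · rw [← h]; simp
  · field_simp
    ring

/-- Integrate the scalar formula with the weights `‖W i j‖ ^ 2`; the rows of `W` have norm one, so
the subtracted term is the trace over `1 + t`. The support condition `hs` removes the pairs with `q
j = 0 < p i`, whose integrand behaves like `p / t` near `0`. -/
theorem relEnt_eq_integral {U V : Matrix ι ι ℂ} (hU : U ∈ Matrix.unitaryGroup ι ℂ)
    (hV : V ∈ Matrix.unitaryGroup ι ℂ) {p q : ι → ℝ} (hp : ∀ i, 0 ≤ p i) (hq : ∀ i, 0 ≤ q i)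
    (hs : ∀ i j, q j = 0 → p i * ‖(star U * V) i j‖ ^ 2 = 0) :
    IntegrableOn (fun t => resolventForm (star U * V) p q t - (∑ i, p i) / (1 + t)) (Set.Ioi 0) ∧
    relEnt (U * Matrix.diagonal (fun i => (p i : ℂ)) * star U)
      (V * Matrix.diagonal (fun i => (q i : ℂ)) * star V) =
      ∫ t in Set.Ioi (0 : ℝ), (resolventForm (star U * V) p q t - (∑ i, p i) / (1 + t)) := by
  set W := star U * V with hWdef
  have hW : W ∈ Matrix.unitaryGroup ι ℂ := mul_mem (Unitary.star_mem hU) hV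
  have e : ∀ t, resolventForm W p q t - (∑ i, p i) / (1 + t) =
      ∑ i, ∑ j, ‖W i j‖ ^ 2 * (p i ^ 2 / (t * p i + q j) - p i / (1 + t)) := by
    intro t
    simp only [mul_sub, Finset.sum_sub_distrib, resolventForm, ← Finset.sum_mul,
      sum_norm_sq_row hW, one_mul, Finset.sum_div]
  have key : ∀ i j, IntegrableOn (fun t => ‖W i j‖ ^ 2 * (p i ^ 2 / (t * p i + q j) -
      p i / (1 + t))) (Set.Ioi 0) ∧ ∫ t in Set.Ioi (0 : ℝ), ‖W i j‖ ^ 2 *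
      (p i ^ 2 / (t * p i + q j) - p i / (1 + t)) =
      ‖W i j‖ ^ 2 * (p i * Real.log (p i) - p i * Real.log (q j)) := by
    intro i j
    rcases (hp i).eq_or_lt with h | h
    · simp [← h]
    rcases (hq j).eq_or_lt with h' | h'
    · have : ‖W i j‖ ^ 2 = 0 := (mul_eq_zero.1 (hs i j h'.symm)).resolve_left h.ne'
      simp [this]
    · have := integral_logRatio h h'
      exact ⟨this.1.const_mul _, by rw [integral_const_mul, this.2]⟩
  constructor
  · simp only [e]
    exact integrable_finsetSum _ fun i _ => integrable_finsetSum _ fun j _ => (key i j).1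
  · simp only [e]
    rw [integral_finsetSum _ fun i _ => integrable_finsetSum _ fun j _ => (key i j).1]
    simp only [integral_finsetSum _ fun j _ => (key _ j).1, (key _ _).2]
    rw [relEnt, vnEntropy_conj_diagonal hU, cfc_conj_diagonal hV]
    have : (U * Matrix.diagonal (fun i => (p i : ℂ)) * star U *
        (V * Matrix.diagonal (fun i => ((Real.log (q i) : ℝ) : ℂ)) * star V)).trace =
        (Matrix.diagonal (fun i => (p i : ℂ)) *
          (W * Matrix.diagonal (fun i => ((Real.log (q i) : ℝ) : ℂ)) * star W)).trace := by
      rw [← trace_conj hU (Matrix.diagonal (fun i => (p i : ℂ)) * _), hWdef, star_mul, star_star]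
      simp only [mul_assoc]
      rw [(Matrix.mem_unitaryGroup_iff).1 hU, mul_one]
    rw [this, Matrix.trace, Complex.re_sum, ← Finset.sum_neg_distrib, ← Finset.sum_sub_distrib]
    refine Finset.sum_congr rfl fun i _ => ?_
    rw [Matrix.diag_apply, Matrix.diagonal_mul,
      conj_diagonal_apply_self W (fun j => Real.log (q j)), ← Complex.ofReal_mul,
      Complex.ofReal_re]
    simp only [mul_sub, Finset.sum_sub_distrib, ← Finset.sum_mul, sum_norm_sq_row hW,
      Real.negMulLog, Finset.mul_sum]
    simp only [mul_left_comm (p i)]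
    ring

/-- Take the diagonal entry of `cB - A ≥ 0` at a null eigenvector of `B`: a sum of nonnegative terms
is at most zero. -/
theorem eigenvalue_support {U V : Matrix ι ι ℂ} {p q : ι → ℝ}
    (hV : V ∈ Matrix.unitaryGroup ι ℂ) (hp : ∀ i, 0 ≤ p i) {c : ℝ}
    (h : ((c : ℂ) • (V * Matrix.diagonal (fun i => (q i : ℂ)) * star V) -
      U * Matrix.diagonal (fun i => (p i : ℂ)) * star U).PosSemidef) (i j : ι) (hj : q j = 0) :
    p i * ‖(star U * V) i j‖ ^ 2 = 0 := by
  have h1 := h.conjTranspose_mul_mul_same V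
  have h2 := h1.diag_nonneg (i := j)
  have hV1 : star V * V = 1 := (Matrix.mem_unitaryGroup_iff').1 hV
  rw [← Matrix.star_eq_conjTranspose, mul_sub, sub_mul, Matrix.sub_apply] at h2
  have e1 : star V * ((c : ℂ) • (V * Matrix.diagonal (fun i => (q i : ℂ)) * star V)) * V =
      (c : ℂ) • Matrix.diagonal (fun i => (q i : ℂ)) := by
    rw [mul_smul_comm, smul_mul_assoc]
    congr 1
    rw [show star V * (V * Matrix.diagonal (fun i => (q i : ℂ)) * star V) * V =
      (star V * V) * Matrix.diagonal (fun i => (q i : ℂ)) * (star V * V) by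
        simp only [mul_assoc], hV1, one_mul, mul_one]
  have e2 : star V * (U * Matrix.diagonal (fun i => (p i : ℂ)) * star U) * V =
      star (star U * V) * Matrix.diagonal (fun i => (p i : ℂ)) * star (star (star U * V)) := by
    rw [star_star, star_mul, star_star]
    simp only [mul_assoc]
  rw [e1, e2, conj_diagonal_apply_self (star (star U * V)) p j, Matrix.smul_apply,
    Matrix.diagonal_apply_eq, hj, Complex.ofReal_zero, smul_zero, zero_sub, ← Complex.ofReal_neg,
    Complex.zero_le_real, Left.nonneg_neg_iff] at h2
  have h3 : ∀ k ∈ Finset.univ, 0 ≤ ‖(star (star U * V)) j k‖ ^ 2 * p k := fun k _ =>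
    mul_nonneg (by positivity) (hp k)
  have h4 := (Finset.sum_eq_zero_iff_of_nonneg h3).1 (le_antisymm h2 (Finset.sum_nonneg h3)) i
    (Finset.mem_univ i)
  rw [mul_comm, Matrix.star_apply, norm_star] at h4
  exact h4

/-- Monotonicity of relative entropy, in the form in which Kosaki's variational formula gives it. -/
theorem relEnt_mono {A' B' : Matrix ι ι ℂ} {A B : Matrix κ κ ℂ} (hA' : A'.PosSemidef)
    (hB' : B'.PosSemidef) (hA : A.PosSemidef) (hB : B.PosSemidef) {c c' : ℝ}
    (hc' : ((c' : ℂ) • B' - A').PosSemidef) (hc : ((c : ℂ) • B - A).PosSemidef)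
    (htr : A'.trace = A.trace)
    (h : ∀ X, ∃ Y, (A' * X).trace.re = (A * Y).trace.re ∧
      (A * (Y * star Y)).trace.re ≤ (A' * (X * star X)).trace.re ∧
      (B * (star Y * Y)).trace.re ≤ (B' * (star X * X)).trace.re) :
    relEnt A' B' ≤ relEnt A B := by
  obtain ⟨U', hU', p', hp', rfl⟩ := PosSemidef.exists_diagonal hA'
  obtain ⟨V', hV', q', hq', rfl⟩ := PosSemidef.exists_diagonal hB'
  obtain ⟨U, hU, p, hp, rfl⟩ := PosSemidef.exists_diagonal hA
  obtain ⟨V, hV, q, hq, rfl⟩ := PosSemidef.exists_diagonal hB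
  have h1 := relEnt_eq_integral hU' hV' hp' hq' (eigenvalue_support hV' hp' hc')
  have h2 := relEnt_eq_integral hU hV hp hq (eigenvalue_support hV hp hc)
  rw [h1.2, h2.2]
  rw [trace_conj_diagonal hU', trace_conj_diagonal hU, Complex.ofReal_inj] at htr
  refine setIntegral_mono_on h1.1 h2.1 measurableSet_Ioi fun t ht => ?_
  rw [htr]
  refine sub_le_sub_right ?_ _
  -- For fixed `t`, the maximiser for the smaller pair is transported to a competitor for the larger
  -- pair.
  obtain ⟨X, hX⟩ := exists_kosaki_eq hU' hV' hp' hq' ht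
  obtain ⟨Y, hY1, hY2, hY3⟩ := h X
  rw [← hX]
  refine le_trans ?_ (kosaki_le hU hV hp hq ht Y)
  rw [kosaki, kosaki, hY1]
  have := mul_le_mul_of_nonneg_left hY2 (le_of_lt ht)
  linarith

end relativeEntropy
end QChain
end

noncomputable section
open scoped ComplexOrder Kronecker
set_option linter.unusedSectionVars false
namespace QChain

/-! ### Holevo quantity and strong subadditivity -/

section ensembles
variable {ι κ : Type*} [Fintype ι] [DecidableEq ι] [Fintype κ] [DecidableEq κ]

theorem PosSemidef.exists_star_mul {A : Matrix ι ι ℂ} (hA : A.PosSemidef) :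
    ∃ B : Matrix ι ι ℂ, A = star B * B := by
  obtain ⟨U, hU, p, hp, rfl⟩ := PosSemidef.exists_diagonal hA
  refine ⟨Matrix.diagonal (fun i => ((√(p i) : ℝ) : ℂ)) * star U, ?_⟩
  have h : Matrix.diagonal (fun i => (p i : ℂ)) = Matrix.diagonal (fun i => ((√(p i) : ℝ) : ℂ)) *
      Matrix.diagonal (fun i => ((√(p i) : ℝ) : ℂ)) := by
    rw [Matrix.diagonal_mul_diagonal]
    congr 1
    ext i
    rw [← Complex.ofReal_mul, Real.mul_self_sqrt (hp i)]
  have h2 : star (Matrix.diagonal (fun i => ((√(p i) : ℝ) : ℂ))) =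
      Matrix.diagonal (fun i => ((√(p i) : ℝ) : ℂ)) := by
    rw [Matrix.star_eq_conjTranspose, Matrix.diagonal_conjTranspose]
    congr 1
    ext i
    simp
  rw [star_mul, star_star, h2, h]
  simp only [mul_assoc]

theorem posSemidef_star_mul (B : Matrix κ ι ℂ) : (B.conjTranspose * B).PosSemidef :=
  Matrix.posSemidef_conjTranspose_mul_self B

theorem trace_mul_self_star_nonneg {A : Matrix ι ι ℂ} (hA : A.PosSemidef) (X : Matrix ι κ ℂ) :
    0 ≤ (A * (X * X.conjTranspose)).trace := by
  rw [← Matrix.mul_assoc, Matrix.trace_mul_comm, ← Matrix.mul_assoc]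
  exact (hA.conjTranspose_mul_mul_same X).trace_nonneg

theorem trace_mul_log {B : Matrix ι ι ℂ} (hB : B.PosSemidef) :
    (B * cfc Real.log B).trace.re = -vnEntropy B := by
  obtain ⟨U, hU, p, hp, rfl⟩ := PosSemidef.exists_diagonal hB
  have h1 : star U * U = 1 := (Matrix.mem_unitaryGroup_iff').1 hU
  rw [cfc_conj_diagonal hU, vnEntropy_conj_diagonal hU,
    show U * Matrix.diagonal (fun i => (p i : ℂ)) * star U *
      (U * Matrix.diagonal (fun i => (Real.log (p i) : ℂ)) * star U) =
      U * (Matrix.diagonal (fun i => (p i : ℂ)) * (star U * U) *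
        Matrix.diagonal (fun i => (Real.log (p i) : ℂ))) * star U by simp only [mul_assoc],
    h1, mul_one, Matrix.diagonal_mul_diagonal, trace_conj hU, Matrix.trace_diagonal,
    Complex.re_sum, ← Finset.sum_neg_distrib]
  refine Finset.sum_congr rfl fun i _ => ?_
  rw [← Complex.ofReal_mul, Complex.ofReal_re, Real.negMulLog]
  ring

/-- Each `A a` is compared with the same total `B`, so the cross terms add up to `Tr B log B`. This
writes the Holevo quantity as a sum of relative entropies. -/
theorem sum_relEnt {α : Type*} [Fintype α] {A : α → Matrix ι ι ℂ} (hA : ∀ a, (A a).PosSemidef) :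
    ∑ a, relEnt (A a) (∑ b, A b) = vnEntropy (∑ b, A b) - ∑ a, vnEntropy (A a) := by
  simp only [relEnt, Finset.sum_sub_distrib, Finset.sum_neg_distrib]
  rw [← Complex.re_sum, ← Matrix.trace_sum, ← Finset.sum_mul,
    trace_mul_log (Matrix.posSemidef_sum _ fun a _ => hA a)]
  ring

theorem sum_sub_posSemidef {α : Type*} [Fintype α] {A : α → Matrix ι ι ℂ}
    (hA : ∀ a, (A a).PosSemidef) (a : α) : (((1 : ℝ) : ℂ) • ∑ b, A b - A a).PosSemidef := by
  classical
  rw [Complex.ofReal_one, one_smul, ← Finset.add_sum_erase _ _ (Finset.mem_univ a),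
    add_sub_cancel_left]
  exact Matrix.posSemidef_sum _ fun b _ => hA b

/-- Monotonicity of the Holevo quantity of an ensemble. -/
theorem holevo_mono {α : Type*} [Fintype α] {A' : α → Matrix ι ι ℂ} {A : α → Matrix κ κ ℂ}
    (hA' : ∀ a, (A' a).PosSemidef) (hA : ∀ a, (A a).PosSemidef)
    (htr : ∀ a, (A' a).trace = (A a).trace)
    (h : ∀ X, ∃ Y, ∀ a, (A' a * X).trace.re = (A a * Y).trace.re ∧
      (A a * (Y * star Y)).trace.re ≤ (A' a * (X * star X)).trace.re ∧
      (A a * (star Y * Y)).trace.re ≤ (A' a * (star X * X)).trace.re) :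
    vnEntropy (∑ a, A' a) - ∑ a, vnEntropy (A' a) ≤
      vnEntropy (∑ a, A a) - ∑ a, vnEntropy (A a) := by
  rw [← sum_relEnt hA', ← sum_relEnt hA]
  refine Finset.sum_le_sum fun a _ => ?_
  refine relEnt_mono (hA' a) (Matrix.posSemidef_sum _ fun a _ => hA' a) (hA a)
    (Matrix.posSemidef_sum _ fun a _ => hA a) (sum_sub_posSemidef hA' a)
    (sum_sub_posSemidef hA a) (htr a) fun X => ?_
  obtain ⟨Y, hY⟩ := h X
  refine ⟨Y, (hY a).1, (hY a).2.1, ?_⟩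
  rw [Finset.sum_mul, Finset.sum_mul, Matrix.trace_sum, Matrix.trace_sum, Complex.re_sum,
    Complex.re_sum]
  exact Finset.sum_le_sum fun b _ => (hY b).2.2

theorem blockDiagonal'_posSemidef {m : Type*} [Fintype m] [DecidableEq m] {n : m → Type*}
    [∀ i, Fintype (n i)] [∀ i, DecidableEq (n i)] {D : ∀ i, Matrix (n i) (n i) ℂ}
    (hD : ∀ i, (D i).PosSemidef) : (Matrix.blockDiagonal' D).PosSemidef := by
  choose B hB using fun i => PosSemidef.exists_star_mul (hD i)
  have : Matrix.blockDiagonal' D =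
      (Matrix.blockDiagonal' B).conjTranspose * Matrix.blockDiagonal' B := by
    rw [Matrix.blockDiagonal'_conjTranspose, ← Matrix.blockDiagonal'_mul]
    congr 1
    ext1 i
    exact hB i
  rw [this]
  exact posSemidef_star_mul _

/-- Strong subadditivity for two classical indices and one quantum system. -/
theorem vnEntropy_ssa {α β : Type*} [Fintype α] [Fintype β]
    {D : α → β → Matrix κ κ ℂ} (hD : ∀ a b, (D a b).PosSemidef) :
    ∑ a, ∑ b, vnEntropy (D a b) - ∑ b, vnEntropy (∑ a, D a b) ≤
      ∑ a, vnEntropy (∑ b, D a b) - vnEntropy (∑ a, ∑ b, D a b) := by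
  classical
  -- Forgetting `b` is dual to the diagonal embedding of `X` as constant blocks, which is
  -- multiplicative, so the conditions of `holevo_mono` hold with equality.
  have h := holevo_mono (A' := fun a => ∑ b, D a b)
    (A := fun a => Matrix.blockDiagonal' (n' := fun _ : β => κ) (D a))
    (fun a => Matrix.posSemidef_sum _ fun b _ => hD a b)
    (fun a => blockDiagonal'_posSemidef (hD a)) (fun a => by
      rw [Matrix.trace_sum, Matrix.trace_blockDiagonal']) (fun X =>
      ⟨Matrix.blockDiagonal' (n' := fun _ : β => κ) (fun _ => X), fun a => by
        simp only [Matrix.star_eq_conjTranspose, Matrix.blockDiagonal'_conjTranspose,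
          ← Matrix.blockDiagonal'_mul, Matrix.trace_blockDiagonal', Finset.sum_mul,
          Matrix.trace_sum, le_refl, and_self]⟩)
  have e : ∑ a, Matrix.blockDiagonal' (n' := fun _ : β => κ) (D a) =
      Matrix.blockDiagonal' (n' := fun _ : β => κ) (fun b => ∑ a, D a b) := by
    have := (map_sum (Matrix.blockDiagonal'AddMonoidHom (fun _ : β => κ) (fun _ : β => κ) ℂ) D
      Finset.univ).symm
    refine this.trans ?_
    change Matrix.blockDiagonal' _ = _
    congr 1
    ext1 b
    exact Finset.sum_apply b _ _
  rw [e, vnEntropy_blockDiagonal' fun b => Matrix.posSemidef_sum _ fun a _ => hD a b] at h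
  simp only [vnEntropy_blockDiagonal' (hD _)] at h
  linarith

theorem sum_fin_succ_fun {M : Type*} [AddCommMonoid M] {k : ℕ} {X : Type*} [Fintype X]
    (f : (Fin (k + 1) → X) → M) : ∑ J, f J = ∑ a, ∑ J : Fin k → X, f (Fin.cons a J) := by
  rw [← (Fin.consEquiv fun _ : Fin (k + 1) => X).sum_comp f, Fintype.sum_prod_type]
  rfl

/-- Conditional entropy of a tuple is at most the sum of the conditional entropies of its
entries. -/
theorem condEntropy_le_sum {X : Type*} [Fintype X] [DecidableEq X] {k : ℕ}
    {D : (Fin k → X) → Matrix κ κ ℂ} (hD : ∀ J, (D J).PosSemidef) :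
    ∑ J, vnEntropy (D J) - vnEntropy (∑ J, D J) ≤
      ∑ l, (∑ i, vnEntropy (∑ J with J l = i, D J) - vnEntropy (∑ J, D J)) := by
  induction k with
  | zero => simp
  | succ k ih =>
    -- The first index is split off against the remaining tuple; the induction hypothesis is used
    -- after summation over the first index.
    have h1 := vnEntropy_ssa (D := fun a (J : Fin k → X) => D (Fin.cons a J)) fun a J => hD _
    have h2 := ih (D := fun J => ∑ a, D (Fin.cons a J)) fun J =>
      Matrix.posSemidef_sum _ fun a _ => hD _
    have e0 : ∑ J : Fin k → X, ∑ a, D (Fin.cons a J) = ∑ J, D J := by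
      rw [sum_fin_succ_fun, Finset.sum_comm]
    have e1 : ∀ a, ∑ J with J 0 = a, D J = ∑ J : Fin k → X, D (Fin.cons a J) := by
      intro a
      rw [Finset.sum_filter, sum_fin_succ_fun, Finset.sum_eq_single a]
      · simp
      · intro b _ hb; simp [hb]
      · simp
    have e2 : ∀ (l : Fin k) i, ∑ J with J l.succ = i, D J =
        ∑ J : Fin k → X with J l = i, ∑ a, D (Fin.cons a J) := by
      intro l i
      rw [Finset.sum_filter, sum_fin_succ_fun, Finset.sum_comm, Finset.sum_filter]
      refine Finset.sum_congr rfl fun J _ => ?_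
      simp only [Fin.cons_succ]
      split_ifs <;> simp
    rw [Fin.sum_univ_succ]
    simp only [e1, e2]
    rw [sum_fin_succ_fun (fun J => vnEntropy (D J))]
    rw [e0] at h2
    have e3 : ∑ a, ∑ J : Fin k → X, D (Fin.cons a J) = ∑ J, D J := (sum_fin_succ_fun D).symm
    rw [e3] at h1
    linarith

end ensembles

/-! ### Positive functionals on direct sums of matrix algebras -/

section functionals
variable {A : Type*} [Ring A] [StarRing A] [Algebra ℂ A]

/-- Polarisation: reality of the values at `1 + a` and `1 + i a` gives the imaginary and the real
parts. -/
theorem IsPositive.map_star [StarModule ℂ A] {φ : A →ₗ[ℂ] ℂ} (hφ : IsPositive φ) (a : A) :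
    φ (star a) = star (φ a) := by
  have him : ∀ x : A, (φ (star x * x)).im = 0 := fun x => (Complex.nonneg_iff.1 (hφ x)).2.symm
  have h1 := him (1 + a)
  have h2 := him (1 + Complex.I • a)
  have h0 := him 1
  have ha := him a
  simp only [star_add, star_one, mul_add, add_mul, one_mul, mul_one, map_add, Complex.add_im,
    star_smul, smul_mul_assoc, mul_smul_comm, map_smul, smul_eq_mul, RCLike.star_def,
    Complex.conj_I, Complex.mul_im, Complex.neg_im, Complex.neg_re, Complex.I_re, Complex.I_im,
    Complex.mul_re] at h1 h2 h0 ha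
  apply Complex.ext
  · simp only [RCLike.star_def, Complex.conj_re]; linarith
  · simp only [RCLike.star_def, Complex.conj_im]; linarith

theorem IsPositive.sum {α : Type*} {s : Finset α} {φ : α → (A →ₗ[ℂ] ℂ)}
    (h : ∀ i ∈ s, IsPositive (φ i)) : IsPositive (∑ i ∈ s, φ i) := fun a => by
  rw [LinearMap.sum_apply]
  exact Finset.sum_nonneg fun i hi => h i hi a

theorem IsPositive.comp {B : Type*} [Ring B] [StarRing B] [Algebra ℂ B] {φ : A →ₗ[ℂ] ℂ}
    (h : IsPositive φ) (e : B →⋆ₐ[ℂ] A) : IsPositive (φ ∘ₗ e.toAlgHom.toLinearMap) := fun a => by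
  change 0 ≤ φ (e (star a * a))
  rw [map_mul, StarHomClass.map_star]
  exact h _

variable {m : ℕ} {n : Fin m → ℕ}

theorem single_eq_sum (x : Blocks n) :
    x = ∑ i, ∑ a, ∑ b, x i a b • Pi.single i (Matrix.single a b (1 : ℂ)) := by
  conv_lhs => rw [← Finset.univ_sum_single x]
  refine Finset.sum_congr rfl fun i _ => ?_
  conv_lhs => rw [Matrix.matrix_eq_sum_single (x i)]
  have e : ∀ (M : Matrix (Fin (n i)) (Fin (n i)) ℂ), Pi.single i M =
      LinearMap.single ℂ (fun i => Matrix (Fin (n i)) (Fin (n i)) ℂ) i M := fun _ => rfl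
  simp only [e, map_sum]
  refine Finset.sum_congr rfl fun a _ => Finset.sum_congr rfl fun b _ => ?_
  rw [← map_smul]
  simp

theorem apply_eq_sum_trace (ψ : Blocks n →ₗ[ℂ] ℂ) (x : Blocks n) :
    ψ x = ∑ i, (density ψ i * x i).trace := by
  conv_lhs => rw [single_eq_sum x]
  simp only [map_sum, map_smul, Matrix.trace, Matrix.diag_apply, Matrix.mul_apply, density,
    Matrix.of_apply]
  refine Finset.sum_congr rfl fun i _ => ?_
  rw [Finset.sum_comm]
  exact Finset.sum_congr rfl fun a _ => Finset.sum_congr rfl fun b _ => by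
    rw [smul_eq_mul, mul_comm]

/-- Testing the functional on a square root of the projection-like matrix `v v*`, placed in block
`i`, yields the quadratic form at `v`. -/
theorem density_posSemidef {ψ : Blocks n →ₗ[ℂ] ℂ} (hψ : IsPositive ψ) (i : Fin m) :
    (density ψ i).PosSemidef := by
  refine Matrix.PosSemidef.of_dotProduct_mulVec_nonneg ?_ fun v => ?_
  · ext a b
    rw [Matrix.conjTranspose_apply, density, Matrix.of_apply, Matrix.of_apply, ← hψ.map_star]
    congr 1
    ext j c d
    by_cases h : j = i
    · subst h
      simp [Matrix.single, Matrix.star_apply, and_comm]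
    · simp [Pi.single_eq_of_ne h]
  · obtain ⟨B, hB⟩ := PosSemidef.exists_star_mul (Matrix.posSemidef_vecMulVec_self_star v)
    have h := hψ (Pi.single i B)
    have e : star (Pi.single i B : Blocks n) * Pi.single i B =
        Pi.single i (Matrix.vecMulVec v (star v)) := by
      rw [hB]
      ext j c d
      by_cases h : j = i
      · subst h; simp
      · simp [Pi.single_eq_of_ne h]
    rw [e, apply_eq_sum_trace, Finset.sum_eq_single i] at h
    · rw [Pi.single_eq_same, Matrix.mul_vecMulVec, Matrix.trace_vecMulVec, dotProduct_comm] at h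
      exact h
    · intro j _ hj; simp [Pi.single_eq_of_ne hj]
    · simp

/-- The density of a functional on `⨁_i M_{n i}` as one block diagonal matrix. -/
def blockDensity (ψ : Blocks n →ₗ[ℂ] ℂ) : Matrix (Σ i, Fin (n i)) (Σ i, Fin (n i)) ℂ :=
  Matrix.blockDiagonal' (density ψ)

theorem blockDensity_posSemidef {ψ : Blocks n →ₗ[ℂ] ℂ} (hψ : IsPositive ψ) :
    (blockDensity ψ).PosSemidef :=
  blockDiagonal'_posSemidef fun i => density_posSemidef hψ i

theorem vnEntropy_blockDensity {ψ : Blocks n →ₗ[ℂ] ℂ} (hψ : IsPositive ψ) :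
    vnEntropy (blockDensity ψ) = blockEntropy ψ :=
  vnEntropy_blockDiagonal' fun i => density_posSemidef hψ i

theorem trace_blockDensity_mul (ψ : Blocks n →ₗ[ℂ] ℂ) (X) :
    (blockDensity ψ * X).trace = ψ (fun i => X.blockDiag' i) := by
  rw [apply_eq_sum_trace]
  simp only [Matrix.trace, Matrix.diag_apply, Matrix.mul_apply, blockDensity, Fintype.sum_sigma]
  refine Finset.sum_congr rfl fun i _ => Finset.sum_congr rfl fun a _ => ?_
  rw [Finset.sum_eq_single i]
  · simp [Matrix.blockDiag'_apply]
  · intro j _ hj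
    exact Finset.sum_eq_zero fun b _ => by
      rw [Matrix.blockDiagonal'_apply_ne _ _ _ hj.symm, zero_mul]
  · simp

theorem trace_blockDensity_mul_blockDiagonal' (ψ : Blocks n →ₗ[ℂ] ℂ) (x : Blocks n) :
    (blockDensity ψ * Matrix.blockDiagonal' x).trace = ψ x := by
  rw [trace_blockDensity_mul]
  congr 1
  ext1 i
  exact congrFun (Matrix.blockDiag'_blockDiagonal' x) i

theorem trace_blockDensity (ψ : Blocks n →ₗ[ℂ] ℂ) : (blockDensity ψ).trace = ψ 1 := by
  rw [← trace_blockDensity_mul_blockDiagonal' ψ 1, Matrix.blockDiagonal'_one, mul_one]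

@[simp] theorem density_add (ψ χ : Blocks n →ₗ[ℂ] ℂ) : density (ψ + χ) = density ψ + density χ :=
  rfl

theorem density_smul (c : ℂ) (ψ : Blocks n →ₗ[ℂ] ℂ) : density (c • ψ) = c • density ψ :=
  rfl

theorem blockDensity_smul (c : ℂ) (ψ : Blocks n →ₗ[ℂ] ℂ) :
    blockDensity (c • ψ) = c • blockDensity ψ := by
  rw [blockDensity, density_smul, Matrix.blockDiagonal'_smul]
  rfl

theorem blockDensity_sum {α : Type*} (s : Finset α) (ψ : α → (Blocks n →ₗ[ℂ] ℂ)) :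
    blockDensity (∑ i ∈ s, ψ i) = ∑ i ∈ s, blockDensity (ψ i) := by
  classical
  induction s using Finset.induction_on with
  | empty =>
    have := blockDensity_smul 0 (0 : Blocks n →ₗ[ℂ] ℂ)
    simpa using this
  | insert a s ha ih =>
    rw [Finset.sum_insert ha, Finset.sum_insert ha, ← ih, blockDensity, density_add,
      Matrix.blockDiagonal'_add]
    rfl

end functionals
end QChain
end

noncomputable section
open scoped ComplexOrder Kronecker
set_option linter.unusedSectionVars false
namespace QChain

/-! ### CNT values and their bound by the entropy of one finite-dimensional algebra -/

section decompositions
variable {A : Type*} [Ring A] [StarRing A] [Algebra ℂ A] {m m' : ℕ} {n : Fin m → ℕ}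
  {n' : Fin m' → ℕ}

theorem vnEntropy_zero {ι : Type*} [Fintype ι] [DecidableEq ι] :
    vnEntropy (0 : Matrix ι ι ℂ) = 0 := by
  have := vnEntropy_diagonal (fun _ : ι => (0 : ℝ))
  simpa using this

theorem IsPositive.ofReal_mass {ω : A →ₗ[ℂ] ℂ} (hω : IsPositive ω) : ((mass ω : ℝ) : ℂ) = ω 1 := by
  have h := hω 1
  rw [star_one, mul_one] at h
  exact Complex.conj_eq_iff_re.1 (Complex.conj_eq_iff_im.2 (Complex.nonneg_iff.1 h).2.symm)

theorem IsPositive.mass_nonneg {ω : A →ₗ[ℂ] ℂ} (hω : IsPositive ω) : 0 ≤ mass ω := by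
  have h := hω 1
  rw [star_one, mul_one] at h
  exact (Complex.nonneg_iff.1 h).1

theorem mass_sum {α : Type*} (s : Finset α) (ψ : α → (A →ₗ[ℂ] ℂ)) :
    mass (∑ i ∈ s, ψ i) = ∑ i ∈ s, mass (ψ i) := by
  simp [mass, LinearMap.sum_apply]

theorem sum_marginal {k r : ℕ} (ψ : (Fin k → Fin r) → (A →ₗ[ℂ] ℂ)) (l : Fin k) :
    ∑ i, marginal ψ l i = ∑ J, ψ J :=
  Finset.sum_fiberwise _ _ _

theorem marginal_comp {k r : ℕ} {B : Type*} [Ring B] [StarRing B] [Algebra ℂ B]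
    (ψ : (Fin k → Fin r) → (A →ₗ[ℂ] ℂ)) (l : Fin k) (i : Fin r) (α : B →ₗ[ℂ] A) :
    marginal ψ l i ∘ₗ α = ∑ J with J l = i, ψ J ∘ₗ α := by
  ext x
  simp [marginal, LinearMap.sum_apply]

theorem IsPositive.marginal {k r : ℕ} {ψ : (Fin k → Fin r) → (A →ₗ[ℂ] ℂ)}
    (h : ∀ J, IsPositive (ψ J)) (l : Fin k) (i : Fin r) : IsPositive (marginal ψ l i) :=
  IsPositive.sum fun J _ => h J

/-- Scaling law of the entropy: for mass `c`, `c S(ω/c) = S(ω) - η(c)`. It also covers mass zero,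
where positivity forces the density to vanish. -/
theorem mass_mul_blockEntropy_normalization {ω : A →ₗ[ℂ] ℂ} {α : Blocks n →ₗ[ℂ] A}
    (hω : IsPositive ω) (hα : IsPositive (ω ∘ₗ α)) (h1 : α 1 = 1) :
    mass ω * blockEntropy (normalization ω ∘ₗ α) =
      blockEntropy (ω ∘ₗ α) - Real.negMulLog (mass ω) := by
  have htr : (blockDensity (ω ∘ₗ α)).trace = (mass ω : ℂ) := by
    rw [trace_blockDensity, LinearMap.comp_apply, h1, hω.ofReal_mass]
  rcases eq_or_ne (mass ω) 0 with h | h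
  · have h0 : blockDensity (ω ∘ₗ α) = 0 := by
      refine ((blockDensity_posSemidef hα).trace_eq_zero_iff).1 ?_
      rw [htr, h, Complex.ofReal_zero]
    rw [h, ← vnEntropy_blockDensity hα, h0, vnEntropy_zero]
    simp
  · have hn : normalization ω ∘ₗ α = ((mass ω)⁻¹ : ℝ) • (ω ∘ₗ α) := by
      ext x
      simp [normalization, ← hω.ofReal_mass]
    have hn' : normalization ω ∘ₗ α = (((mass ω)⁻¹ : ℝ) : ℂ) • (ω ∘ₗ α) := by
      rw [hn]; ext x; simp
    have hp : IsPositive ((((mass ω)⁻¹ : ℝ) : ℂ) • (ω ∘ₗ α)) := fun x => by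
      rw [LinearMap.smul_apply, smul_eq_mul]
      exact mul_nonneg (Complex.zero_le_real.2 (inv_nonneg.2 hω.mass_nonneg)) (hα x)
    rw [hn', ← vnEntropy_blockDensity hp, blockDensity_smul,
      vnEntropy_smul (blockDensity_posSemidef hα), vnEntropy_blockDensity hα, htr,
      Complex.ofReal_re, Real.negMulLog, Real.negMulLog, Real.log_inv]
    field_simp
    ring

/-- With entropies of unnormalised functionals the terms `η(ψ^l_i(1))` cancel. -/
theorem cntValue_eq {k r : ℕ} {φ : A →ₗ[ℂ] ℂ} {α : Fin k → (Blocks n →ₗ[ℂ] A)}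
    {ψ : (Fin k → Fin r) → (A →ₗ[ℂ] ℂ)} (hψ : ∀ J, IsPositive (ψ J))
    (hα : ∀ l J, IsPositive (ψ J ∘ₗ α l)) (h1 : ∀ l, α l 1 = 1) :
    cntValue φ α ψ = ∑ J, Real.negMulLog (mass (ψ J)) +
      ∑ l, (blockEntropy (φ ∘ₗ α l) - ∑ i, blockEntropy (marginal ψ l i ∘ₗ α l)) := by
  have h : ∀ l i, mass (marginal ψ l i) * blockEntropy (normalization (marginal ψ l i) ∘ₗ α l) =
      blockEntropy (marginal ψ l i ∘ₗ α l) - Real.negMulLog (mass (marginal ψ l i)) := by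
    intro l i
    refine mass_mul_blockEntropy_normalization (IsPositive.marginal hψ l i) ?_ (h1 l)
    rw [marginal_comp]
    exact IsPositive.sum fun J _ => hα l J
  rw [cntValue]
  simp only [h, Finset.sum_sub_distrib]
  ring

/-- A *-preserving map that satisfies the Schwarz inequality under all positive functionals. -/
def IsSchwarz {B : Type*} [Ring B] [StarRing B] [Algebra ℂ B] (α : B →ₗ[ℂ] A) : Prop :=
  (∀ x, α (star x) = star (α x)) ∧
    ∀ ω : A →ₗ[ℂ] ℂ, IsPositive ω → ∀ x, 0 ≤ ω (α (star x * x) - star (α x) * α x)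

theorem IsSchwarz.isPositive_comp {B : Type*} [Ring B] [StarRing B] [Algebra ℂ B]
    {α : B →ₗ[ℂ] A} (hα : IsSchwarz α) {ω : A →ₗ[ℂ] ℂ} (hω : IsPositive ω) :
    IsPositive (ω ∘ₗ α) := fun x => by
  have h := hα.2 ω hω x
  rw [map_sub, sub_nonneg] at h
  exact (hω (α x)).trans h

/-- The off-diagonal blocks contribute a second square. Hence restriction to diagonal blocks
satisfies the Schwarz inequality, needed because `holevo_mono` tests against full matrices. -/
theorem blockDiag'_mul_conjTranspose (X : Matrix (Σ i, Fin (n i)) (Σ i, Fin (n i)) ℂ) :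
    (fun i => (X * X.conjTranspose).blockDiag' i) =
      (fun i => X.blockDiag' i * (X.blockDiag' i).conjTranspose) +
      fun i => ((X - Matrix.blockDiagonal' X.blockDiag') *
        (X - Matrix.blockDiagonal' X.blockDiag').conjTranspose).blockDiag' i := by
  ext i a b
  simp only [Matrix.blockDiag'_apply, Matrix.mul_apply, Pi.add_apply, Matrix.add_apply,
    Fintype.sum_sigma, Matrix.conjTranspose_apply, Matrix.sub_apply]
  rw [← Finset.add_sum_erase _ _ (Finset.mem_univ i)]
  congr 1
  rw [← Finset.add_sum_erase (Finset.univ) (fun x => ∑ c, (X ⟨i, a⟩ ⟨x, c⟩ - _) * _)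
    (Finset.mem_univ i)]
  simp only [Matrix.blockDiagonal'_apply_eq, Matrix.blockDiag'_apply, sub_self, zero_mul,
    Finset.sum_const_zero, zero_add]
  refine Finset.sum_congr rfl fun j hj => Finset.sum_congr rfl fun c _ => ?_
  have hij : i ≠ j := (Finset.ne_of_mem_erase hj).symm
  rw [Matrix.blockDiagonal'_apply_ne _ _ _ hij, Matrix.blockDiagonal'_apply_ne _ _ _ hij, sub_zero,
    sub_zero]

theorem apply_blockDiag'_mul_le {χ : Blocks n →ₗ[ℂ] ℂ} (hχ : IsPositive χ)
    (X : Matrix (Σ i, Fin (n i)) (Σ i, Fin (n i)) ℂ) :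
    χ ((fun i => X.blockDiag' i) * star (fun i => X.blockDiag' i)) ≤
      (blockDensity χ * (X * X.conjTranspose)).trace := by
  rw [trace_blockDensity_mul, blockDiag'_mul_conjTranspose, map_add, ← trace_blockDensity_mul]
  exact le_add_of_nonneg_right (trace_mul_self_star_nonneg (blockDensity_posSemidef hχ) _)

/-- The value of a decomposition is at most the entropy on a finite-dimensional algebra through
which all the maps factor. -/
theorem cntValue_le {k r : ℕ} {φ : A →ₗ[ℂ] ℂ} {α : Fin k → (Blocks n →ₗ[ℂ] A)}
    {ψ : (Fin k → Fin r) → (A →ₗ[ℂ] ℂ)} (hψ : ∀ J, IsPositive (ψ J)) (hφ : ∑ J, ψ J = φ)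
    (hα : ∀ l, IsSchwarz (α l)) (h1 : ∀ l, α l 1 = 1) (e : Blocks n' →⋆ₐ[ℂ] A)
    (he : ∀ l x, ∃ y, e y = α l x) :
    cntValue φ α ψ ≤ blockEntropy (φ ∘ₗ e.toAlgHom.toLinearMap) := by
  rw [cntValue_eq hψ (fun l J => (hα l).isPositive_comp (hψ J)) h1]
  set D : (Fin k → Fin r) → Matrix (Σ i, Fin (n' i)) (Σ i, Fin (n' i)) ℂ := fun J =>
    blockDensity (ψ J ∘ₗ e.toAlgHom.toLinearMap) with hD
  have hpos : ∀ ω : A →ₗ[ℂ] ℂ, IsPositive ω →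
      (blockDensity (ω ∘ₗ e.toAlgHom.toLinearMap)).PosSemidef := fun ω hω =>
    blockDensity_posSemidef (hω.comp e)
  have hmarg : ∀ l i, blockDensity (marginal ψ l i ∘ₗ e.toAlgHom.toLinearMap) =
      ∑ J with J l = i, D J := fun l i => by
    rw [marginal_comp, blockDensity_sum]
  have hφ' : IsPositive φ := hφ ▸ IsPositive.sum fun J _ => hψ J
  have htot : blockDensity (φ ∘ₗ e.toAlgHom.toLinearMap) = ∑ J, D J := by
    rw [← blockDensity_sum, ← hφ]
    congr 1
    ext x
    simp
  -- Each map loses information: its Holevo quantity is at most that of the ensemble `ψ^l_i` on the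
  -- common algebra. The competitor for `X` is a preimage under `e` of the image of the diagonal
  -- blocks of `X`.
  have hl : ∀ l, blockEntropy (φ ∘ₗ α l) - ∑ i, blockEntropy (marginal ψ l i ∘ₗ α l) ≤
      vnEntropy (∑ J, D J) - ∑ i, vnEntropy (∑ J with J l = i, D J) := by
    intro l
    have hm := IsPositive.marginal hψ l
    have h := holevo_mono
      (A' := fun i => blockDensity (marginal ψ l i ∘ₗ α l))
      (A := fun i => blockDensity (marginal ψ l i ∘ₗ e.toAlgHom.toLinearMap))
      (fun i => blockDensity_posSemidef ((hα l).isPositive_comp (hm i)))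
      (fun i => hpos _ (hm i))
      (fun i => by
        rw [trace_blockDensity, trace_blockDensity, LinearMap.comp_apply, LinearMap.comp_apply, h1]
        congr 1
        exact (map_one e).symm)
      (fun X => by
        set x : Blocks n := fun i => X.blockDiag' i
        obtain ⟨y, hy⟩ := he l x
        have hsch : ∀ i, ∀ z : Blocks n, marginal ψ l i (star (α l z) * α l z) ≤
            (marginal ψ l i ∘ₗ α l) (star z * z) := fun i z => by
          have := (hα l).2 _ (hm i) z
          rwa [map_sub, sub_nonneg] at this
        have hpair : ∀ (i : Fin r) (z : Blocks n'),
            (blockDensity (marginal ψ l i ∘ₗ e.toAlgHom.toLinearMap) *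
              Matrix.blockDiagonal' z).trace = marginal ψ l i (e z) := fun i z =>
          trace_blockDensity_mul_blockDiagonal' _ z
        have hst : star (Matrix.blockDiagonal' y) = Matrix.blockDiagonal' (star y) :=
          Matrix.blockDiagonal'_conjTranspose y
        refine ⟨Matrix.blockDiagonal' y, fun i => ⟨?_, ?_, ?_⟩⟩
        · rw [hpair, hy, trace_blockDensity_mul]
          rfl
        · rw [hst, ← Matrix.blockDiagonal'_mul]
          refine (Complex.le_def.1 ?_).1
          refine (hpair i (y * star y)).trans_le ?_
          rw [map_mul, map_star, hy, ← star_star (α l x), ← (hα l).1 x, star_star]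
          refine (hsch i (star x)).trans ?_
          rw [star_star]
          exact apply_blockDiag'_mul_le ((hα l).isPositive_comp (hm i)) X
        · rw [hst, ← Matrix.blockDiagonal'_mul]
          refine (Complex.le_def.1 ?_).1
          refine (hpair i (star y * y)).trans_le ?_
          rw [map_mul, map_star, hy]
          refine (hsch i x).trans ?_
          have h2 := apply_blockDiag'_mul_le ((hα l).isPositive_comp (hm i)) X.conjTranspose
          rw [Matrix.conjTranspose_conjTranspose] at h2
          have h3 : (fun i => X.conjTranspose.blockDiag' i) = star x := by
            ext i a b; rfl
          rw [h3, star_star] at h2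
          exact h2)
    rw [← blockDensity_sum, ← blockDensity_sum] at h
    have hs : ∀ (B : Type) [Ring B] [StarRing B] [Algebra ℂ B] (f : B →ₗ[ℂ] A),
        ∑ i, marginal ψ l i ∘ₗ f = φ ∘ₗ f := by
      intro B _ _ _ f
      rw [← hφ, ← sum_marginal ψ l]
      ext x
      simp [LinearMap.sum_apply]
    rw [hs, hs, htot, vnEntropy_blockDensity ((hα l).isPositive_comp hφ')] at h
    simp only [hmarg, vnEntropy_blockDensity ((hα l).isPositive_comp (hm _))] at h
    exact h
  -- With `η(ψ_J(1)) ≤ S(D J)`, the value is at most `∑ S(D J) + ∑_l (S(D) - ∑_i S(D^l_i))`.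
  -- Subadditivity of conditional entropy bounds this by the entropy `S(D)` of the total.
  have hc := condEntropy_le_sum (D := D) fun J => hpos _ (hψ J)
  have hm : ∀ J, Real.negMulLog (mass (ψ J)) ≤ vnEntropy (D J) := by
    intro J
    refine le_trans (le_of_eq ?_) (negMulLog_trace_le (hpos _ (hψ J)))
    rw [trace_blockDensity, mass]
    exact congrArg (fun z => Real.negMulLog (ψ J z).re) (map_one e).symm
  rw [← vnEntropy_blockDensity (hφ'.comp e), htot]
  have h2 := Finset.sum_le_sum fun l (_ : l ∈ Finset.univ) => hl l
  have h3 := Finset.sum_le_sum fun J (_ : J ∈ Finset.univ) => hm J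
  simp only [Finset.sum_sub_distrib] at h2 hc ⊢
  linarith

end decompositions
end QChain
end

noncomputable section
open scoped ComplexOrder Kronecker
set_option linter.unusedSectionVars false
namespace QChain

/-! ### Matrix units and the estimate behind the Pimsner-Popa inequality -/

section comparison
variable {m : ℕ} {n : Fin m → ℕ} {ν : Type*} [Fintype ν] [DecidableEq ν]

/-- The matrix units of `⨁_i M_{n i}`. -/
def blockUnit (i : Fin m) (a b : Fin (n i)) : Blocks n := Pi.single i (Matrix.single a b 1)

theorem blockUnit_mul (i : Fin m) (a b c : Fin (n i)) :
    blockUnit i a b * blockUnit i b c = blockUnit (n := n) i a c := by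
  rw [blockUnit, blockUnit, ← Pi.single_mul, Matrix.single_mul_single_same, mul_one, blockUnit]

theorem blockUnit_mul_of_ne (i : Fin m) {a b c d : Fin (n i)} (h : b ≠ c) :
    blockUnit i a b * blockUnit i c d = (0 : Blocks n) := by
  rw [blockUnit, blockUnit, ← Pi.single_mul, Matrix.single_mul_single_of_ne _ _ _ _ h,
    Pi.single_zero]

theorem blockUnit_mul_of_ne' {i j : Fin m} (h : i ≠ j) (a b : Fin (n i)) (c d : Fin (n j)) :
    blockUnit i a b * blockUnit j c d = (0 : Blocks n) := by
  ext k
  rcases eq_or_ne k i with rfl | hk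
  · simp [blockUnit, Pi.single_eq_of_ne h]
  · simp [blockUnit, Pi.single_eq_of_ne hk]

theorem star_blockUnit (i : Fin m) (a b : Fin (n i)) :
    star (blockUnit i a b) = (blockUnit i b a : Blocks n) := by
  ext j c d
  rcases eq_or_ne j i with rfl | hj
  · simp [blockUnit, Matrix.single, Matrix.star_apply, and_comm]
  · simp [blockUnit, Pi.single_eq_of_ne hj]

theorem sum_blockUnit : ∑ i, ∑ a, blockUnit i a a = (1 : Blocks n) := by
  ext j c d
  simp only [Finset.sum_apply, Matrix.sum_apply]
  rw [Finset.sum_eq_single j]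
  · rw [Pi.one_apply, Matrix.one_apply]
    by_cases h : c = d
    · subst h
      rw [Finset.sum_eq_single c]
      · simp [blockUnit]
      · intro b _ hb
        simp [blockUnit, hb]
      · simp
    · rw [if_neg h]
      exact Finset.sum_eq_zero fun x _ => by
        simp only [blockUnit, Pi.single_eq_same]
        exact Matrix.single_apply_of_ne _ _ _ _ _ fun h' => h (h'.1.symm.trans h'.2)
  · intro i _ hi
    exact Finset.sum_eq_zero fun a _ => by simp [blockUnit, Pi.single_eq_of_ne hi.symm]
  · simp

theorem density_apply (ψ : Blocks n →ₗ[ℂ] ℂ) (i : Fin m) (a b : Fin (n i)) :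
    density ψ i a b = ψ (blockUnit i b a) := rfl

/-- The first index of a nonempty block. -/
def firstIdx {i : Fin m} (a : Fin (n i)) : Fin (n i) := ⟨0, a.pos⟩

/-- The sum of one minimal projection from every nonempty block. -/
def cornerProj (n : Fin m → ℕ) : Blocks n :=
  ∑ q : Σ i, Fin (n i), if q.2.val = 0 then blockUnit q.1 q.2 q.2 else 0

theorem cornerProj_mul (i : Fin m) (a b : Fin (n i)) :
    cornerProj n * blockUnit i (firstIdx a) b = blockUnit i (firstIdx a) b := by
  rw [cornerProj, Finset.sum_mul, Finset.sum_eq_single ⟨i, firstIdx a⟩]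
  · simp [firstIdx, blockUnit_mul]
  · rintro ⟨j, c⟩ _ hne
    split_ifs with h
    · rcases eq_or_ne j i with rfl | hj
      · refine blockUnit_mul_of_ne _ fun hc => hne ?_
        simp only at hc
        rw [hc]
      · exact blockUnit_mul_of_ne' hj _ _ _ _
    · rw [zero_mul]
  · simp

theorem star_cornerProj : star (cornerProj n) = cornerProj n := by
  rw [cornerProj, star_sum]
  refine Finset.sum_congr rfl fun q _ => ?_
  split_ifs
  · exact star_blockUnit _ _ _
  · exact star_zero _

theorem cornerProj_mul_self : cornerProj n * cornerProj n = cornerProj n := by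
  conv_lhs => enter [1]; rw [cornerProj]
  rw [Finset.sum_mul]
  conv_rhs => rw [cornerProj]
  rw [← star_cornerProj]
  refine Finset.sum_congr rfl fun q _ => ?_
  split_ifs with h
  · have hq : firstIdx q.2 = q.2 := Fin.ext h.symm
    have := congrArg star (cornerProj_mul q.1 q.2 q.2)
    rw [hq, star_mul, star_blockUnit] at this
    exact this
  · rw [zero_mul]

theorem norm_trace_mul_sq_le (X Y : Matrix ν ν ℂ) :
    ‖(X * Y).trace‖ ^ 2 ≤ (X * X.conjTranspose).trace.re * (Y.conjTranspose * Y).trace.re := by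
  have e1 : (X * X.conjTranspose).trace.re = ∑ p : ν × ν, ‖X p.1 p.2‖ ^ 2 := by
    rw [Matrix.trace, Complex.re_sum, Fintype.sum_prod_type]
    refine Finset.sum_congr rfl fun i _ => ?_
    rw [Matrix.diag_apply, Matrix.mul_apply, Complex.re_sum]
    refine Finset.sum_congr rfl fun j _ => ?_
    rw [Matrix.conjTranspose_apply, RCLike.star_def, Complex.mul_conj']
    norm_cast
  have e2 : (Y.conjTranspose * Y).trace.re = ∑ p : ν × ν, ‖Y p.2 p.1‖ ^ 2 := by
    rw [Matrix.trace, Complex.re_sum, Fintype.sum_prod_type]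
    refine Finset.sum_congr rfl fun i _ => ?_
    rw [Matrix.diag_apply, Matrix.mul_apply, Complex.re_sum]
    refine Finset.sum_congr rfl fun j _ => ?_
    rw [Matrix.conjTranspose_apply, RCLike.star_def, Complex.conj_mul']
    norm_cast
  rw [e1, e2]
  refine le_trans ?_ (Finset.sum_mul_sq_le_sq_mul_sq _ _ _)
  gcongr
  rw [Matrix.trace, Fintype.sum_prod_type]
  refine (norm_sum_le _ _).trans (Finset.sum_le_sum fun i _ => ?_)
  rw [Matrix.diag_apply, Matrix.mul_apply]
  refine (norm_sum_le _ _).trans (Finset.sum_le_sum fun j _ => ?_)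
  rw [norm_mul]

variable (θ : Blocks n →⋆ₐ[ℂ] Matrix ν ν ℂ)

theorem apply_eq_sum_blockUnit (x : Blocks n) :
    θ x = ∑ i, ∑ a, ∑ b, x i a b • θ (blockUnit i a b) := by
  conv_lhs => rw [single_eq_sum x]
  simp only [map_sum, map_smul]
  rfl

-- Let `M = ∑ e_{0a} x v* e_{a0}`, with block indices suppressed. Its trace is `⟨v, x⟩`, the corner
-- projection `p` satisfies `p M = M`, and `Tr M* M` is the double sum on the right. The
-- Cauchy-Schwarz inequality for `Tr (p M)` gives the estimate.
open Matrix in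
theorem norm_dotProduct_sq_le (x v : ν → ℂ) :
    ‖star v ⬝ᵥ x‖ ^ 2 ≤ (θ (cornerProj n)).trace.re *
      (∑ i, ∑ a, ∑ b, (star v ⬝ᵥ (θ (blockUnit i a b) *ᵥ v)) *
        (star x ⬝ᵥ (θ (blockUnit i b a) *ᵥ x))).re := by
  set p := θ (cornerProj n) with hp
  let g : (i : Fin m) → Fin (n i) → Fin (n i) → Matrix ν ν ℂ := fun i a b => θ (blockUnit i a b)
  let M : Matrix ν ν ℂ := ∑ i, ∑ a, g i (firstIdx a) a * vecMulVec x (star v) * g i a (firstIdx a)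
  have hgg : ∀ i a b c, g i a b * g i b c = g i a c := fun i a b c => by
    simp only [g]; rw [← map_mul, blockUnit_mul]
  have hpM : p * M = M := by
    simp only [M, Finset.mul_sum]
    refine Finset.sum_congr rfl fun i _ => Finset.sum_congr rfl fun a _ => ?_
    rw [← mul_assoc, ← mul_assoc, hp, ← map_mul, cornerProj_mul]
  have htr : M.trace = star v ⬝ᵥ x := by
    simp only [M, Matrix.trace_sum]
    have : ∀ i a, (g i (firstIdx a) a * vecMulVec x (star v) * g i a (firstIdx a)).trace =
        (θ (blockUnit i a a) * vecMulVec x (star v)).trace := by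
      intro i a
      rw [Matrix.trace_mul_comm, ← mul_assoc, hgg]
    simp only [this]
    rw [dotProduct_comm, ← Matrix.trace_vecMulVec]
    conv_rhs => rw [← one_mul (vecMulVec x (star v)), ← map_one θ, ← sum_blockUnit]
    simp only [map_sum, Finset.sum_mul, Matrix.trace_sum]
  have hMM : (M.conjTranspose * M).trace = ∑ i, ∑ a, ∑ b, (star v ⬝ᵥ (θ (blockUnit i a b) *ᵥ v)) *
        (star x ⬝ᵥ (θ (blockUnit i b a) *ᵥ x)) := by
    have hMs : M.conjTranspose =
        ∑ i, ∑ a, g i (firstIdx a) a * vecMulVec v (star x) * g i a (firstIdx a) := by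
      have hgs : ∀ i a b, (g i a b).conjTranspose = g i b a := fun i a b => by
        simp only [g]
        rw [← star_eq_conjTranspose, ← map_star, star_blockUnit]
      simp only [M, Matrix.conjTranspose_sum, Matrix.conjTranspose_mul, hgs,
        Matrix.conjTranspose_vecMulVec, star_star, mul_assoc]
    rw [hMs]
    simp only [M, Finset.sum_mul, Finset.mul_sum, Matrix.trace_sum]
    refine Finset.sum_congr rfl fun i _ => Finset.sum_congr rfl fun a _ => ?_
    rw [Finset.sum_eq_single i]
    · refine Finset.sum_congr rfl fun b _ => ?_
      have hf : firstIdx b = firstIdx a := rfl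
      have e : g i (firstIdx b) b * vecMulVec v (star x) * g i b (firstIdx b) *
          (g i (firstIdx a) a * vecMulVec x (star v) * g i a (firstIdx a)) =
          g i (firstIdx b) b * (vecMulVec v (star x) * ((g i b (firstIdx b) * g i (firstIdx a) a) *
            vecMulVec x (star v))) * g i a (firstIdx a) := by simp only [mul_assoc]
      rw [e, hf, hgg, Matrix.trace_mul_comm, ← mul_assoc, hgg, mul_vecMulVec,
        vecMulVec_mul_vecMulVec, mul_vecMulVec, trace_vecMulVec]
      rw [dotProduct_smul, smul_eq_mul, mul_comm, dotProduct_comm (g i a b *ᵥ v)]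
    · intro j _ hj
      refine Finset.sum_eq_zero fun b _ => ?_
      have e : g j (firstIdx b) b * vecMulVec v (star x) * g j b (firstIdx b) *
          (g i (firstIdx a) a * vecMulVec x (star v) * g i a (firstIdx a)) =
          g j (firstIdx b) b * vecMulVec v (star x) * (g j b (firstIdx b) * g i (firstIdx a) a) *
            vecMulVec x (star v) * g i a (firstIdx a) := by simp only [mul_assoc]
      rw [e]
      have : g j b (firstIdx b) * g i (firstIdx a) a = 0 := by
        simp only [g]
        rw [← map_mul, blockUnit_mul_of_ne' hj, map_zero]
      rw [this]
      simp
    · simp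
  have hpp : p * p.conjTranspose = p := by
    rw [← star_eq_conjTranspose, hp, ← map_star, star_cornerProj, ← map_mul, cornerProj_mul_self]
  have h := norm_trace_mul_sq_le p M
  rwa [hpM, htr, hpp, hMM] at h

end comparison
end QChain
end

noncomputable section
open scoped ComplexOrder Kronecker
set_option linter.unusedSectionVars false
namespace QChain

/-! ### Pimsner-Popa inequality and comparison of entropies -/

section comparison
variable {m : ℕ} {n : Fin m → ℕ} {ν : Type*} [Fintype ν] [DecidableEq ν]
  (θ : Blocks n →⋆ₐ[ℂ] Matrix ν ν ℂ) {D : Matrix ν ν ℂ} {χ : Blocks n →ₗ[ℂ] ℂ}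

theorem isPositive_of_eq_trace (hD : D.PosSemidef) (hχ : ∀ x, χ x = (D * θ x).trace) :
    IsPositive χ := fun x => by
  rw [hχ, map_mul, map_star, ← star_star (θ x)]
  simp only [star_star]
  have := trace_mul_self_star_nonneg hD (θ x).conjTranspose
  rwa [Matrix.conjTranspose_conjTranspose] at this

theorem map_posSemidef {y : Blocks n} (hy : ∀ i, (y i).PosSemidef) : (θ y).PosSemidef := by
  choose B hB using fun i => PosSemidef.exists_star_mul (hy i)
  have : θ y = (θ B).conjTranspose * θ B := by
    rw [← Matrix.star_eq_conjTranspose, ← map_star, ← map_mul]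
    congr 1
    ext1 i
    exact hB i
  rw [this]
  exact posSemidef_star_mul _

open Matrix in
/-- The Pimsner-Popa inequality. -/
theorem pimsnerPopa (hD : D.PosSemidef) (hχ : ∀ x, χ x = (D * θ x).trace) {P : ℝ}
    (hP : (θ (cornerProj n)).trace.re ≤ P) :
    ((P : ℂ) • θ (density χ) - D).PosSemidef := by
  have hpos := isPositive_of_eq_trace θ hD hχ
  have hθ := map_posSemidef θ fun i => density_posSemidef hpos i
  have hherm : ((P : ℂ) • θ (density χ) - D).IsHermitian := by
    refine Matrix.IsHermitian.sub ?_ hD.1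
    rw [Matrix.IsHermitian, Matrix.conjTranspose_smul, hθ.1]
    simp
  refine Matrix.PosSemidef.of_dotProduct_mulVec_nonneg hherm fun x => ?_
  rw [Complex.nonneg_iff]
  refine ⟨?_, (hherm.im_star_dotProduct_mulVec_self x).symm⟩
  -- The rows of `B` decompose `D` into rank-one pieces `v_k v_k*`; the inequality is linear in `D`,
  -- so each piece is treated separately.
  obtain ⟨B, hB⟩ := PosSemidef.exists_star_mul hD
  let v : ν → ν → ℂ := fun k => star (B k)
  have hquad : ∀ Y : Matrix ν ν ℂ, (D * Y).trace = ∑ k, star (v k) ⬝ᵥ (Y *ᵥ v k) := by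
    intro Y
    rw [hB, Matrix.mul_assoc, Matrix.trace_mul_comm, Matrix.trace]
    refine Finset.sum_congr rfl fun k _ => ?_
    rw [Matrix.diag_apply, Matrix.mul_assoc, Matrix.mul_apply]
    simp only [v, star_star, dotProduct]
    refine Finset.sum_congr rfl fun l _ => ?_
    congr 1
  have hDx : star x ⬝ᵥ (D *ᵥ x) = ∑ k, ((‖star (v k) ⬝ᵥ x‖ ^ 2 : ℝ) : ℂ) := by
    rw [hB, ← Matrix.mulVec_mulVec, Matrix.dotProduct_mulVec, Matrix.star_eq_conjTranspose,
      ← Matrix.star_mulVec]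
    simp only [dotProduct, v, star_star]
    refine Finset.sum_congr rfl fun k _ => ?_
    rw [Pi.star_apply, RCLike.star_def, Complex.conj_mul']
    norm_cast
  have hθx : star x ⬝ᵥ (θ (density χ) *ᵥ x) =
      ∑ k, ∑ i, ∑ a, ∑ b, (star (v k) ⬝ᵥ (θ (blockUnit i a b) *ᵥ v k)) *
        (star x ⬝ᵥ (θ (blockUnit i b a) *ᵥ x)) := by
    rw [apply_eq_sum_blockUnit]
    simp only [density_apply, hχ, hquad, Matrix.sum_mulVec, dotProduct_sum, Matrix.smul_mulVec,
      dotProduct_smul, smul_eq_mul, Finset.sum_mul]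
    rw [Finset.sum_comm]
    refine Finset.sum_congr rfl fun i _ => ?_
    rw [Finset.sum_comm]
    simp only [Finset.sum_comm (s := Finset.univ (α := ν))]
  rw [Matrix.sub_mulVec, dotProduct_sub, Matrix.smul_mulVec, dotProduct_smul, hDx, hθx,
    Complex.sub_re, sub_nonneg, smul_eq_mul, Complex.re_ofReal_mul, ← Complex.ofReal_sum,
    Complex.ofReal_re, Complex.re_sum, Finset.mul_sum]
  refine Finset.sum_le_sum fun k _ => ?_
  have h := norm_dotProduct_sq_le θ x (v k)
  refine h.trans (mul_le_mul_of_nonneg_right hP ?_)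
  -- Replacing the trace of the corner projection by `P` requires the double sum to be nonnegative.
  -- It is the quadratic form at `x` of the image of the density of the vector functional.
  have hpk : (vecMulVec (v k) (star (v k))).PosSemidef := Matrix.posSemidef_vecMulVec_self_star _
  let χk : Blocks n →ₗ[ℂ] ℂ :=
    { toFun := fun y => (vecMulVec (v k) (star (v k)) * θ y).trace
      map_add' := fun y z => by rw [map_add, mul_add, Matrix.trace_add]
      map_smul' := fun c y => by rw [map_smul, mul_smul_comm, Matrix.trace_smul]; rfl }
  have hk := map_posSemidef θ fun i => density_posSemidef
    (isPositive_of_eq_trace (χ := χk) θ hpk fun _ => rfl) i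
  have h2 := hk.dotProduct_mulVec_nonneg x
  have e : star x ⬝ᵥ (θ (density χk) *ᵥ x) = ∑ i, ∑ a, ∑ b,
      (star (v k) ⬝ᵥ (θ (blockUnit i a b) *ᵥ v k)) * (star x ⬝ᵥ (θ (blockUnit i b a) *ᵥ x)) := by
    rw [apply_eq_sum_blockUnit]
    have : ∀ i (a b : Fin (n i)), density χk i a b =
        star (v k) ⬝ᵥ (θ (blockUnit i b a) *ᵥ v k) := by
      intro i a b
      rw [density_apply]
      change (vecMulVec (v k) (star (v k)) * _).trace = _
      rw [Matrix.trace_mul_comm, mul_vecMulVec, trace_vecMulVec, dotProduct_comm]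
    simp only [this, Matrix.sum_mulVec, dotProduct_sum, Matrix.smul_mulVec,
      dotProduct_smul, smul_eq_mul]
    exact Finset.sum_congr rfl fun i _ => Finset.sum_comm
  rw [← e]
  exact (Complex.nonneg_iff.1 h2).1

theorem aeval_pi_apply (y : Blocks n) (q : Polynomial ℝ) (i : Fin m) :
    Polynomial.aeval y q i = Polynomial.aeval (y i) q := by
  have := Polynomial.aeval_algHom_apply
    (Pi.evalAlgHom ℝ (fun i => Matrix (Fin (n i)) (Fin (n i)) ℂ) i) y q
  exact this.symm

theorem map_cfc {y : Blocks n} (hy : ∀ i, (y i).PosSemidef) (f : ℝ → ℝ) :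
    cfc f (θ y) = θ (fun i => cfc f (y i)) := by
  obtain ⟨q, hq⟩ := exists_polynomial_eqOn ((finite_spectrum (θ y)).union
    (Set.finite_iUnion fun i => finite_spectrum (y i))) f
  have e : (fun i => cfc f (y i)) = Polynomial.aeval y q := by
    ext1 i
    rw [aeval_pi_apply, cfc_eq_aeval (hy i).1.isSelfAdjoint fun x hx =>
      hq x (Or.inr (Set.mem_iUnion.2 ⟨i, hx⟩))]
  rw [cfc_eq_aeval (map_posSemidef θ hy).1.isSelfAdjoint fun x hx => hq x (Or.inl hx), e]
  exact Polynomial.aeval_algHom_apply (θ.toAlgHom.restrictScalars ℝ) y q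

/-- The logarithm passes through `θ`, so the cross term is `χ(log D_χ) = -S(χ)`. Differences of
entropies thus become relative entropies even though `θ` does not preserve traces. -/
theorem relEnt_map_density (hD : D.PosSemidef) (hχ : ∀ x, χ x = (D * θ x).trace) :
    relEnt D (θ (density χ)) = blockEntropy χ - vnEntropy D := by
  have hpos := isPositive_of_eq_trace θ hD hχ
  rw [relEnt, map_cfc θ (fun i => density_posSemidef hpos i), ← hχ, apply_eq_sum_trace,
    Complex.re_sum]
  simp only [trace_mul_log (density_posSemidef hpos _)]
  rw [Finset.sum_neg_distrib, blockEntropy]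
  simp only [vnEntropy]
  ring

theorem relEnt_smul {ι : Type*} [Fintype ι] [DecidableEq ι] {A : Matrix ι ι ℂ} (hA : A.PosSemidef)
    {c : ℝ} (hc : 0 < c) : relEnt A ((c : ℂ) • A) = -(A.trace.re * Real.log c) := by
  obtain ⟨U, hU, p, hp, rfl⟩ := PosSemidef.exists_diagonal hA
  have h1 : star U * U = 1 := (Matrix.mem_unitaryGroup_iff').1 hU
  have : (c : ℂ) • (U * Matrix.diagonal (fun i => (p i : ℂ)) * star U) =
      U * Matrix.diagonal (fun i => ((c * p i : ℝ) : ℂ)) * star U := by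
    rw [← smul_mul_assoc, ← mul_smul_comm]
    congr 2
    ext i j
    by_cases hij : i = j
    · subst hij; simp
    · simp [hij]
  rw [this, relEnt, vnEntropy_conj_diagonal hU, cfc_conj_diagonal hU (fun i => c * p i),
    show U * Matrix.diagonal (fun i => (p i : ℂ)) * star U *
      (U * Matrix.diagonal (fun i => (Real.log (c * p i) : ℂ)) * star U) =
      U * (Matrix.diagonal (fun i => (p i : ℂ)) * (star U * U) *
        Matrix.diagonal (fun i => (Real.log (c * p i) : ℂ))) * star U by simp only [mul_assoc],
    h1, mul_one, Matrix.diagonal_mul_diagonal, trace_conj hU, Matrix.trace_diagonal,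
    trace_conj_diagonal hU, Complex.ofReal_re, Complex.re_sum, Finset.sum_mul,
    ← Finset.sum_neg_distrib, ← Finset.sum_neg_distrib, ← Finset.sum_sub_distrib]
  refine Finset.sum_congr rfl fun i _ => ?_
  rw [← Complex.ofReal_mul, Complex.ofReal_re, Real.negMulLog]
  rcases (hp i).eq_or_lt with h | h
  · simp [← h]
  · rw [Real.log_mul hc.ne' h.ne']
    ring

theorem trace_map_blockUnit_of_ne (i : Fin m) {a b : Fin (n i)} (h : a ≠ b) :
    (θ (blockUnit i a b)).trace = 0 := by
  rw [← blockUnit_mul i a b b, map_mul, Matrix.trace_mul_comm, ← map_mul,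
    blockUnit_mul_of_ne i h.symm, map_zero, Matrix.trace_zero]

theorem trace_map_blockUnit_nonneg (i : Fin m) (a : Fin (n i)) :
    0 ≤ (θ (blockUnit i a a)).trace := by
  rw [← blockUnit_mul i a a a, map_mul]
  nth_rw 1 [← star_blockUnit i a a]
  rw [map_star]
  exact (posSemidef_star_mul _).trace_nonneg

/-- All diagonal units of one block have equal trace, and one of them is a summand of the corner
projection. -/
theorem trace_map_blockUnit_le (i : Fin m) (a : Fin (n i)) :
    (θ (blockUnit i a a)).trace.re ≤ (θ (cornerProj n)).trace.re := by
  have h1 : (θ (blockUnit i a a)).trace = (θ (blockUnit i (firstIdx a) (firstIdx a))).trace := by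
    rw [← blockUnit_mul i a (firstIdx a) a, map_mul, Matrix.trace_mul_comm, ← map_mul,
      blockUnit_mul]
  rw [h1, cornerProj, map_sum, Matrix.trace_sum, Complex.re_sum]
  have h2 : ∀ q : Σ i, Fin (n i), 0 ≤
      (θ (if q.2.val = 0 then blockUnit q.1 q.2 q.2 else 0)).trace.re := by
    intro q
    split_ifs
    · exact (Complex.nonneg_iff.1 (trace_map_blockUnit_nonneg θ _ _)).1
    · simp
  refine le_trans (le_of_eq ?_) (Finset.single_le_sum (fun q _ => h2 q)
    (Finset.mem_univ (⟨i, firstIdx a⟩ : Σ i, Fin (n i))))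
  rw [if_pos]
  rfl

theorem trace_map_density_le (hD : D.PosSemidef) (hχ : ∀ x, χ x = (D * θ x).trace) {P : ℝ}
    (hP : (θ (cornerProj n)).trace.re ≤ P) :
    (θ (density χ)).trace.re ≤ P * D.trace.re := by
  have hpos := isPositive_of_eq_trace θ hD hχ
  have htr : D.trace.re = ∑ i, ∑ a, (density χ i a a).re := by
    have h := hχ 1
    rw [map_one θ, mul_one] at h
    rw [← h, ← sum_blockUnit]
    simp only [map_sum, Complex.re_sum]
    rfl
  rw [apply_eq_sum_blockUnit, htr]
  simp only [Matrix.trace_sum, Complex.re_sum, Finset.mul_sum, Matrix.trace_smul]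
  refine Finset.sum_le_sum fun i _ => Finset.sum_le_sum fun a _ => ?_
  rw [Finset.sum_eq_single a]
  · have h1 := Complex.nonneg_iff.1 ((density_posSemidef hpos i).diag_nonneg (i := a))
    rw [smul_eq_mul, Complex.mul_re, ← h1.2, zero_mul, sub_zero, mul_comm]
    exact mul_le_mul_of_nonneg_right ((trace_map_blockUnit_le θ i a).trans hP) h1.1
  · intro b _ hb
    rw [trace_map_blockUnit_of_ne θ i hb.symm, smul_zero, Complex.zero_re]
  · simp

/-- The entropies of a state of a matrix algebra and of its restriction to a unital *-subalgebra
differ at most by the logarithm of the sum of the multiplicities. -/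
theorem abs_blockEntropy_sub_le (hD : D.PosSemidef) (hχ : ∀ x, χ x = (D * θ x).trace) {P : ℝ}
    (hP : (θ (cornerProj n)).trace.re ≤ P) (hP1 : 1 ≤ P) :
    |blockEntropy χ - vnEntropy D| ≤ D.trace.re * Real.log P := by
  have hpos := isPositive_of_eq_trace θ hD hχ
  have hθ := map_posSemidef θ fun i => density_posSemidef hpos i
  have hPP := pimsnerPopa θ hD hχ hP
  have hP0 : 0 < P := by linarith
  have hD0 := hD.trace_nonneg
  rw [← relEnt_map_density θ hD hχ, abs_le]
  constructor
  -- Lower bound: restrict both arguments to multiples of the identity. The scalar relative entropy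
  -- is `a log a - a log b`, and `b ≤ P a` because every multiplicity is at most `P`.
  · set a : ℝ := D.trace.re with ha
    set b : ℝ := (θ (density χ)).trace.re with hb
    have haC : ((a : ℝ) : ℂ) = D.trace := (Complex.eq_re_of_ofReal_le hD0).symm
    have hbC : ((b : ℝ) : ℂ) = (θ (density χ)).trace :=
      (Complex.eq_re_of_ofReal_le hθ.trace_nonneg).symm
    have ha0 : 0 ≤ a := (Complex.nonneg_iff.1 hD0).1
    have hb0 : 0 ≤ b := (Complex.nonneg_iff.1 hθ.trace_nonneg).1
    have hab : a ≤ P * b := by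
      have h := (Complex.nonneg_iff.1 hPP.trace_nonneg).1
      rw [Matrix.trace_sub, Matrix.trace_smul, smul_eq_mul, Complex.sub_re,
        Complex.re_ofReal_mul] at h
      linarith
    have hba : b ≤ P * a := trace_map_density_le θ hD hχ hP
    have hs : ∀ x : ℝ, 0 ≤ x →
        (Matrix.diagonal fun _ : Unit => ((x : ℝ) : ℂ)).PosSemidef := fun x hx =>
      Matrix.posSemidef_diagonal_iff.2 fun _ => Complex.zero_le_real.2 hx
    have hone : ∀ (r : ℝ) (Z : Matrix Unit Unit ℂ),
        (Matrix.diagonal (fun _ : Unit => (r : ℂ)) * Z).trace = r * Z () () := fun r Z => by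
      simp [Matrix.trace]
    have hsc : ∀ (M : Matrix ν ν ℂ) (z : ℂ), (M * (z • 1)).trace = z * M.trace := fun M z => by
      rw [mul_smul_comm, mul_one, Matrix.trace_smul, smul_eq_mul]
    have h := relEnt_mono (A' := Matrix.diagonal fun _ : Unit => (a : ℂ))
      (B' := Matrix.diagonal fun _ : Unit => (b : ℂ)) (hs a ha0) (hs b hb0) hD hθ (c := P)
      (c' := P) (by
        have : (P : ℂ) • (Matrix.diagonal fun _ : Unit => (b : ℂ)) -
            Matrix.diagonal (fun _ : Unit => (a : ℂ)) =
            Matrix.diagonal fun _ : Unit => ((P * b - a : ℝ) : ℂ) := by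
          ext i j; simp
        rw [this]
        exact hs _ (by linarith)) hPP (by simp [haC]) (fun X => by
        have hstar : star (X () () • (1 : Matrix ν ν ℂ)) = star (X () ()) • 1 := by
          rw [star_smul, star_one]
        refine ⟨X () () • (1 : Matrix ν ν ℂ), ?_, ?_, ?_⟩
        · rw [hone, hsc, haC, mul_comm]
        · rw [hone, hstar, smul_mul_smul_comm, mul_one, hsc, haC, mul_comm]
          simp [Matrix.mul_apply]
        · rw [hone, hstar, smul_mul_smul_comm, mul_one, hsc, hbC, mul_comm]
          simp [Matrix.mul_apply])
    refine le_trans ?_ h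
    rw [relEnt, vnEntropy_diagonal (fun _ : Unit => a)]
    have hl : cfc Real.log (Matrix.diagonal fun _ : Unit => (b : ℂ)) =
        Matrix.diagonal fun _ : Unit => ((Real.log b : ℝ) : ℂ) := by
      simpa using cfc_conj_diagonal (one_mem (Matrix.unitaryGroup Unit ℂ)) (fun _ => b) Real.log
    rw [hl, Matrix.diagonal_mul_diagonal, Matrix.trace_diagonal]
    simp only [Finset.univ_unique, Finset.sum_singleton, ← Complex.ofReal_mul, Complex.ofReal_re,
      Real.negMulLog]
    rcases ha0.eq_or_lt with h0 | h0
    · simp [← h0]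
    · have hb0' : 0 < b := by
        by_contra hcon
        have : b = 0 := le_antisymm (not_lt.1 hcon) hb0
        rw [this, mul_zero] at hab
        linarith
      have h5 : Real.log b ≤ Real.log P + Real.log a := by
        rw [← Real.log_mul hP0.ne' h0.ne']
        exact Real.log_le_log hb0' hba
      nlinarith
  -- Upper bound: relative entropy decreases in its second argument, and Pimsner-Popa gives `P⁻¹ D ≤
  -- θ(D_χ)`.
  · have h := relEnt_mono hD hθ hD
      (B := (((P⁻¹ : ℝ) : ℂ)) • D)
      (hD.smul (Complex.zero_le_real.2 (inv_nonneg.2 hP0.le))) (c' := P) (c := P) hPP (by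
        rw [smul_smul, ← Complex.ofReal_mul, mul_inv_cancel₀ hP0.ne', Complex.ofReal_one, one_smul,
          sub_self]
        exact Matrix.PosSemidef.zero) rfl (fun X => ⟨X, rfl, le_rfl, by
        have h1 := (Complex.nonneg_iff.1 (trace_mul_self_star_nonneg hPP X.conjTranspose)).1
        rw [Matrix.conjTranspose_conjTranspose, sub_mul, Matrix.trace_sub, smul_mul_assoc,
          Matrix.trace_smul, smul_eq_mul, Complex.sub_re, Complex.re_ofReal_mul] at h1
        rw [smul_mul_assoc, Matrix.trace_smul, smul_eq_mul, Complex.re_ofReal_mul,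
          inv_mul_le_iff₀ hP0]
        exact sub_nonneg.1 h1⟩)
    refine h.trans (le_of_eq ?_)
    rw [relEnt_smul hD (inv_pos.2 hP0), Real.log_inv]
    ring

end comparison
end QChain
end

noncomputable section
open scoped ComplexOrder Kronecker
set_option linter.unusedSectionVars false
namespace QChain

/-! ### Finite-dimensional *-algebras of matrices are direct sums of matrix algebras -/

section structureTheorem
variable {ν : Type*} [Fintype ν] [DecidableEq ν]
variable {C : Type*} [Ring C] [StarRing C] [Algebra ℂ C]

/-- The Jacobson radical is nilpotent, and with `x` it contains `x* x`. A self-adjoint nilpotent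
element vanishes, by repeated use of `c* c = 0 → c = 0`, which holds in matrices. -/
theorem isSemisimpleRing_of_injective [FiniteDimensional ℂ C] (f : C →⋆ₐ[ℂ] Matrix ν ν ℂ)
    (hf : Function.Injective f) : IsSemisimpleRing C := by
  have : IsArtinianRing C := IsArtinianRing.of_finite ℂ C
  rw [IsArtinianRing.isSemisimpleRing_iff_jacobson]
  have h0 : ∀ c : C, star c * c = 0 → c = 0 := fun c hc => by
    have : (f c).conjTranspose * f c = 0 := by
      rw [← Matrix.star_eq_conjTranspose, ← map_star, ← map_mul, hc, map_zero]
    exact (map_eq_zero_iff f hf).1 (Matrix.conjTranspose_mul_self_eq_zero.1 this)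
  have hpow : ∀ (k : ℕ) (y : C), star y = y → y ^ 2 ^ k = 0 → y = 0 := by
    intro k
    induction k with
    | zero => intro y _ h; simpa using h
    | succ k ih =>
      intro y hy h
      refine ih y hy (h0 _ ?_)
      rw [star_pow, hy, ← pow_add, ← two_mul, ← pow_succ', h]
  obtain ⟨k, hk⟩ := IsArtinianRing.isNilpotent_jacobson_bot (R := C)
  rw [eq_bot_iff]
  intro x hx
  have hx' : star x * x ∈ Ideal.jacobson (⊥ : Ideal C) := by
    refine Ideal.mul_mem_left _ _ ?_
    rwa [Ideal.jacobson_bot]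
  have hxk : (star x * x) ^ k = 0 := by
    have := Ideal.pow_mem_pow hx' k
    rw [hk] at this
    exact this
  refine h0 x (hpow k _ (by rw [star_mul, star_star]) ?_)
  rw [← Nat.sub_add_cancel (Nat.lt_two_pow_self (n := k)).le, pow_add, hxk, mul_zero]

/-- Conjugation of a matrix algebra by an invertible matrix. -/
def conjMatrix {n : Type*} [Fintype n] [DecidableEq n] (B : Matrix n n ℂ) (hB : IsUnit B.det) :
    Matrix n n ℂ ≃ₐ[ℂ] Matrix n n ℂ :=
  AlgEquiv.ofAlgHom
    { toFun := fun X => B * X * B⁻¹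
      map_one' := by rw [mul_one, Matrix.mul_nonsing_inv _ hB]
      map_mul' := fun X Y => by
        rw [show B * X * B⁻¹ * (B * Y * B⁻¹) = B * X * (B⁻¹ * B) * Y * B⁻¹ by
          simp only [mul_assoc], Matrix.nonsing_inv_mul _ hB, mul_one]; simp only [mul_assoc]
      map_zero' := by simp
      map_add' := fun X Y => by rw [mul_add, add_mul]
      commutes' := fun c => by
        rw [← Algebra.commutes, mul_assoc, Matrix.mul_nonsing_inv _ hB, mul_one] }
    { toFun := fun X => B⁻¹ * X * B
      map_one' := by rw [mul_one, Matrix.nonsing_inv_mul _ hB]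
      map_mul' := fun X Y => by
        rw [show B⁻¹ * X * B * (B⁻¹ * Y * B) = B⁻¹ * X * (B * B⁻¹) * Y * B by
          simp only [mul_assoc], Matrix.mul_nonsing_inv _ hB, mul_one]; simp only [mul_assoc]
      map_zero' := by simp
      map_add' := fun X Y => by rw [mul_add, add_mul]
      commutes' := fun c => by
        rw [← Algebra.commutes, mul_assoc, Matrix.nonsing_inv_mul _ hB, mul_one] }
    (by
      ext1 X
      change B * (B⁻¹ * X * B) * B⁻¹ = X
      rw [show B * (B⁻¹ * X * B) * B⁻¹ = (B * B⁻¹) * X * (B * B⁻¹) by simp only [mul_assoc],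
        Matrix.mul_nonsing_inv _ hB, one_mul, mul_one])
    (by
      ext1 X
      change B⁻¹ * (B * X * B⁻¹) * B = X
      rw [show B⁻¹ * (B * X * B⁻¹) * B = (B⁻¹ * B) * X * (B⁻¹ * B) by simp only [mul_assoc],
        Matrix.nonsing_inv_mul _ hB, one_mul, mul_one])

-- The Wedderburn isomorphism need not preserve the star. A copy of the `i`-th simple module inside
-- the given representation inherits an inner product for which the representation is a
-- *-representation; `B* B` is its Gram matrix.
open Matrix in
theorem exists_invariant_form {m : ℕ} {n : Fin m → ℕ} (f : C →⋆ₐ[ℂ] Matrix ν ν ℂ)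
    (hf : Function.Injective f) (e : C ≃ₐ[ℂ] Blocks n) (i : Fin m) (hi : NeZero (n i)) :
    ∃ B : Matrix (Fin (n i)) (Fin (n i)) ℂ, IsUnit B.det ∧
      ∀ c, (star B * B) * e (star c) i = star (e c i) * (star B * B) := by
  have hne : f (e.symm (blockUnit i 0 0)) ≠ 0 := by
    rw [Ne, map_eq_zero_iff f hf, EmbeddingLike.map_eq_zero_iff]
    intro h
    have := congrFun (congrFun (congrFun h i) 0) 0
    simp [blockUnit] at this
  obtain ⟨v, hv⟩ : ∃ v, f (e.symm (blockUnit i 0 0)) *ᵥ v ≠ 0 := by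
    by_contra hcon
    push Not at hcon
    exact hne (Matrix.ext_of_mulVec_single fun j => by rw [hcon, Matrix.zero_mulVec])
  -- The columns `e_{a0} v` span a simple submodule, and `W` intertwines the matrix action of the
  -- block with the given one.
  let W : Matrix ν (Fin (n i)) ℂ := Matrix.of fun x a => (f (e.symm (blockUnit i a 0)) *ᵥ v) x
  have hWv : ∀ y, W *ᵥ y = ∑ a, y a • (f (e.symm (blockUnit i a 0)) *ᵥ v) := by
    intro y
    ext x
    simp [W, Matrix.mulVec, dotProduct, mul_comm]
  have hfW : ∀ c, f c * W = W * e c i := by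
    intro c
    have h1 : ∀ a, e c * blockUnit i a 0 = ∑ b, e c i b a • (blockUnit i b 0 : Blocks n) := by
      intro a
      ext j p q
      simp only [Pi.mul_apply, Finset.sum_apply, Pi.smul_apply, Matrix.sum_apply, Matrix.smul_apply]
      rcases eq_or_ne j i with rfl | hj
      · simp [blockUnit, Matrix.mul_apply, Matrix.single_apply]
        by_cases hq : 0 = q <;> simp [hq]
      · simp [blockUnit, Pi.single_eq_of_ne hj]
    have h2 : ∀ a, f c * f (e.symm (blockUnit i a 0)) =
        ∑ b, e c i b a • f (e.symm (blockUnit i b 0)) := by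
      intro a
      have : c = e.symm (e c) := (e.symm_apply_apply c).symm
      rw [← map_mul]
      conv_lhs => rw [this]
      rw [← map_mul, h1]
      simp only [map_sum, map_smul]
    ext x a
    have h3 := congrFun (congrArg (· *ᵥ v) (h2 a)) x
    simp only [Matrix.sum_mulVec, Matrix.smul_mulVec, ← Matrix.mulVec_mulVec, Finset.sum_apply,
      Pi.smul_apply, smul_eq_mul] at h3
    rw [Matrix.mul_apply, Matrix.mul_apply]
    simp only [W, Matrix.of_apply]
    refine Eq.trans ?_ (h3.trans ?_)
    · rfl
    · exact Finset.sum_congr rfl fun b _ => mul_comm _ _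
  -- Applying `e_{0a}` isolates the `a`-th coefficient times `e_{00} v ≠ 0`.
  have hinj : Function.Injective W.mulVec := by
    intro y z hyz
    by_contra hne
    obtain ⟨a, ha⟩ := Function.ne_iff.1 hne
    have h1 : W *ᵥ (y - z) = 0 := by rw [Matrix.mulVec_sub, sub_eq_zero]; exact hyz
    have h2 := congrArg (f (e.symm (blockUnit i 0 a)) *ᵥ ·) h1
    simp only [Matrix.mulVec_mulVec, hfW, Matrix.mulVec_zero] at h2
    have h3 : blockUnit (n := n) i 0 a i *ᵥ (y - z) = Pi.single 0 (y a - z a) := by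
      rw [blockUnit, Pi.single_eq_same, Matrix.single_mulVec, one_mul]
      ext b
      simp [Pi.single_apply, Function.update_apply]
    rw [← Matrix.mulVec_mulVec, e.apply_symm_apply, h3, hWv, Finset.sum_eq_single 0] at h2
    · rw [Pi.single_eq_same] at h2
      exact smul_ne_zero (sub_ne_zero.2 ha) hv h2
    · intro b _ hb
      rw [Pi.single_eq_of_ne hb, zero_smul]
    · simp
  have hH : (W.conjTranspose * W).PosDef := Matrix.PosDef.conjTranspose_mul_self W hinj
  obtain ⟨B, hB⟩ := PosSemidef.exists_star_mul hH.posSemidef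
  refine ⟨B, ?_, fun c => ?_⟩
  · have h1 : (W.conjTranspose * W).det ≠ 0 := hH.det_pos.ne'
    rw [hB, Matrix.det_mul] at h1
    exact isUnit_iff_ne_zero.2 (right_ne_zero_of_mul h1)
  · rw [← hB, Matrix.mul_assoc, ← hfW, map_star, Matrix.star_eq_conjTranspose,
      ← Matrix.mul_assoc, ← Matrix.conjTranspose_mul, hfW, Matrix.conjTranspose_mul,
      Matrix.mul_assoc]
    rfl

/-- A finite-dimensional *-algebra with a faithful *-representation on a finite-dimensional Hilbert
space is a direct sum of matrix algebras. -/
theorem exists_starAlgEquiv_blocks [FiniteDimensional ℂ C] (f : C →⋆ₐ[ℂ] Matrix ν ν ℂ)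
    (hf : Function.Injective f) :
    ∃ (m : ℕ) (n : Fin m → ℕ), Nonempty (C ≃⋆ₐ[ℂ] Blocks n) := by
  have := isSemisimpleRing_of_injective f hf
  obtain ⟨m, n, hn, ⟨e⟩⟩ := IsSemisimpleRing.exists_algEquiv_pi_matrix_of_isAlgClosed ℂ C
  choose B hB hBe using fun i => exists_invariant_form f hf e i (hn i)
  -- Conjugating block `i` by `B i` turns the invariant form into the standard one, so the corrected
  -- isomorphism preserves the star.
  refine ⟨m, n, ⟨StarAlgEquiv.ofAlgEquiv
    (e.trans (AlgEquiv.piCongrRight fun i => conjMatrix (B i) (hB i))) fun c => ?_⟩⟩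
  ext1 i
  change B i * e (star c) i * (B i)⁻¹ = star (B i * e c i * (B i)⁻¹)
  have h := hBe i c
  have hs : IsUnit (star (B i)).det := by
    rw [Matrix.star_eq_conjTranspose, Matrix.det_conjTranspose]
    exact (hB i).star
  have hinv : star ((B i)⁻¹) = (star (B i))⁻¹ := by
    rw [Matrix.star_eq_conjTranspose, Matrix.star_eq_conjTranspose,
      Matrix.conjTranspose_nonsing_inv]
  rw [star_mul, star_mul, hinv]
  have h2 : B i * e (star c) i = (star (B i))⁻¹ * (star (e c i) * (star (B i) * B i)) := by
    rw [← h, mul_assoc, ← mul_assoc _ (star (B i)), Matrix.nonsing_inv_mul _ hs, one_mul]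
  rw [h2, mul_assoc, mul_assoc, mul_assoc, Matrix.mul_nonsing_inv _ (hB i), mul_one]

end structureTheorem
end QChain
end

noncomputable section
open scoped ComplexOrder Kronecker
set_option linter.unusedSectionVars false
namespace QChain

/-! ### Local algebras of a window as full matrix algebras -/

section windows
variable {d : ℕ} [NeZero d] {N : ℕ}

theorem prod_ofFn_update_const {M : Type*} [Monoid M] (a x : M) (j : Fin N) :
    (List.ofFn (Function.update (fun _ : Fin N => a) j x)).prod =
      a ^ (j : ℕ) * x * a ^ (N - 1 - j) := by
  induction N with
  | zero => exact j.elim0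
  | succ N ih =>
    rw [List.ofFn_succ, List.prod_cons]
    rcases Fin.eq_zero_or_eq_succ j with rfl | ⟨j, rfl⟩
    · have : (fun i : Fin N => Function.update (fun _ : Fin (N + 1) => a) 0 x i.succ) =
          fun _ => a := by
        ext1 i; exact Function.update_of_ne (Fin.succ_ne_zero i) _ _
      rw [this, List.ofFn_const, List.prod_replicate]
      simp
    · have : (fun i : Fin N => Function.update (fun _ : Fin (N + 1) => a) j.succ x i.succ) =
          Function.update (fun _ => a) j x := by
        ext1 i
        rcases eq_or_ne i j with rfl | h
        · simp
        · rw [Function.update_of_ne h, Function.update_of_ne ((Fin.succ_injective N).ne h)]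
      have h2 : N + 1 - 1 - ((j : ℕ) + 1) = N - 1 - j := by omega
      rw [this, ih, Function.update_of_ne (Fin.succ_ne_zero j).symm, Fin.val_succ, pow_succ', h2,
        mul_assoc, mul_assoc, mul_assoc]

/-- The configuration `u` with the symbols at the sites `m, …, m + N - 1` replaced by `t`. -/
def splice (m : ℤ) (u : Conf d) (t : Fin N → Fin d) : Conf d :=
  Finsupp.ofSupportFinite
    (fun i => if h : ∃ j : Fin N, i = m + (j : ℕ) then t h.choose else u i)
    (((u.support.finite_toSet).union (Set.finite_range fun j : Fin N => m + ((j : ℕ) : ℤ))).subset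
      fun i hi => by
        by_cases h : ∃ j : Fin N, i = m + (j : ℕ)
        · exact Or.inr ⟨h.choose, h.choose_spec.symm⟩
        · refine Or.inl ?_
          rw [Function.mem_support, dif_neg h] at hi
          simpa using hi)

theorem splice_apply (m : ℤ) (u : Conf d) (t : Fin N → Fin d) (j : Fin N) :
    splice m u t (m + (j : ℕ)) = t j := by
  have h : ∃ k : Fin N, m + ((j : ℕ) : ℤ) = m + (k : ℕ) := ⟨j, rfl⟩
  change (if h : ∃ k : Fin N, m + ((j : ℕ) : ℤ) = m + (k : ℕ) then t h.choose else _) = _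
  rw [dif_pos h]
  congr 1
  have := h.choose_spec
  ext
  omega

theorem splice_apply_of_ne (m : ℤ) (u : Conf d) (t : Fin N → Fin d) {i : ℤ}
    (h : ∀ j : Fin N, i ≠ m + (j : ℕ)) : splice m u t i = u i :=
  dif_neg fun ⟨j, hj⟩ => h j hj

theorem conf_ext_window (m : ℤ) {u v : Conf d} (h1 : ∀ j : Fin N, u (m + (j : ℕ)) = v (m + (j : ℕ)))
    (h2 : ∀ i, (∀ j : Fin N, i ≠ m + (j : ℕ)) → u i = v i) : u = v := by
  ext1 i
  by_cases h : ∃ j : Fin N, i = m + (j : ℕ)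
  · obtain ⟨j, rfl⟩ := h; exact h1 j
  · push Not at h; exact h2 i h

theorem splice_splice (m : ℤ) (u : Conf d) (t t' : Fin N → Fin d) :
    splice m (splice m u t) t' = splice m u t' :=
  conf_ext_window (N := N) m (fun j => by rw [splice_apply, splice_apply]) fun i hi => by
    rw [splice_apply_of_ne _ _ _ hi, splice_apply_of_ne _ _ _ hi, splice_apply_of_ne _ _ _ hi]

theorem splice_cons (m : ℤ) (u : Conf d) (b : Fin d) (t : Fin N → Fin d) :
    splice (m + 1) (u.update m b) t = splice m u (Fin.cons b t : Fin (N + 1) → Fin d) := by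
  refine conf_ext_window (N := N + 1) m (fun j => ?_) fun i hi => ?_
  · rw [splice_apply]
    rcases Fin.eq_zero_or_eq_succ j with rfl | ⟨j, rfl⟩
    · rw [splice_apply_of_ne]
      · simp
      · intro k; simp; omega
    · have : m + ((j.succ : ℕ) : ℤ) = (m + 1) + (j : ℕ) := by rw [Fin.val_succ]; push_cast; ring
      rw [this, splice_apply, Fin.cons_succ]
  · rw [splice_apply_of_ne _ _ _ hi, splice_apply_of_ne]
    · have h0 : i ≠ m := by simpa using hi 0
      simp [Function.update_of_ne h0]
    · intro j
      have := hi j.succ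
      rw [Fin.val_succ] at this
      push_cast at this
      intro h
      apply this
      rw [h]; ring

/-- The product `β_m(A_0) β_{m+1}(A_1) ⋯`. -/
def prodOp (m : ℤ) (A : Fin N → Matrix (Fin d) (Fin d) ℂ) : ChainOp d :=
  (List.ofFn fun j : Fin N => site (m + (j : ℕ)) (A j)).prod

theorem prodOp_succ (m : ℤ) (A : Fin (N + 1) → Matrix (Fin d) (Fin d) ℂ) :
    prodOp m A = site m (A 0) * prodOp (m + 1) fun j => A j.succ := by
  rw [prodOp, List.ofFn_succ, List.prod_cons, prodOp]
  simp only [Fin.val_zero, Nat.cast_zero, add_zero, Fin.val_succ, Nat.cast_succ]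
  congr 4
  ext1 j
  congr 2
  ring

theorem prodOp_apply (m : ℤ) (A : Fin N → Matrix (Fin d) (Fin d) ℂ) (ξ : ChainSpace d)
    (u : Conf d) : prodOp m A ξ u =
      ∑ t : Fin N → Fin d, (∏ j, A j (u (m + (j : ℕ))) (t j)) * ξ (splice m u t) := by
  induction N generalizing m u with
  | zero =>
    have : ∀ t : Fin 0 → Fin d, splice m u t = u := fun t =>
      conf_ext_window (N := 0) m (fun j => j.elim0) fun i hi => splice_apply_of_ne _ _ _ hi
    simp [prodOp, this]
  | succ N ih =>
    rw [prodOp_succ]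
    change site m (A 0) (prodOp (m + 1) _ ξ) u = _
    rw [site_apply, sum_fin_succ_fun]
    refine Finset.sum_congr rfl fun b _ => ?_
    rw [ih, Finset.mul_sum]
    refine Finset.sum_congr rfl fun t _ => ?_
    rw [splice_cons, Fin.prod_univ_succ, Fin.cons_zero, ← mul_assoc]
    congr 2
    · simp
    · refine Finset.prod_congr rfl fun j _ => ?_
      have h1 : m + 1 + ((j : ℕ) : ℤ) ≠ m := by omega
      have h2 : m + ((j.succ : ℕ) : ℤ) = m + 1 + (j : ℕ) := by
        rw [Fin.val_succ]; push_cast; ring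
      rw [Fin.cons_succ, h2]
      simp [Function.update_of_ne h1]

theorem prodOp_mul (m : ℤ) (A B : Fin N → Matrix (Fin d) (Fin d) ℂ) :
    prodOp m A * prodOp m B = prodOp m fun j => A j * B j := by
  ext ξ u
  change prodOp m A (prodOp m B ξ) u = _
  rw [prodOp_apply, prodOp_apply]
  simp only [prodOp_apply, splice_apply, splice_splice, Finset.mul_sum, Matrix.mul_apply]
  rw [Finset.sum_comm]
  refine Finset.sum_congr rfl fun t' _ => ?_
  rw [Finset.prod_univ_sum, Fintype.piFinset_univ, Finset.sum_mul]
  refine Finset.sum_congr rfl fun t _ => ?_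
  rw [Finset.prod_mul_distrib, mul_assoc]

theorem prodOp_one (m : ℤ) : prodOp m (fun _ : Fin N => (1 : Matrix (Fin d) (Fin d) ℂ)) = 1 := by
  simp [prodOp]

theorem prodOp_update (m : ℤ) (j : Fin N) (A : Matrix (Fin d) (Fin d) ℂ) :
    prodOp m (Function.update (fun _ : Fin N => (1 : Matrix (Fin d) (Fin d) ℂ)) j A) =
      site (m + (j : ℕ)) A := by
  have : (fun k : Fin N => site (m + (k : ℕ))
      (Function.update (fun _ : Fin N => (1 : Matrix (Fin d) (Fin d) ℂ)) j A k)) =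
      Function.update (fun _ => 1) j (site (m + (j : ℕ)) A) := by
    ext1 k
    rcases eq_or_ne k j with rfl | h
    · simp
    · simp [Function.update_of_ne h]
  rw [prodOp, this, prod_ofFn_update_const]
  simp

/-- `Λ` consists of the `N` sites `m, …, m + N - 1`. -/
def IsWindow (Λ : Finset ℤ) (m : ℤ) (N : ℕ) : Prop := ∀ i, i ∈ Λ ↔ ∃ j : Fin N, i = m + (j : ℕ)

theorem isWindow_Icc {a b m : ℤ} {N : ℕ} (h1 : a = m) (h2 : b = m + N - 1) :
    IsWindow (Finset.Icc a b) m N := by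
  intro i
  rw [Finset.mem_Icc]
  constructor
  · intro h
    exact ⟨⟨(i - m).toNat, by omega⟩, by simp; omega⟩
  · rintro ⟨j, rfl⟩
    omega

/-- Elementary tensors contain the identity and the single-site operators, and are closed under
products. Adjoints of generators are again generators. -/
theorem mem_span_prodOp {Λ : Finset ℤ} {m : ℤ} (hΛ : IsWindow Λ m N) {x : ChainOp d}
    (hx : x ∈ localAlg d Λ) : x ∈ Submodule.span ℂ (Set.range (prodOp (d := d) (N := N) m)) := by
  have hx' : x ∈ (localAlg d Λ).toSubalgebra := hx
  rw [localAlg, StarAlgebra.adjoin_toSubalgebra] at hx'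
  induction hx' using Algebra.adjoin_induction with
  | mem y hy =>
    have hy' : ∃ i ∈ Λ, ∃ A, site (d := d) i A = y := by
      rcases hy with h | h
      · obtain ⟨i, hi, A, hA⟩ := Set.mem_iUnion₂.1 h
        exact ⟨i, hi, A, hA⟩
      · obtain ⟨i, hi, A, hA⟩ := Set.mem_iUnion₂.1 (Set.mem_star.1 h)
        exact ⟨i, hi, star A, by rw [map_star, hA, star_star]⟩
    obtain ⟨i, hi, A, rfl⟩ := hy'
    obtain ⟨j, rfl⟩ := (hΛ i).1 hi
    rw [← prodOp_update]
    exact Submodule.subset_span ⟨_, rfl⟩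
  | algebraMap c =>
    rw [Algebra.algebraMap_eq_smul_one, ← prodOp_one (N := N) m]
    exact Submodule.smul_mem _ _ (Submodule.subset_span ⟨_, rfl⟩)
  | add y z _ _ hy hz =>
    exact Submodule.add_mem _ (hy (by assumption)) (hz (by assumption))
  | mul y z _ _ hy hz =>
    have h := Submodule.mul_mem_mul (hy (by assumption)) (hz (by assumption))
    rw [Submodule.span_mul_span] at h
    refine Submodule.span_mono ?_ h
    rintro _ ⟨_, ⟨A, rfl⟩, _, ⟨B, rfl⟩, rfl⟩
    exact ⟨_, (prodOp_mul m A B).symm⟩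

theorem prodOp_mem {Λ : Finset ℤ} {m : ℤ} (hΛ : IsWindow Λ m N)
    (A : Fin N → Matrix (Fin d) (Fin d) ℂ) : prodOp m A ∈ localAlg d Λ := by
  refine list_prod_mem fun x hx => ?_
  obtain ⟨j, rfl⟩ := (List.mem_ofFn' _ _).1 hx
  exact site_mem_localAlg ((hΛ _).2 ⟨j, rfl⟩) _

/-- The canonical basis vectors of `ChainSpace d`. -/
def basisVec (u : Conf d) : ChainSpace d := lp.single 2 u (1 : ℂ)

theorem basisVec_apply (u v : Conf d) : basisVec u v = if v = u then 1 else 0 := by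
  rw [basisVec, lp.single_apply]
  by_cases h : v = u
  · subst h; simp
  · simp [h]

theorem inner_basisVec (u : Conf d) (ξ : ChainSpace d) : inner ℂ (basisVec u) ξ = ξ u := by
  rw [basisVec, lp.inner_single_left]
  simp

/-- The configuration equal to `s` on the window and to `0` elsewhere. -/
def confOf (m : ℤ) (s : Fin N → Fin d) : Conf d := splice m 0 s

theorem splice_confOf (m : ℤ) (s t : Fin N → Fin d) : splice m (confOf m s) t = confOf m t :=
  splice_splice _ _ _ _

theorem confOf_apply (m : ℤ) (s : Fin N → Fin d) (j : Fin N) : confOf m s (m + (j : ℕ)) = s j :=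
  splice_apply _ _ _ _

theorem confOf_injective (m : ℤ) : Function.Injective (confOf (d := d) (N := N) m) := by
  intro s t h
  ext1 j
  rw [← confOf_apply m s, h, confOf_apply]

/-- The matrix of an operator in the basis vectors supported in a window. -/
def compress (m : ℤ) (N : ℕ) : ChainOp d →ₗ[ℂ] Matrix (Fin N → Fin d) (Fin N → Fin d) ℂ where
  toFun x := Matrix.of fun s t => x (basisVec (confOf m t)) (confOf m s)
  map_add' _ _ := rfl
  map_smul' _ _ := rfl

theorem compress_apply (m : ℤ) (x : ChainOp d) (s t : Fin N → Fin d) :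
    compress m N x s t = x (basisVec (confOf m t)) (confOf m s) := rfl

theorem compress_prodOp (m : ℤ) (A : Fin N → Matrix (Fin d) (Fin d) ℂ) (s t : Fin N → Fin d) :
    compress m N (prodOp m A) s t = ∏ j, A j (s j) (t j) := by
  rw [compress_apply, prodOp_apply, Finset.sum_eq_single t]
  · simp [splice_confOf, basisVec_apply, confOf_apply]
  · intro t' _ h
    rw [splice_confOf, basisVec_apply, if_neg fun h' => h (confOf_injective m h'), mul_zero]
  · simp

/-- A local operator acts on the coordinates of the window through its compressed matrix and ignores
the others. This makes compression faithful and multiplicative on the local algebra. -/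
theorem local_apply {Λ : Finset ℤ} {m : ℤ} (hΛ : IsWindow Λ m N) {x : ChainOp d}
    (hx : x ∈ localAlg d Λ) (ξ : ChainSpace d) (u : Conf d) :
    x ξ u = ∑ t, compress m N x (fun j => u (m + (j : ℕ))) t * ξ (splice m u t) := by
  have hs := mem_span_prodOp hΛ hx
  clear hx
  induction hs using Submodule.span_induction with
  | mem y hy =>
    obtain ⟨A, rfl⟩ := hy
    simp only [prodOp_apply, compress_prodOp]
  | zero => simp
  | add y z _ _ hy hz =>
    have : (y + z) ξ u = y ξ u + z ξ u := rfl
    rw [this, hy, hz, map_add, ← Finset.sum_add_distrib]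
    exact Finset.sum_congr rfl fun t _ => by rw [Matrix.add_apply, add_mul]
  | smul c y _ hy =>
    have : (c • y) ξ u = c * y ξ u := rfl
    rw [this, hy, map_smul, Finset.mul_sum]
    exact Finset.sum_congr rfl fun t _ => by rw [Matrix.smul_apply, smul_eq_mul, mul_assoc]

/-- Only the left factor has to be local: it maps no component outside the window into the
compressed space. -/
theorem compress_mul {Λ : Finset ℤ} {m : ℤ} (hΛ : IsWindow Λ m N) {x : ChainOp d}
    (hx : x ∈ localAlg d Λ) (y : ChainOp d) :
    compress m N (x * y) = compress m N x * compress m N y := by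
  ext s t
  rw [compress_apply, Matrix.mul_apply]
  change x (y _) _ = _
  rw [local_apply hΛ hx]
  simp only [splice_confOf, confOf_apply, compress_apply]

theorem compress_star (m : ℤ) (x : ChainOp d) :
    compress m N (star x) = star (compress m N x) := by
  ext s t
  rw [Matrix.star_apply, compress_apply, compress_apply, ← inner_basisVec, ← inner_basisVec,
    ContinuousLinearMap.star_eq_adjoint, ContinuousLinearMap.adjoint_inner_right,
    ← inner_conj_symm]
  rfl

theorem compress_one (m : ℤ) : compress (d := d) m N 1 = 1 := by
  ext s t
  rw [compress_apply, one_apply_eq_self, basisVec_apply, Matrix.one_apply]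
  simp only [(confOf_injective m).eq_iff]

/-- `compress` as a *-homomorphism on the local algebra of the window. -/
def localHom {Λ : Finset ℤ} {m : ℤ} (hΛ : IsWindow Λ m N) :
    localAlg d Λ →⋆ₐ[ℂ] Matrix (Fin N → Fin d) (Fin N → Fin d) ℂ where
  toFun x := compress m N (x : ChainOp d)
  map_one' := compress_one m
  map_mul' x y := compress_mul hΛ x.2 y
  map_zero' := map_zero _
  map_add' x y := map_add (compress m N) (x : ChainOp d) y
  commutes' c := by
    change compress m N (algebraMap ℂ (ChainOp d) c) = _
    rw [Algebra.algebraMap_eq_smul_one, map_smul, compress_one, ← Algebra.algebraMap_eq_smul_one]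
  map_star' x := compress_star m (x : ChainOp d)

theorem compress_injOn {Λ : Finset ℤ} {m : ℤ} (hΛ : IsWindow Λ m N) {x y : ChainOp d}
    (hx : x ∈ localAlg d Λ) (hy : y ∈ localAlg d Λ) (h : compress m N x = compress m N y) :
    x = y := by
  ext ξ u
  rw [local_apply hΛ hx, local_apply hΛ hy, h]

theorem exists_compress_eq {Λ : Finset ℤ} {m : ℤ} (hΛ : IsWindow Λ m N)
    (X : Matrix (Fin N → Fin d) (Fin N → Fin d) ℂ) : ∃ x ∈ localAlg d Λ, compress m N x = X := by
  refine ⟨∑ s, ∑ t, X s t • prodOp m fun j => Matrix.single (s j) (t j) 1,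
    sum_mem fun s _ => sum_mem fun t _ => SMulMemClass.smul_mem _ (prodOp_mem hΛ _), ?_⟩
  ext s t
  simp only [map_sum, map_smul, Matrix.sum_apply, Matrix.smul_apply, compress_prodOp]
  rw [Finset.sum_eq_single s, Finset.sum_eq_single t]
  · simp
  · intro t' _ h
    obtain ⟨j, hj⟩ := Function.ne_iff.1 h
    rw [Finset.prod_eq_zero (Finset.mem_univ j), smul_zero]
    simp [hj]
  · simp
  · intro s' _ h
    refine Finset.sum_eq_zero fun t' _ => ?_
    obtain ⟨j, hj⟩ := Function.ne_iff.1 h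
    rw [Finset.prod_eq_zero (Finset.mem_univ j), smul_zero]
    simp [hj]
  · simp

theorem gaugeUnitary_eq_prodOp (g : Matrix.unitaryGroup (Fin d) ℂ) {Λ : Finset ℤ} {m : ℤ}
    (hΛ : IsWindow Λ m N) : gaugeUnitary g Λ = prodOp m fun _ : Fin N => (g : Matrix _ _ ℂ) := by
  have hinj : Function.Injective fun j : Fin N => m + ((j : ℕ) : ℤ) := fun i j h => by
    ext; simpa using h
  have hl : (List.ofFn fun j : Fin N => m + ((j : ℕ) : ℤ)).Nodup := List.nodup_ofFn.2 hinj
  have e : Λ = (List.ofFn fun j : Fin N => m + ((j : ℕ) : ℤ)).toFinset := by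
    ext i
    rw [hΛ i, List.mem_toFinset, List.mem_ofFn']
    exact ⟨fun ⟨j, h⟩ => ⟨j, h.symm⟩, fun ⟨j, h⟩ => ⟨j, h.symm⟩⟩
  subst e
  exact (Finset.noncommProd_toFinset _ _ _ hl).trans (by rw [List.map_ofFn, prodOp]; rfl)

/-- The matrix `g^{⊗ N}`. -/
def tensorPower (N : ℕ) (A : Matrix (Fin d) (Fin d) ℂ) :
    Matrix (Fin N → Fin d) (Fin N → Fin d) ℂ :=
  Matrix.of fun s t => ∏ j, A (s j) (t j)

theorem compress_gaugeUnitary (g : Matrix.unitaryGroup (Fin d) ℂ) {Λ : Finset ℤ} {m : ℤ}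
    (hΛ : IsWindow Λ m N) : compress m N (gaugeUnitary g Λ) = tensorPower N (g : Matrix _ _ ℂ) := by
  rw [gaugeUnitary_eq_prodOp g hΛ]
  ext s t
  rw [compress_prodOp]
  rfl

theorem gaugeUnitary_mem_localAlg (g : Matrix.unitaryGroup (Fin d) ℂ) {Λ : Finset ℤ} {m : ℤ}
    (hΛ : IsWindow Λ m N) : gaugeUnitary g Λ ∈ localAlg d Λ := by
  rw [gaugeUnitary_eq_prodOp g hΛ]
  exact prodOp_mem hΛ _

/-- Compression identifies the gauge-invariant algebra with the commutant of the matrices `g^{⊗N}`,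
as required for the multiplicity bound. -/
theorem mem_gaugeLocal_iff {G : Subgroup (Matrix.unitaryGroup (Fin d) ℂ)} {Λ : Finset ℤ} {m : ℤ}
    (hΛ : IsWindow Λ m N) {x : ChainOp d} (hx : x ∈ localAlg d Λ) :
    x ∈ gaugeLocal G Λ ↔ ∀ g ∈ G, Commute (tensorPower N (g : Matrix (Fin d) (Fin d) ℂ))
      (compress m N x) := by
  have h : ∀ g, gaugeAut g Λ x = x ↔ Commute (tensorPower N (g : Matrix (Fin d) (Fin d) ℂ))
      (compress m N x) := by
    intro g
    have hu := gaugeUnitary_mem g Λ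
    have hm := gaugeUnitary_mem_localAlg g hΛ
    rw [gaugeAut_apply]
    have h1 : gaugeUnitary g Λ * x * star (gaugeUnitary g Λ) = x ↔
        gaugeUnitary g Λ * x = x * gaugeUnitary g Λ := by
      constructor
      · intro h
        conv_rhs => rw [← h, mul_assoc, Unitary.star_mul_self_of_mem hu, mul_one]
      · intro h
        rw [h, mul_assoc, Unitary.mul_star_self_of_mem hu, mul_one]
    rw [h1, Commute, SemiconjBy, ← compress_gaugeUnitary g hΛ, ← compress_mul hΛ hm,
      ← compress_mul hΛ hx]
    exact ⟨fun h => by rw [h], fun h => compress_injOn hΛ (mul_mem hm hx) (mul_mem hx hm) h⟩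
  constructor
  · intro hxG g hg
    exact (h g).1 (hxG.2 g hg)
  · intro hc
    exact ⟨hx, fun g hg => (h g).2 (hc g hg)⟩

end windows
end QChain
end

noncomputable section
open scoped ComplexOrder Kronecker
set_option linter.unusedSectionVars false
namespace QChain

/-! ### Multiplicities of a commutant -/

section multiplicity
variable {m : ℕ} {n : Fin m → ℕ} {ν : Type*} [Fintype ν] [DecidableEq ν]

theorem exists_orthogonal_projection (V : Submodule ℂ (ν → ℂ)) :
    ∃ q : Matrix ν ν ℂ, star q = q ∧ (∀ x ∈ V, q.mulVec x = x) ∧ (∀ x, q.mulVec x ∈ V) ∧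
      q.trace = Module.finrank ℂ V := by
  let V' : Submodule ℂ (EuclideanSpace ℂ ν) :=
    V.comap (WithLp.linearEquiv 2 ℂ (ν → ℂ)).toLinearMap
  let q := (Matrix.toEuclideanCLM (n := ν) (𝕜 := ℂ)).symm V'.starProjection
  have hq : ∀ x, q.mulVec x = (V'.starProjection (WithLp.toLp 2 x)).ofLp := fun x => by
    have := Matrix.ofLp_toEuclideanCLM q (WithLp.toLp 2 x)
    rw [StarAlgEquiv.apply_symm_apply] at this
    exact this.symm
  have h1 : ∀ x ∈ V, q.mulVec x = x := fun x hx => by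
    rw [hq, Submodule.starProjection_eq_self_iff.2]
    exact hx
  have h2 : ∀ x, q.mulVec x ∈ V := fun x => by
    rw [hq]
    exact V'.starProjection_apply_mem (WithLp.toLp 2 x)
  refine ⟨q, ?_, h1, h2, ?_⟩
  · exact ((Matrix.toEuclideanCLM (n := ν) (𝕜 := ℂ)).symm.map_star' _).symm.trans
      (congrArg _ (isSelfAdjoint_starProjection V'))
  · have hp : LinearMap.IsProj V (Matrix.toLin' q) := ⟨h2, h1⟩
    rw [← hp.trace, Matrix.trace_toLin'_eq]

theorem blockUnit_mul_mul (i : Fin m) (a : Fin (n i)) (y : Blocks n) :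
    blockUnit i a a * y * blockUnit i a a = y i a a • blockUnit i a a := by
  ext1 j
  rcases eq_or_ne j i with rfl | hj
  · simp [blockUnit, Matrix.single_mul_mul_single, Matrix.smul_single]
  · simp [blockUnit, Pi.single_eq_of_ne hj]

theorem blockUnit_mul_mul_of_ne {i j : Fin m} (h : i ≠ j) (a b : Fin (n i)) (c d : Fin (n j))
    (y : Blocks n) : blockUnit i a b * y * blockUnit j c d = 0 := by
  ext1 k
  rcases eq_or_ne k i with rfl | hk
  · simp [blockUnit, Pi.single_eq_of_ne h]
  · simp [blockUnit, Pi.single_eq_of_ne hk]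

theorem blockUnit_mul_mul_cornerProj (q : Σ i, Fin (n i)) (hq : q.2.val = 0) (y : Blocks n) :
    blockUnit q.1 q.2 q.2 * y * cornerProj n = y q.1 q.2 q.2 • blockUnit q.1 q.2 q.2 := by
  rw [cornerProj, Finset.mul_sum, Finset.sum_eq_single q]
  · rw [if_pos hq, blockUnit_mul_mul]
  · rintro ⟨j, c⟩ _ hne
    split_ifs with h
    · refine blockUnit_mul_mul_of_ne (fun hj => hne ?_) _ _ _ _ _
      obtain ⟨i, a⟩ := q
      obtain rfl : i = j := hj
      obtain rfl : a = c := Fin.ext (hq.trans h.symm)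
      rfl
    · rw [mul_zero]
  · simp

/-- Bicommutant bound on multiplicities: if the range of `θ` is the commutant of a *-closed
semigroup `K` then its minimal projections have total rank at most `dim span K`. -/
theorem trace_cornerProj_le (θ : Blocks n →⋆ₐ[ℂ] Matrix ν ν ℂ) (hθ : Function.Injective θ)
    (K : Set (Matrix ν ν ℂ)) (hmul : ∀ a ∈ K, ∀ b ∈ K, a * b ∈ K) (hone : 1 ∈ K)
    (hstar : ∀ a ∈ K, star a ∈ K) (hrange : ∀ X, (∀ a ∈ K, Commute a X) → ∃ y, θ y = X)
    (hcomm : ∀ y, ∀ a ∈ K, Commute a (θ y)) (W : Submodule ℂ (Matrix ν ν ℂ)) (hW : K ⊆ W) :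
    (θ (cornerProj n)).trace.re ≤ Module.finrank ℂ W := by
  classical
  have hex : ∀ q : Σ i, Fin (n i), ∃ x, (θ (blockUnit q.1 q.2 q.2)).mulVec x ≠ 0 := by
    intro q
    by_contra! h
    have h0 : θ (blockUnit q.1 q.2 q.2) = 0 := by
      ext a b
      have := congrFun (h (Pi.single b 1)) a
      simpa using this
    have h1 := congrFun (hθ (h0.trans (map_zero θ).symm)) q.1
    have h2 := congrFun (congrFun h1 q.2) q.2
    simp [blockUnit] at h2
  choose w hw using hex
  let u : (Σ i, Fin (n i)) → Blocks n := fun q => if q.2.val = 0 then blockUnit q.1 q.2 q.2 else 0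
  have hu : ∀ q q', q ≠ q' → u q * u q' = 0 := by
    rintro ⟨i, a⟩ ⟨j, b⟩ hne
    simp only [u]
    split_ifs with h h'
    · refine blockUnit_mul_of_ne' (fun hj => hne ?_) _ _ _ _
      obtain rfl : i = j := hj
      obtain rfl : a = b := Fin.ext (h.trans h'.symm)
      rfl
    all_goals simp
  have huu : ∀ q, u q * u q = u q := by
    intro q
    simp only [u]
    split_ifs
    · exact blockUnit_mul _ _ _ _
    · simp
  have hc : cornerProj n = ∑ q, u q := rfl
  -- A vector in the range of the corner projection with a nonzero component under every minimal
  -- projection chosen.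
  let v : ν → ℂ := ∑ q, (θ (u q)).mulVec (w q)
  have hv : ∀ q, (θ (u q)).mulVec v = (θ (u q)).mulVec (w q) := by
    intro q
    simp only [v, Matrix.mulVec_sum, Matrix.mulVec_mulVec, ← map_mul]
    rw [Finset.sum_eq_single q]
    · rw [huu]
    · intro q' _ hne
      rw [hu q q' hne.symm, map_zero, Matrix.zero_mulVec]
    · simp
  have hpv : (θ (cornerProj n)).mulVec v = v := by
    rw [hc, map_sum, Matrix.sum_mulVec]
    exact Finset.sum_congr rfl fun q _ => hv q
  let V : Submodule ℂ (ν → ℂ) := Submodule.span ℂ ((fun a : Matrix ν ν ℂ => a.mulVec v) '' K)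
  have hVK : ∀ a ∈ K, ∀ x ∈ V, a.mulVec x ∈ V := by
    intro a ha x hx
    induction hx using Submodule.span_induction with
    | mem x hx =>
      obtain ⟨b, hb, rfl⟩ := hx
      simp only [Matrix.mulVec_mulVec]
      exact Submodule.subset_span ⟨_, hmul a ha b hb, rfl⟩
    | zero => simp
    | add x y _ _ hx hy => rw [Matrix.mulVec_add]; exact V.add_mem hx hy
    | smul c x _ hx => rw [Matrix.mulVec_smul]; exact V.smul_mem c hx
  have hpV : ∀ x ∈ V, (θ (cornerProj n)).mulVec x = x := by
    intro x hx
    induction hx using Submodule.span_induction with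
    | mem x hx =>
      obtain ⟨b, hb, rfl⟩ := hx
      simp only
      rw [Matrix.mulVec_mulVec, ← (hcomm _ b hb).eq, ← Matrix.mulVec_mulVec, hpv]
    | zero => simp
    | add x y _ _ hx hy => rw [Matrix.mulVec_add, hx, hy]
    | smul c x _ hx => rw [Matrix.mulVec_smul, hx]
  obtain ⟨q, hqs, hq1, hq2, hqt⟩ := exists_orthogonal_projection V
  have hqa : ∀ a ∈ K, q * a * q = a * q := fun a ha => by
    refine Matrix.ext_of_mulVec_single fun j => ?_
    rw [mul_assoc, ← Matrix.mulVec_mulVec]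
    refine hq1 _ ?_
    rw [← Matrix.mulVec_mulVec]
    exact hVK a ha _ (hq2 _)
  -- `V = span K v` is invariant under `K` and its adjoints, so the projection onto it commutes with
  -- `K` and belongs to the range of `θ`.
  obtain ⟨y, hy⟩ := hrange q fun a ha => by
    have h := congrArg star (hqa _ (hstar a ha))
    simp only [star_mul, star_star, hqs] at h
    exact (hqa a ha).symm.trans (by rw [mul_assoc, h])
  have hys : star y = y := hθ (by rw [map_star, hy, hqs])
  have hcy : cornerProj n * y = y := by
    refine hθ ?_
    rw [map_mul, hy]
    refine Matrix.ext_of_mulVec_single fun j => ?_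
    rw [← Matrix.mulVec_mulVec]
    exact hpV _ (hq2 _)
  have hyc : y * cornerProj n = y := by
    have := congrArg star hcy
    rwa [star_mul, hys, star_cornerProj] at this
  have hvV : v ∈ V := Submodule.subset_span ⟨1, hone, by simp⟩
  have huy : ∀ q, u q * y = u q := by
    intro r
    simp only [u]
    split_ifs with h
    · have h1 := blockUnit_mul_mul_cornerProj r h y
      rw [mul_assoc, hyc] at h1
      have h2 : (θ (blockUnit r.1 r.2 r.2 * y)).mulVec v = (θ (u r)).mulVec (w r) := by
        rw [map_mul, ← Matrix.mulVec_mulVec, hy, hq1 v hvV, ← hv]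
        simp [u, h]
      have h3 : (θ (blockUnit r.1 r.2 r.2)).mulVec v = (θ (u r)).mulVec (w r) := by
        rw [← hv]
        simp [u, h]
      rw [h1, map_smul, Matrix.smul_mulVec, h3] at h2
      have h4 : (θ (u r)).mulVec (w r) ≠ 0 := by
        have := hw r
        simpa only [u, if_pos h] using this
      -- By minimality `u y` is a multiple of `u`. Evaluation at `v`, which `θ y` fixes, shows that
      -- the factor is one. Thus `y` is the whole corner projection.
      have h5 : y r.1 r.2 r.2 = 1 := by
        have : (y r.1 r.2 r.2 - 1) • (θ (u r)).mulVec (w r) = 0 := by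
          rw [sub_smul, one_smul, h2, sub_self]
        rcases smul_eq_zero.1 this with h | h
        · exact sub_eq_zero.1 h
        · exact absurd h h4
      rw [h1, h5, one_smul]
    · rw [zero_mul]
  have hpy : cornerProj n = y := by
    rw [← hcy, hc, Finset.sum_mul]
    exact Finset.sum_congr rfl fun r _ => (huy r).symm
  rw [hpy, hy, hqt, Complex.natCast_re, Nat.cast_le]
  -- The rank of the corner projection is `dim V`, and `V` lies in the image of `W` under evaluation
  -- at `v`.
  have hVW : V ≤ W.map (LinearMap.flip (Matrix.mulVecBilin ℂ ℂ) v) := by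
    refine Submodule.span_le.2 ?_
    rintro _ ⟨a, ha, rfl⟩
    exact ⟨a, hW ha, rfl⟩
  exact (Submodule.finrank_mono hVW).trans (Submodule.finrank_map_le _ _)

end multiplicity

/-! ### Gauge-invariant algebras and polynomial growth of multiplicities -/

section gauge
variable {d : ℕ} [NeZero d] {N : ℕ} {G : Subgroup (Matrix.unitaryGroup (Fin d) ℂ)}

theorem tensorPower_mul (A B : Matrix (Fin d) (Fin d) ℂ) :
    tensorPower N A * tensorPower N B = tensorPower N (A * B) := by
  ext s t
  simp only [tensorPower, Matrix.mul_apply, Matrix.of_apply]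
  rw [Finset.prod_univ_sum, Fintype.piFinset_univ]
  exact Finset.sum_congr rfl fun u _ => Finset.prod_mul_distrib.symm

theorem tensorPower_one : tensorPower N (1 : Matrix (Fin d) (Fin d) ℂ) = 1 := by
  have := compress_gaugeUnitary (1 : Matrix.unitaryGroup (Fin d) ℂ)
    (isWindow_Icc (a := 0) (N := N) rfl rfl)
  rw [gaugeUnitary_eq_prodOp 1 (isWindow_Icc (a := 0) (N := N) rfl rfl)] at this
  change compress 0 N (prodOp 0 fun _ => 1) = tensorPower N 1 at this
  rw [← this, prodOp_one, compress_one]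

theorem tensorPower_star (A : Matrix (Fin d) (Fin d) ℂ) :
    star (tensorPower N A) = tensorPower N (star A) := by
  ext s t
  simp [tensorPower, Matrix.star_apply]

variable (d N) in
/-- The matrices whose `(s, t)` entry depends only on the numbers of positions `j` with given
`(s j, t j)`. -/
def countSpan : Submodule ℂ (Matrix (Fin N → Fin d) (Fin N → Fin d) ℂ) :=
  Submodule.span ℂ (Set.range fun c : Fin d × Fin d → Fin (N + 1) =>
    Matrix.of fun s t : Fin N → Fin d =>
      if ∀ p, Finset.card {j | (s j, t j) = p} = (c p).val then (1 : ℂ) else 0)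

/-- There is one spanning matrix for each assignment of a count in `0, …, N` to each of the `d ^ 2`
symbol pairs. -/
theorem finrank_countSpan_le : Module.finrank ℂ (countSpan d N) ≤ (N + 1) ^ d ^ 2 := by
  refine (finrank_range_le_card _).trans (le_of_eq ?_)
  simp [sq]

theorem tensorPower_mem_countSpan (A : Matrix (Fin d) (Fin d) ℂ) :
    tensorPower N A ∈ countSpan d N := by
  classical
  have : tensorPower N A = ∑ c : Fin d × Fin d → Fin (N + 1), (∏ p, A p.1 p.2 ^ (c p).val) •
      Matrix.of fun s t : Fin N → Fin d =>
        if ∀ p, Finset.card {j | (s j, t j) = p} = (c p).val then (1 : ℂ) else 0 := by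
    ext s t
    let c : Fin d × Fin d → Fin (N + 1) := fun p =>
      ⟨Finset.card {j | (s j, t j) = p}, by
        have := Finset.card_le_univ {j : Fin N | (s j, t j) = p}
        rw [Fintype.card_fin] at this
        omega⟩
    rw [Matrix.sum_apply, Finset.sum_eq_single c]
    · simp only [Matrix.smul_apply, Matrix.of_apply, tensorPower]
      rw [if_pos fun p => rfl, smul_eq_mul, mul_one]
      rw [← Finset.prod_fiberwise_of_maps_to (s := Finset.univ) (t := Finset.univ)
        (g := fun j => (s j, t j)) (fun _ _ => Finset.mem_univ _)]
      refine Finset.prod_congr rfl fun p _ => ?_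
      rw [Finset.prod_congr rfl (g := fun _ => A p.1 p.2), Finset.prod_const]
      intro j hj
      rw [Finset.mem_filter] at hj
      rw [← hj.2]
    · intro c' _ hc'
      simp only [Matrix.smul_apply, Matrix.of_apply]
      rw [if_neg, smul_zero]
      intro h
      exact hc' (funext fun p => Fin.ext (h p).symm)
    · simp
  rw [this]
  exact sum_mem fun c _ => Submodule.smul_mem _ _ (Submodule.subset_span ⟨c, rfl⟩)

/-- `compress` as a *-homomorphism on the gauge-invariant local algebra of the window. -/
def gaugeHom (G : Subgroup (Matrix.unitaryGroup (Fin d) ℂ)) {Λ : Finset ℤ} {m : ℤ}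
    (hΛ : IsWindow Λ m N) :
    gaugeLocal G Λ →⋆ₐ[ℂ] Matrix (Fin N → Fin d) (Fin N → Fin d) ℂ :=
  (localHom hΛ).comp (StarSubalgebra.inclusion fun _ h => h.1)

theorem gaugeHom_injective {Λ : Finset ℤ} {m : ℤ} (hΛ : IsWindow Λ m N) :
    Function.Injective (gaugeHom G hΛ) := fun x y h =>
  Subtype.ext (compress_injOn hΛ x.2.1 y.2.1 h)

theorem exists_gaugeLocal_equiv {Λ : Finset ℤ} {m : ℤ} (hΛ : IsWindow Λ m N) :
    ∃ (k : ℕ) (n : Fin k → ℕ), Nonempty (gaugeLocal G Λ ≃⋆ₐ[ℂ] Blocks n) := by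
  have : FiniteDimensional ℂ (gaugeLocal G Λ) :=
    FiniteDimensional.of_injective (gaugeHom G hΛ).toAlgHom.toLinearMap (gaugeHom_injective hΛ)
  exact exists_starAlgEquiv_blocks _ (gaugeHom_injective hΛ)

/-- The matrices `g^{⊗N}`, `g ∈ G`, form a *-closed semigroup because `G` is a group of unitaries.
The gauge-invariant algebra is their commutant, and they all lie in `countSpan`. -/
theorem trace_gaugeHom_cornerProj_le {Λ : Finset ℤ} {m : ℤ} (hΛ : IsWindow Λ m N) {k : ℕ}
    {n : Fin k → ℕ} (e : gaugeLocal G Λ ≃⋆ₐ[ℂ] Blocks n) :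
    (gaugeHom G hΛ (e.symm (cornerProj n))).trace.re ≤ ((N : ℝ) + 1) ^ d ^ 2 := by
  let θ : Blocks n →⋆ₐ[ℂ] Matrix (Fin N → Fin d) (Fin N → Fin d) ℂ :=
    (gaugeHom G hΛ).comp (e.symm : Blocks n →⋆ₐ[ℂ] gaugeLocal G Λ)
  have h := trace_cornerProj_le θ ((gaugeHom_injective hΛ).comp e.symm.injective)
    ((fun g : Matrix.unitaryGroup (Fin d) ℂ => tensorPower N (g : Matrix (Fin d) (Fin d) ℂ)) '' G)
    ?_ ?_ ?_ ?_ ?_ (countSpan d N) ?_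
  · refine h.trans ?_
    exact_mod_cast finrank_countSpan_le
  · rintro _ ⟨a, ha, rfl⟩ _ ⟨b, hb, rfl⟩
    exact ⟨a * b, G.mul_mem ha hb, (tensorPower_mul _ _).symm⟩
  · exact ⟨1, G.one_mem, tensorPower_one⟩
  · rintro _ ⟨a, ha, rfl⟩
    exact ⟨a⁻¹, G.inv_mem ha, (tensorPower_star _).symm⟩
  · intro X hX
    obtain ⟨x, hx, rfl⟩ := exists_compress_eq hΛ X
    refine ⟨e ⟨x, (mem_gaugeLocal_iff hΛ hx).2 fun g hg => hX _ ⟨g, hg, rfl⟩⟩, ?_⟩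
    change gaugeHom G hΛ (e.symm (e _)) = _
    rw [StarAlgEquiv.symm_apply_apply]
    rfl
  · rintro y _ ⟨a, ha, rfl⟩
    exact (mem_gaugeLocal_iff hΛ (e.symm y).2.1).1 (e.symm y).2 a ha
  · rintro _ ⟨a, ha, rfl⟩
    exact tensorPower_mem_countSpan _

/-- Tensoring with the identity as a *-homomorphism. -/
def ampHom (ν Y : Type*) [Fintype ν] [DecidableEq ν] [Fintype Y] [DecidableEq Y] :
    Matrix ν ν ℂ →⋆ₐ[ℂ] Matrix (ν × Y) (ν × Y) ℂ where
  toFun X := X ⊗ₖ (1 : Matrix Y Y ℂ)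
  map_one' := Matrix.one_kronecker_one
  map_mul' A B := by rw [← Matrix.mul_kronecker_mul, one_mul]
  map_zero' := Matrix.zero_kronecker _
  map_add' A B := Matrix.add_kronecker _ _ _
  commutes' c := by
    rw [Algebra.algebraMap_eq_smul_one, Matrix.smul_kronecker, Matrix.one_kronecker_one,
      ← Algebra.algebraMap_eq_smul_one]
  map_star' A := by
    rw [Matrix.star_eq_conjTranspose, Matrix.star_eq_conjTranspose, Matrix.conjTranspose_kronecker,
      Matrix.conjTranspose_one]

/-- Comparison of the entropy of a functional on the gauge-invariant local algebra with the entropy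
of a density matrix of an extension to `M_d^{⊗ N} ⊗ M_Y`. -/
theorem abs_blockEntropy_gauge_sub_le {Y : Type*} [Fintype Y] [DecidableEq Y] [Nonempty Y]
    {Λ : Finset ℤ} {m : ℤ} (hΛ : IsWindow Λ m N) {k : ℕ}
    {n : Fin k → ℕ} (e : gaugeLocal G Λ ≃⋆ₐ[ℂ] Blocks n) (χ : Blocks n →ₗ[ℂ] ℂ)
    {D : Matrix ((Fin N → Fin d) × Y) ((Fin N → Fin d) × Y) ℂ} (hD : D.PosSemidef)
    (hχ : ∀ x : gaugeLocal G Λ,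
      χ (e x) = (D * (compress m N (x : ChainOp d) ⊗ₖ (1 : Matrix Y Y ℂ))).trace) :
    |blockEntropy χ - vnEntropy D| ≤
      D.trace.re * Real.log (((N : ℝ) + 1) ^ d ^ 2 * Fintype.card Y) := by
  refine abs_blockEntropy_sub_le (((ampHom _ Y).comp (gaugeHom G hΛ)).comp
    (e.symm : Blocks n →⋆ₐ[ℂ] gaugeLocal G Λ)) hD (fun y => ?_) ?_ ?_
  · have := hχ (e.symm y)
    rwa [StarAlgEquiv.apply_symm_apply] at this
  · change ((gaugeHom G hΛ (e.symm (cornerProj n))) ⊗ₖ (1 : Matrix Y Y ℂ)).trace.re ≤ _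
    rw [Matrix.trace_kronecker, Matrix.trace_one, ← Complex.ofReal_natCast, Complex.re_mul_ofReal]
    exact mul_le_mul_of_nonneg_right (trace_gaugeHom_cornerProj_le hΛ e) (by positivity)
  · have h1 : (1 : ℝ) ≤ ((N : ℝ) + 1) ^ d ^ 2 := one_le_pow₀ (by linarith [N.cast_nonneg (α := ℝ)])
    have h2 : (1 : ℝ) ≤ Fintype.card Y := by exact_mod_cast Fintype.card_pos
    nlinarith

end gauge
end QChain
end

noncomputable section
open scoped ComplexOrder Kronecker
set_option linter.unusedSectionVars false
namespace QChain

/-! ### Kraus families, purifications and rotation of the environment -/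

section kraus
variable {S S' Ω Ω' κ : Type*} [Fintype S] [DecidableEq S] [Fintype S'] [DecidableEq S']
  [Fintype Ω] [DecidableEq Ω] [Fintype Ω'] [DecidableEq Ω'] [Fintype κ] [DecidableEq κ]

/-- The map `C ↦ ∑_{r,s,t} X_{st} V_{rs}^* C V_{rt}` of a Kraus family `V`. -/
def kstep (V : Ω → S → Matrix κ κ ℂ) (X : Matrix S S ℂ) : Module.End ℂ (Matrix κ κ ℂ) where
  toFun C := ∑ r, ∑ s, ∑ t, X s t • ((V r s).conjTranspose * C * V r t)
  map_add' C C' := by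
    simp only [mul_add, add_mul, smul_add, Finset.sum_add_distrib]
  map_smul' c C := by
    simp only [mul_smul_comm, smul_mul_assoc, RingHom.id_apply, Finset.smul_sum]
    simp only [smul_comm c]

theorem kstep_apply (V : Ω → S → Matrix κ κ ℂ) (X : Matrix S S ℂ) (C : Matrix κ κ ℂ) :
    kstep V X C = ∑ r, ∑ s, ∑ t, X s t • ((V r s).conjTranspose * C * V r t) := rfl

theorem kstep_eq_sum (V : Ω → S → Matrix κ κ ℂ) (X : Matrix S S ℂ) :
    kstep V X = ∑ r, kstep (fun _ : Unit => V r) X := by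
  ext1 C
  simp [kstep_apply, LinearMap.sum_apply]

theorem kstep_one (V : Ω → S → Matrix κ κ ℂ) (C : Matrix κ κ ℂ) :
    kstep V 1 C = ∑ r, ∑ s, (V r s).conjTranspose * C * V r s := by
  rw [kstep_apply]
  refine Finset.sum_congr rfl fun r _ => Finset.sum_congr rfl fun s _ => ?_
  rw [Finset.sum_eq_single s]
  · simp
  · intro t _ h
    rw [Matrix.one_apply_ne h.symm, zero_smul]
  · simp

theorem kstep_posSemidef (V : Ω → S → Matrix κ κ ℂ) {C : Matrix κ κ ℂ} (hC : C.PosSemidef) :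
    (kstep V 1 C).PosSemidef := by
  rw [kstep_one]
  exact Matrix.posSemidef_sum _ fun r _ => Matrix.posSemidef_sum _ fun s _ =>
    hC.conjTranspose_mul_mul_same _

theorem kstep_equiv (V : Ω → S → Matrix κ κ ℂ) (f : S' ≃ S) (X : Matrix S' S' ℂ) :
    kstep (fun r s => V r (f s)) X = kstep V (Matrix.reindex f f X) := by
  ext1 C
  rw [kstep_apply, kstep_apply]
  refine Finset.sum_congr rfl fun r _ => ?_
  rw [← f.sum_comp]
  refine Finset.sum_congr rfl fun s _ => ?_
  rw [← f.sum_comp]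
  simp

/-- Composition of Kraus families. -/
def kcomp (V : Ω → S → Matrix κ κ ℂ) (V' : Ω' → S' → Matrix κ κ ℂ) :
    Ω × Ω' → S × S' → Matrix κ κ ℂ := fun r s => V' r.2 s.2 * V r.1 s.1

/-- The maps act in the Heisenberg picture, `C ↦ V* C V`, so the inner step contributes the left
factor of the product of Kraus operators. -/
theorem kstep_kcomp (V : Ω → S → Matrix κ κ ℂ) (V' : Ω' → S' → Matrix κ κ ℂ) (X : Matrix S S ℂ)
    (X' : Matrix S' S' ℂ) : kstep (kcomp V V') (X ⊗ₖ X') = kstep V X * kstep V' X' := by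
  ext1 C
  rw [Module.End.mul_apply, kstep_apply, kstep_apply]
  simp only [Fintype.sum_prod_type, kstep_apply, Finset.mul_sum, Finset.sum_mul, Finset.smul_sum]
  refine Finset.sum_congr rfl fun r _ => ?_
  rw [Finset.sum_comm]
  refine Finset.sum_congr rfl fun s _ => ?_
  rw [Finset.sum_congr rfl fun x _ => Finset.sum_comm, Finset.sum_comm]
  refine Finset.sum_congr rfl fun t _ => Finset.sum_congr rfl fun r' _ =>
    Finset.sum_congr rfl fun s' _ => Finset.sum_congr rfl fun t' _ => ?_
  simp only [kcomp, Matrix.kroneckerMap_apply, Matrix.conjTranspose_mul, mul_smul_comm,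
    smul_mul_assoc, smul_smul, mul_assoc]

/-- The tensor product of a tuple of matrices. -/
def tensor {K : ℕ} (X : Fin K → Matrix S S ℂ) : Matrix (Fin K → S) (Fin K → S) ℂ :=
  Matrix.of fun s t => ∏ j, X j (s j) (t j)

theorem tensor_one {K : ℕ} : tensor (fun _ : Fin K => (1 : Matrix S S ℂ)) = 1 := by
  ext s t
  rw [tensor, Matrix.of_apply]
  by_cases h : s = t
  · subst h; simp
  · obtain ⟨j, hj⟩ := Function.ne_iff.1 h
    rw [Matrix.one_apply_ne h]
    exact Finset.prod_eq_zero (Finset.mem_univ j) (Matrix.one_apply_ne hj)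

/-- Products of Kraus operators along a word. -/
def word : {K : ℕ} → (Fin K → Ω → S → Matrix κ κ ℂ) → (Fin K → Ω) → (Fin K → S) → Matrix κ κ ℂ
  | 0, _, _, _ => 1
  | _ + 1, V, I, s =>
    word (fun j => V j.succ) (fun j => I j.succ) (fun j => s j.succ) * V 0 (I 0) (s 0)

theorem kstep_word {K : ℕ} (V : Fin K → Ω → S → Matrix κ κ ℂ) (X : Fin K → Matrix S S ℂ) :
    kstep (word V) (tensor X) = (List.ofFn fun j => kstep (V j) (X j)).prod := by
  induction K with
  | zero =>
    ext1 C
    simp [kstep_apply, word, tensor]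
  | succ K ih =>
    rw [List.ofFn_succ, List.prod_cons, ← ih]
    ext1 C
    rw [Module.End.mul_apply, kstep_apply, kstep_apply, sum_fin_succ_fun]
    refine Finset.sum_congr rfl fun r _ => ?_
    simp only [kstep_apply, Finset.mul_sum, Finset.sum_mul, Finset.smul_sum]
    rw [Finset.sum_congr rfl fun x _ => by
      rw [sum_fin_succ_fun, Finset.sum_congr rfl fun y _ => Finset.sum_congr rfl fun z _ =>
        sum_fin_succ_fun _]]
    rw [Finset.sum_comm]
    refine Finset.sum_congr rfl fun s _ => ?_
    rw [Finset.sum_congr rfl fun x _ => Finset.sum_comm, Finset.sum_comm]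
    refine Finset.sum_congr rfl fun t _ => Finset.sum_congr rfl fun r' _ =>
      Finset.sum_congr rfl fun s' _ => Finset.sum_congr rfl fun t' _ => ?_
    simp only [word, tensor, Matrix.of_apply, Fin.prod_univ_succ, Fin.cons_zero, Fin.cons_succ,
      Matrix.conjTranspose_mul, mul_smul_comm, smul_mul_assoc, smul_smul, mul_assoc]

/-- The amplitudes of a Kraus family as a matrix from the environment to the system. -/
def amplitude (V : Ω → S → Matrix κ κ ℂ) (Q : Matrix κ κ ℂ) : Matrix (S × (κ × κ)) Ω ℂ :=
  Matrix.of fun s r => (Q * V r s.1) s.2.1 s.2.2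

/-- The numbers `(Q V_{rs})_c` are the coefficients of a vector on system, memory and environment.
Its marginal on system and memory extends the functional defined by the Kraus family; the memory
indices `c` arise from writing out the trace. -/
theorem trace_amplitude (V : Ω → S → Matrix κ κ ℂ) (Q : Matrix κ κ ℂ) (X : Matrix S S ℂ) :
    (amplitude V Q * (amplitude V Q).conjTranspose * (X ⊗ₖ (1 : Matrix (κ × κ) (κ × κ) ℂ))).trace =
      (kstep V X (Q.conjTranspose * Q)).trace := by
  have h1 : ∀ r s t, ((V r s).conjTranspose * (Q.conjTranspose * Q) * V r t).trace =
      ∑ c : κ × κ, star ((Q * V r s) c.1 c.2) * (Q * V r t) c.1 c.2 := by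
    intro r s t
    have : (V r s).conjTranspose * (Q.conjTranspose * Q) * V r t =
        (Q * V r s).conjTranspose * (Q * V r t) := by
      simp only [Matrix.conjTranspose_mul, mul_assoc]
    rw [this, Matrix.trace, Fintype.sum_prod_type, Finset.sum_comm]
    simp only [Matrix.diag_apply, Matrix.mul_apply (M := (Q * V r s).conjTranspose),
      Matrix.conjTranspose_apply]
  rw [kstep_apply]
  simp only [Matrix.trace_sum, Matrix.trace_smul, h1, smul_eq_mul]
  rw [Matrix.trace]
  simp only [Matrix.diag_apply, Matrix.mul_apply (N := X ⊗ₖ (1 : Matrix (κ × κ) (κ × κ) ℂ)),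
    Fintype.sum_prod_type (f := fun p : S × (κ × κ) => _), Matrix.kroneckerMap_apply]
  have h2 : ∀ (t : S) (c : κ × κ), (∑ s, ∑ c', (amplitude V Q * (amplitude V Q).conjTranspose)
      (t, c) (s, c') * (X s t * (1 : Matrix (κ × κ) (κ × κ) ℂ) c' c)) =
      ∑ s, ∑ r, X s t * (star ((Q * V r s) c.1 c.2) * (Q * V r t) c.1 c.2) := by
    intro t c
    refine Finset.sum_congr rfl fun s _ => ?_
    rw [Finset.sum_eq_single c]
    · rw [Matrix.one_apply_eq, mul_one, Matrix.mul_apply, Finset.sum_mul]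
      refine Finset.sum_congr rfl fun r _ => ?_
      simp only [amplitude, Matrix.conjTranspose_apply, Matrix.of_apply]
      ring
    · intro c' _ h
      rw [Matrix.one_apply_ne h, mul_zero, mul_zero]
    · simp
  simp only [h2, Finset.mul_sum]
  rw [Finset.sum_congr rfl fun t _ => Finset.sum_comm]
  rw [Finset.sum_congr rfl fun t _ => Finset.sum_congr rfl fun s _ => Finset.sum_comm]
  rw [Finset.sum_comm, Finset.sum_congr rfl fun t _ => Finset.sum_comm, Finset.sum_comm]

/-- The diagonal of the environment Gram matrix consists of the masses of the functionals of the
individual Kraus operators. Thus a decomposition of the state corresponds to a measurement of the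
environment. -/
theorem amplitude_diag (V : Ω → S → Matrix κ κ ℂ) (Q : Matrix κ κ ℂ) (r : Ω) :
    ((amplitude V Q).conjTranspose * amplitude V Q) r r =
      (kstep (fun _ : Unit => V r) 1 (Q.conjTranspose * Q)).trace := by
  rw [← trace_amplitude, Matrix.one_kronecker_one, mul_one, Matrix.trace_mul_comm, Matrix.trace,
    Finset.univ_unique, Finset.sum_singleton]
  rfl

/-- The density matrix of the functional `X ↦ Tr (kstep V X (Q^* Q))`. -/
def kdensity (V : Ω → S → Matrix κ κ ℂ) (Q : Matrix κ κ ℂ) : Matrix S S ℂ :=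
  let T : Matrix S (Ω × (κ × κ)) ℂ := Matrix.of fun s r => (Q * V r.1 s) r.2.1 r.2.2
  T * T.conjTranspose

theorem kdensity_posSemidef (V : Ω → S → Matrix κ κ ℂ) (Q : Matrix κ κ ℂ) :
    (kdensity V Q).PosSemidef := Matrix.posSemidef_self_mul_conjTranspose _

theorem trace_kdensity (V : Ω → S → Matrix κ κ ℂ) (Q : Matrix κ κ ℂ) (X : Matrix S S ℂ) :
    (kdensity V Q * X).trace = (kstep V X (Q.conjTranspose * Q)).trace := by
  rw [← trace_amplitude]
  have h : ∀ s t, kdensity V Q s t =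
      ∑ c, (amplitude V Q * (amplitude V Q).conjTranspose) (s, c) (t, c) := by
    intro s t
    simp only [kdensity, Matrix.mul_apply, Fintype.sum_prod_type (f := fun p : Ω × (κ × κ) => _)]
    rw [Finset.sum_comm]
    rfl
  rw [Matrix.trace, Matrix.trace, Fintype.sum_prod_type]
  refine Finset.sum_congr rfl fun s _ => ?_
  rw [Matrix.diag_apply, Matrix.mul_apply]
  simp only [h, Finset.sum_mul, Matrix.diag_apply,
    Matrix.mul_apply (N := X ⊗ₖ (1 : Matrix (κ × κ) (κ × κ) ℂ)),
    Fintype.sum_prod_type (f := fun p : S × (κ × κ) => _), Matrix.kroneckerMap_apply]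
  rw [Finset.sum_comm]
  refine Finset.sum_congr rfl fun c _ => Finset.sum_congr rfl fun t _ => ?_
  rw [Finset.sum_eq_single c]
  · rw [Matrix.one_apply_eq, mul_one]
  · intro c' _ h
    rw [Matrix.one_apply_ne h, mul_zero, mul_zero]
  · simp

/-- The environment basis can be rotated so that the environment state becomes diagonal. -/
theorem exists_rotation (V : Ω → S → Matrix κ κ ℂ) (Q : Matrix κ κ ℂ) :
    ∃ V' : Ω → S → Matrix κ κ ℂ, (∀ X, kstep V' X = kstep V X) ∧
      ∑ r, Real.negMulLog (kstep (fun _ : Unit => V' r) 1 (Q.conjTranspose * Q)).trace.re =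
        vnEntropy (amplitude V Q * (amplitude V Q).conjTranspose) := by
  obtain ⟨Z, hZ, p, -, hp⟩ := PosSemidef.exists_diagonal
    (Matrix.posSemidef_conjTranspose_mul_self (amplitude V Q))
  have hZ1 : star Z * Z = 1 := (Matrix.mem_unitaryGroup_iff').1 hZ
  have hZ2 : Z * star Z = 1 := (Matrix.mem_unitaryGroup_iff).1 hZ
  -- A unitary recombination of Kraus operators leaves the completely positive map unchanged. With
  -- `Z` diagonalising the environment Gram matrix, the new masses are its eigenvalues.
  let V' : Ω → S → Matrix κ κ ℂ := fun r s => ∑ w, Z w r • V w s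
  have hV' : amplitude V' Q = amplitude V Q * Z := by
    ext s r
    have h : Q * V' r s.1 = ∑ w, Z w r • (Q * V w s.1) := by
      simp only [V', Matrix.mul_sum, Matrix.mul_smul]
    change (Q * V' r s.1) s.2.1 s.2.2 = _
    rw [h, Matrix.sum_apply, Matrix.mul_apply]
    exact Finset.sum_congr rfl fun w _ => mul_comm (Z w r) _
  refine ⟨V', fun X => ?_, ?_⟩
  · ext1 C
    have h : ∀ s t, ∑ r, (V' r s).conjTranspose * C * V' r t =
        ∑ r, (V r s).conjTranspose * C * V r t := by
      intro s t
      have h1 : ∀ r, (V' r s).conjTranspose * C * V' r t =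
          ∑ w, ∑ w', (Z w' r * star (Z w r)) • ((V w s).conjTranspose * C * V w' t) := by
        intro r
        simp only [V', Matrix.conjTranspose_sum, Matrix.conjTranspose_smul, Finset.sum_mul,
          Finset.mul_sum, smul_mul_assoc, mul_smul_comm, Finset.smul_sum, smul_smul]
        exact Finset.sum_comm
      simp only [h1]
      rw [Finset.sum_comm]
      refine Finset.sum_congr rfl fun w _ => ?_
      rw [Finset.sum_comm]
      simp only [← Finset.sum_smul]
      have h2 : ∀ w', ∑ r, Z w' r * star (Z w r) = (1 : Matrix Ω Ω ℂ) w' w := fun w' => by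
        rw [← hZ2, Matrix.mul_apply]
        rfl
      simp only [h2]
      rw [Finset.sum_eq_single w]
      · simp
      · intro w' _ hw
        rw [Matrix.one_apply_ne hw, zero_smul]
      · simp
    rw [kstep_apply, kstep_apply, Finset.sum_comm]
    conv_rhs => rw [Finset.sum_comm]
    refine Finset.sum_congr rfl fun s _ => ?_
    rw [Finset.sum_comm]
    conv_rhs => rw [Finset.sum_comm]
    refine Finset.sum_congr rfl fun t _ => ?_
    rw [← Finset.smul_sum, ← Finset.smul_sum, h]
  · rw [vnEntropy_mul_conjTranspose, hp, vnEntropy_conj_diagonal hZ]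
    refine Finset.sum_congr rfl fun r _ => ?_
    rw [← amplitude_diag, hV', Matrix.conjTranspose_mul, Matrix.mul_assoc,
      ← Matrix.mul_assoc (amplitude V Q).conjTranspose, hp, ← Matrix.star_eq_conjTranspose]
    have : star Z * (Z * Matrix.diagonal (fun i => (p i : ℂ)) * star Z * Z) =
        Matrix.diagonal fun i => (p i : ℂ) := by
      simp only [mul_assoc]
      rw [hZ1, mul_one, ← mul_assoc, hZ1, one_mul]
    rw [this, Matrix.diagonal_apply_eq, Complex.ofReal_re]

end kraus

/-! ### From complete positivity to Kraus operators -/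

section cp
variable {A B : Type*} [Ring A] [StarRing A] [Algebra ℂ A] [Ring B] [StarRing B] [Algebra ℂ B]

/-- Complete positivity is applied to the matrix with first row `x` and all other rows zero; its
square has entries `x_p* x_q`. -/
theorem IsCompletelyPositive.exists_gram {F : A →ₗ[ℂ] B} (hF : IsCompletelyPositive F)
    {P : Type*} [Fintype P] (x : P → A) : ∃ (N : ℕ) (y : Fin N → P → B),
      ∀ p q, F (star (x p) * x q) = ∑ k, star (y k p) * y k q := by
  let f := Fintype.equivFin P
  obtain ⟨Y, hY⟩ := hF (Fintype.card P)
    (Matrix.of fun i j => if (i : ℕ) = 0 then x (f.symm j) else 0)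
  refine ⟨_, fun k p => Y k (f p), fun p q => ?_⟩
  have h := congrFun (congrFun hY (f p)) (f q)
  rw [Matrix.map_apply, Matrix.star_eq_conjTranspose, Matrix.star_eq_conjTranspose,
    Matrix.mul_apply, Matrix.mul_apply] at h
  simp only [Matrix.conjTranspose_apply, Matrix.of_apply] at h
  rw [← h, Finset.sum_eq_single ⟨0, (f p).pos⟩]
  · simp
  · intro i _ hi
    rw [if_neg fun h0 => hi (Fin.ext h0), star_zero, zero_mul]
  · simp

theorem exists_kraus {d : ℕ} [NeZero d]
    {E : Matrix (Fin d × Fin d) (Fin d × Fin d) ℂ →ₗ[ℂ] Matrix (Fin d) (Fin d) ℂ}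
    (hE : IsCompletelyPositive E) :
    ∃ (N : ℕ) (V : Fin N × Fin d → Fin d → Matrix (Fin d) (Fin d) ℂ),
      ∀ A C, E (A ⊗ₖ C) = kstep V A C := by
  obtain ⟨N, y, hy⟩ := hE.exists_gram fun p : Fin d × Fin d =>
    Matrix.single ((0, 0) : Fin d × Fin d) p (1 : ℂ)
  have hs : ∀ p q : Fin d × Fin d, star (Matrix.single ((0, 0) : Fin d × Fin d) p (1 : ℂ)) *
      Matrix.single (0, 0) q 1 = Matrix.single p q 1 := fun p q => by
    rw [Matrix.star_eq_conjTranspose, Matrix.conjTranspose_single, star_one,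
      Matrix.single_mul_single_same, mul_one]
  simp only [hs] at hy
  -- The environment index consists of the Gram index and the row of the Gram factor; the first
  -- matrix leg of `E` becomes the system index.
  refine ⟨N, fun k t => Matrix.of fun b j => y k.1 (t, b) k.2 j, fun A C => ?_⟩
  have h1 : E (A ⊗ₖ C) = ∑ p, ∑ q, (A p.1 q.1 * C p.2 q.2) • ∑ k, star (y k p) * y k q := by
    conv_lhs => rw [Matrix.matrix_eq_sum_single (A ⊗ₖ C)]
    simp only [map_sum, ← hy, ← map_smul, Matrix.smul_single, smul_eq_mul, mul_one,
      Matrix.kroneckerMap_apply]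
  have h2 : ∀ k s t, ∑ c, (Matrix.of fun b j => y k (s, b) c j).conjTranspose * C *
      (Matrix.of fun b j => y k (t, b) c j) =
      ∑ a, ∑ b, C a b • (star (y k (s, a)) * y k (t, b)) := by
    intro k s t
    ext i j
    simp only [Matrix.sum_apply, Matrix.smul_apply, smul_eq_mul, Matrix.mul_apply,
      Matrix.star_apply, Matrix.conjTranspose_apply, Matrix.of_apply, Finset.mul_sum,
      Finset.sum_mul]
    rw [Finset.sum_congr rfl fun c _ => Finset.sum_comm, Finset.sum_comm]
    refine Finset.sum_congr rfl fun a _ => ?_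
    rw [Finset.sum_comm]
    exact Finset.sum_congr rfl fun b _ => Finset.sum_congr rfl fun c _ => by ring
  rw [h1, kstep_apply, Fintype.sum_prod_type]
  have h3 : ∀ k, ∑ c, ∑ s, ∑ t, A s t • ((Matrix.of fun b j => y k (s, b) c j).conjTranspose * C *
      (Matrix.of fun b j => y k (t, b) c j)) =
      ∑ s, ∑ t, ∑ a, ∑ b, (A s t * C a b) • (star (y k (s, a)) * y k (t, b)) := by
    intro k
    rw [Finset.sum_comm]
    refine Finset.sum_congr rfl fun s _ => ?_
    rw [Finset.sum_comm]
    refine Finset.sum_congr rfl fun t _ => ?_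
    rw [← Finset.smul_sum, h2]
    simp only [Finset.smul_sum, smul_smul]
  simp only [h3, Fintype.sum_prod_type, Finset.smul_sum]
  conv_rhs => rw [Finset.sum_comm]
  refine Finset.sum_congr rfl fun s _ => ?_
  conv_rhs => rw [Finset.sum_comm]
  rw [Finset.sum_comm]
  refine Finset.sum_congr rfl fun t _ => ?_
  conv_rhs => rw [Finset.sum_comm]
  refine Finset.sum_congr rfl fun a _ => ?_
  conv_rhs => rw [Finset.sum_comm]

end cp

/-! ### Fixed points of positive trace-preserving maps -/

section fixedPoint
variable {κ : Type*} [Fintype κ] [DecidableEq κ]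

theorem PosSemidef.norm_apply_le_trace {C : Matrix κ κ ℂ} (hC : C.PosSemidef) (i j : κ) :
    ‖C i j‖ ≤ C.trace.re := by
  obtain ⟨B, rfl⟩ := PosSemidef.exists_star_mul hC
  have h1 : (star B * B).trace.re = ∑ l, ∑ k, ‖B k l‖ ^ 2 := by
    rw [Matrix.trace, Complex.re_sum]
    refine Finset.sum_congr rfl fun l _ => ?_
    rw [Matrix.diag_apply, Matrix.mul_apply, Complex.re_sum]
    refine Finset.sum_congr rfl fun k _ => ?_
    rw [Matrix.star_apply, RCLike.star_def, Complex.conj_mul']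
    norm_cast
  have hle : ∀ l, ∑ k, ‖B k l‖ ^ 2 ≤ ∑ l, ∑ k, ‖B k l‖ ^ 2 := fun l =>
    Finset.single_le_sum (f := fun l => ∑ k, ‖B k l‖ ^ 2) (fun l _ => by positivity)
      (Finset.mem_univ l)
  rw [h1, Matrix.mul_apply]
  calc ‖∑ k, star B i k * B k j‖ ≤ ∑ k, ‖B k i‖ * ‖B k j‖ := by
        refine (norm_sum_le _ _).trans (le_of_eq ?_)
        simp
    _ ≤ ∑ k, (‖B k i‖ ^ 2 + ‖B k j‖ ^ 2) / 2 := Finset.sum_le_sum fun k _ => by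
        nlinarith [sq_nonneg (‖B k i‖ - ‖B k j‖)]
    _ ≤ _ := by
        rw [← Finset.sum_div, Finset.sum_add_distrib]
        linarith [hle i, hle j]

theorem isClosed_posSemidef : IsClosed {C : Matrix κ κ ℂ | C.PosSemidef} := by
  simp only [Matrix.posSemidef_iff_dotProduct_mulVec, Set.ofPred_and, Set.ofPred_forall]
  refine IsClosed.inter ?_ (isClosed_iInter fun x => ?_)
  · exact isClosed_eq (by fun_prop) continuous_id
  · exact isClosed_le continuous_const (by fun_prop)

/-- Mean ergodic theorem for a trace-preserving positive map on matrices. -/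
theorem exists_fixed_posSemidef (L : Module.End ℂ (Matrix κ κ ℂ))
    (hL : ∀ C, C.PosSemidef → (L C).PosSemidef) (ht : ∀ C, (L C).trace = C.trace)
    {R₀ : Matrix κ κ ℂ} (hR₀ : R₀.PosSemidef) {I : Type*} (f : I → Matrix κ κ ℂ →ₗ[ℂ] ℂ)
    (hf : ∀ a r, f a ((L ^ r) R₀) = f a R₀) :
    ∃ R : Matrix κ κ ℂ, R.PosSemidef ∧ L R = R ∧ ∀ a, f a R = f a R₀ := by
  let K : Set (Matrix κ κ ℂ) := {C | C.PosSemidef} ∩ {C | C.trace = R₀.trace} ∩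
    ⋂ a, {C | f a C = f a R₀}
  have hLr : ∀ r, ((L ^ r) R₀).PosSemidef ∧ ((L ^ r) R₀).trace = R₀.trace := by
    intro r
    induction r with
    | zero => exact ⟨hR₀, rfl⟩
    | succ r ih =>
      rw [pow_succ', Module.End.mul_apply]
      exact ⟨hL _ ih.1, (ht _).trans ih.2⟩
  have hKc : IsCompact K := by
    have hB : IsCompact (Set.univ.pi fun _ : κ => Set.univ.pi fun _ : κ =>
        Metric.closedBall (0 : ℂ) R₀.trace.re) :=
      isCompact_univ_pi fun _ => isCompact_univ_pi fun _ => isCompact_closedBall _ _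
    refine IsCompact.of_isClosed_subset hB ?_ ?_
    · refine (isClosed_posSemidef.inter (isClosed_eq (by fun_prop) continuous_const)).inter
        (isClosed_iInter fun a => isClosed_eq ?_ continuous_const)
      exact LinearMap.continuous_of_finiteDimensional _
    · rintro C ⟨⟨h1, h2⟩, -⟩ i _ j _
      rw [mem_closedBall_zero_iff, ← (h2 : C.trace = R₀.trace)]
      exact PosSemidef.norm_apply_le_trace h1 i j
  -- Cesàro averages of the orbit stay in a compact set of positive matrices of fixed trace, where
  -- the functionals `f a` keep their values at `R₀`.
  let S : ℕ → Matrix κ κ ℂ := fun r => ((r : ℂ) + 1)⁻¹ • ∑ i ∈ Finset.range (r + 1), (L ^ i) R₀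
  have hr : ∀ r : ℕ, (r : ℂ) + 1 ≠ 0 := fun r => by exact_mod_cast r.succ_ne_zero
  have havg : ∀ (g : Matrix κ κ ℂ →ₗ[ℂ] ℂ), (∀ i, g ((L ^ i) R₀) = g R₀) →
      ∀ r, g (S r) = g R₀ := by
    intro g hg r
    simp only [S, map_smul, map_sum, hg, Finset.sum_const, Finset.card_range, nsmul_eq_mul,
      smul_eq_mul, Nat.cast_add, Nat.cast_one]
    rw [← mul_assoc, inv_mul_cancel₀ (hr r), one_mul]
  have hSK : ∀ r, S r ∈ K := fun r => by
    refine ⟨⟨?_, havg (Matrix.traceLinearMap κ ℂ ℂ) (fun i => (hLr i).2) r⟩,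
      Set.mem_iInter.2 fun a => havg (f a) (hf a) r⟩
    refine (Matrix.posSemidef_sum _ fun i _ => (hLr i).1).smul ?_
    have : ((r : ℂ) + 1)⁻¹ = ((((r : ℝ) + 1)⁻¹ : ℝ) : ℂ) := by push_cast; rfl
    rw [this]
    exact Complex.zero_le_real.2 (by positivity)
  have : FirstCountableTopology (Matrix κ κ ℂ) :=
    inferInstanceAs (FirstCountableTopology (κ → κ → ℂ))
  obtain ⟨R, hRK, g, hg, hlim⟩ := hKc.tendsto_subseq hSK
  refine ⟨R, hRK.1.1, ?_, fun a => Set.mem_iInter.1 hRK.2 a⟩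
  have hLc : Continuous L := LinearMap.continuous_of_finiteDimensional _
  have h1 : Filter.Tendsto (fun r => L (S (g r)) - S (g r)) Filter.atTop (nhds (L R - R)) :=
    ((hLc.tendsto R).comp hlim).sub hlim
  -- The sum telescopes. Orbit points are uniformly bounded by their trace, so the difference is
  -- `O(1/r)` and every limit point is fixed.
  have hdiff : ∀ r, L (S r) - S r = ((r : ℂ) + 1)⁻¹ • ((L ^ (r + 1)) R₀ - R₀) := by
    intro r
    simp only [S, map_smul, map_sum, ← smul_sub]
    rw [← Finset.sum_sub_distrib]
    congr 1
    have : ∀ i, L ((L ^ i) R₀) = (L ^ (i + 1)) R₀ := fun i => by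
      rw [pow_succ', Module.End.mul_apply]
    simp only [this]
    rw [Finset.sum_range_sub (fun i => (L ^ i) R₀), pow_zero, Module.End.one_apply]
  have h2 : Filter.Tendsto (fun r => L (S r) - S r) Filter.atTop (nhds 0) := by
    refine tendsto_pi_nhds.2 fun i => tendsto_pi_nhds.2 fun j => ?_
    have hb : ∀ r : ℕ, ‖(L (S r) - S r) i j‖ ≤ (2 * R₀.trace.re) * (1 / ((r : ℝ) + 1)) := by
      intro r
      rw [hdiff, Matrix.smul_apply, Matrix.sub_apply, smul_eq_mul, norm_mul, norm_inv, mul_comm,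
        one_div]
      have e : ‖(r : ℂ) + 1‖ = (r : ℝ) + 1 := by
        rw [← Complex.ofReal_natCast, ← Complex.ofReal_one, ← Complex.ofReal_add,
          Complex.norm_real, Real.norm_of_nonneg (by positivity)]
      rw [e]
      refine mul_le_mul_of_nonneg_right ((norm_sub_le _ _).trans ?_) (by positivity)
      have h3 := PosSemidef.norm_apply_le_trace (hLr (r + 1)).1 i j
      rw [(hLr (r + 1)).2] at h3
      linarith [PosSemidef.norm_apply_le_trace hR₀ i j]
    refine squeeze_zero_norm hb ?_
    simpa using tendsto_one_div_add_atTop_nhds_zero_nat.const_mul (2 * R₀.trace.re)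
  have h3 := tendsto_nhds_unique h1 (h2.comp hg.tendsto_atTop)
  exact sub_eq_zero.1 h3

end fixedPoint

/-! ### Trace-preserving form of a stationary finitely correlated state -/

section canonical
variable {δ Ω : Type} [Fintype δ] [DecidableEq δ] [Fintype Ω] [DecidableEq Ω]
  {S : Type*} [Fintype S]
  [DecidableEq S]

theorem intertwine_prod {κ : Type*} [Fintype κ] [DecidableEq κ] {V : Ω → S → Matrix δ δ ℂ}
    {W : Ω → S → Matrix κ κ ℂ} {F : Matrix δ κ ℂ} (h : ∀ r s, V r s * F = F * W r s)
    (L : List (Matrix S S ℂ)) (C : Matrix δ δ ℂ) :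
    F.conjTranspose * (L.map (kstep V)).prod C * F =
      (L.map (kstep W)).prod (F.conjTranspose * C * F) := by
  induction L with
  | nil => rfl
  | cons X L ih =>
    rw [List.map_cons, List.prod_cons, List.map_cons, List.prod_cons, Module.End.mul_apply,
      Module.End.mul_apply, ← ih, kstep_apply, kstep_apply]
    simp only [Matrix.mul_sum, Matrix.sum_mul, Matrix.mul_smul, Matrix.smul_mul]
    refine Finset.sum_congr rfl fun r _ => Finset.sum_congr rfl fun s _ =>
      Finset.sum_congr rfl fun t _ => ?_
    congr 1
    have h' : F.conjTranspose * (V r s).conjTranspose =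
        (W r s).conjTranspose * F.conjTranspose := by
      rw [← Matrix.conjTranspose_mul, h, Matrix.conjTranspose_mul]
    simp only [Matrix.mul_assoc]
    rw [h, ← Matrix.mul_assoc F.conjTranspose, h']
    simp only [Matrix.mul_assoc]

/-- Reduction of a stationary finitely correlated functional to the support of its initial state:
one obtains a trace-preserving transfer operator together with a positive fixed point. -/
theorem exists_canonical_form (V : Ω → S → Matrix δ δ ℂ) {σ : Matrix δ δ ℂ} (hσ : σ.PosSemidef)
    (hinv : ∀ C, (σ * kstep V 1 C).trace = (σ * C).trace)
    (hpad : ∀ (L : List (Matrix S S ℂ)) r, (σ * (L.map (kstep V)).prod ((kstep V 1 ^ r) 1)).trace =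
      (σ * (L.map (kstep V)).prod 1).trace) :
    ∃ (κ : Type) (_ : Fintype κ) (_ : DecidableEq κ) (W : Ω → S → Matrix κ κ ℂ)
      (Q : Matrix κ κ ℂ), (∀ C, (kstep W 1 C).trace = C.trace) ∧
      kstep W 1 (Q.conjTranspose * Q) = Q.conjTranspose * Q ∧
      ∀ L : List (Matrix S S ℂ), ((L.map (kstep W)).prod (Q.conjTranspose * Q)).trace =
        (σ * (L.map (kstep V)).prod 1).trace := by
  classical
  obtain ⟨U, hU, p, hp, rfl⟩ := PosSemidef.exists_diagonal hσ
  set σ := U * Matrix.diagonal (fun i => (p i : ℂ)) * star U with hσdef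
  let κ : Type := {i // p i ≠ 0}
  have hU1 : star U * U = 1 := (Matrix.mem_unitaryGroup_iff').1 hU
  -- `F` is the square root of `σ` restricted to its support, and `G` is a left inverse of `F`.
  -- After compression by `F` the initial state becomes the trace.
  let F : Matrix δ κ ℂ := Matrix.of fun a i => U a i * (√(p i) : ℂ)
  let G : Matrix κ δ ℂ := Matrix.of fun i a => ((√(p i) : ℝ) : ℂ)⁻¹ * star (U a i)
  have hs : ∀ i : κ, ((√(p i) : ℝ) : ℂ) ≠ 0 := fun i => by
    have := (Real.sqrt_pos.2 (lt_of_le_of_ne (hp i) i.2.symm)).ne'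
    exact_mod_cast this
  have hGF : G * F = 1 := by
    ext i j
    rw [Matrix.mul_apply]
    have h1 : ∑ a, star (U a i) * U a j = (1 : Matrix δ δ ℂ) i j := by
      rw [← hU1, Matrix.mul_apply]
      rfl
    have h2 : ∀ a, G i a * F a j =
        ((√(p i) : ℝ) : ℂ)⁻¹ * ((√(p j) : ℝ) : ℂ) * (star (U a i) * U a j) :=
      fun a => by simp only [G, F, Matrix.of_apply]; ring
    simp only [h2, ← Finset.mul_sum, h1]
    by_cases h : i = j
    · subst h
      rw [Matrix.one_apply_eq, Matrix.one_apply_eq, mul_one, inv_mul_cancel₀ (hs i)]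
    · rw [Matrix.one_apply_ne h, Matrix.one_apply_ne fun h' => h (Subtype.ext h'), mul_zero]
  have hFF : F * F.conjTranspose = σ := by
    ext a b
    have h2 : ∀ i : κ, F a i * F.conjTranspose i b = U a i * (p i : ℂ) * star (U b i) := by
      intro i
      simp only [F, Matrix.conjTranspose_apply, Matrix.of_apply, star_mul', RCLike.star_def,
        Complex.conj_ofReal]
      have : ((√(p i) : ℝ) : ℂ) * ((√(p i) : ℝ) : ℂ) = (p i : ℂ) := by
        rw [← Complex.ofReal_mul, Real.mul_self_sqrt (hp i)]
      rw [← this]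
      ring
    rw [Matrix.mul_apply, hσdef, Matrix.mul_apply]
    simp only [h2, Matrix.mul_diagonal, Matrix.star_apply]
    rw [← Fintype.sum_subtype_add_sum_subtype (fun i => p i ≠ 0)
      (fun i => U a i * (p i : ℂ) * star (U b i)), left_eq_add]
    refine Finset.sum_eq_zero fun i _ => ?_
    rw [not_not.1 i.2]
    simp
  have htr : ∀ C, (σ * C).trace = (F.conjTranspose * C * F).trace := fun C => by
    rw [← hFF, Matrix.trace_mul_comm, ← Matrix.mul_assoc, Matrix.trace_mul_comm, Matrix.mul_assoc]
  let W : Ω → S → Matrix κ κ ℂ := fun r s => G * V r s * F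
  -- The range of `F` is invariant under the Kraus operators. `Z = 1 - FG` vanishes on it, so
  -- invariance of `σ` makes `∑ Tr (Z V F)* (Z V F)` zero, and each term vanishes.
  have hVF : ∀ r s, V r s * F = F * W r s := by
    let Z : Matrix δ δ ℂ := 1 - F * G
    have hZF : Z * F = 0 := by
      simp only [Z]
      rw [Matrix.sub_mul, Matrix.mul_assoc, hGF, Matrix.one_mul, Matrix.mul_one, sub_self]
    have h0 := hinv (Z.conjTranspose * Z)
    rw [htr, htr] at h0
    have e1 : F.conjTranspose * (Z.conjTranspose * Z) * F = 0 := by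
      rw [Matrix.mul_assoc, Matrix.mul_assoc, hZF, Matrix.mul_zero, Matrix.mul_zero]
    rw [e1, Matrix.trace_zero, kstep_one] at h0
    have e2 : F.conjTranspose * (∑ r, ∑ s, (V r s).conjTranspose * (Z.conjTranspose * Z) * V r s) *
        F = ∑ r, ∑ s, (Z * V r s * F).conjTranspose * (Z * V r s * F) := by
      simp only [Matrix.mul_sum, Matrix.sum_mul, Matrix.conjTranspose_mul, Matrix.mul_assoc]
    rw [e2] at h0
    simp only [Matrix.trace_sum] at h0
    have hn : ∀ r s, 0 ≤ ((Z * V r s * F).conjTranspose * (Z * V r s * F)).trace := fun r s =>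
      (Matrix.posSemidef_conjTranspose_mul_self _).trace_nonneg
    intro r s
    have h1 := (Finset.sum_eq_zero_iff_of_nonneg fun r _ => Finset.sum_nonneg fun s _ => hn r s).1
      h0 r (Finset.mem_univ r)
    have h2 := (Finset.sum_eq_zero_iff_of_nonneg fun s _ => hn r s).1 h1 s (Finset.mem_univ s)
    have h3 : Z * V r s * F = 0 := Matrix.trace_conjTranspose_mul_self_eq_zero_iff.1 h2
    simp only [Z] at h3
    rw [Matrix.sub_mul, Matrix.sub_mul, Matrix.one_mul, sub_eq_zero] at h3
    simp only [W]
    rw [h3]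
    simp only [Matrix.mul_assoc]
  have hC : ∀ C' : Matrix κ κ ℂ, C' = F.conjTranspose * (G.conjTranspose * C' * G) * F := by
    intro C'
    have hGF' : F.conjTranspose * G.conjTranspose = 1 := by
      rw [← Matrix.conjTranspose_mul, hGF, Matrix.conjTranspose_one]
    rw [← Matrix.mul_assoc, ← Matrix.mul_assoc, hGF', Matrix.one_mul, Matrix.mul_assoc, hGF,
      Matrix.mul_one]
  have hone : ∀ C, F.conjTranspose * kstep V 1 C * F = kstep W 1 (F.conjTranspose * C * F) :=
    fun C => by simpa using intertwine_prod hVF [1] C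
  have htp : ∀ C, (kstep W 1 C).trace = C.trace := by
    intro C
    conv_lhs => rw [hC C]
    rw [← hone, ← htr, hinv, htr, ← hC]
  have hpow : ∀ r, (kstep W 1 ^ r) (F.conjTranspose * F) =
      F.conjTranspose * ((kstep V 1 ^ r) 1) * F := by
    intro r
    induction r with
    | zero => simp
    | succ r ih =>
      rw [pow_succ', Module.End.mul_apply, ih, ← hone, pow_succ', Module.End.mul_apply]
  -- `F* F`, the compressed identity, need not be fixed. The padding hypothesis `hpad` keeps all
  -- expectation values constant along its orbit, so a limit of Cesàro averages can replace it.
  obtain ⟨R, hR, hfix, hval⟩ := exists_fixed_posSemidef (kstep W 1)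
    (fun C h => kstep_posSemidef W h) htp (Matrix.posSemidef_conjTranspose_mul_self F)
    (fun L : List (Matrix S S ℂ) => Matrix.traceLinearMap κ ℂ ℂ ∘ₗ (L.map (kstep W)).prod)
    (fun L r => by
      change ((L.map (kstep W)).prod _).trace = ((L.map (kstep W)).prod _).trace
      have h1 : F.conjTranspose * F = F.conjTranspose * (1 : Matrix δ δ ℂ) * F := by
        rw [Matrix.mul_one]
      rw [hpow, ← intertwine_prod hVF, ← htr, hpad, htr, intertwine_prod hVF, ← h1])
  obtain ⟨Q, rfl⟩ := PosSemidef.exists_star_mul hR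
  refine ⟨κ, inferInstance, inferInstance, W, Q, htp, hfix, fun L => ?_⟩
  have h1 : F.conjTranspose * F = F.conjTranspose * (1 : Matrix δ δ ℂ) * F := by rw [Matrix.mul_one]
  refine (hval L).trans ?_
  change ((L.map (kstep W)).prod _).trace = _
  rw [h1, ← intertwine_prod hVF, ← htr]

end canonical
end QChain
end

noncomputable section
open scoped ComplexOrder Kronecker
set_option linter.unusedSectionVars false
namespace QChain

/-! ### Positive functionals on C*-algebras and ultrafilter limits -/

section positive
variable {A : Type*}

theorem IsPositive.norm_apply_sq_le [Ring A] [StarRing A] [Algebra ℂ A] [StarModule ℂ A]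
    {φ : A →ₗ[ℂ] ℂ} (hφ : IsPositive φ) (a : A) :
    ‖φ a‖ ^ 2 ≤ (φ 1).re * (φ (star a * a)).re := by
  -- Positivity at the element `-t φ(a) 1 + a`, for real `t`; the discriminant of this quadratic
  -- gives the Cauchy-Schwarz inequality.
  have hq : ∀ t : ℝ, 0 ≤ (‖φ a‖ ^ 2 * (φ 1).re) * (t * t) + (-2 * ‖φ a‖ ^ 2) * t +
      (φ (star a * a)).re := by
    intro t
    have h := (Complex.nonneg_iff.1 (hφ ((-(t : ℂ) * φ a) • 1 + a))).1
    have e : φ (star ((-(t : ℂ) * φ a) • 1 + a) * ((-(t : ℂ) * φ a) • 1 + a)) =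
        ((t : ℂ) * t * (star (φ a) * φ a)) * φ 1 - 2 * (t : ℂ) * (star (φ a) * φ a) +
          φ (star a * a) := by
      rw [star_add, star_smul, star_one, add_mul, mul_add, mul_add, smul_mul_smul_comm, one_mul,
        smul_mul_assoc, one_mul, mul_smul_comm, mul_one, map_add, map_add, map_add, map_smul,
        map_smul, map_smul, hφ.map_star, smul_eq_mul, smul_eq_mul, smul_eq_mul, star_mul',
        star_neg, RCLike.star_def, Complex.conj_ofReal]
      ring
    have e2 : star (φ a) * φ a = ((‖φ a‖ ^ 2 : ℝ) : ℂ) := by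
      rw [RCLike.star_def, Complex.conj_mul']
      push_cast
      rfl
    have e3 : ((t : ℂ) * t * ((‖φ a‖ ^ 2 : ℝ) : ℂ)) * φ 1 -
        2 * (t : ℂ) * ((‖φ a‖ ^ 2 : ℝ) : ℂ) + φ (star a * a) =
        ((t * t * ‖φ a‖ ^ 2 : ℝ) : ℂ) * φ 1 - ((2 * t * ‖φ a‖ ^ 2 : ℝ) : ℂ) +
          φ (star a * a) := by
      push_cast
      ring
    rw [e, e2, e3, Complex.add_re, Complex.sub_re, Complex.re_ofReal_mul, Complex.ofReal_re] at h
    linarith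
  have hd := discrim_le_zero hq
  rw [discrim] at hd
  rcases eq_or_ne (φ a) 0 with h0 | h0
  · rw [h0, norm_zero]
    have h1 := (Complex.nonneg_iff.1 (hφ 1)).1
    rw [star_one, one_mul] at h1
    have h2 := (Complex.nonneg_iff.1 (hφ a)).1
    simpa using mul_nonneg h1 h2
  · have hp : 0 < ‖φ a‖ ^ 2 := by positivity
    have : ‖φ a‖ ^ 2 * (‖φ a‖ ^ 2) ≤ ‖φ a‖ ^ 2 * ((φ 1).re * (φ (star a * a)).re) := by
      nlinarith
    exact le_of_mul_le_mul_left this hp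

theorem IsPositive.nonneg_apply [CStarAlgebra A] [PartialOrder A] [StarOrderedRing A]
    {φ : A →ₗ[ℂ] ℂ} (hφ : IsPositive φ) {a : A} (ha : 0 ≤ a) : 0 ≤ φ a := by
  obtain ⟨y, rfl⟩ := CStarAlgebra.nonneg_iff_eq_star_mul_self.1 ha
  exact hφ y

/-- Automatic continuity of positive functionals: combine Cauchy-Schwarz with `a* a ≤ ‖a‖² 1`. -/
theorem IsPositive.norm_apply_le [CStarAlgebra A] {φ : A →ₗ[ℂ] ℂ} (hφ : IsPositive φ) (a : A) :
    ‖φ a‖ ≤ (φ 1).re * ‖a‖ := by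
  let _ := CStarAlgebra.spectralOrder A
  have _ := CStarAlgebra.spectralOrderedRing A
  have h1 := (Complex.nonneg_iff.1 (hφ 1)).1
  rw [star_one, one_mul] at h1
  have h2 := (Complex.nonneg_iff.1 (hφ.nonneg_apply
    (sub_nonneg.2 (CStarAlgebra.star_mul_le_algebraMap_norm_sq (a := a))))).1
  have e : algebraMap ℝ A (‖a‖ ^ 2) = ((‖a‖ ^ 2 : ℝ) : ℂ) • (1 : A) := by
    rw [Algebra.algebraMap_eq_smul_one]
    exact (Complex.coe_smul _ _).symm
  rw [e, map_sub, map_smul, smul_eq_mul, Complex.sub_re, Complex.re_ofReal_mul] at h2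
  have h3 := hφ.norm_apply_sq_le a
  refine le_of_sq_le_sq ?_ (by positivity)
  calc ‖φ a‖ ^ 2 ≤ (φ 1).re * (φ (star a * a)).re := h3
    _ ≤ (φ 1).re * (‖a‖ ^ 2 * (φ 1).re) := mul_le_mul_of_nonneg_left (by linarith) h1
    _ = _ := by ring

theorem IsPositive.norm_apply_le_of_isClosed {B : Type*} [CStarAlgebra B] {S : StarSubalgebra ℂ B}
    (hS : IsClosed (S : Set B)) {φ : S →ₗ[ℂ] ℂ} (hφ : IsPositive φ) (a : S) :
    ‖φ a‖ ≤ (φ 1).re * ‖a‖ :=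
  have _ := hS
  IsPositive.norm_apply_le (A := S) hφ a

theorem exists_near_of_mem_topologicalClosure [CStarAlgebra A] {F : ℕ → StarSubalgebra ℂ A}
    (hF : Monotone F) {x : A} (hx : x ∈ (⨆ n, F n).topologicalClosure) {ε : ℝ} (hε : 0 < ε) :
    ∃ n, ∃ y ∈ F n, ‖x - y‖ < ε := by
  have h : x ∈ closure ((⨆ n, F n : StarSubalgebra ℂ A) : Set A) := hx
  rw [StarSubalgebra.coe_iSup_of_directed hF.directed_le] at h
  obtain ⟨y, hy, hxy⟩ := Metric.mem_closure_iff.1 h ε hε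
  obtain ⟨n, hn⟩ := Set.mem_iUnion.1 hy
  exact ⟨n, y, hn, by rwa [← dist_eq_norm]⟩

/-- Pointwise bounded sequences of linear functionals have pointwise limits along an ultrafilter. -/
theorem exists_limit_functional [AddCommGroup A] [Module ℂ A] (f : ℕ → A →ₗ[ℂ] ℂ)
    (hf : ∀ x, ∃ C, ∀ n, ‖f n x‖ ≤ C) : ∃ g : A →ₗ[ℂ] ℂ, ∀ x,
      Filter.Tendsto (fun n => f n x) (Filter.hyperfilter ℕ : Filter ℕ) (nhds (g x)) := by
  have h : ∀ x, ∃ z, Filter.Tendsto (fun n => f n x) (Filter.hyperfilter ℕ : Filter ℕ)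
      (nhds z) := by
    intro x
    obtain ⟨C, hC⟩ := hf x
    obtain ⟨z, -, hz⟩ := (isCompact_closedBall (0 : ℂ) C).ultrafilter_le_nhds
      ((Filter.hyperfilter ℕ).map fun n => f n x) (by
        rw [Ultrafilter.coe_map, Filter.le_principal_iff, Filter.mem_map]
        exact Filter.univ_mem' fun n => mem_closedBall_zero_iff.2 (hC n))
    exact ⟨z, hz⟩
  choose g hg using h
  exact ⟨{ toFun := g
           map_add' := fun x y => tendsto_nhds_unique (hg (x + y)) (by
            simpa only [map_add] using (hg x).add (hg y))
           map_smul' := fun c x => tendsto_nhds_unique (hg (c • x)) (by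
            simpa only [map_smul, RingHom.id_apply] using (hg x).const_smul c) }, hg⟩

end positive

/-! ### Functionals given by density matrices in windows -/

section windows
variable {d : ℕ} [NeZero d] {κ Ω : Type} [Fintype κ] [DecidableEq κ] [Fintype Ω] [DecidableEq Ω]

theorem prodOp_append {a b : ℕ} (m : ℤ) (A : Fin a → Matrix (Fin d) (Fin d) ℂ)
    (B : Fin b → Matrix (Fin d) (Fin d) ℂ) :
    prodOp m (Fin.append A B) = prodOp m A * prodOp (m + a) B := by
  rw [prodOp, prodOp, prodOp, ← List.prod_append, ← List.ofFn_fin_append]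
  congr 2
  ext1 j
  refine Fin.addCases (fun j => ?_) (fun j => ?_) j
  · simp
  · simp [add_assoc]

theorem compress_prodOp_eq {N : ℕ} (m : ℤ) (A : Fin N → Matrix (Fin d) (Fin d) ℂ) :
    compress m N (prodOp m A) = tensor A := by
  ext s t
  exact compress_prodOp m A s t

/-- Composition of Kraus families for adjacent windows. -/
def kappend {S Ω' : Type*} {a b : ℕ} (V : Ω → (Fin a → S) → Matrix κ κ ℂ)
    (V' : Ω' → (Fin b → S) → Matrix κ κ ℂ) : Ω × Ω' → (Fin (a + b) → S) → Matrix κ κ ℂ :=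
  fun r s => kcomp V V' r ((Fin.appendEquiv a b).symm s)

theorem kstep_kappend {S Ω' : Type*} [Fintype S] [DecidableEq S] [Fintype Ω'] [DecidableEq Ω']
    {a b : ℕ} (V : Ω → (Fin a → S) → Matrix κ κ ℂ) (V' : Ω' → (Fin b → S) → Matrix κ κ ℂ)
    (A : Fin a → Matrix S S ℂ) (B : Fin b → Matrix S S ℂ) :
    kstep (kappend V V') (tensor (Fin.append A B)) = kstep V (tensor A) * kstep V' (tensor B) := by
  rw [← kstep_kcomp]
  refine (kstep_equiv (kcomp V V') (Fin.appendEquiv a b).symm _).trans ?_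
  congr 1
  ext s t
  simp [tensor, Fin.prod_univ_add, Matrix.kroneckerMap_apply, Fin.appendEquiv]

/-- The compression of `x* x` is the Gram matrix of the vectors `x e_s`. This needs no locality of
`x`, so window functionals are positive on all bounded operators. -/
theorem compress_star_mul_self_posSemidef (m : ℤ) (N : ℕ) (x : ChainOp d) :
    (compress m N (star x * x)).PosSemidef := by
  have h : compress m N (star x * x) =
      Matrix.gram ℂ fun s : Fin N → Fin d => x (basisVec (confOf m s)) := by
    refine Matrix.ext fun s t => ?_
    have h1 := ContinuousLinearMap.adjoint_inner_right x (basisVec (confOf m s))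
      (x (basisVec (confOf m t)))
    rw [inner_basisVec, ← ContinuousLinearMap.star_eq_adjoint] at h1
    exact h1
  exact h ▸ Matrix.posSemidef_gram ℂ _

/-- The functional with density matrix `D` in a window. -/
def windowFunctional (m : ℤ) {N : ℕ} (D : Matrix (Fin N → Fin d) (Fin N → Fin d) ℂ) :
    ChainOp d →ₗ[ℂ] ℂ :=
  Matrix.traceLinearMap _ ℂ ℂ ∘ₗ LinearMap.mulLeft ℂ D ∘ₗ compress m N

theorem windowFunctional_apply (m : ℤ) {N : ℕ} (D : Matrix (Fin N → Fin d) (Fin N → Fin d) ℂ)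
    (x : ChainOp d) : windowFunctional m D x = (D * compress m N x).trace := rfl

theorem windowFunctional_isPositive (m : ℤ) {N : ℕ}
    {D : Matrix (Fin N → Fin d) (Fin N → Fin d) ℂ} (hD : D.PosSemidef) :
    IsPositive (windowFunctional m D) := by
  intro x
  obtain ⟨B, rfl⟩ := PosSemidef.exists_star_mul hD
  rw [windowFunctional_apply, mul_assoc, Matrix.trace_mul_comm, Matrix.star_eq_conjTranspose]
  exact ((compress_star_mul_self_posSemidef m N x).mul_mul_conjTranspose_same B).trace_nonneg

end windows

/-! ### Transfer representations and the decompositions they induce -/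

section transfer
variable {d : ℕ} [NeZero d]

/-- A representation of a functional on the chain by a trace-preserving transfer operator with a
positive fixed point. -/
structure IsTransfer {κ Ω : Type} [Fintype κ] [DecidableEq κ] [Fintype Ω] [DecidableEq Ω]
    (φ : quasiLocalAlg d →ₗ[ℂ] ℂ) (W : Ω → Fin d → Matrix κ κ ℂ) (Q : Matrix κ κ ℂ) : Prop where
  isState : IsState φ
  trace_step : ∀ C, (kstep W 1 C).trace = C.trace
  step_fixed : kstep W 1 (Q.conjTranspose * Q) = Q.conjTranspose * Q
  apply_prodOp : ∀ (m : ℤ) (N : ℕ) (A : Fin N → Matrix (Fin d) (Fin d) ℂ) (x : quasiLocalAlg d),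
    (x : ChainOp d) = prodOp m A →
      φ x = ((List.ofFn fun j => kstep W (A j)).prod (Q.conjTranspose * Q)).trace

/-- The product of single-site observables at consecutive sites. -/
def siteProd : ℤ → List (Matrix (Fin d) (Fin d) ℂ) → quasiLocalAlg d
  | _, [] => 1
  | m, A :: L => siteEmb d m A * siteProd (m + 1) L

theorem siteProd_ofFn {N : ℕ} (m : ℤ) (A : Fin N → Matrix (Fin d) (Fin d) ℂ) :
    siteProd m (List.ofFn A) = (List.ofFn fun j : Fin N => siteEmb d (m + (j : ℤ)) (A j)).prod := by
  induction N generalizing m with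
  | zero => simp [siteProd]
  | succ N ih =>
    rw [List.ofFn_succ, siteProd, ih, List.ofFn_succ, List.prod_cons]
    simp [add_assoc, add_comm (1 : ℤ)]

theorem coe_siteProd_ofFn {N : ℕ} (m : ℤ) (A : Fin N → Matrix (Fin d) (Fin d) ℂ) :
    (siteProd m (List.ofFn A) : ChainOp d) = prodOp m A := by
  induction N generalizing m with
  | zero => simp [siteProd, prodOp]
  | succ N ih =>
    rw [List.ofFn_succ, siteProd, prodOp_succ, ← ih]
    rfl

/-- Appending identities does not change the observable, although it changes the nested expression
when `E` is not unital. This supplies the padding hypothesis of `exists_canonical_form`. -/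
theorem siteProd_append_replicate (m : ℤ) (L : List (Matrix (Fin d) (Fin d) ℂ)) (r : ℕ) :
    siteProd m (L ++ List.replicate r 1) = siteProd m L := by
  induction L generalizing m with
  | nil =>
    induction r generalizing m with
    | zero => rfl
    | succ r ih =>
      have := ih (m + 1)
      rw [List.nil_append] at this
      rw [List.nil_append, List.replicate_succ]
      change siteEmb d m 1 * siteProd (m + 1) (List.replicate r 1) = 1
      rw [this, map_one, one_mul]
      rfl
  | cons A L ih => rw [List.cons_append, siteProd, ih, siteProd]

theorem nestedE_eq {Ω : Type} [Fintype Ω] [DecidableEq Ω]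
    {E : Matrix (Fin d × Fin d) (Fin d × Fin d) ℂ →ₗ[ℂ] Matrix (Fin d) (Fin d) ℂ}
    {V : Ω → Fin d → Matrix (Fin d) (Fin d) ℂ} (hV : ∀ A C, E (A ⊗ₖ C) = kstep V A C)
    (L : List (Matrix (Fin d) (Fin d) ℂ)) : nestedE E L = (L.map (kstep V)).prod 1 := by
  induction L with
  | nil => rfl
  | cons A L ih => rw [nestedE, hV, ih, List.map_cons, List.prod_cons, Module.End.mul_apply]

theorem exists_trace_eq {δ : Type*} [Fintype δ] [DecidableEq δ] {ρ : Matrix δ δ ℂ →ₗ[ℂ] ℂ}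
    (hρ : IsPositive ρ) : ∃ σ : Matrix δ δ ℂ, σ.PosSemidef ∧ ∀ C, ρ C = (σ * C).trace := by
  let σ : Matrix δ δ ℂ := Matrix.of fun a b => ρ (Matrix.single b a 1)
  have h : ∀ C, ρ C = (σ * C).trace := by
    intro C
    conv_lhs => rw [Matrix.matrix_eq_sum_single C]
    rw [Matrix.trace, Finset.sum_comm]
    simp only [map_sum, Matrix.diag_apply, Matrix.mul_apply, σ, Matrix.of_apply]
    refine Finset.sum_congr rfl fun a _ => Finset.sum_congr rfl fun b _ => ?_
    have : Matrix.single b a (C b a) = C b a • Matrix.single b a 1 := by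
      rw [Matrix.smul_single, smul_eq_mul, mul_one]
    rw [this, map_smul, smul_eq_mul, mul_comm]
  refine ⟨σ, ?_, h⟩
  refine Matrix.PosSemidef.of_dotProduct_mulVec_nonneg ?_ fun v => ?_
  · ext a b
    rw [Matrix.conjTranspose_apply]
    simp only [σ, Matrix.of_apply]
    rw [← hρ.map_star, Matrix.star_eq_conjTranspose, Matrix.conjTranspose_single, star_one]
  · obtain ⟨B, hB⟩ := PosSemidef.exists_star_mul (Matrix.posSemidef_vecMulVec_self_star v)
    have h1 := hρ B
    rwa [← hB, h, Matrix.mul_vecMulVec, Matrix.trace_vecMulVec, dotProduct_comm] at h1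

theorem exists_isTransfer {φ : quasiLocalAlg d →ₗ[ℂ] ℂ}
    {E : Matrix (Fin d × Fin d) (Fin d × Fin d) ℂ →ₗ[ℂ] Matrix (Fin d) (Fin d) ℂ}
    {ρ : Matrix (Fin d) (Fin d) ℂ →ₗ[ℂ] ℂ} (h : IsFinitelyCorrelated φ E ρ) :
    ∃ (κ Ω : Type) (_ : Fintype κ) (_ : DecidableEq κ) (_ : Fintype Ω) (_ : DecidableEq Ω)
      (W : Ω → Fin d → Matrix κ κ ℂ) (Q : Matrix κ κ ℂ), IsTransfer φ W Q := by
  obtain ⟨K, V, hV⟩ := exists_kraus h.completelyPositive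
  obtain ⟨σ, hσ, hρ⟩ := exists_trace_eq h.isState_initial.1
  have happ : ∀ m L, φ (siteProd m L) = (σ * (L.map (kstep V)).prod 1).trace := by
    intro m L
    have := h.apply_tensor m _ L.get
    rw [← siteProd_ofFn, List.ofFn_get] at this
    rw [this, hρ, nestedE_eq hV]
  obtain ⟨κ, i1, i2, W, Q, h1, h2, h3⟩ := exists_canonical_form V hσ
    (fun C => by rw [← hV, ← hρ, ← hρ, h.invariant]) (fun L r => by
      rw [← happ 0 L, ← siteProd_append_replicate 0 L r, happ, List.map_append, List.prod_append,
        List.map_replicate, List.prod_replicate, Module.End.mul_apply])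
  refine ⟨κ, _, i1, i2, inferInstance, inferInstance, W, Q, h.isState, h1, h2, ?_⟩
  intro m N A x hx
  have : x = siteProd m (List.ofFn A) := Subtype.ext (by rw [hx, coe_siteProd_ofFn])
  rw [this, happ, ← h3, List.map_ofFn]
  rfl

section extension
variable {κ Ω : Type} [Fintype κ] [DecidableEq κ] [Fintype Ω] [DecidableEq Ω]
  {φ : quasiLocalAlg d →ₗ[ℂ] ℂ} {W : Ω → Fin d → Matrix κ κ ℂ} {Q : Matrix κ κ ℂ}

theorem eqOn_of_prodOp {N : ℕ} {Λ : Finset ℤ} {m : ℤ} (hΛ : IsWindow Λ m N)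
    {f g : ChainOp d →ₗ[ℂ] ℂ} (h : ∀ A : Fin N → Matrix (Fin d) (Fin d) ℂ,
      f (prodOp m A) = g (prodOp m A)) {x : ChainOp d} (hx : x ∈ localAlg d Λ) : f x = g x := by
  refine LinearMap.eqOn_span (f := f) (g := g) ?_ (mem_span_prodOp hΛ hx)
  rintro _ ⟨A, rfl⟩
  exact h A

theorem eqOn_localAlg {N : ℕ} {Λ : Finset ℤ} {m : ℤ} (hΛ : IsWindow Λ m N)
    {f g : localAlg d Λ →ₗ[ℂ] ℂ}
    (h : ∀ A, f ⟨prodOp m A, prodOp_mem hΛ A⟩ = g ⟨prodOp m A, prodOp_mem hΛ A⟩) : f = g := by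
  have hs : Submodule.span ℂ (Set.range fun A : Fin N → Matrix (Fin d) (Fin d) ℂ =>
      (⟨prodOp m A, prodOp_mem hΛ A⟩ : localAlg d Λ)) = ⊤ := by
    refine Submodule.map_injective_of_injective
      (f := (localAlg d Λ).subtype.toAlgHom.toLinearMap) Subtype.val_injective ?_
    rw [Submodule.map_span, ← Set.range_comp]
    refine le_antisymm (Submodule.span_le.2 ?_) ?_
    · rintro _ ⟨A, rfl⟩
      exact ⟨⟨prodOp m A, prodOp_mem hΛ A⟩, trivial, rfl⟩
    · rintro _ ⟨x, -, rfl⟩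
      exact mem_span_prodOp hΛ x.2
  refine LinearMap.ext_on hs ?_
  rintro _ ⟨A, rfl⟩
  exact h A

/-- The values of a functional with a transfer operator on a local algebra. -/
theorem IsTransfer.apply_local (h : IsTransfer φ W Q) {N : ℕ} {Λ : Finset ℤ} {m : ℤ}
    (hΛ : IsWindow Λ m N) {x : quasiLocalAlg d} (hx : (x : ChainOp d) ∈ localAlg d Λ) :
    φ x = (kstep (word fun _ : Fin N => W) (compress m N (x : ChainOp d))
      (Q.conjTranspose * Q)).trace := by
  have e := eqOn_localAlg hΛ
    (f := φ ∘ₗ (StarSubalgebra.inclusion (localAlg_le Λ)).toAlgHom.toLinearMap)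
    (g := windowFunctional m (kdensity (word fun _ : Fin N => W) Q) ∘ₗ
      (localAlg d Λ).subtype.toAlgHom.toLinearMap) fun A => by
    change φ _ = windowFunctional m _ (prodOp m A)
    rw [windowFunctional_apply, trace_kdensity, compress_prodOp_eq, kstep_word]
    exact h.apply_prodOp m N A _ rfl
  have e' := LinearMap.congr_fun e ⟨x, hx⟩
  change φ x = windowFunctional m _ (x : ChainOp d) at e'
  rw [e', windowFunctional_apply, trace_kdensity]

/-- The Kraus family `F` in the middle window, and the free evolution on `M` sites to the left and
to the right. -/
def paddedKraus (W : Ω → Fin d → Matrix κ κ ℂ) {N : ℕ} (F : (Fin N → Fin d) → Matrix κ κ ℂ)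
    (M : ℕ) : ((Fin M → Ω) × Unit) × (Fin M → Ω) → (Fin (M + N + M) → Fin d) → Matrix κ κ ℂ :=
  kappend (kappend (word fun _ => W) fun _ : Unit => F) (word fun _ => W)

/-- The functional of a Kraus operator in the middle window. -/
def paddedFunctional (W : Ω → Fin d → Matrix κ κ ℂ) (Q : Matrix κ κ ℂ) {N : ℕ}
    (F : (Fin N → Fin d) → Matrix κ κ ℂ) (m : ℤ) (M : ℕ) : ChainOp d →ₗ[ℂ] ℂ :=
  windowFunctional (m - M) (kdensity (paddedKraus W F M) Q)

theorem paddedFunctional_prodOp {N : ℕ} (F : (Fin N → Fin d) → Matrix κ κ ℂ) (m : ℤ) (M : ℕ)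
    (A A'' : Fin M → Matrix (Fin d) (Fin d) ℂ) (A' : Fin N → Matrix (Fin d) (Fin d) ℂ) :
    paddedFunctional W Q F m M (prodOp (m - M) (Fin.append (Fin.append A A') A'')) =
      ((List.ofFn fun j => kstep W (A j)).prod (kstep (fun _ : Unit => F) (tensor A')
        ((List.ofFn fun j => kstep W (A'' j)).prod (Q.conjTranspose * Q)))).trace := by
  rw [paddedFunctional, windowFunctional_apply, trace_kdensity, compress_prodOp_eq, paddedKraus,
    kstep_kappend, kstep_kappend, kstep_word, kstep_word]
  rfl

theorem IsTransfer.prod_step_fixed (h : IsTransfer φ W Q) (M : ℕ) :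
    (List.ofFn fun _ : Fin M => kstep W 1).prod (Q.conjTranspose * Q) = Q.conjTranspose * Q := by
  rw [List.ofFn_const, List.prod_replicate]
  induction M with
  | zero => rfl
  | succ M ih => rw [pow_succ, Module.End.mul_apply, h.step_fixed, ih]

theorem IsTransfer.trace_prod_step (h : IsTransfer φ W Q) (M : ℕ) (C : Matrix κ κ ℂ) :
    ((List.ofFn fun _ : Fin M => kstep W 1).prod C).trace = C.trace := by
  rw [List.ofFn_const, List.prod_replicate]
  induction M with
  | zero => rfl
  | succ M ih => rw [pow_succ', Module.End.mul_apply, h.trace_step, ih]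

/-- The free steps on the left disappear under the trace, and those on the right act on their fixed
point. Hence the value in the middle window does not depend on the padding. -/
theorem IsTransfer.paddedFunctional_local (h : IsTransfer φ W Q) {N : ℕ} {Λ : Finset ℤ} {m : ℤ}
    (hΛ : IsWindow Λ m N) (F : (Fin N → Fin d) → Matrix κ κ ℂ) (M : ℕ) {x : ChainOp d}
    (hx : x ∈ localAlg d Λ) : paddedFunctional W Q F m M x =
      (kstep (fun _ : Unit => F) (compress m N x) (Q.conjTranspose * Q)).trace := by
  have e' : paddedFunctional W Q F m M x =
      windowFunctional m (kdensity (fun _ : Unit => F) Q) x := by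
    refine eqOn_of_prodOp hΛ (fun A => ?_) hx
    have e1 : prodOp m A = prodOp (m - M) (Fin.append (Fin.append (fun _ : Fin M => 1) A)
        fun _ : Fin M => 1) := by
      rw [prodOp_append, prodOp_append, prodOp_one, prodOp_one, one_mul, mul_one, sub_add_cancel]
    rw [windowFunctional_apply, trace_kdensity, compress_prodOp_eq, e1, paddedFunctional_prodOp,
      h.trace_prod_step, h.prod_step_fixed]
  rw [e', windowFunctional_apply, trace_kdensity]

/-- Summing over the Kraus family restores the free evolution in the middle, hence the original
state on the whole padded window. -/
theorem IsTransfer.sum_paddedFunctional (h : IsTransfer φ W Q) {N : ℕ} {m : ℤ} {I : Type*}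
    [Fintype I] [DecidableEq I] (F : I → (Fin N → Fin d) → Matrix κ κ ℂ)
    (hF : ∀ A : Fin N → Matrix (Fin d) (Fin d) ℂ,
      kstep F (tensor A) = (List.ofFn fun j => kstep W (A j)).prod)
    {M : ℕ} {Λ : Finset ℤ} (hΛ : IsWindow Λ (m - M) (M + N + M)) {x : quasiLocalAlg d}
    (hx : (x : ChainOp d) ∈ localAlg d Λ) :
    ∑ i, paddedFunctional W Q (F i) m M (x : ChainOp d) = φ x := by
  have e := eqOn_localAlg hΛ
    (f := (∑ i, paddedFunctional W Q (F i) m M) ∘ₗ (localAlg d Λ).subtype.toAlgHom.toLinearMap)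
    (g := φ ∘ₗ (StarSubalgebra.inclusion (localAlg_le Λ)).toAlgHom.toLinearMap) fun A => by
    change (∑ i, paddedFunctional W Q (F i) m M) (prodOp (m - M) A) = φ _
    rw [h.apply_prodOp (m - M) (M + N + M) A _ rfl, LinearMap.sum_apply]
    obtain ⟨A₁, A₃, rfl⟩ : ∃ (A₁ : Fin (M + N) → Matrix (Fin d) (Fin d) ℂ)
        (A₃ : Fin M → Matrix (Fin d) (Fin d) ℂ), A = Fin.append A₁ A₃ :=
      ⟨_, _, (Fin.append_castAdd_natAdd).symm⟩
    obtain ⟨A₁, A₂, rfl⟩ : ∃ (B : Fin M → Matrix (Fin d) (Fin d) ℂ)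
        (A₂ : Fin N → Matrix (Fin d) (Fin d) ℂ), A₁ = Fin.append B A₂ :=
      ⟨_, _, (Fin.append_castAdd_natAdd).symm⟩
    simp only [paddedFunctional_prodOp]
    have e2 : ∀ {a b : ℕ} (B : Fin a → Matrix (Fin d) (Fin d) ℂ)
        (B' : Fin b → Matrix (Fin d) (Fin d) ℂ),
        (List.ofFn fun j => kstep W (Fin.append B B' j)).prod =
          (List.ofFn fun j => kstep W (B j)).prod * (List.ofFn fun j => kstep W (B' j)).prod := by
      intro a b B B'
      rw [← List.prod_append, ← List.ofFn_fin_append]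
      congr 2
      ext1 j
      refine Fin.addCases (fun j => ?_) (fun j => ?_) j <;> simp
    rw [e2, e2, ← hF, Module.End.mul_apply, Module.End.mul_apply, kstep_eq_sum F,
      LinearMap.sum_apply, map_sum, Matrix.trace_sum]
  have e' := LinearMap.congr_fun e ⟨x, hx⟩
  change (∑ i, paddedFunctional W Q (F i) m M) (x : ChainOp d) = φ x at e'
  rw [← e', LinearMap.sum_apply]

theorem isClosed_quasiLocalAlg :
    IsClosed ((quasiLocalAlg d : StarSubalgebra ℂ (ChainOp d)) : Set (ChainOp d)) :=
  StarSubalgebra.isClosed_topologicalClosure _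

theorem localAlg_Icc_mono : Monotone fun n : ℕ => localAlg d (Finset.Icc (-n : ℤ) n) :=
  fun a b h => localAlg_mono (Finset.Icc_subset_Icc (by omega) (by omega))

/-- A Kraus decomposition in a window defines a decomposition of the functional. -/
theorem IsTransfer.exists_decomposition (h : IsTransfer φ W Q) {N : ℕ} {m : ℤ} {Λ : Finset ℤ}
    (hΛ : IsWindow Λ m N) {I : Type*} [Fintype I] [DecidableEq I]
    (F : I → (Fin N → Fin d) → Matrix κ κ ℂ)
    (hF : ∀ A : Fin N → Matrix (Fin d) (Fin d) ℂ,
      kstep F (tensor A) = (List.ofFn fun j => kstep W (A j)).prod) :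
    ∃ ψ : I → quasiLocalAlg d →ₗ[ℂ] ℂ, (∀ i, IsPositive (ψ i)) ∧ ∑ i, ψ i = φ ∧
      ∀ i (x : quasiLocalAlg d), (x : ChainOp d) ∈ localAlg d Λ → ψ i x =
        (kstep (fun _ : Unit => F i) (compress m N (x : ChainOp d))
          (Q.conjTranspose * Q)).trace := by
  let f : I → ℕ → quasiLocalAlg d →ₗ[ℂ] ℂ := fun i M =>
    paddedFunctional W Q (F i) m M ∘ₗ (quasiLocalAlg d).subtype.toAlgHom.toLinearMap
  have hf : ∀ i M (x : quasiLocalAlg d), f i M x = paddedFunctional W Q (F i) m M (x : ChainOp d) :=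
    fun _ _ _ => rfl
  have hpos : ∀ i M, IsPositive (f i M) := fun i M =>
    (windowFunctional_isPositive _ (kdensity_posSemidef _ _)).comp (quasiLocalAlg d).subtype
  have hloc : ∀ i M (x : quasiLocalAlg d), (x : ChainOp d) ∈ localAlg d Λ → f i M x =
        (kstep (fun _ : Unit => F i) (compress m N (x : ChainOp d)) (Q.conjTranspose * Q)).trace :=
    fun i M x hx => h.paddedFunctional_local hΛ (F i) M hx
  -- The padding length goes to infinity along an ultrafilter. The masses do not depend on it, which
  -- gives the pointwise bounds.
  choose ψ hψ using fun i => exists_limit_functional (f i) fun x =>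
    ⟨(f i 0 1).re * ‖x‖, fun n => by
      have := (hpos i n).norm_apply_le_of_isClosed isClosed_quasiLocalAlg x
      rwa [hloc i n 1 (one_mem _), ← hloc i 0 1 (one_mem _)] at this⟩
  have hψpos : ∀ i, IsPositive (ψ i) := fun i x =>
    ge_of_tendsto' (hψ i (star x * x)) fun M => hpos i M x
  refine ⟨ψ, hψpos, ?_, fun i x hx => ?_⟩
  · have hsum : IsPositive (∑ i, ψ i) := IsPositive.sum fun i _ => hψpos i
    have hl : ∀ (n : ℕ) (x : quasiLocalAlg d),
        (x : ChainOp d) ∈ localAlg d (Finset.Icc (-n : ℤ) n) → (∑ i, ψ i) x = φ x := by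
      intro n x hx
      have ht : Filter.Tendsto (fun M => ∑ i, f i M x) (Filter.hyperfilter ℕ : Filter ℕ)
          (nhds (∑ i, ψ i x)) := tendsto_finsetSum _ fun i _ => hψ i x
      rw [LinearMap.sum_apply]
      refine tendsto_nhds_unique ht (tendsto_const_nhds.congr' ?_)
      -- A nonprincipal ultrafilter contains all tails, so eventually the padded window covers `[-n,
      -- n]`.
      have hev : ∀ᶠ M : ℕ in Filter.hyperfilter ℕ, n + m.natAbs + 1 ≤ M :=
        Nat.hyperfilter_le_atTop (Filter.eventually_ge_atTop _)
      filter_upwards [hev] with M hM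
      refine (h.sum_paddedFunctional F hF (M := M)
        (Λ := Finset.Icc (m - M) (m - M + (M + N + M : ℕ) - 1)) (isWindow_Icc rfl rfl)
        (localAlg_mono (Finset.Icc_subset_Icc ?_ ?_) hx)).symm
      · omega
      · push_cast
        omega
    -- Both positive functionals are bounded and agree on the dense union of local algebras.
    ext1 x
    rw [← sub_eq_zero, ← norm_eq_zero]
    refine le_antisymm (le_of_forall_pos_le_add fun ε hε => ?_) (norm_nonneg _)
    have hc : 0 ≤ ((∑ i, ψ i) 1).re + (φ 1).re := by
      have h1 := (Complex.nonneg_iff.1 (hsum 1)).1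
      have h2 := (Complex.nonneg_iff.1 (h.isState.1 1)).1
      rw [star_one, one_mul] at h1 h2
      exact add_nonneg h1 h2
    obtain ⟨n, y, hy, hxy⟩ := exists_near_of_mem_topologicalClosure localAlg_Icc_mono x.2
      (ε := ε / (((∑ i, ψ i) 1).re + (φ 1).re + 1)) (by positivity)
    let y' : quasiLocalAlg d := ⟨y, localAlg_le _ hy⟩
    have e : (∑ i, ψ i) x - φ x = (∑ i, ψ i) (x - y') - φ (x - y') := by
      rw [map_sub, map_sub, hl n y' hy]
      ring
    have hxy' : ‖x - y'‖ < ε / (((∑ i, ψ i) 1).re + (φ 1).re + 1) := hxy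
    rw [lt_div_iff₀ (by positivity)] at hxy'
    rw [e, zero_add]
    refine (norm_sub_le _ _).trans ((add_le_add
      (hsum.norm_apply_le_of_isClosed isClosed_quasiLocalAlg _)
      (h.isState.1.norm_apply_le_of_isClosed isClosed_quasiLocalAlg _)).trans ?_)
    nlinarith [norm_nonneg (x - y')]
  · refine tendsto_nhds_unique (hψ i x) ?_
    simp only [hloc i _ x hx]
    exact tendsto_const_nhds

end extension

end transfer
end QChain
end

noncomputable section
open scoped ComplexOrder Kronecker
set_option linter.unusedSectionVars false
namespace QChain

/-! ### Kraus words of consecutive blocks -/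

section lumps
variable {S Ω κ : Type*} [Fintype S] [DecidableEq S] [Fintype Ω] [DecidableEq Ω] [Fintype κ]
  [DecidableEq κ] {k n : ℕ}

/-- Grouping `k * n` sites into `k` blocks of `n` sites. -/
def lumpEquiv (S : Type*) (k n : ℕ) : (Fin (k * n) → S) ≃ (Fin k → Fin n → S) :=
  (Equiv.arrowCongr finProdFinEquiv.symm (Equiv.refl S)).trans (Equiv.curry _ _ _)

theorem lumpEquiv_apply (t : Fin (k * n) → S) (l : Fin k) (j : Fin n) :
    lumpEquiv S k n t l j = t (finProdFinEquiv (l, j)) := rfl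

theorem prod_ofFn_lump {M : Type*} [Monoid M] (f : Fin (k * n) → M) :
    (List.ofFn f).prod =
      (List.ofFn fun l : Fin k =>
        (List.ofFn fun j : Fin n => f (finProdFinEquiv (l, j))).prod).prod := by
  rw [List.ofFn_mul, List.prod_flatten, List.map_ofFn]
  congr 2
  ext1 l
  change (List.ofFn _).prod = _
  congr 2
  ext1 j
  congr 1
  ext
  simp [add_comm, mul_comm]

theorem kstep_lump (V : Fin k → Ω → (Fin n → S) → Matrix κ κ ℂ) (A : Fin (k * n) → Matrix S S ℂ) :
    kstep (fun r t => word V r (lumpEquiv S k n t)) (tensor A) =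
      (List.ofFn fun l => kstep (V l) (tensor fun j => A (finProdFinEquiv (l, j)))).prod := by
  rw [← kstep_word, kstep_equiv]
  congr 1
  ext s t
  rw [Matrix.reindex_apply, Matrix.submatrix_apply, tensor, Matrix.of_apply, tensor,
    Matrix.of_apply, ← finProdFinEquiv.prod_comp, Fintype.prod_prod_type]
  have h1 : ∀ (u : Fin k → Fin n → S) l j,
      (lumpEquiv S k n).symm u (finProdFinEquiv (l, j)) = u l j := fun u l j => by
    rw [← lumpEquiv_apply ((lumpEquiv S k n).symm u), Equiv.apply_symm_apply]
  simp only [h1]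
  rfl

theorem kstep_comp_env {Ω' : Type*} [Fintype Ω'] [DecidableEq Ω'] (f : Ω' ≃ Ω)
    (V : Ω → S → Matrix κ κ ℂ) (X : Matrix S S ℂ) : kstep (fun r => V (f r)) X = kstep V X := by
  ext1 C
  rw [kstep_apply, kstep_apply]
  exact f.sum_comp fun r => ∑ s, ∑ t, X s t • ((V r s).conjTranspose * C * V r t)

theorem word_eq_unit {K : ℕ} (V : Fin K → Ω → S → Matrix κ κ ℂ) (J : Fin K → Ω)
    (u : Fin K → Unit) (s : Fin K → S) :
    word V J s = word (fun l (_ : Unit) => V l (J l)) u s := by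
  induction K with
  | zero => rfl
  | succ K ih => rw [word, word, ih _ _ fun j => u j.succ]

theorem kstep_lump_unit (V : Fin k → Ω → (Fin n → S) → Matrix κ κ ℂ) (J : Fin k → Ω)
    (A : Fin (k * n) → Matrix S S ℂ) :
    kstep (fun (_ : Unit) t => word V J (lumpEquiv S k n t)) (tensor A) =
      (List.ofFn fun l =>
        kstep (fun _ : Unit => V l (J l)) (tensor fun j => A (finProdFinEquiv (l, j)))).prod := by
  rw [← kstep_lump, ← kstep_comp_env (Equiv.ofUnique Unit (Fin k → Unit))]
  congr 1
  ext1 r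
  ext1 t
  exact word_eq_unit V J _ _

theorem sum_prod_ofFn {M : Type*} [Semiring M] (g : Fin k → Ω → M) :
    ∑ J : Fin k → Ω, (List.ofFn fun l => g l (J l)).prod =
      (List.ofFn fun l => ∑ r, g l r).prod := by
  induction k with
  | zero => simp
  | succ k ih =>
    rw [sum_fin_succ_fun, List.ofFn_succ, List.prod_cons, ← ih, Finset.sum_mul]
    refine Finset.sum_congr rfl fun r _ => ?_
    rw [Finset.mul_sum]
    refine Finset.sum_congr rfl fun J _ => ?_
    rw [List.ofFn_succ, List.prod_cons]
    simp

/-- The constraint at position `l` is imposed by replacing the forbidden factors there by zero,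
which reduces to the unconstrained sum. -/
theorem sum_filter_prod_ofFn {M : Type*} [Semiring M] (g : Fin k → Ω → M) (l : Fin k) (i : Ω) :
    ∑ J : Fin k → Ω with J l = i, (List.ofFn fun l => g l (J l)).prod =
      (List.ofFn (Function.update (fun l => ∑ r, g l r) l (g l i))).prod := by
  let g' : Fin k → Ω → M := fun l' r => if l' = l ∧ r ≠ i then 0 else g l' r
  have h1 : (fun l' => ∑ r, g' l' r) = Function.update (fun l => ∑ r, g l r) l (g l i) := by
    ext1 l'
    rcases eq_or_ne l' l with rfl | h
    · rw [Function.update_self, Finset.sum_eq_single i]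
      · simp [g']
      · intro r _ hr
        simp [g', hr]
      · simp
    · rw [Function.update_of_ne h]
      simp [g', h]
  rw [← h1, ← sum_prod_ofFn, Finset.sum_filter]
  refine Finset.sum_congr rfl fun J _ => ?_
  split_ifs with h
  · congr 2
    ext1 l'
    simp only [g']
    rw [if_neg]
    rintro ⟨rfl, h'⟩
    exact h' h
  · refine (List.prod_eq_zero ((List.mem_ofFn' _ _).2 ⟨l, ?_⟩)).symm
    simp [g', h]

end lumps

/-! ### Powers of automorphisms -/

section aut
variable {A : Type*} [Ring A] [StarRing A] [Algebra ℂ A]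

/-- Powers of an automorphism as linear maps. -/
abbrev autPow (θ : A ≃⋆ₐ[ℂ] A) (p : ℕ) : A →ₗ[ℂ] A := (θ : A →ₗ[ℂ] A) ^ p

theorem autPow_succ (θ : A ≃⋆ₐ[ℂ] A) (p : ℕ) (x : A) : autPow θ (p + 1) x = θ (autPow θ p x) := by
  rw [autPow, pow_succ']
  rfl

theorem autPow_one (θ : A ≃⋆ₐ[ℂ] A) (p : ℕ) : autPow θ p 1 = 1 := by
  induction p with
  | zero => rfl
  | succ p ih => rw [autPow_succ, ih, map_one]

theorem autPow_star_mul (θ : A ≃⋆ₐ[ℂ] A) (p : ℕ) (x y : A) :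
    autPow θ p (star x * y) = star (autPow θ p x) * autPow θ p y := by
  induction p with
  | zero => rfl
  | succ p ih => rw [autPow_succ, ih, map_mul, map_star, autPow_succ, autPow_succ]

theorem IsPositive.comp_autPow {ω : A →ₗ[ℂ] ℂ} (hω : IsPositive ω) (θ : A ≃⋆ₐ[ℂ] A) (p : ℕ) :
    IsPositive (ω ∘ₗ autPow θ p) := fun a => by
  rw [LinearMap.comp_apply, autPow_star_mul]
  exact hω _

end aut

/-! ### The shift on local operators -/

section shift
variable {d : ℕ} [NeZero d] {N : ℕ}

/-- Powers of the shift as linear maps. -/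
def shiftLin (p : ℕ) : ChainOp d →ₗ[ℂ] ChainOp d :=
  ({ toFun := shiftOp, map_add' := map_add shiftOp, map_smul' := fun c x => map_smul shiftOp c x } :
    Module.End ℂ (ChainOp d)) ^ p

theorem shiftLin_succ (p : ℕ) (x : ChainOp d) : shiftLin (p + 1) x = shiftOp (shiftLin p x) := by
  rw [shiftLin, pow_succ']
  rfl

theorem shiftLin_prodOp (p : ℕ) (m : ℤ) (A : Fin N → Matrix (Fin d) (Fin d) ℂ) :
    shiftLin p (prodOp m A) = prodOp (m + p) A := by
  induction p with
  | zero => simp [shiftLin]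
  | succ p ih =>
    rw [shiftLin_succ, ih, prodOp, map_list_prod, List.map_ofFn, prodOp]
    refine congrArg List.prod (congrArg List.ofFn (funext fun j => ?_))
    rw [Function.comp, shiftOp_site]
    congr 2
    push_cast
    ring

theorem shiftLin_local {Λ Λ' : Finset ℤ} {m : ℤ} {p : ℕ} (hΛ : IsWindow Λ m N)
    (hΛ' : IsWindow Λ' (m + p) N) {x : ChainOp d} (hx : x ∈ localAlg d Λ) :
    shiftLin p x ∈ localAlg d Λ' ∧ compress (m + p) N (shiftLin p x) = compress m N x := by
  have hs := mem_span_prodOp hΛ hx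
  clear hx
  induction hs using Submodule.span_induction with
  | mem y hy =>
    obtain ⟨A, rfl⟩ := hy
    rw [shiftLin_prodOp, compress_prodOp_eq, compress_prodOp_eq]
    exact ⟨prodOp_mem hΛ' A, rfl⟩
  | zero => exact ⟨by rw [map_zero]; exact zero_mem _, by simp⟩
  | add y z _ _ hy hz =>
    rw [map_add, map_add, map_add, hy.2, hz.2]
    exact ⟨add_mem hy.1 hz.1, rfl⟩
  | smul c y _ hy =>
    rw [map_smul, map_smul, map_smul, hy.2]
    exact ⟨SMulMemClass.smul_mem c hy.1, rfl⟩

/-- Powers of the shift of the gauge-invariant algebra as linear maps. -/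
abbrev gaugeShiftPow (G : Subgroup (Matrix.unitaryGroup (Fin d) ℂ)) (p : ℕ) :
    gaugeAlg G →ₗ[ℂ] gaugeAlg G := autPow (gaugeShift G) p

theorem coe_gaugeShift_pow {G : Subgroup (Matrix.unitaryGroup (Fin d) ℂ)} (p : ℕ)
    (x : gaugeAlg G) :
    (gaugeShiftPow G p x : ChainOp d) =
      shiftLin p (x : ChainOp d) := by
  induction p with
  | zero => rfl
  | succ p ih =>
    rw [gaugeShiftPow, autPow_succ, shiftLin_succ, ← ih]
    rfl

end shift

/-! ### Decompositions with large CNT value -/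

section lower
variable {d : ℕ} [NeZero d] {κ Ω : Type} [Fintype κ] [DecidableEq κ] [Fintype Ω] [DecidableEq Ω]
  {φ : quasiLocalAlg d →ₗ[ℂ] ℂ} {W : Ω → Fin d → Matrix κ κ ℂ} {Q : Matrix κ κ ℂ}

theorem IsTransfer.kstep_word_one (h : IsTransfer φ W Q) (n p : ℕ) :
    (kstep (word fun _ : Fin n => W) 1 ^ p) (Q.conjTranspose * Q) = Q.conjTranspose * Q ∧
    ∀ C, ((kstep (word fun _ : Fin n => W) 1 ^ p) C).trace = C.trace := by
  have e : kstep (word fun _ : Fin n => W) 1 = (List.ofFn fun _ : Fin n => kstep W 1).prod := by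
    rw [← kstep_word, tensor_one]
  rw [e]
  induction p with
  | zero => exact ⟨rfl, fun _ => rfl⟩
  | succ p ih =>
    refine ⟨?_, fun C => ?_⟩
    · rw [pow_succ, Module.End.mul_apply, h.prod_step_fixed, ih.1]
    · rw [pow_succ', Module.End.mul_apply, h.trace_prod_step, ih.2]

theorem IsTransfer.trace_fixed (h : IsTransfer φ W Q) : (Q.conjTranspose * Q).trace = 1 := by
  have := h.apply_prodOp 0 0 (fun _ => 1) 1 (prodOp_one 0).symm
  rw [h.isState.2] at this
  simpa using this.symm

theorem IsTransfer.nonempty (h : IsTransfer φ W Q) : Nonempty κ := by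
  by_contra hne
  rw [not_nonempty_iff] at hne
  have := h.trace_fixed
  simp [Matrix.trace] at this

/-- Summing over the Kraus indices of the other blocks gives the free evolution there. With the
identity as observable, it preserves the trace to the left of block `l` and fixes `Q* Q` to the
right. -/
theorem IsTransfer.marginal_lump (h : IsTransfer φ W Q) {k n : ℕ} {I : Type*} [Fintype I]
    [DecidableEq I] (V : I → (Fin n → Fin d) → Matrix κ κ ℂ)
    (hV : kstep V 1 = kstep (word fun _ : Fin n => W) 1) (l : Fin k) (i : I)
    {Λ : Finset ℤ} {m : ℤ} (hΛ : IsWindow Λ m n) {x : ChainOp d} (hx : x ∈ localAlg d Λ) :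
    ∑ J : Fin k → I with J l = i, (kstep (fun (_ : Unit) t =>
      word (fun _ : Fin k => V) J (lumpEquiv (Fin d) k n t))
      (compress m (k * n) (shiftLin (n * l) x)) (Q.conjTranspose * Q)).trace =
    (kstep (fun _ : Unit => V i) (compress m n x) (Q.conjTranspose * Q)).trace := by
  have e' : ((∑ J : Fin k → I with J l = i, windowFunctional m (kdensity (fun (_ : Unit) t =>
      word (fun _ : Fin k => V) J (lumpEquiv (Fin d) k n t)) Q)) ∘ₗ shiftLin (n * l)) x =
      windowFunctional m (kdensity (fun _ : Unit => V i) Q) x := by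
    refine eqOn_of_prodOp hΛ (fun A => ?_) hx
    change (∑ J : Fin k → I with J l = i, windowFunctional m _) (shiftLin (n * l) (prodOp m A)) =
      windowFunctional m _ (prodOp m A)
    -- The shifted observable is `A` in block `l` and the identity in every other block.
    let A' : Fin (k * n) → Matrix (Fin d) (Fin d) ℂ := fun q =>
      Function.update (fun _ : Fin k => fun _ : Fin n => (1 : Matrix (Fin d) (Fin d) ℂ)) l A
        (finProdFinEquiv.symm q).1 (finProdFinEquiv.symm q).2
    have hA' : ∀ l' j, A' (finProdFinEquiv (l', j)) =
        Function.update (fun _ : Fin k => fun _ : Fin n => (1 : Matrix (Fin d) (Fin d) ℂ)) l A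
          l' j := fun l' j => by
      simp only [A', Equiv.symm_apply_apply]
    have e1 : shiftLin (n * l) (prodOp m A) = prodOp m A' := by
      rw [shiftLin_prodOp, prodOp, prodOp, prod_ofFn_lump]
      have : (fun l' : Fin k => (List.ofFn fun j : Fin n =>
          site (m + ((finProdFinEquiv (l', j) : ℕ) : ℤ)) (A' (finProdFinEquiv (l', j)))).prod) =
          Function.update (fun _ => (1 : ChainOp d)) l (prodOp (m + (n * l : ℕ)) A) := by
        ext1 l'
        simp only [hA']
        rcases eq_or_ne l' l with rfl | hl
        · simp only [Function.update_self, prodOp]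
          have hj : ∀ j : Fin n, m + ((finProdFinEquiv (l', j) : ℕ) : ℤ) =
              m + (n * l' : ℕ) + (j : ℕ) := fun j => by
            simp only [finProdFinEquiv_apply_val]
            push_cast
            ring
          simp only [hj]
        · simp only [Function.update_of_ne hl, map_one, List.ofFn_const, List.prod_replicate,
            one_pow]
      rw [this, prod_ofFn_update_const]
      simp [prodOp]
    rw [e1, LinearMap.sum_apply]
    simp only [windowFunctional_apply, trace_kdensity, compress_prodOp_eq, kstep_lump_unit]
    rw [← Matrix.trace_sum, ← LinearMap.sum_apply,
      sum_filter_prod_ofFn (fun l' r => kstep (fun _ : Unit => V r)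
        (tensor fun j => A' (finProdFinEquiv (l', j))))]
    have e2 : Function.update (fun l' => ∑ r, kstep (fun _ : Unit => V r)
        (tensor fun j => A' (finProdFinEquiv (l', j)))) l (kstep (fun _ : Unit => V i)
        (tensor fun j => A' (finProdFinEquiv (l, j)))) =
        Function.update (fun _ => kstep (word fun _ : Fin n => W) 1) l
          (kstep (fun _ : Unit => V i) (tensor A)) := by
      ext1 l'
      rcases eq_or_ne l' l with rfl | hl
      · rw [Function.update_self, Function.update_self]
        simp only [hA', Function.update_self]
      · rw [Function.update_of_ne hl, Function.update_of_ne hl, ← kstep_eq_sum]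
        simp only [hA', Function.update_of_ne hl, tensor_one, hV]
    rw [e2, prod_ofFn_update_const, Module.End.mul_apply, Module.End.mul_apply,
      (h.kstep_word_one n _).1, (h.kstep_word_one n _).2]
  rw [LinearMap.comp_apply, LinearMap.sum_apply] at e'
  simpa only [windowFunctional_apply, trace_kdensity] using e'


variable {G : Subgroup (Matrix.unitaryGroup (Fin d) ℂ)} {A : Type*} [Ring A] [StarRing A]
  [Algebra ℂ A]

/-- The embedding of a direct sum of matrix algebras onto a gauge-invariant local algebra. -/
def localIncl {Λ : Finset ℤ} {b : ℕ} {nb : Fin b → ℕ} (e : gaugeLocal G Λ ≃⋆ₐ[ℂ] Blocks nb) :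
    Blocks nb →⋆ₐ[ℂ] gaugeAlg G :=
  (StarSubalgebra.inclusion (gaugeLocal_le Λ)).comp (e.symm : Blocks nb →⋆ₐ[ℂ] gaugeLocal G Λ)

theorem coe_localIncl {Λ : Finset ℤ} {b : ℕ} {nb : Fin b → ℕ} (e : gaugeLocal G Λ ≃⋆ₐ[ℂ] Blocks nb)
    (x : gaugeLocal G Λ) : (localIncl e (e x) : ChainOp d) = x := by
  change ((e.symm (e x) : gaugeLocal G Λ) : ChainOp d) = x
  rw [StarAlgEquiv.symm_apply_apply]

theorem IsTransfer.apply_shift (h : IsTransfer φ W Q) {N p : ℕ} {Λ : Finset ℤ} {m : ℤ}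
    (hΛ : IsWindow Λ m N) {x : ChainOp d} (hx : x ∈ localAlg d Λ) {y : quasiLocalAlg d}
    (hy : (y : ChainOp d) = shiftLin p x) :
    φ y = (kstep (word fun _ : Fin N => W) (compress m N x) (Q.conjTranspose * Q)).trace := by
  have hΛ' : IsWindow (Finset.Icc (m + p) (m + p + N - 1)) (m + p) N := isWindow_Icc rfl rfl
  have hs := shiftLin_local hΛ hΛ' hx
  rw [h.apply_local hΛ' (by rw [hy]; exact hs.1), hy, hs.2]

/-- The system-memory marginal of the purification extends the state on the gauge-invariant algebra.
The multiplicity bound acquires the memory dimension as an additional factor. -/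
theorem IsTransfer.abs_blockEntropy_sub_amplitude (h : IsTransfer φ W Q)
    (ι : A →⋆ₐ[ℂ] quasiLocalAlg d)
    {N : ℕ} {Λ : Finset ℤ}
    {m : ℤ} (hΛ : IsWindow Λ m N) {b : ℕ} {nb : Fin b → ℕ} (e : gaugeLocal G Λ ≃⋆ₐ[ℂ] Blocks nb)
    {p : ℕ} {α : Blocks nb →ₗ[ℂ] A}
    (hα : ∀ x : gaugeLocal G Λ, (ι (α (e x)) : ChainOp d) = shiftLin p (x : ChainOp d))
    {Ω' : Type*} [Fintype Ω'] [DecidableEq Ω'] (V : Ω' → (Fin N → Fin d) → Matrix κ κ ℂ)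
    (hV : ∀ A : Fin N → Matrix (Fin d) (Fin d) ℂ,
      kstep V (tensor A) = (List.ofFn fun j => kstep W (A j)).prod) :
    |blockEntropy ((φ ∘ₗ ι.toAlgHom.toLinearMap) ∘ₗ α) -
      vnEntropy (amplitude V Q * (amplitude V Q).conjTranspose)| ≤
      Real.log (((N : ℝ) + 1) ^ d ^ 2 * Fintype.card (κ × κ)) := by
  have hne := h.nonempty
  have hVx : ∀ x ∈ localAlg d Λ, (kstep V (compress m N x) (Q.conjTranspose * Q)).trace =
      (kstep (word fun _ : Fin N => W) (compress m N x) (Q.conjTranspose * Q)).trace := by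
    intro x hx
    have e : windowFunctional m (kdensity V Q) x =
        windowFunctional m (kdensity (word fun _ : Fin N => W) Q) x := by
      refine eqOn_of_prodOp hΛ (fun A => ?_) hx
      rw [windowFunctional_apply, windowFunctional_apply, trace_kdensity, trace_kdensity,
        compress_prodOp_eq, kstep_word, hV]
    simpa only [windowFunctional_apply, trace_kdensity] using e
  have htr : (amplitude V Q * (amplitude V Q).conjTranspose).trace = 1 := by
    have h1 := trace_amplitude V Q 1
    rw [Matrix.one_kronecker_one, mul_one] at h1
    rw [h1, ← tensor_one, hV, h.trace_prod_step, h.trace_fixed]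
  have := abs_blockEntropy_gauge_sub_le (Y := κ × κ) hΛ e
    ((φ ∘ₗ ι.toAlgHom.toLinearMap) ∘ₗ α)
    (Matrix.posSemidef_self_mul_conjTranspose (amplitude V Q)) fun x => by
      rw [trace_amplitude, hVx _ x.2.1]
      exact h.apply_shift hΛ x.2.1 (hα x)
  rwa [htr, Complex.one_re, one_mul] at this

/-- Decompositions of large CNT entropy. -/
theorem IsTransfer.exists_le_cntValue (h : IsTransfer φ W Q) (ι : A →⋆ₐ[ℂ] quasiLocalAlg d)
    (k n : ℕ)
    {b : ℕ} {nb : Fin b → ℕ} (e : gaugeLocal G (Finset.Icc (1 : ℤ) n) ≃⋆ₐ[ℂ] Blocks nb)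
    {b' : ℕ} {nb' : Fin b' → ℕ}
    (e' : gaugeLocal G (Finset.Icc (1 : ℤ) (k * n : ℕ)) ≃⋆ₐ[ℂ] Blocks nb')
    {α : Fin k → Blocks nb →ₗ[ℂ] A} {α' : Blocks nb' →ₗ[ℂ] A} (h1 : ∀ l, α l 1 = 1)
    (hαpos : ∀ l (ω : A →ₗ[ℂ] ℂ), IsPositive ω → IsPositive (ω ∘ₗ α l))
    (hα : ∀ l x, (ι (α l (e x)) : ChainOp d) = shiftLin (n * l) (x : ChainOp d))
    (hα' : ∀ x, (ι (α' (e' x)) : ChainOp d) = x) :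
    ∃ (r : ℕ) (ψ : (Fin k → Fin r) → (A →ₗ[ℂ] ℂ)), (∀ J, IsPositive (ψ J)) ∧
      ∑ J, ψ J = φ ∘ₗ ι.toAlgHom.toLinearMap ∧
      blockEntropy ((φ ∘ₗ ι.toAlgHom.toLinearMap) ∘ₗ α') -
        Real.log ((((k * n : ℕ) : ℝ) + 1) ^ d ^ 2 * Fintype.card (κ × κ)) -
        2 * k * Real.log (((n : ℝ) + 1) ^ d ^ 2 * Fintype.card (κ × κ)) ≤
      cntValue (φ ∘ₗ ι.toAlgHom.toLinearMap) α ψ := by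
  have hne := h.nonempty
  have hΛ : IsWindow (Finset.Icc (1 : ℤ) n) 1 n := isWindow_Icc rfl (by ring)
  have hΛ' : IsWindow (Finset.Icc (1 : ℤ) (k * n : ℕ)) 1 (k * n) := isWindow_Icc rfl (by ring)
  -- The Kraus basis of one block is rotated so that its masses are the eigenvalues of the
  -- environment state; the same basis is used in all `k` blocks.
  obtain ⟨V₁, hV₁, hη⟩ := exists_rotation (word fun _ : Fin n => W) Q
  let f := (Fintype.equivFin (Fin n → Ω)).symm
  let V : Fin (Fintype.card (Fin n → Ω)) → (Fin n → Fin d) → Matrix κ κ ℂ := fun i => V₁ (f i)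
  have hV : ∀ X, kstep V X = kstep (word fun _ : Fin n => W) X := fun X =>
    (kstep_comp_env f V₁ X).trans (hV₁ X)
  let F : (Fin k → Fin (Fintype.card (Fin n → Ω))) → (Fin (k * n) → Fin d) → Matrix κ κ ℂ :=
    fun J t => word (fun _ : Fin k => V) J (lumpEquiv (Fin d) k n t)
  have hF : ∀ A : Fin (k * n) → Matrix (Fin d) (Fin d) ℂ,
      kstep F (tensor A) = (List.ofFn fun j => kstep W (A j)).prod := fun A => by
    refine (kstep_lump (fun _ => V) A).trans ?_
    simp only [hV, kstep_word]
    exact (prod_ofFn_lump fun j => kstep W (A j)).symm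
  obtain ⟨ψ', hpos, hsum, hval⟩ := h.exists_decomposition hΛ' F hF
  let ψ : (Fin k → Fin (Fintype.card (Fin n → Ω))) → (A →ₗ[ℂ] ℂ) := fun J =>
    ψ' J ∘ₗ ι.toAlgHom.toLinearMap
  have hψ : ∀ J, IsPositive (ψ J) := fun J => (hpos J).comp ι
  have hψval : ∀ J (x : A), (ι x : ChainOp d) ∈ localAlg d (Finset.Icc (1 : ℤ) (k * n : ℕ)) →
      ψ J x = (kstep (fun _ : Unit => F J) (compress 1 (k * n) (ι x : ChainOp d))
        (Q.conjTranspose * Q)).trace := fun J x hx => hval J (ι x) hx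
  refine ⟨_, ψ, hψ, ?_, ?_⟩
  · ext1 x
    rw [← hsum, LinearMap.comp_apply, LinearMap.sum_apply, LinearMap.sum_apply]
    rfl
  rw [cntValue_eq hψ (fun l J => hαpos l _ (hψ J)) h1]
  set P := Real.log (((n : ℝ) + 1) ^ d ^ 2 * Fintype.card (κ × κ)) with hP
  set P' := Real.log ((((k * n : ℕ) : ℝ) + 1) ^ d ^ 2 * Fintype.card (κ × κ)) with hP'
  let μ : Fin (Fintype.card (Fin n → Ω)) → ℝ := fun i =>
    (kstep (fun _ : Unit => V i) 1 (Q.conjTranspose * Q)).trace.re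
  have hμ : ∑ i, μ i = 1 := by
    simp only [μ]
    rw [← Complex.re_sum, ← Matrix.trace_sum, ← LinearMap.sum_apply, ← kstep_eq_sum, hV]
    have h1 := (h.kstep_word_one n 1).1
    rw [pow_one] at h1
    rw [h1, h.trace_fixed, Complex.one_re]
  have hημ : ∑ i, Real.negMulLog (μ i) = vnEntropy (amplitude (word fun _ : Fin n => W) Q *
      (amplitude (word fun _ : Fin n => W) Q).conjTranspose) := by
    rw [← hη]
    exact f.sum_comp fun r => Real.negMulLog
      (kstep (fun _ : Unit => V₁ r) 1 (Q.conjTranspose * Q)).trace.re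
  have hmass : ∀ J, mass (ψ J) =
      (((amplitude F Q).conjTranspose * amplitude F Q) J J).re := fun J => by
    rw [amplitude_diag, mass, hψval J 1 (by rw [map_one]; exact one_mem _)]
    have : compress 1 (k * n) (ι 1 : ChainOp d) = 1 := by
      rw [map_one]
      exact compress_one 1
    rw [this]
  -- The masses are the diagonal of the joint environment state, so their Shannon entropy is at
  -- least its von Neumann entropy, which equals that of system and memory.
  have hjoint : blockEntropy ((φ ∘ₗ ι.toAlgHom.toLinearMap) ∘ₗ α') - P' ≤
      ∑ J, Real.negMulLog (mass (ψ J)) := by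
    have h1 := h.abs_blockEntropy_sub_amplitude ι hΛ' e' (p := 0) hα' F hF
    have h2 := vnEntropy_le_diag (Matrix.posSemidef_conjTranspose_mul_self (amplitude F Q))
    rw [← vnEntropy_mul_conjTranspose] at h2
    simp only [hmass]
    have h3 := (abs_le.1 h1).2
    linarith
  -- The state on the block has entropy at least the environment entropy minus `P`. The pieces have
  -- total entropy at most the same environment entropy plus `P`, because the rotated environment is
  -- diagonal.
  have hsingle : ∀ l : Fin k, -(2 * P) ≤
      blockEntropy ((φ ∘ₗ ι.toAlgHom.toLinearMap) ∘ₗ α l) -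
        ∑ i, blockEntropy (marginal ψ l i ∘ₗ α l) := by
    intro l
    have h1 := (abs_le.1 (h.abs_blockEntropy_sub_amplitude ι hΛ e (hα l)
      (word fun _ : Fin n => W) fun A => kstep_word _ _)).1
    have h2 : ∀ i, blockEntropy (marginal ψ l i ∘ₗ α l) ≤ Real.negMulLog (μ i) + μ i * P := by
      intro i
      -- One Kraus operator gives a one-column amplitude: the piece is pure on system and memory,
      -- and its unnormalised entropy there is `η(μ i)`.
      let T := amplitude (fun _ : Unit => V i) Q
      have h3 := abs_blockEntropy_gauge_sub_le (Y := κ × κ) hΛ e (marginal ψ l i ∘ₗ α l)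
        (Matrix.posSemidef_self_mul_conjTranspose T) fun x => by
          rw [trace_amplitude, ← h.marginal_lump V (hV 1) l i hΛ x.2.1]
          rw [marginal, LinearMap.comp_apply, LinearMap.sum_apply]
          refine Finset.sum_congr rfl fun J _ => ?_
          rw [← hα l x]
          refine hψval J _ ?_
          rw [hα l x]
          have hw : IsWindow (Finset.Icc (1 + (n * l : ℕ) : ℤ) (1 + (n * l : ℕ) + n - 1))
            (1 + (n * l : ℕ)) n := isWindow_Icc rfl rfl
          refine localAlg_mono (Finset.Icc_subset_Icc ?_ ?_) (shiftLin_local hΛ hw x.2.1).1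
          · omega
          · have h5 : n * (l : ℕ) + n ≤ k * n := by
              have := Nat.mul_le_mul_left n (Nat.succ_le_of_lt l.2)
              rw [Nat.mul_succ, Nat.mul_comm n k] at this
              exact this
            omega
      have hT : (T * T.conjTranspose).trace.re = μ i := by
        rw [Matrix.trace_mul_comm, Matrix.trace, Finset.univ_unique, Finset.sum_singleton,
          Matrix.diag_apply, amplitude_diag]
      have hT2 : vnEntropy (T * T.conjTranspose) = Real.negMulLog (μ i) := by
        rw [vnEntropy_mul_conjTranspose,
          vnEntropy_unique (Matrix.posSemidef_conjTranspose_mul_self T), Matrix.trace_mul_comm, hT]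
      rw [hT, hT2] at h3
      have := (abs_le.1 h3).2
      linarith
    have h4 := Finset.sum_le_sum fun i (_ : i ∈ Finset.univ) => h2 i
    rw [Finset.sum_add_distrib, ← Finset.sum_mul, hμ, one_mul, hημ] at h4
    linarith
  have h5 := Finset.sum_le_sum fun l (_ : l ∈ Finset.univ) => hsingle l
  rw [Finset.sum_const, Finset.card_univ, Fintype.card_fin, nsmul_eq_mul] at h5
  linarith

end lower
end QChain
end

noncomputable section
open scoped ComplexOrder Kronecker
set_option linter.unusedSectionVars false
namespace QChain

/-! ### Uniform continuity of the entropy -/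

section continuity
variable {ι : Type*} [Fintype ι] [DecidableEq ι]

theorem PosSemidef.spectrum_subset {D : Matrix ι ι ℂ} (hD : D.PosSemidef) :
    spectrum ℝ D ⊆ Set.Icc 0 D.trace.re := by
  rw [hD.1.spectrum_real_eq_range_eigenvalues]
  rintro _ ⟨i, rfl⟩
  refine ⟨hD.eigenvalues_nonneg i, ?_⟩
  rw [hD.1.trace_eq_sum_eigenvalues, ← RCLike.ofReal_sum]
  exact Finset.single_le_sum (f := hD.1.eigenvalues) (fun j _ => hD.eigenvalues_nonneg j)
    (Finset.mem_univ i)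

open scoped Matrix.Norms.L2Operator in
theorem continuousOn_vnEntropy :
    ContinuousOn vnEntropy {D : Matrix ι ι ℂ | D.PosSemidef ∧ D.trace = 1} := by
  refine Complex.continuous_re.comp_continuousOn ?_
  refine (Continuous.matrix_trace continuous_id).comp_continuousOn ?_
  refine (continuousOn_cfc (Matrix ι ι ℂ) (isCompact_Icc (a := (0 : ℝ)) (b := 1)) Real.negMulLog
    Real.continuous_negMulLog.continuousOn).mono ?_
  rintro D ⟨hD, h1⟩
  refine ⟨hD.1, ?_⟩
  have := PosSemidef.spectrum_subset hD
  rwa [h1, Complex.one_re] at this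

theorem isCompact_densityMatrices :
    IsCompact {D : Matrix ι ι ℂ | D.PosSemidef ∧ D.trace = 1} := by
  refine IsCompact.of_isClosed_subset (s := Set.univ.pi fun _ : ι => Set.univ.pi fun _ : ι =>
    Metric.closedBall (0 : ℂ) 1) (isCompact_univ_pi fun _ => isCompact_univ_pi fun _ =>
      isCompact_closedBall _ _) (isClosed_posSemidef.inter
        (isClosed_eq (Continuous.matrix_trace continuous_id) continuous_const)) ?_
  rintro D ⟨hD, h1⟩ i _ j _
  rw [mem_closedBall_zero_iff]
  refine (PosSemidef.norm_apply_le_trace hD i j).trans ?_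
  rw [h1, Complex.one_re]

/-- Density matrices form a compact set, so continuity is uniform. The approximation of maps needs a
`δ` that works for all states at once. -/
theorem exists_abs_vnEntropy_sub_lt {ε : ℝ} (hε : 0 < ε) : ∃ δ > 0, ∀ D D' : Matrix ι ι ℂ,
    D.PosSemidef → D.trace = 1 → D'.PosSemidef → D'.trace = 1 → (∀ i j, ‖D i j - D' i j‖ < δ) →
      |vnEntropy D - vnEntropy D'| < ε := by
  have h := isCompact_densityMatrices.uniformContinuousOn_of_continuous
    (continuousOn_vnEntropy (ι := ι))
  have h' : UniformContinuousOn (fun D : ι → ι → ℂ => vnEntropy (Matrix.of D))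
    {D | (Matrix.of D).PosSemidef ∧ (Matrix.of D).trace = 1} := h
  obtain ⟨δ, hδ, H⟩ := Metric.uniformContinuousOn_iff.1 h' ε hε
  refine ⟨δ, hδ, fun D D' h1 h2 h3 h4 h5 => ?_⟩
  refine H D ⟨h1, h2⟩ D' ⟨h3, h4⟩ ?_
  refine (dist_pi_lt_iff hδ).2 fun i => (dist_pi_lt_iff hδ).2 fun j => ?_
  rw [dist_eq_norm]
  exact h5 i j

variable {b : ℕ} {nb : Fin b → ℕ}

theorem exists_abs_blockEntropy_sub_lt {ε : ℝ} (hε : 0 < ε) : ∃ δ > 0,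
    ∀ χ χ' : Blocks nb →ₗ[ℂ] ℂ, IsState χ → IsState χ' →
      (∀ i a c, ‖χ (blockUnit i a c) - χ' (blockUnit i a c)‖ < δ) →
      |blockEntropy χ - blockEntropy χ'| < ε := by
  obtain ⟨δ, hδ, H⟩ := exists_abs_vnEntropy_sub_lt (ι := Σ i, Fin (nb i)) hε
  refine ⟨δ, hδ, fun χ χ' h1 h2 h => ?_⟩
  rw [← vnEntropy_blockDensity h1.1, ← vnEntropy_blockDensity h2.1]
  refine H _ _ (blockDensity_posSemidef h1.1) (by rw [trace_blockDensity, h1.2])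
    (blockDensity_posSemidef h2.1) (by rw [trace_blockDensity, h2.2]) ?_
  rintro ⟨i, a⟩ ⟨j, c⟩
  rcases eq_or_ne i j with rfl | hij
  · rw [blockDensity, blockDensity, Matrix.blockDiagonal'_apply_eq, Matrix.blockDiagonal'_apply_eq]
    exact h i c a
  · rw [blockDensity, blockDensity, Matrix.blockDiagonal'_apply_ne _ _ _ hij,
      Matrix.blockDiagonal'_apply_ne _ _ _ hij, sub_zero, norm_zero]
    exact hδ

end continuity

/-! ### Completely positive maps as Gram sums and their Schwarz inequality -/

section gram
variable {A : Type*} [Ring A] [StarRing A] [Algebra ℂ A] [StarModule ℂ A]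
  {b : ℕ} {nb : Fin b → ℕ} {K : Type*} [Fintype K]

/-- The completely positive map `x ↦ ∑ x_{pq} Y_p* Y_q`. -/
def gramMap (Y : K → (Σ i, Fin (nb i)) → A) : Blocks nb →ₗ[ℂ] A where
  toFun x := ∑ k, ∑ i, ∑ a, ∑ c, x i a c • (star (Y k ⟨i, a⟩) * Y k ⟨i, c⟩)
  map_add' x y := by
    simp only [Pi.add_apply, Matrix.add_apply, add_smul, Finset.sum_add_distrib]
  map_smul' z x := by
    simp only [Pi.smul_apply, Matrix.smul_apply, smul_assoc, Finset.smul_sum, RingHom.id_apply]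

theorem gramMap_apply (Y : K → (Σ i, Fin (nb i)) → A) (x : Blocks nb) :
    gramMap Y x = ∑ k, ∑ i, ∑ a, ∑ c, x i a c • (star (Y k ⟨i, a⟩) * Y k ⟨i, c⟩) := rfl

theorem gramMap_blockUnit (Y : K → (Σ i, Fin (nb i)) → A) (i : Fin b) (a c : Fin (nb i)) :
    gramMap Y (blockUnit i a c) = ∑ k, star (Y k ⟨i, a⟩) * Y k ⟨i, c⟩ := by
  rw [gramMap_apply]
  refine Finset.sum_congr rfl fun k _ => ?_
  rw [Finset.sum_eq_single i, Finset.sum_eq_single a, Finset.sum_eq_single c]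
  · simp [blockUnit]
  · intro c' _ h
    simp [blockUnit, h.symm]
  · simp
  · intro a' _ h
    simp [blockUnit, h.symm]
  · simp
  · intro j _ h
    simp [blockUnit, Pi.single_eq_of_ne h]
  · simp

theorem gramMap_one (Y : K → (Σ i, Fin (nb i)) → A) :
    gramMap Y 1 = ∑ k, ∑ i, ∑ a, star (Y k ⟨i, a⟩) * Y k ⟨i, a⟩ := by
  rw [gramMap_apply]
  refine Finset.sum_congr rfl fun k _ => Finset.sum_congr rfl fun i _ =>
    Finset.sum_congr rfl fun a _ => ?_
  simp [Matrix.one_apply]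

theorem gramMap_star (Y : K → (Σ i, Fin (nb i)) → A) (x : Blocks nb) :
    gramMap Y (star x) = star (gramMap Y x) := by
  rw [gramMap_apply, gramMap_apply]
  simp only [star_sum, star_smul, star_mul, star_star]
  refine Finset.sum_congr rfl fun k _ => Finset.sum_congr rfl fun i _ => ?_
  rw [Finset.sum_comm]
  rfl

/-- Explicit sum of squares for the Schwarz defect: expand the differences between `∑ x_{ec} Y_c`
and `Y_e α(x)`. Unitality collapses the last term to `α(x)* α(x)`. -/
theorem gramMap_star_mul_sub (Y : K → (Σ i, Fin (nb i)) → A) (h1 : gramMap Y 1 = 1)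
    (x : Blocks nb) :
    gramMap Y (star x * x) - star (gramMap Y x) * gramMap Y x = ∑ k, ∑ i, ∑ e,
      star (∑ c, x i e c • Y k ⟨i, c⟩ - Y k ⟨i, e⟩ * gramMap Y x) *
        (∑ c, x i e c • Y k ⟨i, c⟩ - Y k ⟨i, e⟩ * gramMap Y x) := by
  set g := gramMap Y x with hg
  have e1 : ∑ k, ∑ i, ∑ e, star (∑ c, x i e c • Y k ⟨i, c⟩) * ∑ c, x i e c • Y k ⟨i, c⟩ =
      gramMap Y (star x * x) := by
    rw [gramMap_apply]
    refine Finset.sum_congr rfl fun k _ => Finset.sum_congr rfl fun i _ => ?_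
    have h : ∀ e : Fin (nb i), star (∑ c, x i e c • Y k ⟨i, c⟩) * ∑ c, x i e c • Y k ⟨i, c⟩ =
        ∑ a, ∑ c, (star (x i e a) * x i e c) • (star (Y k ⟨i, a⟩) * Y k ⟨i, c⟩) := fun e => by
      simp only [star_sum, star_smul, Finset.sum_mul, Finset.mul_sum, smul_mul_smul_comm]
      exact Finset.sum_comm
    simp only [h]
    rw [Finset.sum_comm]
    refine Finset.sum_congr rfl fun a _ => ?_
    rw [Finset.sum_comm]
    refine Finset.sum_congr rfl fun c _ => ?_
    rw [← Finset.sum_smul]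
    rfl
  have e2 : ∑ k, ∑ i, ∑ e, star (Y k ⟨i, e⟩) * ∑ c, x i e c • Y k ⟨i, c⟩ = g := by
    rw [hg, gramMap_apply]
    simp only [Finset.mul_sum, mul_smul_comm]
  have e3 : ∑ k, ∑ i, ∑ e, star (∑ c, x i e c • Y k ⟨i, c⟩) * Y k ⟨i, e⟩ = star g := by
    rw [← e2]
    simp only [star_sum, star_mul, star_star]
  have e4 := h1
  rw [gramMap_one] at e4
  have h : ∀ k i e, star (∑ c, x i e c • Y k ⟨i, c⟩ - Y k ⟨i, e⟩ * g) *
        (∑ c, x i e c • Y k ⟨i, c⟩ - Y k ⟨i, e⟩ * g) =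
      star (∑ c, x i e c • Y k ⟨i, c⟩) * (∑ c, x i e c • Y k ⟨i, c⟩) -
      (star (∑ c, x i e c • Y k ⟨i, c⟩) * Y k ⟨i, e⟩) * g -
      star g * (star (Y k ⟨i, e⟩) * ∑ c, x i e c • Y k ⟨i, c⟩) +
      star g * (star (Y k ⟨i, e⟩) * Y k ⟨i, e⟩) * g := fun k i e => by
    rw [star_sub, star_mul]
    noncomm_ring
  simp only [h, Finset.sum_add_distrib, Finset.sum_sub_distrib, ← Finset.mul_sum, ← Finset.sum_mul,
    e1, e2, e3, e4]
  noncomm_ring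

theorem gramMap_isSchwarz (Y : K → (Σ i, Fin (nb i)) → A) (h1 : gramMap Y 1 = 1) :
    IsSchwarz (gramMap Y) := by
  refine ⟨gramMap_star Y, fun ω hω x => ?_⟩
  rw [gramMap_star_mul_sub Y h1]
  simp only [map_sum]
  exact Finset.sum_nonneg fun k _ => Finset.sum_nonneg fun i _ => Finset.sum_nonneg fun e _ => hω _

theorem apply_eq_sum_smul_blockUnit (α : Blocks nb →ₗ[ℂ] A) (x : Blocks nb) :
    α x = ∑ i, ∑ a, ∑ c, x i a c • α (blockUnit i a c) := by
  conv_lhs => rw [← Finset.univ_sum_single x]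
  rw [map_sum]
  refine Finset.sum_congr rfl fun i _ => ?_
  conv_lhs => rw [Matrix.matrix_eq_sum_single (x i)]
  have e : ∀ f : Matrix (Fin (nb i)) (Fin (nb i)) ℂ, (Pi.single i f : Blocks nb) =
      LinearMap.single ℂ (fun i => Matrix (Fin (nb i)) (Fin (nb i)) ℂ) i f := fun _ => rfl
  rw [e]
  simp only [map_sum]
  refine Finset.sum_congr rfl fun a _ => Finset.sum_congr rfl fun c _ => ?_
  rw [← map_smul, blockUnit, ← e, ← Pi.single_smul, Matrix.smul_single, smul_eq_mul, mul_one]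

theorem ext_blockUnit {α β : Blocks nb →ₗ[ℂ] A}
    (h : ∀ i a c, α (blockUnit i a c) = β (blockUnit i a c)) : α = β := by
  refine LinearMap.ext fun x => ?_
  rw [apply_eq_sum_smul_blockUnit, apply_eq_sum_smul_blockUnit β]
  simp only [h]

/-- The units `e_{0a}` of each block satisfy `e_{0a}* e_{0c} = e_{ac}`, so the Gram representation
of their images determines the map. -/
theorem IsCompletelyPositive.exists_gramMap {α : Blocks nb →ₗ[ℂ] A}
    (hα : IsCompletelyPositive α) :
    ∃ (N : ℕ) (Y : Fin N → (Σ i, Fin (nb i)) → A), α = gramMap Y := by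
  obtain ⟨N, y, hy⟩ := hα.exists_gram fun p : Σ i, Fin (nb i) =>
    (blockUnit p.1 (firstIdx p.2) p.2 : Blocks nb)
  refine ⟨N, y, ?_⟩
  refine ext_blockUnit fun i a c => ?_
  rw [gramMap_blockUnit]
  simp only [← hy ⟨i, a⟩ ⟨i, c⟩]
  rw [star_blockUnit]
  exact congrArg α (blockUnit_mul i a (firstIdx c) c).symm

end gram

/-! ### Approximation by maps into local algebras -/

section approx
variable {b : ℕ} {nb : Fin b → ℕ}

/-- The tracial state. -/
def blockTrace (nb : Fin b → ℕ) : Blocks nb →ₗ[ℂ] ℂ where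
  toFun x := (Fintype.card (Σ i, Fin (nb i)) : ℂ)⁻¹ * ∑ i, (x i).trace
  map_add' x y := by
    simp only [Pi.add_apply, Matrix.trace_add, Finset.sum_add_distrib, mul_add]
  map_smul' c x := by
    simp only [Pi.smul_apply, Matrix.trace_smul, smul_eq_mul, ← Finset.mul_sum, RingHom.id_apply]
    ring

theorem blockTrace_one [Nonempty (Σ i, Fin (nb i))] : blockTrace nb 1 = 1 := by
  change (Fintype.card (Σ i, Fin (nb i)) : ℂ)⁻¹ *
    ∑ i, (1 : Matrix (Fin (nb i)) (Fin (nb i)) ℂ).trace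
    = 1
  simp only [Matrix.trace_one, Fintype.card_sigma, Fintype.card_fin]
  rw [← Nat.cast_sum, inv_mul_cancel₀]
  have := Fintype.card_pos (α := Σ i, Fin (nb i))
  rw [Fintype.card_sigma] at this
  simp only [Fintype.card_fin] at this
  exact_mod_cast this.ne'

theorem blockTrace_blockUnit (i : Fin b) (a c : Fin (nb i)) :
    blockTrace nb (blockUnit i a c) =
      (Fintype.card (Σ i, Fin (nb i)) : ℂ)⁻¹ * if a = c then 1 else 0 := by
  change (Fintype.card (Σ i, Fin (nb i)) : ℂ)⁻¹ * ∑ j, (blockUnit i a c j : Matrix _ _ ℂ).trace = _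
  congr 1
  rw [Finset.sum_eq_single i]
  · rw [blockUnit, Pi.single_eq_same]
    split_ifs with h
    · rw [h, Matrix.trace_single_eq_same]
    · rw [Matrix.trace_single_eq_of_ne _ _ _ h]
  · intro j _ h
    rw [blockUnit, Pi.single_eq_of_ne h, Matrix.trace_zero]
  · simp

variable {A : Type*} [CStarAlgebra A] {K : Type*} [Fintype K]

/-- The contraction of a completely positive map by `s`, made unital with the tracial state. -/
def unitalMap (s : ℝ) (Y : K → (Σ i, Fin (nb i)) → A) : Blocks nb →ₗ[ℂ] A :=
  (s : ℂ) • gramMap Y + (blockTrace nb).smulRight (1 - (s : ℂ) • gramMap Y 1)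

theorem unitalMap_apply (s : ℝ) (Y : K → (Σ i, Fin (nb i)) → A) (x : Blocks nb) :
    unitalMap s Y x = (s : ℂ) • gramMap Y x + blockTrace nb x • (1 - (s : ℂ) • gramMap Y 1) := rfl

theorem unitalMap_unital [Nonempty (Σ i, Fin (nb i))] (s : ℝ) (Y : K → (Σ i, Fin (nb i)) → A) :
    unitalMap s Y 1 = 1 := by
  rw [unitalMap_apply, blockTrace_one, one_smul, add_sub_cancel]

theorem continuous_gramMap (x : Blocks nb) :
    Continuous fun Y : K → (Σ i, Fin (nb i)) → A => gramMap Y x := by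
  simp only [gramMap_apply]
  fun_prop

theorem continuous_unitalMap (x : Blocks nb) :
    Continuous fun p : ℝ × (K → (Σ i, Fin (nb i)) → A) => unitalMap p.1 p.2 x := by
  simp only [unitalMap_apply]
  have h1 : Continuous fun p : ℝ × (K → (Σ i, Fin (nb i)) → A) => gramMap p.2 x :=
    (continuous_gramMap x).comp continuous_snd
  have h2 : Continuous fun p : ℝ × (K → (Σ i, Fin (nb i)) → A) => gramMap (nb := nb) p.2 1 :=
    (continuous_gramMap 1).comp continuous_snd
  have h3 : Continuous fun p : ℝ × (K → (Σ i, Fin (nb i)) → A) => (p.1 : ℂ) :=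
    Complex.continuous_ofReal.comp continuous_fst
  exact (h3.smul h1).add (continuous_const.smul (continuous_const.sub (h3.smul h2)))

theorem gramMap_mem {F : StarSubalgebra ℂ A} {Y : K → (Σ i, Fin (nb i)) → A}
    (hY : ∀ k p, Y k p ∈ F) (x : Blocks nb) : gramMap Y x ∈ F := by
  rw [gramMap_apply]
  exact sum_mem fun k _ => sum_mem fun i _ => sum_mem fun a _ => sum_mem fun c _ =>
    SMulMemClass.smul_mem _ (mul_mem (star_mem (hY _ _)) (hY _ _))

theorem unitalMap_mem {F : StarSubalgebra ℂ A} {s : ℝ} {Y : K → (Σ i, Fin (nb i)) → A}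
    (hY : ∀ k p, Y k p ∈ F) (x : Blocks nb) : unitalMap s Y x ∈ F := by
  rw [unitalMap_apply]
  exact add_mem (SMulMemClass.smul_mem _ (gramMap_mem hY x)) (SMulMemClass.smul_mem _
    (sub_mem (one_mem _) (SMulMemClass.smul_mem _ (gramMap_mem hY 1))))

theorem one_sub_nonneg [PartialOrder A] [StarOrderedRing A] {a : A} (ha : IsSelfAdjoint a)
    (h : ‖a‖ ≤ 1) : 0 ≤ 1 - a := by
  rw [sub_nonneg]
  refine ha.le_algebraMap_norm_self.trans ?_
  rw [← map_one (algebraMap ℝ A)]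
  exact algebraMap_mono A h

/-- The norm bound makes the defect `1 - s α(1)` a square `R* R`. The tracial correction is then a
Gram sum too, and a unital Gram sum is Schwarz. -/
theorem unitalMap_isSchwarz [Nonempty (Σ i, Fin (nb i))] {s : ℝ} (hs : 0 ≤ s)
    {Y : K → (Σ i, Fin (nb i)) → A} (h : ‖(s : ℂ) • gramMap Y 1‖ ≤ 1) :
    IsSchwarz (unitalMap s Y) := by
  classical
  let _ := CStarAlgebra.spectralOrder A
  have _ := CStarAlgebra.spectralOrderedRing A
  have hsa : IsSelfAdjoint ((s : ℂ) • gramMap Y 1) := by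
    rw [IsSelfAdjoint, star_smul, ← gramMap_star, star_one]
    congr 1
    exact Complex.conj_ofReal s
  obtain ⟨R, hR⟩ := CStarAlgebra.nonneg_iff_eq_star_mul_self.1 (one_sub_nonneg hsa h)
  set c := Fintype.card (Σ i, Fin (nb i)) with hc
  -- One extra factor for each diagonal unit realises the normalised trace times `R* R`.
  let Z : K ⊕ (Σ i, Fin (nb i)) → (Σ i, Fin (nb i)) → A :=
    Sum.elim (fun k p => ((√s : ℝ) : ℂ) • Y k p)
      fun j p => if p = j then ((√(c : ℝ)⁻¹ : ℝ) : ℂ) • R else 0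
  have hsm : ∀ (t : ℝ) (_ : 0 ≤ t) (u v : A), star (((√t : ℝ) : ℂ) • u) * (((√t : ℝ) : ℂ) • v) =
      (t : ℂ) • (star u * v) := fun t ht u v => by
    rw [star_smul, smul_mul_smul_comm]
    congr 1
    rw [Complex.star_def, Complex.conj_ofReal, ← Complex.ofReal_mul, Real.mul_self_sqrt ht]
  have hZ : unitalMap s Y = gramMap Z := by
    refine ext_blockUnit fun i a d => ?_
    rw [unitalMap_apply, gramMap_blockUnit, gramMap_blockUnit, Fintype.sum_sum_type,
      blockTrace_blockUnit, hR, Finset.smul_sum]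
    congr 1
    · exact Finset.sum_congr rfl fun k _ => (hsm s hs _ _).symm
    · rw [Finset.sum_eq_single ⟨i, a⟩]
      · simp only [Z, Sum.elim_inr, if_true]
        by_cases had : a = d
        · subst had
          rw [if_pos rfl, if_pos rfl, hsm _ (by positivity)]
          simp [hc]
        · have : (⟨i, d⟩ : Σ i, Fin (nb i)) ≠ ⟨i, a⟩ := fun e => had (by simpa using e.symm)
          rw [if_neg had, if_neg this]
          simp
      · intro j _ hj
        simp [Z, hj.symm]
      · simp
  rw [hZ]
  exact gramMap_isSchwarz Z (by rw [← hZ, unitalMap_unital])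

theorem IsSchwarz.isState_comp {B : Type*} [Ring B] [StarRing B] [Algebra ℂ B]
    {α : B →ₗ[ℂ] A} (hα : IsSchwarz α) (h1 : α 1 = 1) {ω : A →ₗ[ℂ] ℂ} (hω : IsState ω) :
    IsState (ω ∘ₗ α) := ⟨hα.isPositive_comp hω.1, by rw [LinearMap.comp_apply, h1, hω.2]⟩

/-- Approximation of unital completely positive maps from finite-dimensional algebras by maps into
a dense union of subalgebras. -/
theorem IsCompletelyPositive.exists_approx {F : ℕ → StarSubalgebra ℂ A} (hF : Monotone F)
    (hd : ∀ x : A, ∀ ε > 0, ∃ M, ∃ y ∈ F M, ‖x - y‖ < ε) {α : Blocks nb →ₗ[ℂ] A}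
    (hα : IsCompletelyPositive α) (h1 : α 1 = 1) {ε : ℝ} (hε : 0 < ε) :
    ∃ (M : ℕ) (β : Blocks nb →ₗ[ℂ] A), IsSchwarz β ∧ β 1 = 1 ∧ (∀ x, β x ∈ F M) ∧
      ∀ ω : A →ₗ[ℂ] ℂ, IsState ω → |blockEntropy (ω ∘ₗ α) - blockEntropy (ω ∘ₗ β)| ≤ ε := by
  obtain ⟨N, Y, rfl⟩ := hα.exists_gramMap
  -- For the zero algebra the trace cannot be normalised; the map involves no factors and serves
  -- itself.
  rcases isEmpty_or_nonempty (Σ i, Fin (nb i)) with hJ | hJ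
  · exact ⟨0, gramMap Y, gramMap_isSchwarz Y h1, h1, gramMap_mem fun k p => isEmptyElim p,
      fun ω _ => by rw [sub_self, abs_zero]; exact hε.le⟩
  obtain ⟨δ, hδ, H⟩ := exists_abs_blockEntropy_sub_lt (nb := nb) hε
  have hY1 : unitalMap 1 Y = gramMap Y := by
    refine LinearMap.ext fun x => ?_
    rw [unitalMap_apply, h1, Complex.ofReal_one, one_smul, one_smul, sub_self, smul_zero, add_zero]
  have hs : ∀ᶠ s : ℝ in nhdsWithin 1 (Set.Iio 1), ∀ i a c,
      ‖gramMap Y (blockUnit i a c) - unitalMap s Y (blockUnit i a c)‖ < δ := by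
    refine Filter.eventually_all.2 fun i => Filter.eventually_all.2 fun a =>
      Filter.eventually_all.2 fun c => nhdsWithin_le_nhds ?_
    have hc : Continuous fun s : ℝ =>
        ‖gramMap Y (blockUnit i a c) - unitalMap s Y (blockUnit i a c)‖ :=
      (continuous_const.sub ((continuous_unitalMap (blockUnit i a c)).comp
        (continuous_id.prodMk continuous_const))).norm
    refine hc.continuousAt.eventually_lt continuousAt_const ?_
    rwa [hY1, sub_self, norm_zero]
  -- A contraction factor slightly below one leaves room: after replacing the factors `Y` by nearby
  -- local ones, `s α(1)` still has norm below one.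
  obtain ⟨s, hs, hs0, hs1⟩ := (hs.and (Ioo_mem_nhdsLT zero_lt_one)).exists
  have hn1 : ‖(1 : A)‖ ≤ 1 := by
    rcases subsingleton_or_nontrivial A with h | h
    · rw [Subsingleton.elim (1 : A) 0, norm_zero]
      exact zero_le_one
    · exact CStarRing.norm_one.le
  have hY : ∀ᶠ Y' in nhds Y, (∀ i a c,
      ‖gramMap Y (blockUnit i a c) - unitalMap s Y' (blockUnit i a c)‖ < δ) ∧
      ‖(s : ℂ) • gramMap Y' (1 : Blocks nb)‖ < 1 := by
    refine Filter.Eventually.and (Filter.eventually_all.2 fun i => Filter.eventually_all.2 fun a =>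
      Filter.eventually_all.2 fun c => ?_) ?_
    · have hc : Continuous fun Y' : Fin N → (Σ i, Fin (nb i)) → A =>
          ‖gramMap Y (blockUnit i a c) - unitalMap s Y' (blockUnit i a c)‖ :=
        (continuous_const.sub ((continuous_unitalMap (blockUnit i a c)).comp
          (continuous_const.prodMk continuous_id))).norm
      exact hc.continuousAt.eventually_lt continuousAt_const (hs i a c)
    · have hc : Continuous fun Y' : Fin N → (Σ i, Fin (nb i)) → A =>
          ‖(s : ℂ) • gramMap Y' (1 : Blocks nb)‖ := ((continuous_gramMap 1).const_smul _).norm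
      refine hc.continuousAt.eventually_lt continuousAt_const ?_
      rw [h1, norm_smul, Complex.norm_real, Real.norm_of_nonneg hs0.le]
      nlinarith [norm_nonneg (1 : A)]
  obtain ⟨η, hη, hY⟩ := Metric.eventually_nhds_iff.1 hY
  choose M Y' hY' hYY' using fun k p => hd (Y k p) η hη
  obtain ⟨M₀, hM₀⟩ := (Set.finite_range fun q : Fin N × (Σ i, Fin (nb i)) => M q.1 q.2).bddAbove
  obtain ⟨h2, h3⟩ := hY (y := Y') ((dist_pi_lt_iff hη).2 fun k => (dist_pi_lt_iff hη).2 fun p => by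
    rw [dist_comm, dist_eq_norm]
    exact hYY' k p)
  have hβ := unitalMap_isSchwarz hs0.le h3.le
  refine ⟨M₀, unitalMap s Y', hβ, unitalMap_unital s Y', unitalMap_mem fun k p =>
    hF (hM₀ ⟨(k, p), rfl⟩) (hY' k p), fun ω hω => (H _ _ ?_ ?_ fun i a c => ?_).le⟩
  · exact (gramMap_isSchwarz Y h1).isState_comp h1 hω
  · exact hβ.isState_comp (unitalMap_unital s Y') hω
  · rw [LinearMap.comp_apply, LinearMap.comp_apply, ← map_sub]
    refine (hω.1.norm_apply_le _).trans_lt ?_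
    rw [hω.2, Complex.one_re, one_mul]
    exact h2 i a c

end approx

/-! ### Stability of the CNT functional and the orbit bound -/

section compare
variable {A : Type*} [Ring A] [StarRing A] [Algebra ℂ A] {b : ℕ} {nb : Fin b → ℕ} {k r : ℕ}

/-- The mass terms do not involve the maps. For each map, the entropy of `φ` changes by at most `ε`,
and so does the average over the marginals, whose masses add up to one. -/
theorem cntValue_sub_le {φ : A →ₗ[ℂ] ℂ} (hφ : IsState φ) {α β : Fin k → (Blocks nb →ₗ[ℂ] A)}
    {ε : ℝ} (h : ∀ l (ω : A →ₗ[ℂ] ℂ), IsState ω →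
      |blockEntropy (ω ∘ₗ α l) - blockEntropy (ω ∘ₗ β l)| ≤ ε)
    {ψ : (Fin k → Fin r) → (A →ₗ[ℂ] ℂ)} (hψ : ∀ J, IsPositive (ψ J)) (hsum : ∑ J, ψ J = φ) :
    cntValue φ α ψ - cntValue φ β ψ ≤ k * (2 * ε) := by
  have h1 : ∀ l i, mass (marginal ψ l i) * blockEntropy (normalization (marginal ψ l i) ∘ₗ β l) -
      mass (marginal ψ l i) * blockEntropy (normalization (marginal ψ l i) ∘ₗ α l) ≤
      mass (marginal ψ l i) * ε := fun l i => by
    have hp := IsPositive.marginal hψ l i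
    rw [← mul_sub]
    rcases hp.mass_nonneg.eq_or_lt with h0 | h0
    · rw [← h0, zero_mul, zero_mul]
    refine mul_le_mul_of_nonneg_left ?_ h0.le
    have hs : IsState (normalization (marginal ψ l i)) := by
      refine ⟨fun a => ?_, ?_⟩
      · rw [normalization, LinearMap.smul_apply, smul_eq_mul, ← hp.ofReal_mass,
          ← Complex.ofReal_inv]
        exact mul_nonneg (Complex.zero_le_real.2 (inv_nonneg.2 h0.le)) (hp a)
      · rw [normalization, LinearMap.smul_apply, smul_eq_mul, ← hp.ofReal_mass]
        exact inv_mul_cancel₀ (Complex.ofReal_ne_zero.2 h0.ne')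
    linarith [(abs_le.1 (h l _ hs)).1]
  have h2 : ∀ l, ∑ i, mass (marginal ψ l i) = 1 := fun l => by
    rw [← mass_sum, sum_marginal, hsum, mass, hφ.2, Complex.one_re]
  have h3 : ∀ l : Fin k, blockEntropy (φ ∘ₗ α l) - blockEntropy (φ ∘ₗ β l) +
      (∑ i, mass (marginal ψ l i) * blockEntropy (normalization (marginal ψ l i) ∘ₗ β l) -
      ∑ i, mass (marginal ψ l i) * blockEntropy (normalization (marginal ψ l i) ∘ₗ α l)) ≤
      2 * ε := fun l => by
    have h4 := Finset.sum_le_sum fun i (_ : i ∈ Finset.univ) => h1 l i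
    rw [Finset.sum_sub_distrib, ← Finset.sum_mul, h2, one_mul] at h4
    linarith [(abs_le.1 (h l φ hφ)).2]
  have h5 := Finset.sum_le_sum fun l (_ : l ∈ Finset.univ) => h3 l
  rw [Finset.sum_add_distrib, Finset.sum_sub_distrib, Finset.sum_sub_distrib, Finset.sum_const,
    Finset.card_univ, Fintype.card_fin, nsmul_eq_mul] at h5
  rw [cntValue, cntValue]
  linarith

theorem cntH_le_of_approx {φ : A →ₗ[ℂ] ℂ} (hφ : IsState φ) {α β : Fin k → (Blocks nb →ₗ[ℂ] A)}
    {ε : ℝ} (h : ∀ l (ω : A →ₗ[ℂ] ℂ), IsState ω →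
      |blockEntropy (ω ∘ₗ α l) - blockEntropy (ω ∘ₗ β l)| ≤ ε)
    (hβ : ∀ l, IsSchwarz (β l)) (h1 : ∀ l, β l 1 = 1) {b' : ℕ} {nb' : Fin b' → ℕ}
    (e : Blocks nb' →⋆ₐ[ℂ] A) (he : ∀ l x, ∃ y, e y = β l x) :
    cntH φ α ≤ ((blockEntropy (φ ∘ₗ e.toAlgHom.toLinearMap) + k * (2 * ε) : ℝ) : EReal) := by
  refine iSup_le fun r => iSup_le fun ψ => iSup_le fun hψ => EReal.coe_le_coe_iff.2 ?_
  have h2 := cntValue_sub_le hφ h hψ.1 hψ.2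
  have h3 := cntValue_le hψ.1 hψ.2 hβ h1 e he
  linarith

theorem IsSchwarz.comp_autPow {B : Type*} [Ring B] [StarRing B] [Algebra ℂ B] {β : B →ₗ[ℂ] A}
    (hβ : IsSchwarz β) (θ : A ≃⋆ₐ[ℂ] A) (p : ℕ) : IsSchwarz (autPow θ p ∘ₗ β) := by
  have hstar : ∀ x, autPow θ p (star x) = star (autPow θ p x) := fun x => by
    have := autPow_star_mul θ p x 1
    rwa [mul_one, autPow_one, mul_one] at this
  refine ⟨fun x => ?_, fun ω hω x => ?_⟩
  · rw [LinearMap.comp_apply, hβ.1, hstar, LinearMap.comp_apply]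
  · rw [LinearMap.comp_apply, LinearMap.comp_apply, ← autPow_star_mul, ← map_sub]
    exact hβ.2 _ (hω.comp_autPow θ p) x

theorem IsState.comp_autPow {ω : A →ₗ[ℂ] ℂ} (hω : IsState ω) (θ : A ≃⋆ₐ[ℂ] A) (p : ℕ) :
    IsState (ω ∘ₗ autPow θ p) :=
  ⟨hω.1.comp_autPow θ p, by rw [LinearMap.comp_apply, autPow_one, hω.2]⟩

/-- Bound on the CNT entropy along an orbit by the entropies of local algebras. -/
theorem cntH_orbit_le {φ : A →ₗ[ℂ] ℂ} (hφ : IsState φ) (θ : A ≃⋆ₐ[ℂ] A)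
    {α β : Blocks nb →ₗ[ℂ] A} {ε : ℝ} (h : ∀ ω : A →ₗ[ℂ] ℂ, IsState ω →
      |blockEntropy (ω ∘ₗ α) - blockEntropy (ω ∘ₗ β)| ≤ ε)
    (hβ : IsSchwarz β) (h1 : β 1 = 1) {b' : ℕ} {nb' : Fin b' → ℕ}
    (e : Blocks nb' →⋆ₐ[ℂ] A) (he : ∀ l : Fin k, ∀ x, ∃ y, e y = autPow θ l (β x)) :
    cntH φ (fun l : Fin k => autPow θ l ∘ₗ α) ≤
      ((blockEntropy (φ ∘ₗ e.toAlgHom.toLinearMap) + k * (2 * ε) : ℝ) : EReal) :=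
  cntH_le_of_approx hφ (β := fun l : Fin k => autPow θ l ∘ₗ β)
    (fun l ω hω => by
      rw [← LinearMap.comp_assoc, ← LinearMap.comp_assoc]
      exact h _ (hω.comp_autPow θ l)) (fun l => hβ.comp_autPow θ l)
    (fun l => by rw [LinearMap.comp_apply, h1, autPow_one]) e he

end compare
end QChain
end

noncomputable section
open scoped ComplexOrder Kronecker
set_option linter.unusedSectionVars false
namespace QChain

/-! ### Subadditivity of the von Neumann entropy -/

section subadditivity
variable {α β : Type*} [Fintype α] [DecidableEq α] [Fintype β] [DecidableEq β]

/-- The inequality `log x ≤ x - 1` at `x = pq / r`. Summed over a joint distribution with marginals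
`p`, `q`, the correction `pq - r` disappears. -/
theorem negMulLog_le_of_support {r p q : ℝ} (hr : 0 ≤ r) (hp : 0 ≤ p) (hq : 0 ≤ q)
    (h1 : p = 0 → r = 0) (h2 : q = 0 → r = 0) :
    Real.negMulLog r ≤ -(r * Real.log p) - r * Real.log q + (p * q - r) := by
  rcases hr.eq_or_lt with rfl | hr
  · simp only [Real.negMulLog_zero, zero_mul, neg_zero, sub_zero, zero_add]
    positivity
  have hp' : 0 < p := hp.lt_of_ne fun h => hr.ne' (h1 h.symm)
  have hq' : 0 < q := hq.lt_of_ne fun h => hr.ne' (h2 h.symm)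
  have h := Real.log_le_sub_one_of_pos (x := p * q / r) (by positivity)
  rw [Real.log_div (by positivity) hr.ne', Real.log_mul hp'.ne' hq'.ne'] at h
  have h3 := mul_le_mul_of_nonneg_left h hr.le
  have e : r * (p * q / r - 1) = p * q - r := by field_simp
  rw [e] at h3
  rw [Real.negMulLog]
  linarith

theorem sum_negMulLog_le {r : α → β → ℝ} (hr : ∀ i j, 0 ≤ r i j) (h1 : ∑ i, ∑ j, r i j = 1) :
    ∑ i, ∑ j, Real.negMulLog (r i j) ≤
      ∑ i, Real.negMulLog (∑ j, r i j) + ∑ j, Real.negMulLog (∑ i, r i j) := by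
  set p : α → ℝ := fun i => ∑ j, r i j with hp
  set q : β → ℝ := fun j => ∑ i, r i j with hq
  have h1' : ∑ j, q j = 1 := by rw [hq, Finset.sum_comm, h1]
  have h : ∀ i j, Real.negMulLog (r i j) ≤
      -(r i j * Real.log (p i)) - r i j * Real.log (q j) + (p i * q j - r i j) := fun i j =>
    negMulLog_le_of_support (hr i j) (Finset.sum_nonneg fun j _ => hr i j)
      (Finset.sum_nonneg fun i _ => hr i j)
      (fun h => (Finset.sum_eq_zero_iff_of_nonneg fun j _ => hr i j).1 h j (Finset.mem_univ j))
      (fun h => (Finset.sum_eq_zero_iff_of_nonneg fun i _ => hr i j).1 h i (Finset.mem_univ i))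
  refine (Finset.sum_le_sum fun i _ => Finset.sum_le_sum fun j _ => h i j).trans (le_of_eq ?_)
  have e1 : ∑ i, ∑ j, r i j * Real.log (p i) = ∑ i, p i * Real.log (p i) := by
    simp only [← Finset.sum_mul]
    rfl
  have e2 : ∑ i, ∑ j, r i j * Real.log (q j) = ∑ j, q j * Real.log (q j) := by
    rw [Finset.sum_comm]
    simp only [← Finset.sum_mul]
    rfl
  have e3 : ∑ i, ∑ j, p i * q j = 1 := by
    simp only [← Finset.mul_sum, h1', mul_one]
    exact h1
  simp only [Finset.sum_add_distrib, Finset.sum_sub_distrib, Finset.sum_neg_distrib, e1, e2, e3,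
    Real.negMulLog, neg_mul]
  have h1'' : ∑ i, ∑ j, r i j = 1 := h1
  rw [h1'']
  change _ = -∑ i, p i * Real.log (p i) + -∑ j, q j * Real.log (q j)
  ring

theorem vnEntropy_conj {D W : Matrix α α ℂ} (hD : D.PosSemidef) (hW : W * star W = 1) :
    vnEntropy (star W * D * W) = vnEntropy D := by
  obtain ⟨B, rfl⟩ := PosSemidef.exists_star_mul hD
  have h1 : star W * (star B * B) * W = (B * W).conjTranspose * (B * W) := by
    rw [Matrix.conjTranspose_mul]
    simp only [Matrix.star_eq_conjTranspose, mul_assoc]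
  rw [h1, ← vnEntropy_mul_conjTranspose, Matrix.conjTranspose_mul, ← Matrix.star_eq_conjTranspose,
    ← Matrix.star_eq_conjTranspose, mul_assoc, ← mul_assoc W, hW, one_mul,
    Matrix.star_eq_conjTranspose, vnEntropy_mul_conjTranspose]

theorem trace_conj_mul_conj {U : Matrix α α ℂ} (hU : star U * U = 1) (P X : Matrix α α ℂ) :
    ((U * P * star U) * (U * X * star U)).trace = (P * X).trace := by
  have e : (U * P * star U) * (U * X * star U) = U * (P * X * star U) := by
    simp only [mul_assoc]
    rw [← mul_assoc (star U) U, hU, one_mul]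
  rw [e, Matrix.trace_mul_comm, mul_assoc, hU, mul_one]

theorem vnEntropy_submatrix {D : Matrix α α ℂ} (hD : D.PosSemidef) (f : β ≃ α) :
    vnEntropy (D.submatrix f f) = vnEntropy D := by
  obtain ⟨B, rfl⟩ := PosSemidef.exists_star_mul hD
  have h1 : (star B * B).submatrix f f = (B.submatrix id f).conjTranspose * B.submatrix id f := by
    ext i j
    rfl
  have h2 : B.submatrix id f * (B.submatrix id f).conjTranspose = B * B.conjTranspose := by
    ext i j
    simp only [Matrix.mul_apply, Matrix.submatrix_apply, Matrix.conjTranspose_apply, id]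
    exact f.sum_comp fun x => B i x * star (B j x)
  rw [h1, ← vnEntropy_mul_conjTranspose, h2, vnEntropy_mul_conjTranspose,
    Matrix.star_eq_conjTranspose]

/-- Subadditivity of the von Neumann entropy. -/
theorem vnEntropy_subadditive {ρ : Matrix (α × β) (α × β) ℂ} {ρ₁ : Matrix α α ℂ}
    {ρ₂ : Matrix β β ℂ} (hρ : ρ.PosSemidef) (h1 : ρ₁.PosSemidef) (h2 : ρ₂.PosSemidef)
    (htr : ρ.trace = 1) (hm1 : ∀ X, (ρ * (X ⊗ₖ (1 : Matrix β β ℂ))).trace = (ρ₁ * X).trace)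
    (hm2 : ∀ X, (ρ * ((1 : Matrix α α ℂ) ⊗ₖ X)).trace = (ρ₂ * X).trace) :
    vnEntropy ρ ≤ vnEntropy ρ₁ + vnEntropy ρ₂ := by
  obtain ⟨U, hU, p, hp, rfl⟩ := PosSemidef.exists_diagonal h1
  obtain ⟨V, hV, q, hq, rfl⟩ := PosSemidef.exists_diagonal h2
  have hU1 : U * star U = 1 := Matrix.mem_unitaryGroup_iff.1 hU
  have hV1 : V * star V = 1 := Matrix.mem_unitaryGroup_iff.1 hV
  have hU2 : star U * U = 1 := Matrix.mem_unitaryGroup_iff'.1 hU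
  have hV2 : star V * V = 1 := Matrix.mem_unitaryGroup_iff'.1 hV
  have hWs : star (U ⊗ₖ V) = star U ⊗ₖ star V := Matrix.conjTranspose_kronecker U V
  have hW : (U ⊗ₖ V) * star (U ⊗ₖ V) = 1 := by
    rw [hWs, ← Matrix.mul_kronecker_mul, hU1, hV1, Matrix.one_kronecker_one]
  -- In the product eigenbasis of the marginals the diagonal of `ρ` is a joint distribution whose
  -- marginals are the two spectra, so classical subadditivity applies.
  set D := star (U ⊗ₖ V) * ρ * (U ⊗ₖ V) with hDdef
  have hD : D.PosSemidef := by
    have := hρ.conjTranspose_mul_mul_same (U ⊗ₖ V)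
    exact this
  have htrD : ∀ X, (D * X).trace = (ρ * ((U ⊗ₖ V) * X * star (U ⊗ₖ V))).trace := fun X => by
    rw [hDdef, mul_assoc, mul_assoc, Matrix.trace_mul_comm (star (U ⊗ₖ V))]
    simp only [mul_assoc]
  have hdiag : ∀ x, 0 ≤ (D x x).re := fun x => (Complex.nonneg_iff.1 hD.diag_nonneg).1
  have s1 : ∀ i, ∑ j, (D (i, j) (i, j)).re = p i := fun i => by
    have e : ∑ j, D (i, j) (i, j) = (D * (Matrix.single i i 1 ⊗ₖ (1 : Matrix β β ℂ))).trace := by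
      simp [Matrix.trace, Matrix.mul_apply, Fintype.sum_prod_type, Matrix.kroneckerMap_apply,
        Matrix.single_apply, Matrix.one_apply, ite_and, Finset.sum_ite_eq]
    rw [← Complex.re_sum, e, htrD, hWs, ← Matrix.mul_kronecker_mul, ← Matrix.mul_kronecker_mul,
      mul_one, hV1, hm1, trace_conj_mul_conj hU2]
    simp [Matrix.trace, Matrix.diagonal_mul, Matrix.single_apply]
  have s2 : ∀ j, ∑ i, (D (i, j) (i, j)).re = q j := fun j => by
    have e : ∑ i, D (i, j) (i, j) = (D * ((1 : Matrix α α ℂ) ⊗ₖ Matrix.single j j 1)).trace := by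
      simp [Matrix.trace, Matrix.mul_apply, Fintype.sum_prod_type, Matrix.kroneckerMap_apply,
        Matrix.single_apply, Matrix.one_apply, ite_and, Finset.sum_ite_eq]
    rw [← Complex.re_sum, e, htrD, hWs, ← Matrix.mul_kronecker_mul, ← Matrix.mul_kronecker_mul,
      mul_one, hU1, hm2, trace_conj_mul_conj hV2]
    simp [Matrix.trace, Matrix.diagonal_mul, Matrix.single_apply]
  rw [← vnEntropy_conj hρ hW, vnEntropy_conj_diagonal hU, vnEntropy_conj_diagonal hV]
  refine (vnEntropy_le_diag hD).trans ?_
  rw [Fintype.sum_prod_type]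
  have h3 : ∑ i, ∑ j, (D (i, j) (i, j)).re = 1 := by
    rw [← Fintype.sum_prod_type (f := fun x => (D x x).re), ← Complex.re_sum]
    have : D.trace = 1 := by
      have := htrD 1
      rwa [mul_one, mul_one, hW, mul_one, htr] at this
    rw [show ∑ x, D x x = D.trace from rfl, this, Complex.one_re]
  have h4 := sum_negMulLog_le (fun i j => hdiag (i, j)) h3
  simpa only [s1, s2] using h4

end subadditivity

/-! ### Adding maps to the CNT functional and taking limits along orbits -/

section monotonicity
variable {A : Type*} [Ring A] [StarRing A] [Algebra ℂ A] {b : ℕ} {nb : Fin b → ℕ} {k K : ℕ}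

theorem blockEntropy_zero : blockEntropy (0 : Blocks nb →ₗ[ℂ] ℂ) = 0 := by
  rw [blockEntropy]
  refine Finset.sum_eq_zero fun i _ => ?_
  have : density (0 : Blocks nb →ₗ[ℂ] ℂ) i = 0 := by
    ext a c
    rfl
  rw [this]
  exact vnEntropy_zero

/-- Extending a decomposition by trivial indices. -/
theorem exists_cntValue_le_of_injective {r : ℕ} {φ : A →ₗ[ℂ] ℂ} (hφ : IsState φ) (hk : 0 < k)
    {f : Fin k → Fin K} (hf : f.Injective) {α : Fin K → (Blocks nb →ₗ[ℂ] A)}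
    (hα : ∀ l (ω : A →ₗ[ℂ] ℂ), IsPositive ω → IsPositive (ω ∘ₗ α l)) (h1 : ∀ l, α l 1 = 1)
    {ψ : (Fin k → Fin r) → (A →ₗ[ℂ] ℂ)} (hψ : ∀ J, IsPositive (ψ J)) (hsum : ∑ J, ψ J = φ) :
    ∃ ψ' : (Fin K → Fin r) → (A →ₗ[ℂ] ℂ), (∀ J, IsPositive (ψ' J)) ∧ ∑ J, ψ' J = φ ∧
      cntValue φ (fun l => α (f l)) ψ ≤ cntValue φ α ψ' := by
  have hne : Nonempty (Fin k → Fin r) := by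
    by_contra h
    rw [not_nonempty_iff] at h
    rw [Finset.univ_eq_empty, Finset.sum_empty] at hsum
    have := hφ.2
    rw [← hsum] at this
    simp at this
  -- Default symbol for the added positions. At such a position the marginal is `φ` for `i₀` and
  -- zero otherwise, so its contribution cancels.
  let i₀ : Fin r := hne.some ⟨0, hk⟩
  let ext' : (Fin k → Fin r) → Fin K → Fin r := fun J => Function.extend f J fun _ => i₀
  have hext : ∀ J l, ext' J (f l) = J l := fun J l => hf.extend_apply _ _ _
  have hinj : ext'.Injective := fun J J' h => by
    ext1 l
    rw [← hext J, h, hext]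
  let ψ' : (Fin K → Fin r) → (A →ₗ[ℂ] ℂ) := Function.extend ext' ψ 0
  have hψ'1 : ∀ J, ψ' (ext' J) = ψ J := fun J => hinj.extend_apply _ _ _
  have hψ'0 : ∀ J ∉ Set.range ext', ψ' J = 0 := fun J hJ =>
    Function.extend_apply' _ _ _ fun ⟨a, ha⟩ => hJ ⟨a, ha⟩
  have hpos : ∀ J, IsPositive (ψ' J) := fun J => by
    by_cases h : J ∈ Set.range ext'
    · obtain ⟨J', rfl⟩ := h
      rw [hψ'1]
      exact hψ J'
    · rw [hψ'0 J h]
      exact fun a => le_refl _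
  have hs : ∑ J, ψ' J = φ := by
    rw [← hsum]
    exact (Fintype.sum_of_injective ext' hinj _ _ hψ'0 fun J => (hψ'1 J).symm).symm
  have hmarg : ∀ l i, marginal ψ' (f l) i = marginal ψ l i := fun l i => by
    rw [marginal, marginal, Finset.sum_filter, Finset.sum_filter]
    refine (Fintype.sum_of_injective ext' hinj _ _ (fun J hJ => ?_) fun J => ?_).symm
    · rw [hψ'0 J hJ, ite_self]
    · rw [hext, hψ'1]
  have hmarg' : ∀ l ∉ Set.range f, ∀ i, marginal ψ' l i = if i = i₀ then φ else 0 := by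
    intro l hl i
    rw [marginal, ← hs]
    have h2 : ∀ J, J l ≠ i₀ → ψ' J = 0 := fun J hJ => hψ'0 J fun ⟨J', h⟩ => hJ (by
      rw [← h]
      exact Function.extend_apply' _ _ _ fun ⟨a, ha⟩ => hl ⟨a, ha⟩)
    split_ifs with h
    · subst h
      exact Finset.sum_filter_of_ne fun J _ hJ => by_contra fun h => hJ (h2 J h)
    · exact Finset.sum_eq_zero fun J hJ => h2 J (by rw [(Finset.mem_filter.1 hJ).2]; exact h)
  refine ⟨ψ', hpos, hs, le_of_eq ?_⟩
  rw [cntValue_eq hψ (fun l J => hα _ _ (hψ J)) (fun l => h1 _),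
    cntValue_eq hpos (fun l J => hα _ _ (hpos J)) h1]
  congr 1
  · refine Fintype.sum_of_injective ext' hinj _ _ (fun J hJ => ?_) fun J => ?_
    · rw [hψ'0 J hJ]
      simp [mass]
    · rw [hψ'1]
  · refine Fintype.sum_of_injective f hf _ _ (fun l hl => ?_) fun l => ?_
    · rw [sub_eq_zero, Finset.sum_eq_single i₀]
      · rw [hmarg' l hl, if_pos rfl]
      · intro i _ hi
        rw [hmarg' l hl, if_neg hi, LinearMap.zero_comp, blockEntropy_zero]
      · simp
    · simp only [hmarg]

theorem natCast_eq_coe (K : ℕ) : (K : EReal) = ((K : ℝ) : EReal) := by simp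

theorem natCast_nonneg (K : ℕ) : (0 : EReal) ≤ K := by
  rw [natCast_eq_coe, ← EReal.coe_zero, EReal.coe_le_coe_iff]
  exact K.cast_nonneg

/-- Decompositions adapted to the translates by multiples of `n` are extended trivially to all `kn`
translates. The bounds then hold along the multiples of `n`, which suffices for the limit superior.
-/
theorem le_cntEntropyAlong {φ : A →ₗ[ℂ] ℂ} (hφ : IsState φ) (θ : A ≃⋆ₐ[ℂ] A)
    {α : Blocks nb →ₗ[ℂ] A} (hα : ∀ ω : A →ₗ[ℂ] ℂ, IsPositive ω → IsPositive (ω ∘ₗ α))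
    (h1 : α 1 = 1) {n : ℕ} (hn : 0 < n) {c : ℝ} {u : ℕ → ℝ}
    (hu : Filter.Tendsto u Filter.atTop (nhds c))
    (h : ∀ k, 0 < k → ∃ (r : ℕ) (ψ : (Fin k → Fin r) → (A →ₗ[ℂ] ℂ)), (∀ J, IsPositive (ψ J)) ∧
      ∑ J, ψ J = φ ∧ ((k * n : ℕ) : ℝ) * u k ≤
        cntValue φ (fun l : Fin k => autPow θ (n * l) ∘ₗ α) ψ) :
    (c : EReal) ≤ cntEntropyAlong φ θ α := by
  refine EReal.ge_of_forall_gt_iff_ge.1 fun z hz => ?_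
  refine Filter.le_limsup_of_frequently_le' ?_
  refine (Filter.tendsto_id.atTop_mul_const' hn).frequently (Filter.Eventually.frequently ?_)
  filter_upwards [Filter.eventually_gt_atTop 0,
    hu.eventually (eventually_gt_nhds (EReal.coe_lt_coe_iff.1 hz))] with k hk hzk
  obtain ⟨r, ψ, hψ, hsum, hle⟩ := h k hk
  have hf : ∀ l : Fin k, n * (l : ℕ) < k * n := fun l => by
    rw [mul_comm]
    exact Nat.mul_lt_mul_of_pos_right l.2 hn
  obtain ⟨ψ', hψ', hsum', hle'⟩ := exists_cntValue_le_of_injective hφ hk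
    (f := fun l : Fin k => (⟨n * l, hf l⟩ : Fin (k * n)))
    (fun l l' hl => Fin.ext (Nat.eq_of_mul_eq_mul_left hn (Fin.mk.inj hl)))
    (α := fun l : Fin (k * n) => autPow θ l ∘ₗ α)
    (fun l ω hω => hα _ (hω.comp_autPow θ l))
    (fun l => by rw [LinearMap.comp_apply, h1, autPow_one]) hψ hsum
  have h2 : (((k * n : ℕ) * u k : ℝ) : EReal) ≤
      cntH φ (fun l : Fin (k * n) => autPow θ l ∘ₗ α) :=
    le_trans (EReal.coe_le_coe_iff.2 (hle.trans hle'))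
      (le_iSup_of_le r (le_iSup_of_le ψ' (le_iSup_of_le ⟨hψ', hsum'⟩ le_rfl)))
  refine le_trans ?_ (EReal.div_le_div_right_of_nonneg (natCast_nonneg (k * n)) h2)
  rw [id_eq, natCast_eq_coe, ← EReal.coe_div, EReal.coe_le_coe_iff]
  have : ((k * n : ℕ) : ℝ) ≠ 0 := by positivity
  rw [mul_div_cancel_left₀ _ this]
  exact hzk.le

theorem cntEntropyAlong_le {φ : A →ₗ[ℂ] ℂ} (θ : A ≃⋆ₐ[ℂ] A) {α : Blocks nb →ₗ[ℂ] A} {c : ℝ}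
    {u : ℕ → ℝ} (hu : Filter.Tendsto u Filter.atTop (nhds c))
    (h : ∀ k : ℕ, 0 < k → cntH φ (fun l : Fin k => autPow θ l ∘ₗ α) ≤ ((k * u k : ℝ) : EReal)) :
    cntEntropyAlong φ θ α ≤ c := by
  have hu' : Filter.Tendsto (fun k => (u k : EReal)) Filter.atTop (nhds (c : EReal)) :=
    (continuous_coe_real_ereal.tendsto c).comp hu
  rw [← hu'.limsup_eq]
  refine Filter.limsup_le_limsup ?_
  filter_upwards [Filter.eventually_gt_atTop 0] with k hk
  refine (EReal.div_le_div_right_of_nonneg (natCast_nonneg k) (h k hk)).trans (le_of_eq ?_)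
  rw [natCast_eq_coe, ← EReal.coe_div]
  have : (k : ℝ) ≠ 0 := by positivity
  congr 1
  field_simp

end monotonicity
end QChain
end

noncomputable section
open scoped ComplexOrder Kronecker
set_option linter.unusedSectionVars false
namespace QChain

/-! ### Window entropies and comparison with the gauge-invariant algebras -/

section window
variable {d : ℕ} [NeZero d] {κ Ω : Type} [Fintype κ] [DecidableEq κ] [Fintype Ω] [DecidableEq Ω]
  {φ : quasiLocalAlg d →ₗ[ℂ] ℂ} {W : Ω → Fin d → Matrix κ κ ℂ} {Q : Matrix κ κ ℂ}
  {G : Subgroup (Matrix.unitaryGroup (Fin d) ℂ)}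

/-- The entropy of the restriction to `N` consecutive sites. -/
def windowEntropy (W : Ω → Fin d → Matrix κ κ ℂ) (Q : Matrix κ κ ℂ) (N : ℕ) : ℝ :=
  vnEntropy (kdensity (word fun _ : Fin N => W) Q)

theorem IsTransfer.kstep_one_fixed (h : IsTransfer φ W Q) (N : ℕ) :
    kstep (word fun _ : Fin N => W) 1 (Q.conjTranspose * Q) = Q.conjTranspose * Q := by
  have h1 := (h.kstep_word_one N 1).1
  rwa [pow_one] at h1

theorem IsTransfer.trace_kstep_one (h : IsTransfer φ W Q) (N : ℕ) (C : Matrix κ κ ℂ) :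
    (kstep (word fun _ : Fin N => W) 1 C).trace = C.trace := by
  have h1 := (h.kstep_word_one N 1).2 C
  rwa [pow_one] at h1

theorem IsTransfer.trace_kdensity_word (h : IsTransfer φ W Q) (N : ℕ) :
    (kdensity (word fun _ : Fin N => W) Q).trace = 1 := by
  rw [← mul_one (kdensity _ Q), trace_kdensity, h.kstep_one_fixed, h.trace_fixed]

theorem IsTransfer.windowEntropy_nonneg (h : IsTransfer φ W Q) (N : ℕ) :
    0 ≤ windowEntropy W Q N := by
  have := negMulLog_trace_le (kdensity_posSemidef (word fun _ : Fin N => W) Q)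
  rwa [h.trace_kdensity_word, Complex.one_re, Real.negMulLog_one] at this

theorem kdensity_apply {S : Type*} [Fintype S] [DecidableEq S] {Ω' : Type*} [Fintype Ω']
    [DecidableEq Ω'] (V : Ω' → S → Matrix κ κ ℂ) (Q : Matrix κ κ ℂ) (s t : S) :
    kdensity V Q s t = (kstep V (Matrix.single t s 1) (Q.conjTranspose * Q)).trace := by
  rw [← trace_kdensity, Matrix.trace_mul_single]
  simp

theorem single_eq_tensor {S : Type*} [Fintype S] [DecidableEq S] {N : ℕ} (s t : Fin N → S) :
    (Matrix.single s t 1 : Matrix (Fin N → S) (Fin N → S) ℂ) =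
      tensor fun j => Matrix.single (s j) (t j) 1 := by
  ext u v
  simp only [tensor, Matrix.of_apply, Matrix.single_apply, Finset.prod_ite_zero,
    Finset.prod_const_one, Finset.mem_univ, forall_true_left, funext_iff, forall_and]

/-- For adjacent windows, trace preservation gives the right marginal and the fixed point gives the
left one; both marginals are again window states. -/
theorem IsTransfer.subadditive (h : IsTransfer φ W Q) : Subadditive (windowEntropy W Q) := by
  intro M N
  set V := word fun _ : Fin M => W
  set V' := word fun _ : Fin N => W
  have hpos := kdensity_posSemidef (kcomp V V') Q
  have htr : ∀ X X', (kdensity (kcomp V V') Q * (X ⊗ₖ X')).trace =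
      (kstep V X (kstep V' X' (Q.conjTranspose * Q))).trace := fun X X' => by
    rw [trace_kdensity, kstep_kcomp, Module.End.mul_apply]
  have h1 := vnEntropy_subadditive hpos (kdensity_posSemidef V Q) (kdensity_posSemidef V' Q)
    (by rw [← mul_one (kdensity (kcomp V V') Q), ← Matrix.one_kronecker_one, htr,
      h.trace_kstep_one, h.kstep_one_fixed, h.trace_fixed])
    (fun X => by rw [htr, h.kstep_one_fixed, trace_kdensity])
    (fun X => by rw [htr, h.trace_kstep_one, trace_kdensity])
  refine le_trans (le_of_eq ?_) h1
  rw [windowEntropy, ← vnEntropy_submatrix (kdensity_posSemidef _ Q) (Fin.appendEquiv M N)]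
  congr 1
  ext ⟨s, s'⟩ ⟨t, t'⟩
  have e : Matrix.single (t, t') (s, s') (1 : ℂ) =
      Matrix.single t s 1 ⊗ₖ Matrix.single t' s' 1 := by
    rw [Matrix.single_kronecker_single, mul_one]
  rw [Matrix.submatrix_apply, kdensity_apply, kdensity_apply, e, kstep_kcomp, single_eq_tensor,
    single_eq_tensor, single_eq_tensor, kstep_word, kstep_word, kstep_word, ← List.prod_append,
    ← List.ofFn_fin_append]
  congr 4
  ext1 j
  refine Fin.addCases (fun i => ?_) (fun i => ?_) j
  · simp [Fin.appendEquiv]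
  · simp [Fin.appendEquiv]

theorem IsTransfer.abs_blockEntropy_sub_window (h : IsTransfer φ W Q) {N : ℕ} {Λ : Finset ℤ}
    {m : ℤ} (hΛ : IsWindow Λ m N) {b : ℕ} {nb : Fin b → ℕ} (e : gaugeLocal G Λ ≃⋆ₐ[ℂ] Blocks nb)
    (χ : Blocks nb →ₗ[ℂ] ℂ)
    (hχ : ∀ x : gaugeLocal G Λ, ∃ y : quasiLocalAlg d, (y : ChainOp d) = x ∧ χ (e x) = φ y) :
    |blockEntropy χ - windowEntropy W Q N| ≤ Real.log (((N : ℝ) + 1) ^ d ^ 2) := by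
  set D := kdensity (word fun _ : Fin N => W) Q with hD
  have hDp : D.PosSemidef := kdensity_posSemidef _ Q
  let f := Equiv.prodPUnit.{0} (Fin N → Fin d)
  have h1 := abs_blockEntropy_gauge_sub_le (Y := Unit) hΛ e χ (D := D.submatrix f f)
    ((Matrix.posSemidef_submatrix_equiv f).2 hDp) fun x => by
      obtain ⟨y, hy, hxy⟩ := hχ x
      rw [hxy, h.apply_local hΛ (x := y) (by rw [hy]; exact x.2.1), hy, ← trace_kdensity, ← hD]
      simp [Matrix.trace, Matrix.mul_apply, Fintype.sum_prod_type, f]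
  rw [vnEntropy_submatrix hDp] at h1
  have htr : (D.submatrix f f).trace = 1 := by
    rw [← h.trace_kdensity_word N, ← hD]
    exact f.sum_comp fun i => D i i
  rw [htr, Complex.one_re, one_mul, Fintype.card_unit, Nat.cast_one, mul_one] at h1
  exact h1

/-- The estimate holds for every identification with a direct sum of matrix algebras, and one
exists, so it passes to the supremum in the definition of `entropy`. -/
theorem IsTransfer.abs_entropy_sub_window (h : IsTransfer φ W Q) {φG : gaugeAlg G →ₗ[ℂ] ℂ}
    (hφ : ∀ a, φG a = φ (StarSubalgebra.inclusion (gaugeAlg_le G) a)) {N : ℕ} {Λ : Finset ℤ}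
    {m : ℤ} (hΛ : IsWindow Λ m N) :
    |entropy (localize φG Λ) - windowEntropy W Q N| ≤ Real.log (((N : ℝ) + 1) ^ d ^ 2) := by
  have hb : ∀ x ∈ {x | ∃ (m : ℕ) (n : Fin m → ℕ) (e : gaugeLocal G Λ ≃⋆ₐ[ℂ] Blocks n),
      x = blockEntropy (localize φG Λ ∘ₗ (e.symm : Blocks n →ₗ[ℂ] gaugeLocal G Λ))},
      |x - windowEntropy W Q N| ≤ Real.log (((N : ℝ) + 1) ^ d ^ 2) := by
    rintro _ ⟨b, nb, e, rfl⟩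
    refine h.abs_blockEntropy_sub_window hΛ e _ fun x => ⟨StarSubalgebra.inclusion
      (gaugeAlg_le G) (StarSubalgebra.inclusion (gaugeLocal_le Λ) x), rfl, ?_⟩
    rw [← hφ, LinearMap.comp_apply]
    have : (e.symm : Blocks nb →ₗ[ℂ] gaugeLocal G Λ) (e x) = x := e.symm_apply_apply x
    rw [this]
    rfl
  obtain ⟨b, nb, ⟨e⟩⟩ := exists_gaugeLocal_equiv (G := G) hΛ
  have hmem : blockEntropy (localize φG Λ ∘ₗ (e.symm : Blocks nb →ₗ[ℂ] gaugeLocal G Λ)) ∈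
      {x | ∃ (m : ℕ) (n : Fin m → ℕ) (e : gaugeLocal G Λ ≃⋆ₐ[ℂ] Blocks n),
        x = blockEntropy (localize φG Λ ∘ₗ (e.symm : Blocks n →ₗ[ℂ] gaugeLocal G Λ))} :=
    ⟨b, nb, e, rfl⟩
  rw [entropy, abs_le]
  constructor
  · have h1 := le_csSup ⟨windowEntropy W Q N + Real.log (((N : ℝ) + 1) ^ d ^ 2), fun x hx => by
      linarith [(abs_le.1 (hb x hx)).2]⟩ hmem
    linarith [(abs_le.1 (hb _ hmem)).1]
  · rw [sub_le_iff_le_add']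
    exact csSup_le ⟨_, hmem⟩ fun x hx => by linarith [(abs_le.1 (hb x hx)).2]

end window

/-! ### Elementary limits -/

section limits

theorem tendsto_log_div {c : ℝ} (hc : 0 < c) (D : ℕ) :
    Filter.Tendsto (fun n : ℕ => Real.log (((n : ℝ) + 1) ^ D * c) / n) Filter.atTop (nhds 0) := by
  have h1 : Filter.Tendsto (fun n : ℕ => Real.log ((n : ℝ) + 1) / n) Filter.atTop (nhds 0) := by
    have h2 : Filter.Tendsto (fun x : ℝ => Real.log x ^ 1 / (1 * x + (-1))) Filter.atTop (nhds 0) :=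
      Real.tendsto_pow_log_div_mul_add_atTop 1 (-1) 1 one_ne_zero
    have h3 := h2.comp (Filter.tendsto_atTop_add_const_right Filter.atTop (1 : ℝ)
      tendsto_natCast_atTop_atTop)
    refine h3.congr fun n => ?_
    simp
  have h2 : Filter.Tendsto (fun n : ℕ => Real.log c / (n : ℝ)) Filter.atTop (nhds 0) :=
    tendsto_const_nhds.div_atTop tendsto_natCast_atTop_atTop
  have h3 := (h1.const_mul (D : ℝ)).add h2
  rw [mul_zero, add_zero] at h3
  refine h3.congr fun n => ?_
  rw [Real.log_mul (by positivity) hc.ne', Real.log_pow]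
  ring

/-- Absorbs the fixed number of additional sites by which the supports of the translates exceed `k`.
-/
theorem tendsto_div_shift {f : ℕ → ℝ} {s : ℝ}
    (hf : Filter.Tendsto (fun n : ℕ => f n / n) Filter.atTop (nhds s)) (a : ℕ) :
    Filter.Tendsto (fun n : ℕ => f (a + n) / n) Filter.atTop (nhds s) := by
  have h1 : Filter.Tendsto (fun n : ℕ => f (a + n) / ((a + n : ℕ) : ℝ)) Filter.atTop (nhds s) :=
    hf.comp (Filter.tendsto_add_atTop_nat a |>.congr fun n => add_comm n a)
  have h2 : Filter.Tendsto (fun n : ℕ => (a : ℝ) / n + 1) Filter.atTop (nhds (0 + 1)) :=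
    (tendsto_const_nhds.div_atTop tendsto_natCast_atTop_atTop).add_const 1
  have h3 := h1.mul h2
  rw [zero_add, mul_one] at h3
  refine h3.congr' ?_
  filter_upwards [Filter.eventually_gt_atTop 0] with n hn
  have : (n : ℝ) ≠ 0 := by positivity
  have : ((a + n : ℕ) : ℝ) ≠ 0 := by positivity
  field_simp
  push_cast
  ring

end limits

/-! ### Complete positivity of homomorphisms -/

section cp
variable {A B : Type*} [Ring A] [StarRing A] [Algebra ℂ A] [Ring B] [StarRing B] [Algebra ℂ B]

theorem isCompletelyPositive_starAlgHom (e : B →⋆ₐ[ℂ] A) :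
    IsCompletelyPositive e.toAlgHom.toLinearMap := fun n X => by
  refine ⟨X.map e, ?_⟩
  ext i j
  rw [Matrix.map_apply, Matrix.mul_apply, Matrix.mul_apply]
  change e _ = _
  rw [map_sum]
  refine Finset.sum_congr rfl fun k _ => ?_
  rw [map_mul]
  congr 1
  exact map_star e _

end cp

/-! ### Translates of gauge-invariant local algebras -/

section shift
variable {d : ℕ} [NeZero d] {G : Subgroup (Matrix.unitaryGroup (Fin d) ℂ)}

theorem shiftOp_mem_gaugeLocal {a b : ℤ} {x : ChainOp d}
    (hx : x ∈ gaugeLocal G (Finset.Icc a b)) :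
    shiftOp x ∈ gaugeLocal G (Finset.Icc (a + 1) (b + 1)) := by
  have hU' : ∀ g (Λ : Finset ℤ), shiftOp (gaugeUnitary (d := d) g Λ) =
      gaugeUnitary g (Λ.map (addRightEmbedding (1 : ℤ))) := fun g Λ => by
    refine (Finset.map_noncommProd Λ _ (fun _ _ _ _ h => site_commute h _ _)
      (shiftOp (d := d))).trans ?_
    simp [shiftOp_site, gaugeUnitary, Finset.noncommProd, Multiset.map_map]
  have hU := fun g => hU' g (Finset.Icc a b)
  simp only [Finset.map_add_right_Icc] at hU
  refine ⟨?_, fun g hg => ?_⟩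
  · have hle : localAlg d (Finset.Icc a b) ≤ (localAlg d (Finset.Icc (a + 1) (b + 1))).comap
        (shiftOp (d := d) : _ →⋆ₐ[ℂ] ChainOp d) := by
      refine StarAlgebra.adjoin_le ?_
      intro y hy
      obtain ⟨i, hi, A, rfl⟩ := Set.mem_iUnion₂.1 hy
      change shiftOp _ ∈ localAlg d (Finset.Icc (a + 1) (b + 1))
      rw [shiftOp_site]
      refine site_mem_localAlg ?_ A
      rw [Finset.mem_Icc] at hi ⊢
      omega
    exact hle hx.1
  · rw [gaugeAut_apply, ← hU, ← map_star, ← map_mul, ← map_mul, ← gaugeAut_apply, hx.2 g hg]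

theorem shiftLin_mem_gaugeLocal {a b : ℤ} {x : ChainOp d}
    (hx : x ∈ gaugeLocal G (Finset.Icc a b)) (p : ℕ) :
    shiftLin p x ∈ gaugeLocal G (Finset.Icc (a + p) (b + p)) := by
  induction p with
  | zero => simpa [shiftLin] using hx
  | succ p ih =>
    rw [shiftLin_succ]
    have := shiftOp_mem_gaugeLocal ih
    rwa [add_assoc, add_assoc] at this

end shift
end QChain
end

noncomputable section
open scoped ComplexOrder Kronecker
set_option linter.unusedSectionVars false
namespace QChain

/-! ### Existence of the mean entropy and the two bounds -/

variable {d : ℕ} [NeZero d] {κ Ω : Type} [Fintype κ] [DecidableEq κ] [Fintype Ω] [DecidableEq Ω]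
  {φ : quasiLocalAlg d →ₗ[ℂ] ℂ} {W : Ω → Fin d → Matrix κ κ ℂ} {Q : Matrix κ κ ℂ}
  {G : Subgroup (Matrix.unitaryGroup (Fin d) ℂ)}

theorem IsTransfer.tendsto_windowEntropy (h : IsTransfer φ W Q) :
    Filter.Tendsto (fun n : ℕ => windowEntropy W Q n / n) Filter.atTop
      (nhds h.subadditive.lim) :=
  h.subadditive.tendsto_lim ⟨0, by
    rintro _ ⟨n, rfl⟩
    exact div_nonneg (h.windowEntropy_nonneg n) n.cast_nonneg⟩

theorem IsTransfer.hasMeanEntropy (h : IsTransfer φ W Q) {φG : gaugeAlg G →ₗ[ℂ] ℂ}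
    (hφ : ∀ a, φG a = φ (StarSubalgebra.inclusion (gaugeAlg_le G) a)) :
    HasMeanEntropy φG h.subadditive.lim := by
  have h1 : Filter.Tendsto (fun n : ℕ => (1 / (n : ℝ)) *
      entropy (localize φG (Finset.Icc (1 : ℤ) n)) - windowEntropy W Q n / n)
      Filter.atTop (nhds 0) := by
    refine squeeze_zero_norm (fun n => ?_) (tendsto_log_div one_pos (d ^ 2))
    have h2 := h.abs_entropy_sub_window hφ (N := n) (isWindow_Icc (a := 1) rfl (by ring))
    have e : (1 / (n : ℝ)) * entropy (localize φG (Finset.Icc (1 : ℤ) n)) -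
        windowEntropy W Q n / n =
        (entropy (localize φG (Finset.Icc (1 : ℤ) n)) - windowEntropy W Q n) / n := by ring
    rw [e, Real.norm_eq_abs, abs_div, Nat.abs_cast, mul_one]
    exact div_le_div_of_nonneg_right h2 n.cast_nonneg
  have h3 := h1.add h.tendsto_windowEntropy
  rw [zero_add] at h3
  exact h3.congr fun n => sub_add_cancel _ _

theorem coe_autPow_localIncl {Λ : Finset ℤ} {b : ℕ} {nb : Fin b → ℕ}
    (e : gaugeLocal G Λ ≃⋆ₐ[ℂ] Blocks nb) (ι : gaugeAlg G →⋆ₐ[ℂ] quasiLocalAlg d)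
    (hι : ∀ a, (ι a : ChainOp d) = a) (x : gaugeLocal G Λ) (p : ℕ) :
    (ι (autPow (gaugeShift G) p (localIncl e (e x))) : ChainOp d) = shiftLin p (x : ChainOp d) := by
  rw [hι, coe_gaugeShift_pow, coe_localIncl]

/-- The map used is the inclusion of `𝔄_{[1,n]}`. Its translates by multiples of `n` occupy disjoint
blocks; for `k → ∞` the rate is at least `s - 2 P n / n`, which tends to `s` with `n`. -/
theorem IsTransfer.le_cntEntropy (h : IsTransfer φ W Q) (ι : gaugeAlg G →⋆ₐ[ℂ] quasiLocalAlg d)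
    (hι : ∀ a, (ι a : ChainOp d) = a) (hs : IsState (φ ∘ₗ ι.toAlgHom.toLinearMap)) :
    (h.subadditive.lim : EReal) ≤
      cntEntropy (φ ∘ₗ ι.toAlgHom.toLinearMap) (gaugeShift G) := by
  have hne := h.nonempty
  set c : ℝ := (Fintype.card (κ × κ) : ℝ) with hc
  have hc0 : 0 < c := by
    rw [hc]
    exact_mod_cast Fintype.card_pos
  set s := h.subadditive.lim
  set L : ℕ → ℝ := fun n => Real.log (((n : ℝ) + 1) ^ d ^ 2) with hL
  set P : ℕ → ℝ := fun n => Real.log (((n : ℝ) + 1) ^ d ^ 2 * c) with hP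
  have hLt : Filter.Tendsto (fun n : ℕ => L n / n) Filter.atTop (nhds 0) := by
    simpa only [mul_one] using tendsto_log_div one_pos (d ^ 2)
  have hPt : Filter.Tendsto (fun n : ℕ => P n / n) Filter.atTop (nhds 0) :=
    tendsto_log_div hc0 (d ^ 2)
  have hf : Filter.Tendsto (fun n : ℕ => (windowEntropy W Q n - L n - P n) / n) Filter.atTop
      (nhds s) := by
    have := (h.tendsto_windowEntropy.sub hLt).sub hPt
    rw [sub_zero, sub_zero] at this
    exact this.congr fun n => by ring
  have hmain : ∀ n : ℕ, 0 < n → ((s - 2 * (P n / n) : ℝ) : EReal) ≤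
      cntEntropy (φ ∘ₗ ι.toAlgHom.toLinearMap) (gaugeShift G) := by
    intro n hn
    have hn' : (n : ℝ) ≠ 0 := by positivity
    have hΛ : IsWindow (Finset.Icc (1 : ℤ) n) 1 n := isWindow_Icc rfl (by ring)
    obtain ⟨b, nb, ⟨e⟩⟩ := exists_gaugeLocal_equiv (G := G) hΛ
    have hu := (hf.comp (Filter.tendsto_id.atTop_mul_const' hn)).sub_const (2 * (P n / n))
    have hone : (localIncl e).toAlgHom.toLinearMap 1 = 1 := map_one (localIncl e)
    have hpos : ∀ ω : gaugeAlg G →ₗ[ℂ] ℂ, IsPositive ω →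
        IsPositive (ω ∘ₗ (localIncl e).toAlgHom.toLinearMap) := fun ω hω => hω.comp (localIncl e)
    refine (le_cntEntropyAlong hs (gaugeShift G) hpos hone hn hu fun k hk => ?_).trans
      (le_iSup_of_le b (le_iSup_of_le nb (le_iSup_of_le (localIncl e).toAlgHom.toLinearMap
        (le_iSup_of_le ⟨isCompletelyPositive_starAlgHom (localIncl e), hone⟩ le_rfl))))
    have hΛ' : IsWindow (Finset.Icc (1 : ℤ) (k * n : ℕ)) 1 (k * n) := isWindow_Icc rfl (by ring)
    obtain ⟨b', nb', ⟨e'⟩⟩ := exists_gaugeLocal_equiv (G := G) hΛ'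
    obtain ⟨r, ψ, hψ, hsum, hle⟩ := h.exists_le_cntValue ι k n e e'
      (α := fun l => autPow (gaugeShift G) (n * l) ∘ₗ (localIncl e).toAlgHom.toLinearMap)
      (α' := (localIncl e').toAlgHom.toLinearMap)
      (fun l => by rw [LinearMap.comp_apply, hone, autPow_one])
      (fun l ω hω => hpos _ (hω.comp_autPow (gaugeShift G) (n * l)))
      (fun l x => coe_autPow_localIncl e ι hι x (n * l))
      (fun x => (hι _).trans (coe_localIncl e' x))
    refine ⟨r, ψ, hψ, hsum, le_trans ?_ hle⟩
    have h1 := (abs_le.1 (h.abs_blockEntropy_sub_window hΛ' e'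
      ((φ ∘ₗ ι.toAlgHom.toLinearMap) ∘ₗ (localIncl e').toAlgHom.toLinearMap)
      fun x => ⟨ι (localIncl e' (e' x)), (hι _).trans (coe_localIncl e' x), rfl⟩)).1
    have h2 : ((k * n : ℕ) : ℝ) * ((windowEntropy W Q (k * n) - L (k * n) - P (k * n)) /
        ((k * n : ℕ) : ℝ) - 2 * (P n / n)) =
        windowEntropy W Q (k * n) - L (k * n) - P (k * n) - 2 * k * P n := by
      have : ((k * n : ℕ) : ℝ) ≠ 0 := by positivity
      rw [mul_sub, mul_div_cancel₀ _ this]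
      push_cast
      field_simp
    change ((k * n : ℕ) : ℝ) * ((windowEntropy W Q (k * n) - L (k * n) - P (k * n)) /
        ((k * n : ℕ) : ℝ) - 2 * (P n / n)) ≤ _
    rw [h2]
    have h3 : -L (k * n) ≤ _ := h1
    change _ ≤ _ - P (k * n) - 2 * k * P n
    linarith
  have hlim : Filter.Tendsto (fun n : ℕ => ((s - 2 * (P n / n) : ℝ) : EReal)) Filter.atTop
      (nhds (s : EReal)) := by
    have := (hPt.const_mul 2).const_sub s
    rw [mul_zero, sub_zero] at this
    exact (continuous_coe_real_ereal.tendsto s).comp this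
  refine le_of_tendsto hlim ?_
  filter_upwards [Filter.eventually_gt_atTop 0] with n hn
  exact hmain n hn

theorem isClosed_gaugeAlg :
    IsClosed ((gaugeAlg G : StarSubalgebra ℂ (ChainOp d)) : Set (ChainOp d)) :=
  StarSubalgebra.isClosed_topologicalClosure _

/-- The local subalgebras of the gauge-invariant algebra. -/
def localSub (G : Subgroup (Matrix.unitaryGroup (Fin d) ℂ)) (M : ℕ) :
    StarSubalgebra ℂ (gaugeAlg G) :=
  (gaugeLocal G (Finset.Icc (-M : ℤ) M)).comap (gaugeAlg G).subtype

theorem localSub_mono : Monotone (localSub G) := fun M M' hM x hx =>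
  gaugeLocal_mono (Finset.Icc_subset_Icc (by omega) (by omega)) hx

theorem exists_near_localSub (x : gaugeAlg G) (ε : ℝ) (hε : 0 < ε) :
    ∃ M, ∃ y ∈ localSub G M, ‖x - y‖ < ε := by
  obtain ⟨M, y, hy, hxy⟩ := exists_near_of_mem_topologicalClosure
    (F := fun n : ℕ => gaugeLocal G (Finset.Icc (-n : ℤ) n))
    (fun M M' hM => gaugeLocal_mono (Finset.Icc_subset_Icc (by omega) (by omega))) x.2 hε
  exact ⟨M, ⟨y, gaugeLocal_le _ hy⟩, hy, hxy⟩

theorem exists_local_approx {B : Type*} [CStarAlgebra B] (S : StarSubalgebra ℂ B)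
    (hS : IsClosed (S : Set B)) {F : ℕ → StarSubalgebra ℂ S} (hF : Monotone F)
    (hd : ∀ x : S, ∀ ε > 0, ∃ M, ∃ y ∈ F M, ‖x - y‖ < ε) {b : ℕ} {nb : Fin b → ℕ}
    {α : Blocks nb →ₗ[ℂ] S} (hα : IsCompletelyPositive α) (h1 : α 1 = 1) {ε : ℝ} (hε : 0 < ε) :
    ∃ (M : ℕ) (β : Blocks nb →ₗ[ℂ] S), IsSchwarz β ∧ β 1 = 1 ∧ (∀ x, β x ∈ F M) ∧
      ∀ ω : S →ₗ[ℂ] ℂ, IsState ω → |blockEntropy (ω ∘ₗ α) - blockEntropy (ω ∘ₗ β)| ≤ ε :=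
  have _ := hS
  IsCompletelyPositive.exists_approx (A := S) hF hd hα h1 hε

/-- The translates of a local approximation have values in one interval algebra of length `k +
O(1)`, so the rate is at most the mean entropy plus the approximation error. -/
theorem IsTransfer.cntEntropy_le (h : IsTransfer φ W Q) (ι : gaugeAlg G →⋆ₐ[ℂ] quasiLocalAlg d)
    (hι : ∀ a, (ι a : ChainOp d) = a) (hs : IsState (φ ∘ₗ ι.toAlgHom.toLinearMap)) :
    cntEntropy (φ ∘ₗ ι.toAlgHom.toLinearMap) (gaugeShift G) ≤ (h.subadditive.lim : EReal) := by
  refine iSup_le fun b => iSup_le fun nb => iSup_le fun α => iSup_le fun hα => ?_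
  refine EReal.le_of_forall_lt_iff_le.1 fun z hz => ?_
  set s := h.subadditive.lim
  have hz' : s < z := EReal.coe_lt_coe_iff.1 hz
  -- An error `ε` in each entropy costs `2ε` per map, which is exactly `z - s`.
  have hε : 0 < (z - s) / 2 := by linarith
  obtain ⟨M, β, hβ, h1, hβM, hβα⟩ := exists_local_approx (gaugeAlg G) isClosed_gaugeAlg
    localSub_mono exists_near_localSub hα.1 hα.2 hε
  set f : ℕ → ℝ := fun n => windowEntropy W Q n + Real.log (((n : ℝ) + 1) ^ d ^ 2) with hf
  have hft : Filter.Tendsto (fun n : ℕ => f n / n) Filter.atTop (nhds s) := by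
    have := h.tendsto_windowEntropy.add (tendsto_log_div one_pos (d ^ 2))
    rw [add_zero] at this
    refine this.congr fun n => ?_
    rw [mul_one, hf]
    ring
  have hu := (tendsto_div_shift hft (2 * M + 1)).add_const (2 * ((z - s) / 2))
  have hz2 : s + 2 * ((z - s) / 2) = z := by ring
  rw [hz2] at hu
  refine cntEntropyAlong_le (gaugeShift G) hu fun k hk => ?_
  -- The translates by `0, …, k - 1` of `[-M, M]` fit into this interval of `2M + 1 + k` sites.
  have hΛ : IsWindow (Finset.Icc (-M : ℤ) (M + k)) (-M) (2 * M + 1 + k) :=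
    isWindow_Icc rfl (by push_cast; ring)
  obtain ⟨b', nb', ⟨e⟩⟩ := exists_gaugeLocal_equiv (G := G) hΛ
  refine (cntH_orbit_le hs (gaugeShift G) hβα hβ h1 (localIncl e) fun l x => ?_).trans
    (EReal.coe_le_coe_iff.2 ?_)
  · have hmem : shiftLin l ((β x : gaugeAlg G) : ChainOp d) ∈
        gaugeLocal G (Finset.Icc (-M : ℤ) (M + k)) := by
      refine gaugeLocal_mono (Finset.Icc_subset_Icc ?_ ?_) (shiftLin_mem_gaugeLocal (hβM x) l)
      · omega
      · have := l.2
        omega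
    refine ⟨e ⟨_, hmem⟩, Subtype.ext ?_⟩
    rw [coe_localIncl, coe_gaugeShift_pow]
  · have h2 := (abs_le.1 (h.abs_blockEntropy_sub_window hΛ e
      ((φ ∘ₗ ι.toAlgHom.toLinearMap) ∘ₗ (localIncl e).toAlgHom.toLinearMap)
      fun x => ⟨ι (localIncl e (e x)), (hι _).trans (coe_localIncl e x), rfl⟩)).2
    have hk' : (k : ℝ) ≠ 0 := by positivity
    rw [mul_add, mul_div_cancel₀ _ hk', hf]
    linarith

theorem IsState.comp_starAlgHom {A B : Type*} [Ring A] [StarRing A] [Algebra ℂ A] [Ring B]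
    [StarRing B] [Algebra ℂ B] {ω : A →ₗ[ℂ] ℂ} (hω : IsState ω) (e : B →⋆ₐ[ℂ] A) :
    IsState (ω ∘ₗ e.toAlgHom.toLinearMap) :=
  ⟨hω.1.comp e, (congrArg ω (map_one e)).trans hω.2⟩

theorem comp_starAlgHom_apply {A B : Type*} [Ring A] [StarRing A] [Algebra ℂ A] [Ring B]
    [StarRing B] [Algebra ℂ B] (ω : A →ₗ[ℂ] ℂ) (e : B →⋆ₐ[ℂ] A) (x : B) :
    (ω ∘ₗ e.toAlgHom.toLinearMap) x = ω (e x) := rfl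

theorem coe_inclusion {A : Type*} [Semiring A] [StarRing A] [Algebra ℂ A] [StarModule ℂ A]
    {S T : StarSubalgebra ℂ A} (h : S ≤ T) (x : S) :
    (StarSubalgebra.inclusion h x : A) = x := rfl

theorem IsTransfer.cntEntropy_eq (h : IsTransfer φ W Q) {φG : gaugeAlg G →ₗ[ℂ] ℂ}
    (hφ : ∀ a, φG a = φ (StarSubalgebra.inclusion (gaugeAlg_le G) a)) :
    cntEntropy φG (gaugeShift G) = (h.subadditive.lim : EReal) := by
  have hι := coe_inclusion (gaugeAlg_le G)
  generalize StarSubalgebra.inclusion (gaugeAlg_le G) = ι at hφ hι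
  obtain rfl : φG = φ ∘ₗ ι.toAlgHom.toLinearMap :=
    LinearMap.ext fun a => by rw [comp_starAlgHom_apply, hφ]
  have hs := h.isState.comp_starAlgHom ι
  exact le_antisymm (h.cntEntropy_le ι hι hs) (h.le_cntEntropy ι hι hs)

end QChain
end

open QChain
theorem mainTheorem1 (d : ℕ) [NeZero d] (G : Subgroup (Matrix.unitaryGroup (Fin d) ℂ))
    (φ : gaugeAlg G →ₗ[ℂ] ℂ) (hφ : IsGeneralizedMarkovChain G φ) :
    ∃ s : ℝ, HasMeanEntropy φ s ∧ cntEntropy φ (gaugeShift G) = (s : EReal) := by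
  obtain ⟨φ', E, ρ, hE, -, hφ⟩ := hφ
  obtain ⟨κ, Ω, _, _, _, _, W, Q, h⟩ := exists_isTransfer hE
  exact ⟨_, h.hasMeanEntropy hφ, h.cntEntropy_eq hφ⟩
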